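/- Let $\Sigma$ be a compact smooth manifold without boundary of dimension $n$, let $T^k\to M\to\Sigma$ be a smooth principal $T^k$-bundle, and let $h$ be a fixed inner product on $\mathfrak t^k$. For a Riemannian metric $g$ on $\Sigma$ and a principal connection $\mu$ with curvature $F=F_\mu$ (a $\mathfrak t^k$-valued two-form on $\Sigma$), let $(F^2)_{ij}=h_{IJ}g^{kl}F^I_{ik}F^J_{jl}$, $|F|^2=\operatorname{tr}_gF^2$ and $(d_g^*F)_j=-\nabla^iF_{ij}$. Let $(g_t,\mu_t)$ be a smooth solution of the Ricci–Yang–Mills flow $$\partial_t g=-2\,\mathrm{Rc}_g+F_\mu^2,\qquad \partial_t\mu=-d_g^*F_\mu$$ on a time interval $I$ of positive length, let $T>t$ for all $t\in I$, put $\tau=T-t$, and let $f_-$ be a smooth solution on $I$ of the conjugate heat equation $$\partial_t f_-=-\Delta f_-+|\nabla f_-|^2-R+\tfrac12|F|^2+\tfrac{n}{2\tau}.$$ Put $u=(4\pi\tau)^{-n/2}e^{-f_-}$ and $$\mathcal W_-=\int_\Sigma\Big[\tau\big(|\nabla f_-|^2+R-\tfrac14|F|^2\big)+f_--n\Big]u\,dV_g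 .$$ Then, for all $t\in I$ (with one-sided derivatives at end points of $I$), $$\frac{d}{dt}\mathcal W_-=\int_\Sigma\Big[2\tau\Big|\mathrm{Rc}-\tfrac12F^2+\nabla^2f_--\tfrac{g}{2\tau}\Big|^2+\tau\big|d_g^*F+\nabla f_-\lrcorner F\big|^2-\tfrac14|F|^2\Big]u\,dV_g .$$ Suppose moreover that $n=2$, that $\Sigma$ is a Riemann surface in whose conformal class the metric lies, that the bundle is trivial, and that $f_t:\Sigma\to\mathfrak t^k$ are associated potential functions, that is, smooth on $I\times\Sigma$ with $\mu_t=\bar\mu+d^cf_t$ for a flat connection $\bar\mu$, and $\partial_tf=\Delta_{g_t}f$. Then $\mathcal W_--\int_\Sigma|\nabla f|^2_{g,h}\,u\,dV_g$ is differentiable and nondecreasing on $I$, and $$\frac{d}{dt}\Big[\mathcal W_--\int_\Sigma|\nabla f|^2_{g,h}\,u\,dV_g\Big]\ \ge\ \int_\Sigma\Big[2\tau\Big|\mathrm{Rc}-\tfrac12F^2+\nabla^2f_--\tfrac{g}{2\tau}\Big|^2+\tau\big|d_g^*F+\nabla f_-\lrcorner F\big|^2\Big]u\,dV_g\ \ge\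 0 .$$ -/

import Mathlib

open scoped ContDiff Manifold
open Set MeasureTheory

noncomputable section

namespace RYM

/-! ### Local tensor calculus

Tensors on an open set of `ℝⁿ` are given by their components. `G` is the matrix `g_ij` of a metric,
`F I i j` are the components `F^I_ij` of a two-form with values in `𝔱ᵏ = ℝᵏ`, and `h` is the Gram
matrix of an inner product on `𝔱ᵏ`. -/

/-- The model space `ℝⁿ`. -/
abbrev Coord (n : ℕ) := EuclideanSpace ℝ (Fin n)

/-- The partial derivative `∂_i φ`. -/
def pd {n : ℕ} (i : Fin n) (φ : Coord n → ℝ) (y : Coord n) : ℝ :=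
  fderiv ℝ φ y (EuclideanSpace.single i 1)

namespace Loc

/-- The Christoffel symbol `Γ^m_ij` of the Levi-Civita connection. -/
def chris {n : ℕ} (G : Coord n → Matrix (Fin n) (Fin n) ℝ) (m i j : Fin n) (y : Coord n) : ℝ :=
  (1 / 2) * ∑ l, (G y)⁻¹ m l *
    (pd i (fun z => G z j l) y + pd j (fun z => G z i l) y - pd l (fun z => G z i j) y)

/-- The Ricci tensor `Rc_ij` (positive on round spheres). -/
def ric {n : ℕ} (G : Coord n → Matrix (Fin n) (Fin n) ℝ) (i j : Fin n) (y : Coord n) : ℝ :=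
  ∑ m, (pd m (chris G m i j) y - pd j (chris G m i m) y) +
    ∑ m, ∑ l, (chris G m m l y * chris G l i j y - chris G m j l y * chris G l i m y)

/-- The scalar curvature `R = g^ij Rc_ij`. -/
def scal {n : ℕ} (G : Coord n → Matrix (Fin n) (Fin n) ℝ) (y : Coord n) : ℝ :=
  ∑ i, ∑ j, (G y)⁻¹ i j * ric G i j y

/-- The Hessian `∇_i ∇_j φ`. -/
def hess {n : ℕ} (G : Coord n → Matrix (Fin n) (Fin n) ℝ) (φ : Coord n → ℝ) (i j : Fin n)
    (y : Coord n) : ℝ :=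
  pd i (pd j φ) y - ∑ m, chris G m i j y * pd m φ y

/-- The Laplacian `Δφ = g^ij ∇_i ∇_j φ`. -/
def lap {n : ℕ} (G : Coord n → Matrix (Fin n) (Fin n) ℝ) (φ : Coord n → ℝ) (y : Coord n) : ℝ :=
  ∑ i, ∑ j, (G y)⁻¹ i j * hess G φ i j y

/-- `|∇φ|² = g^ij ∂_i φ ∂_j φ`. -/
def gradSq {n : ℕ} (G : Coord n → Matrix (Fin n) (Fin n) ℝ) (φ : Coord n → ℝ) (y : Coord n) : ℝ :=
  ∑ i, ∑ j, (G y)⁻¹ i j * pd i φ y * pd j φ y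

/-- `|α|² = h_IJ g^ij α^I_i α^J_j` for a `𝔱ᵏ`-valued covector `α` at `y`. -/
def covecNormSq {n k : ℕ} (h : Matrix (Fin k) (Fin k) ℝ) (G : Coord n → Matrix (Fin n) (Fin n) ℝ)
    (y : Coord n) (α : Fin k → Fin n → ℝ) : ℝ :=
  ∑ a, ∑ b, ∑ i, ∑ j, h a b * (G y)⁻¹ i j * α a i * α b j

/-- `|A|² = g^ik g^jl A_ij A_kl` for a `(0,2)`-tensor `A` at `y`. -/
def tensorNormSq {n : ℕ} (G : Coord n → Matrix (Fin n) (Fin n) ℝ) (y : Coord n)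
    (A : Fin n → Fin n → ℝ) : ℝ :=
  ∑ i, ∑ j, ∑ k, ∑ l, (G y)⁻¹ i k * (G y)⁻¹ j l * A i j * A k l

/-- `(F²)_ij = h_IJ g^kl F^I_ik F^J_jl`. -/
def curvSq {n k : ℕ} (h : Matrix (Fin k) (Fin k) ℝ) (G : Coord n → Matrix (Fin n) (Fin n) ℝ)
    (F : Fin k → Fin n → Fin n → Coord n → ℝ) (i j : Fin n) (y : Coord n) : ℝ :=
  ∑ a, ∑ b, ∑ l, ∑ m, h a b * (G y)⁻¹ l m * F a i l y * F b j m y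

/-- `|F|²_{g,h} = h_IJ g^ik g^jl F^I_ij F^J_kl`, which is `tr_g F²`. -/
def curvNormSq {n k : ℕ} (h : Matrix (Fin k) (Fin k) ℝ) (G : Coord n → Matrix (Fin n) (Fin n) ℝ)
    (F : Fin k → Fin n → Fin n → Coord n → ℝ) (y : Coord n) : ℝ :=
  ∑ i, ∑ j, (G y)⁻¹ i j * curvSq h G F i j y

/-- The covariant derivative `∇_m F^I_ij`. -/
def covF {n k : ℕ} (G : Coord n → Matrix (Fin n) (Fin n) ℝ)
    (F : Fin k → Fin n → Fin n → Coord n → ℝ) (a : Fin k) (m i j : Fin n) (y : Coord n) : ℝ :=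
  pd m (F a i j) y - ∑ l, chris G l m i y * F a l j y - ∑ l, chris G l m j y * F a i l y

/-- The codifferential `(d*_g F)^I_j = - g^mi ∇_m F^I_ij`. -/
def codiff {n k : ℕ} (G : Coord n → Matrix (Fin n) (Fin n) ℝ)
    (F : Fin k → Fin n → Fin n → Coord n → ℝ) (a : Fin k) (j : Fin n) (y : Coord n) : ℝ :=
  -∑ m, ∑ i, (G y)⁻¹ m i * covF G F a m i j y

/-- The contraction `(∇φ ⌟ F)^I_j = g^mi ∂_m φ F^I_ij`. -/
def gradContract {n k : ℕ} (G : Coord n → Matrix (Fin n) (Fin n) ℝ) (φ : Coord n → ℝ)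
    (F : Fin k → Fin n → Fin n → Coord n → ℝ) (a : Fin k) (j : Fin n) (y : Coord n) : ℝ :=
  ∑ m, ∑ i, (G y)⁻¹ m i * pd m φ y * F a i j y

end Loc

/-! ### Riemannian metrics in charts -/

/-- Smooth Riemannian metrics on a smooth `n`-manifold. -/
abbrev Metric (n : ℕ) (S : Type*) [TopologicalSpace S] [ChartedSpace (Coord n) S]
    [IsManifold (𝓡 n) ∞ S] :=
  Bundle.ContMDiffRiemannianMetric (𝓡 n) ∞ (Coord n) (fun x : S => TangentSpace (𝓡 n) x)

section Base

variable {n k : ℕ} {S : Type*} [TopologicalSpace S] [ChartedSpace (Coord n) S]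

/-- The coordinate vector `∂_i` of the chart `c` at the point with coordinates `y`. -/
def coordVec (c : OpenPartialHomeomorph S (Coord n)) (y : Coord n) (i : Fin n) :
    TangentSpace (𝓡 n) (c.symm y) :=
  mfderiv (𝓡 n) (𝓡 n) c.symm y (EuclideanSpace.single i (1 : ℝ) : Coord n)

/-- The coordinates `v^j = dy^j(v)` of a tangent vector in the chart `c`. -/
def vecCoord (c : OpenPartialHomeomorph S (Coord n)) (x : S) (v : TangentSpace (𝓡 n) x)
    (j : Fin n) : ℝ :=
  (show Coord n from mfderiv (𝓡 n) (𝓡 n) c x v) j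

/-- Components in the chart `c` of a `𝔱ᵏ`-valued bilinear form on tangent vectors. -/
def formComp (F : (x : S) → TangentSpace (𝓡 n) x → TangentSpace (𝓡 n) x → (Fin k → ℝ))
    (c : OpenPartialHomeomorph S (Coord n)) (a : Fin k) (i j : Fin n) (y : Coord n) : ℝ :=
  F (c.symm y) (coordVec c y i) (coordVec c y j) a

/-- A smooth (almost) complex structure; on a surface it is the same as the structure of a Riemann
surface, as it is automatically integrable there. -/
structure ComplexStructure (n : ℕ) (S : Type*) [TopologicalSpace S]
    [ChartedSpace (Coord n) S] where
  J : (x : S) → TangentSpace (𝓡 n) x →L[ℝ] TangentSpace (𝓡 n) x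
  sq : ∀ (x : S) (v : TangentSpace (𝓡 n) x), J x (J x v) = -v
  smooth : ∀ c ∈ atlas (Coord n) S, ∀ i j : Fin n,
    ContDiffOn ℝ ∞ (fun y => vecCoord c (c.symm y) (J (c.symm y) (coordVec c y i)) j) c.target

/-- The one-form `d^c f = - df ∘ J` of a `𝔱ᵏ`-valued function `f`. -/
def dc (C : ComplexStructure n S) (f : S → (Fin k → ℝ)) (x : S) (v : TangentSpace (𝓡 n) x) :
    Fin k → ℝ :=
  -(show Fin k → ℝ from mfderiv (𝓡 n) 𝓘(ℝ, Fin k → ℝ) f x (C.J x v))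

variable [IsManifold (𝓡 n) ∞ S]

/-- The components `g_ij` of the metric `g` in the chart `c`. -/
def metricComp (g : Metric n S) (c : OpenPartialHomeomorph S (Coord n)) (y : Coord n) :
    Matrix (Fin n) (Fin n) ℝ :=
  Matrix.of fun i j => g.inner (c.symm y) (coordVec c y i) (coordVec c y j)

/-- `g` is a metric in the conformal class of the complex structure. -/
def IsHermitian (C : ComplexStructure n S) (g : Metric n S) : Prop :=
  ∀ (x : S) (v w : TangentSpace (𝓡 n) x), g.inner x (C.J x v) (C.J x w) = g.inner x v w

/-- The measure `√(det g_ij) dy` on the domain of the chart `c` (zero outside it). -/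
def chartVolume [MeasurableSpace S] (g : Metric n S) (c : OpenPartialHomeomorph S (Coord n)) :
    Measure S :=
  Measure.map c.symm ((volume.restrict c.target).withDensity
    fun y => ENNReal.ofReal (√(metricComp g c y).det))

/-- The Riemannian measure `dV_g`: the smallest measure that dominates the measures
`√(det g_ij) dy` of all charts. These agree on overlaps, so that it restricts on the domain of each
chart to the measure of that chart. -/
def riemannianVolume [MeasurableSpace S] (g : Metric n S) : Measure S :=
  ⨆ c ∈ atlas (Coord n) S, chartVolume g c

/-! Scalars at a point, computed in the preferred chart at that point (they do not depend on the
chart). -/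

/-- Scalar curvature. -/
def scalAt (g : Metric n S) (x : S) : ℝ :=
  Loc.scal (metricComp g (chartAt (Coord n) x)) (chartAt (Coord n) x x)

/-- `Δ_g φ`. -/
def lapAt (g : Metric n S) (φ : S → ℝ) (x : S) : ℝ :=
  Loc.lap (metricComp g (chartAt (Coord n) x)) (φ ∘ (chartAt (Coord n) x).symm)
    (chartAt (Coord n) x x)

/-- `|∇φ|²_g`. -/
def gradSqAt (g : Metric n S) (φ : S → ℝ) (x : S) : ℝ :=
  Loc.gradSq (metricComp g (chartAt (Coord n) x)) (φ ∘ (chartAt (Coord n) x).symm)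
    (chartAt (Coord n) x x)

/-- `|∇f|²_{g,h}` for a `𝔱ᵏ`-valued function `f`. -/
def vecGradSqAt (h : Matrix (Fin k) (Fin k) ℝ) (g : Metric n S) (f : S → (Fin k → ℝ)) (x : S) : ℝ :=
  Loc.covecNormSq h (metricComp g (chartAt (Coord n) x)) (chartAt (Coord n) x x)
    fun a i => pd i (fun y => f ((chartAt (Coord n) x).symm y) a) (chartAt (Coord n) x x)

/-- `|F|²_{g,h}`. -/
def curvNormSqAt (h : Matrix (Fin k) (Fin k) ℝ) (g : Metric n S)
    (F : (x : S) → TangentSpace (𝓡 n) x → TangentSpace (𝓡 n) x → (Fin k → ℝ)) (x : S) : ℝ :=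
  Loc.curvNormSq h (metricComp g (chartAt (Coord n) x)) (formComp F (chartAt (Coord n) x))
    (chartAt (Coord n) x x)

/-- `|Rc - ½ F² + ∇²φ - g / (2τ)|²_g`. -/
def solitonSqAt (h : Matrix (Fin k) (Fin k) ℝ) (g : Metric n S)
    (F : (x : S) → TangentSpace (𝓡 n) x → TangentSpace (𝓡 n) x → (Fin k → ℝ)) (φ : S → ℝ) (τ : ℝ)
    (x : S) : ℝ :=
  let c := chartAt (Coord n) x
  let G := metricComp g c
  Loc.tensorNormSq G (c x) fun i j =>
    Loc.ric G i j (c x) - (1 / 2) * Loc.curvSq h G (formComp F c) i j (c x)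
      + Loc.hess G (φ ∘ c.symm) i j (c x) - G (c x) i j / (2 * τ)

/-- `|d*_g F + ∇φ ⌟ F|²_{g,h}`. -/
def yangMillsSqAt (h : Matrix (Fin k) (Fin k) ℝ) (g : Metric n S)
    (F : (x : S) → TangentSpace (𝓡 n) x → TangentSpace (𝓡 n) x → (Fin k → ℝ)) (φ : S → ℝ)
    (x : S) : ℝ :=
  let c := chartAt (Coord n) x
  let G := metricComp g c
  Loc.covecNormSq h G (c x) fun a j =>
    Loc.codiff G (formComp F c) a j (c x)
      + Loc.gradContract G (φ ∘ c.symm) (formComp F c) a j (c x)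

/-- The one-form `d*_g F`, evaluated on a tangent vector. -/
def codiffAt (g : Metric n S)
    (F : (x : S) → TangentSpace (𝓡 n) x → TangentSpace (𝓡 n) x → (Fin k → ℝ)) (x : S)
    (v : TangentSpace (𝓡 n) x) : Fin k → ℝ :=
  let c := chartAt (Coord n) x
  fun a => ∑ j, Loc.codiff (metricComp g c) (formComp F c) a j (c x) * vecCoord c x v j

end Base

/-! ### Principal torus bundles and connections -/

section Bundle

variable {n k : ℕ} {S : Type*} [TopologicalSpace S] [ChartedSpace (Coord n) S]
  {E' H' : Type*} [NormedAddCommGroup E'] [NormedSpace ℝ E'] [TopologicalSpace H']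
  {M : Type*} [TopologicalSpace M] [ChartedSpace H' M] {I' : ModelWithCorners ℝ E' H'}

/-- A smooth principal bundle `Tᵏ → M → S`, where `Tᵏ = ℝᵏ / ℤᵏ`: a smooth action of `ℝᵏ` on `M`
all of whose stabilizers are `ℤᵏ` (that is, a free action of `Tᵏ`), whose orbits are the fibers of
the smooth map `proj`, and which has smooth local sections (that is, local trivializations). -/
structure TorusBundle (n k : ℕ) (S : Type*) [TopologicalSpace S] [ChartedSpace (Coord n) S]
    {E' H' : Type*} [NormedAddCommGroup E'] [NormedSpace ℝ E'] [TopologicalSpace H']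
    (M : Type*) [TopologicalSpace M] [ChartedSpace H' M] (I' : ModelWithCorners ℝ E' H') where
  proj : M → S
  contMDiff_proj : ContMDiff I' (𝓡 n) ∞ proj
  act : (Fin k → ℝ) → M → M
  contMDiff_act : ContMDiff (𝓘(ℝ, Fin k → ℝ).prod I') I' ∞
    (fun q : (Fin k → ℝ) × M => act q.1 q.2)
  act_zero : ∀ p, act 0 p = p
  act_add : ∀ v w p, act (v + w) p = act v (act w p)
  act_eq_self_iff : ∀ v p, act v p = p ↔ ∃ m : Fin k → ℤ, v = fun i => (m i : ℝ)
  proj_eq_iff : ∀ p q, proj p = proj q ↔ ∃ v, act v p = q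
  exists_section : ∀ x : S, ∃ s : S → M, ∃ U : Set S, IsOpen U ∧ x ∈ U ∧
    ContMDiffOn (𝓡 n) I' ∞ s U ∧ ∀ y ∈ U, proj (s y) = y
  finrank_eq : Module.finrank ℝ E' = n + k

/-- The bundle is trivial: it has a smooth global section. -/
def TorusBundle.IsTrivial (P : TorusBundle n k S M I') : Prop :=
  ∃ s : S → M, ContMDiff (𝓡 n) I' ∞ s ∧ ∀ y, P.proj (s y) = y

/-- A smooth section of the bundle near `x`. -/
def TorusBundle.localSection (P : TorusBundle n k S M I') (x : S) : S → M :=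
  (P.exists_section x).choose

/-- A one-form on `M` in the preferred chart at `q`, as a function on the model space. -/
def oneFormIn {V : Type*} [NormedAddCommGroup V] [NormedSpace ℝ V]
    (θ : (p : M) → TangentSpace I' p →L[ℝ] V) (q : M) (y : E') : E' →L[ℝ] V :=
  (θ ((extChartAt I' q).symm y)).comp (mfderiv 𝓘(ℝ, E') I' (extChartAt I' q).symm y)

/-- The exterior derivative `dθ(X, Y)` of a one-form on `M` at `p`, computed in the preferred chart
at `p` (with `(dθ)_ij = ∂_i θ_j - ∂_j θ_i`). -/
def extDerivOneForm {V : Type*} [NormedAddCommGroup V] [NormedSpace ℝ V]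
    (θ : (p : M) → TangentSpace I' p →L[ℝ] V) (p : M) (X Y : TangentSpace I' p) : V :=
  let D := fderiv ℝ (oneFormIn θ p) (extChartAt I' p p)
  let X' : E' := mfderiv I' 𝓘(ℝ, E') (extChartAt I' p) p X
  let Y' : E' := mfderiv I' 𝓘(ℝ, E') (extChartAt I' p) p Y
  D X' Y' - D Y' X'

/-- A smooth principal connection: a smooth one-form on `M` with values in `𝔱ᵏ = ℝᵏ` which is
invariant under the torus and maps the fundamental vector field of each `ξ` to `ξ`. -/
structure PrincipalConnection (P : TorusBundle n k S M I') where
  form : (p : M) → TangentSpace I' p →L[ℝ] (Fin k → ℝ)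
  smooth : ∀ q : M, ContDiffOn ℝ ∞ (oneFormIn form q) (extChartAt I' q).target
  fundamental : ∀ (p : M) (ξ : Fin k → ℝ), form (P.act 0 p)
    (mfderiv 𝓘(ℝ, Fin k → ℝ) I' (fun v : Fin k → ℝ => P.act v p) 0 ξ) = ξ
  invariant : ∀ (v : Fin k → ℝ) (p : M) (X : TangentSpace I' p),
    form (P.act v p) (mfderiv I' I' (P.act v) p X) = form p X

/-- The curvature `F_μ`, the two-form on the base with `π^* F_μ = dμ`: the pull-back of `dμ` by a
local section (it does not depend on the section). -/
def PrincipalConnection.curv {P : TorusBundle n k S M I'} (μ : PrincipalConnection P) (x : S)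
    (v w : TangentSpace (𝓡 n) x) : Fin k → ℝ :=
  extDerivOneForm μ.form (P.localSection x x)
    (mfderiv (𝓡 n) I' (P.localSection x) x v) (mfderiv (𝓡 n) I' (P.localSection x) x w)

variable [IsManifold (𝓡 n) ∞ S]

/-- `(g_t, μ_t)` is a smooth solution on the time interval `T` of the Ricci-Yang-Mills flow
`∂_t g = -2 Rc + F²`, `∂_t μ = - d*_g F` with the fixed inner product `h` on `𝔱ᵏ`. Time derivatives
at an end point of the interval are one-sided. -/
structure IsRYMFlow (P : TorusBundle n k S M I') (h : Matrix (Fin k) (Fin k) ℝ) (T : Set ℝ)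
    (g : ℝ → Metric n S) (μ : ℝ → PrincipalConnection P) : Prop where
  smooth_metric : ∀ c ∈ atlas (Coord n) S, ∀ i j : Fin n,
    ContDiffOn ℝ ∞ (fun q : ℝ × Coord n => metricComp (g q.1) c q.2 i j) (T ×ˢ c.target)
  smooth_connection : ∀ p : M,
    ContDiffOn ℝ ∞ (fun q : ℝ × E' => oneFormIn (μ q.1).form p q.2)
      (T ×ˢ (extChartAt I' p).target)
  metric_eq : ∀ t ∈ T, ∀ c ∈ atlas (Coord n) S, ∀ y ∈ c.target, ∀ i j : Fin n,
    HasDerivWithinAt (fun s => metricComp (g s) c y i j)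
      (-2 * Loc.ric (metricComp (g t) c) i j y
        + Loc.curvSq h (metricComp (g t) c) (formComp (μ t).curv c) i j y) T t
  connection_eq : ∀ t ∈ T, ∀ (p : M) (X : TangentSpace I' p),
    HasDerivWithinAt (fun s => (μ s).form p X)
      (-codiffAt (g t) (μ t).curv (P.proj p) (mfderiv I' (𝓡 n) P.proj p X)) T t

/-- `φ_t` is a smooth solution of the conjugate heat equation
`∂_t φ = - Δφ + |∇φ|² - R + ½ |F|² + n / (2τ)`, with `τ = T₁ - t`. -/
structure IsConjugateHeat {P : TorusBundle n k S M I'} (h : Matrix (Fin k) (Fin k) ℝ) (T : Set ℝ)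
    (T₁ : ℝ) (g : ℝ → Metric n S) (μ : ℝ → PrincipalConnection P) (φ : ℝ → S → ℝ) : Prop where
  smooth : ContMDiffOn (𝓘(ℝ, ℝ).prod (𝓡 n)) 𝓘(ℝ, ℝ) ∞ (fun q : ℝ × S => φ q.1 q.2) (T ×ˢ univ)
  eq : ∀ t ∈ T, ∀ x : S, HasDerivWithinAt (fun s => φ s x)
    (-lapAt (g t) (φ t) x + gradSqAt (g t) (φ t) x - scalAt (g t) x
      + (1 / 2) * curvNormSqAt h (g t) (μ t).curv x + (n : ℝ) / (2 * (T₁ - t))) T t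

/-- `f_t` are the potential functions of the flow with respect to the flat background connection
`μ₀`: smooth `𝔱ᵏ`-valued functions with `μ_t = μ₀ + π^* d^c f_t` and `∂_t f = Δ f`. -/
structure IsPotential {P : TorusBundle n k S M I'} (C : ComplexStructure n S) (T : Set ℝ)
    (g : ℝ → Metric n S) (μ : ℝ → PrincipalConnection P) (μ₀ : PrincipalConnection P)
    (f : ℝ → S → (Fin k → ℝ)) : Prop where
  flat : ∀ (x : S) (v w : TangentSpace (𝓡 n) x), μ₀.curv x v w = 0
  smooth : ContMDiffOn (𝓘(ℝ, ℝ).prod (𝓡 n)) 𝓘(ℝ, Fin k → ℝ) ∞ (fun q : ℝ × S => f q.1 q.2)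
    (T ×ˢ univ)
  connection_eq : ∀ t ∈ T, ∀ (p : M) (X : TangentSpace I' p),
    (μ t).form p X = μ₀.form p X + dc C (f t) (P.proj p) (mfderiv I' (𝓡 n) P.proj p X)
  heat_eq : ∀ t ∈ T, ∀ (x : S) (a : Fin k),
    HasDerivWithinAt (fun s => f s x a) (lapAt (g t) (fun z => f t z a) x) T t

end Bundle

/-! ### The entropy -/

section Entropy

variable {n k : ℕ} {S : Type*} [TopologicalSpace S] [ChartedSpace (Coord n) S]
  [IsManifold (𝓡 n) ∞ S] [MeasurableSpace S]

/-- `u = e^{-φ} / (4πτ)^{n/2}`. -/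
def density (n : ℕ) {S : Type*} (φ : S → ℝ) (τ : ℝ) (x : S) : ℝ :=
  Real.exp (-φ x) / (4 * Real.pi * τ) ^ ((n : ℝ) / 2)

/-- The entropy
`W_-(g, F, h, φ, τ) = ∫ [τ (|∇φ|² + R - ¼ |F|²) + φ - n] u dV_g`. -/
def entropy (h : Matrix (Fin k) (Fin k) ℝ) (g : Metric n S)
    (F : (x : S) → TangentSpace (𝓡 n) x → TangentSpace (𝓡 n) x → (Fin k → ℝ)) (φ : S → ℝ)
    (τ : ℝ) : ℝ :=
  ∫ x, (τ * (gradSqAt g φ x + scalAt g x - (1 / 4) * curvNormSqAt h g F x) + φ x - n)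
    * density n φ τ x ∂(riemannianVolume g)

end Entropy

end RYM

end

noncomputable section

namespace RYM

set_option linter.unusedSectionVars false

/-! The first formula is Perelman's entropy computation, carried out for the Ricci-Yang-Mills flow.
Write `f` for the solution of the conjugate heat equation and put `w = τ(2Δf - |∇f|² + R - ¼|F|²) +
f - n`. Since `Δu = u(|∇f|² - Δf)` has integral zero, `∫ w u dV` is the entropy
(`entropy_eq_integral`). The conjugate heat equation says that `∂_t(u dV) = -Δu dV`, hence `∂_t(w u
dV) = ((∂_t + Δ)w - 2⟨∇w, ∇f⟩) u dV - Δ(wu) dV`, and the last term integrates to zero. What remains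
is the pointwise identity `(∂_t + Δ)w - 2⟨∇w, ∇f⟩ = 2τ|Rc - ½F² + ∇²f - g/2τ|² + τ|d*F + ∇f⌟F|² -
¼|F|²`, which is `entropyIntegrand_flow` up to a factor four. It combines the Bochner formula with
the evolution of `Δf`, `|∇f|²`, `R` and `|F|²`; these rest on the contracted Bianchi identity and,
through `dF = 0`, on the divergence of `F²`.

For the second claim the term `-¼|F|²` has to be compensated. A potential that solves the heat
equation satisfies `(∂_t - Δ)|∇f|² = -2|∇²f|² - F²(∇f, ∇f)`, because the Ricci term of the Bochner
formula cancels that of the moving metric. On a surface the curvature of `d^c f` is `Δf` times the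
area form, so `|F|² = 2|Δf|²`, while `(Δf)² ≤ 2|∇²f|²`. Hence the energy loses at least `¼|F|²`
(`curvNormSqAt_le`). The area form is available at all times because `Rc` and `F²` are multiples of
`g` in dimension two, so the flow preserves the conformal class.

All tensor calculus takes place in a commutative ring with commuting derivations and an invertible
symmetric matrix `g`. The tensor identities thus become algebra, and time is one more derivation
commuting with the others. The ring used is that of smooth functions on time interval times
coordinate domain; `Realizes` translates between it and the component formulas, and `LocalFlow`
records the flow there. The inner product on the torus algebra is factored as `Bᵀ B`, so that a
vector-valued curvature becomes a finite family of real closed two-forms.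

Globally, the measure restricts to the coordinate density in each chart, a finite partition of unity
reduces differentiation under the integral to compact sets of `ℝⁿ`, and Green's formula removes the
divergences. Curvature in a chart is `dA` for the connection form `A` in a local section, which
yields smoothness, closedness and the evolution of `F`. -/

/-- Riemannian geometry over a commutative ring of functions: commuting derivations and a metric
with its inverse. -/
structure MetricRing (A ι : Type*) [CommRing A] [Algebra ℝ A] [Fintype ι] [DecidableEq ι] where
  d : ι → Derivation ℝ A A
  d_comm : ∀ i j x, d i (d j x) = d j (d i x)
  g : Matrix ι ι A
  gi : Matrix ι ι A
  g_symm : ∀ i j, g i j = g j i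
  g_mul_gi : g * gi = 1

theorem two_mul_cancel {A : Type*} [CommRing A] [Algebra ℝ A] {x y : A} (h : 2 * x = 2 * y) :
    x = y := by
  have h2 : ∀ z : A, (1 / 2 : ℝ) • (2 * z) = z := fun z => by
    rw [two_mul, ← two_smul ℝ z, smul_smul]; norm_num
  rw [← h2 x, h, h2]

theorem matrix_map_mul {A ι : Type*} [CommRing A] [Algebra ℝ A] [Fintype ι]
    (D : Derivation ℝ A A) (X Y : Matrix ι ι A) :
    (X * Y).map D = X.map D * Y + X * Y.map D := by
  ext i j
  simp only [Matrix.map_apply, Matrix.mul_apply, Matrix.add_apply, map_sum, Derivation.leibniz,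
    smul_eq_mul, ← Finset.sum_add_distrib]
  exact Finset.sum_congr rfl fun k _ => by ring

theorem matrix_map_add {A ι : Type*} [CommRing A] [Algebra ℝ A] (D : Derivation ℝ A A)
    (X Y : Matrix ι ι A) : (X + Y).map D = X.map D + Y.map D := by ext; simp

theorem matrix_map_sub {A ι : Type*} [CommRing A] [Algebra ℝ A] (D : Derivation ℝ A A)
    (X Y : Matrix ι ι A) : (X - Y).map D = X.map D - Y.map D := by ext; simp

theorem matrix_map_neg {A ι : Type*} [CommRing A] [Algebra ℝ A] (D : Derivation ℝ A A)
    (X : Matrix ι ι A) : (-X).map D = -X.map D := by ext; simp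

/-- Exchanging the two summation indices turns the sum into its negative. -/
theorem sum_antisymm_mul_symm {A ι : Type*} [CommRing A] [Algebra ℝ A] [Fintype ι]
    {a s : ι → ι → A} (ha : ∀ i j, a i j = -a j i) (hs : ∀ i j, s i j = s j i) :
    ∑ i, ∑ j, a i j * s i j = 0 := by
  apply two_mul_cancel
  rw [two_mul, mul_zero]
  nth_rewrite 2 [Finset.sum_comm]
  simp only [← Finset.sum_add_distrib]
  refine Finset.sum_eq_zero fun i _ => Finset.sum_eq_zero fun j _ => ?_
  rw [ha j i, hs j i]; ring

/-! ### The Levi-Civita connection of a metric ring. -/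

namespace MetricRing

variable {A ι : Type*} [CommRing A] [Algebra ℝ A] [Fintype ι] [DecidableEq ι]
  (M : MetricRing A ι)

theorem gi_mul_g : M.gi * M.g = 1 := mul_eq_one_comm.mp M.g_mul_gi

theorem g_transpose : M.g.transpose = M.g := by
  ext i j; exact M.g_symm j i

theorem gi_transpose : M.gi.transpose = M.gi := by
  have h : M.gi.transpose * M.g = 1 := by
    have := congrArg Matrix.transpose M.g_mul_gi
    rwa [Matrix.transpose_mul, M.g_transpose, Matrix.transpose_one] at this
  calc M.gi.transpose = M.gi.transpose * (M.g * M.gi) := by rw [M.g_mul_gi, mul_one]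
    _ = M.gi := by rw [← mul_assoc, h, one_mul]

theorem gi_symm (i j : ι) : M.gi i j = M.gi j i := by
  conv_lhs => rw [← M.gi_transpose]
  rfl

theorem sum_g_gi (x : ι → A) (i : ι) : ∑ j, M.g i j * ∑ k, M.gi j k * x k = x i := by
  have h : M.g.mulVec (M.gi.mulVec x) = x := by rw [Matrix.mulVec_mulVec, M.g_mul_gi]; simp
  exact congrFun h i

/-- The Christoffel symbols. -/
def chris (m i j : ι) : A :=
  (1 / 2 : ℝ) • ∑ l, M.gi m l * (M.d i (M.g j l) + M.d j (M.g i l) - M.d l (M.g i j))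

theorem chris_symm (m i j : ι) : M.chris m i j = M.chris m j i := by
  unfold chris
  simp only [M.g_symm i j, add_comm]

/-- Lowering the index cancels the inverse metric and leaves the Christoffel symbol of the first
kind, which is linear in the derivatives of `g`. -/
theorem sum_g_chris (j k i : ι) : ∑ m, M.g j m * M.chris m k i =
    (1 / 2 : ℝ) • (M.d k (M.g i j) + M.d i (M.g k j) - M.d j (M.g k i)) := by
  unfold chris
  simp only [mul_smul_comm, ← Finset.smul_sum]
  rw [M.sum_g_gi (fun l => M.d k (M.g i l) + M.d i (M.g k l) - M.d l (M.g k i))]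

/-- The metric is parallel. -/
theorem d_g (k i j : ι) : M.d k (M.g i j) =
    ∑ m, M.chris m k i * M.g m j + ∑ m, M.g i m * M.chris m k j := by
  have h1 : ∑ m, M.chris m k i * M.g m j = ∑ m, M.g j m * M.chris m k i :=
    Finset.sum_congr rfl fun m _ => by rw [mul_comm, M.g_symm]
  rw [h1, M.sum_g_chris, M.sum_g_chris, ← smul_add, M.g_symm j i]
  have : M.d k (M.g i j) + M.d i (M.g k j) - M.d j (M.g k i) +
      (M.d k (M.g i j) + M.d j (M.g k i) - M.d i (M.g k j)) = (2 : ℝ) • M.d k (M.g i j) := by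
    rw [two_smul]; ring
  rw [this, smul_smul]; norm_num

/-- The connection matrix `(Γ_k)^m_i`. -/
def conn (k : ι) : Matrix ι ι A := Matrix.of fun m i => M.chris m k i

theorem map_g (k : ι) : M.g.map (M.d k) = (M.conn k).transpose * M.g + M.g * M.conn k := by
  ext i j
  simp [conn, Matrix.mul_apply, M.d_g k i j]

/-- Differentiate `g * gi = 1`. An arbitrary derivation is allowed, so that the formula serves
coordinate derivatives and the time derivative alike. -/
theorem map_gi_of (D : Derivation ℝ A A) : M.gi.map D = -(M.gi * M.g.map D * M.gi) := by
  have h := matrix_map_mul D M.g M.gi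
  have h1 : (1 : Matrix ι ι A).map D = 0 := by
    ext i j; by_cases hij : i = j <;> simp [hij]
  rw [M.g_mul_gi, h1] at h
  have h2 : M.gi * (M.g.map D * M.gi + M.g * M.gi.map D) = 0 := by rw [← h, mul_zero]
  rw [mul_add, ← mul_assoc M.gi M.g, M.gi_mul_g, one_mul, ← mul_assoc] at h2
  exact eq_neg_of_add_eq_zero_right h2

theorem map_gi (k : ι) : M.gi.map (M.d k) = -(M.conn k * M.gi) - M.gi * (M.conn k).transpose := by
  rw [map_gi_of, map_g, mul_add, add_mul, ← mul_assoc M.gi M.g, M.gi_mul_g, one_mul, mul_assoc,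
    mul_assoc, M.g_mul_gi, mul_one]
  abel

theorem d_gi (k i j : ι) : M.d k (M.gi i j) =
    -∑ m, M.chris i k m * M.gi m j - ∑ m, M.chris j k m * M.gi i m := by
  have := congrFun (congrFun (M.map_gi k) i) j
  simpa [conn, Matrix.mul_apply, mul_comm] using this

/-- The trace of a derivative of the metric. -/
theorem trace_chris (k : ι) :
    ∑ i, ∑ j, M.gi i j * M.d k (M.g i j) = 2 * ∑ m, M.chris m m k := by
  have h1 : ∑ i, ∑ j, M.gi i j * M.d k (M.g i j) = (M.gi * M.g.map (M.d k)).trace := by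
    simp only [Matrix.trace, Matrix.diag_apply, Matrix.mul_apply, Matrix.map_apply]
    exact Finset.sum_congr rfl fun i _ => Finset.sum_congr rfl fun j _ => by rw [M.g_symm]
  have h2 : (M.gi * ((M.conn k).transpose * M.g)).trace = (M.conn k).trace := by
    rw [Matrix.trace_mul_comm, mul_assoc, M.g_mul_gi, mul_one, Matrix.trace_transpose]
  have h3 : (M.conn k).trace = ∑ m, M.chris m m k :=
    Finset.sum_congr rfl fun m _ => M.chris_symm m k m
  rw [h1, map_g, mul_add, Matrix.trace_add, h2, ← mul_assoc, M.gi_mul_g, one_mul, h3, two_mul]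

/-! ### Curvature -/

/-- The curvature matrix. -/
def curvMat (i j : ι) : Matrix ι ι A :=
  (M.conn j).map (M.d i) - (M.conn i).map (M.d j) + M.conn i * M.conn j - M.conn j * M.conn i

/-- The Ricci tensor. -/
def ric (i j : ι) : A :=
  ∑ m, (M.d m (M.chris m i j) - M.d j (M.chris m i m)) +
    ∑ m, ∑ l, (M.chris m m l * M.chris l i j - M.chris m j l * M.chris l i m)

/-- The Ricci tensor as a trace of the curvature matrices `dΓ + Γ ∧ Γ`. In this form the
differential identities for curvature are identities in a noncommutative matrix ring. -/
theorem ric_eq (i j : ι) : M.ric i j = ∑ m, M.curvMat m j m i := by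
  simp only [ric, curvMat, conn, Matrix.sub_apply, Matrix.add_apply, Matrix.map_apply,
    Matrix.mul_apply, Matrix.of_apply, ← Finset.sum_add_distrib]
  refine Finset.sum_congr rfl fun m _ => ?_
  simp only [M.chris_symm _ j i, M.chris_symm _ m i, Finset.sum_sub_distrib]
  ring

theorem curvMat_antisymm (i j : ι) : M.curvMat i j = -M.curvMat j i := by
  unfold curvMat; abel

theorem map_map_comm (i j : ι) (X : Matrix ι ι A) :
    (X.map (M.d i)).map (M.d j) = (X.map (M.d j)).map (M.d i) := by
  ext a b; exact M.d_comm _ _ _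

/-- Two commuting derivatives are applied to `gi`, which is parallel. The vanishing commutator is
the curvature acting on both indices of `gi`. -/
theorem curvMat_mul_gi (i j : ι) :
    M.curvMat i j * M.gi = -(M.curvMat i j * M.gi).transpose := by
  have h := M.map_map_comm i j M.gi
  have ht : ∀ k l, ((M.conn k).transpose).map (M.d l) = ((M.conn k).map (M.d l)).transpose :=
    fun _ _ => rfl
  rw [map_gi, map_gi] at h
  simp only [matrix_map_sub, matrix_map_neg, matrix_map_mul, map_gi, ht] at h
  rw [Matrix.transpose_mul, M.gi_transpose]
  simp only [curvMat, Matrix.transpose_add, Matrix.transpose_sub, Matrix.transpose_mul]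
  rw [← sub_eq_zero] at h ⊢
  rw [← h]
  noncomm_ring

/-- Expanding `dΓ + Γ ∧ Γ`, second derivatives cancel because the derivations commute and the
products cancel formally. Christoffel corrections for the two form indices are omitted: they would
cancel in the cyclic sum by symmetry. -/
theorem second_bianchi (i j k : ι) :
    ((M.curvMat i j).map (M.d k) + M.conn k * M.curvMat i j - M.curvMat i j * M.conn k) +
    ((M.curvMat j k).map (M.d i) + M.conn i * M.curvMat j k - M.curvMat j k * M.conn i) +
    ((M.curvMat k i).map (M.d j) + M.conn j * M.curvMat k i - M.curvMat k i * M.conn j) = 0 := by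
  simp only [curvMat, matrix_map_sub, matrix_map_add, matrix_map_mul]
  rw [M.map_map_comm i k, M.map_map_comm j i, M.map_map_comm k j]
  noncomm_ring

/-- The curvature with its third index raised. -/
def curvUp (i j : ι) : Matrix ι ι A := M.curvMat i j * M.gi

theorem curvUp_antisymm (i j : ι) (m l : ι) : M.curvUp i j m l = -M.curvUp j i m l := by
  rw [curvUp, curvMat_antisymm]; simp [curvUp]

theorem curvUp_antisymm' (i j : ι) (m l : ι) : M.curvUp i j m l = -M.curvUp i j l m := by
  exact congrFun (congrFun (M.curvMat_mul_gi i j) m) l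

/-- Raising an index commutes with covariant differentiation, since the metric is parallel. -/
theorem second_bianchi_up (i j k : ι) :
    ((M.curvUp i j).map (M.d k) + M.conn k * M.curvUp i j + M.curvUp i j * (M.conn k).transpose) +
    ((M.curvUp j k).map (M.d i) + M.conn i * M.curvUp j k + M.curvUp j k * (M.conn i).transpose) +
    ((M.curvUp k i).map (M.d j) + M.conn j * M.curvUp k i + M.curvUp k i * (M.conn j).transpose)
      = 0 := by
  have h := congrArg (· * M.gi) (M.second_bianchi i j k)
  simp only [zero_mul] at h
  rw [← h]
  simp only [curvUp, matrix_map_mul, map_gi]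
  noncomm_ring

/-- The divergence of a vector. -/
def div0 (X : ι → A) : A := ∑ m, M.d m (X m) + ∑ m, ∑ p, M.chris m m p * X p

/-- The divergence over the upper index `m` of a mixed tensor `B_k^m`. -/
def div1 (B : ι → ι → A) (k : ι) : A :=
  ∑ m, M.d m (B k m) + ∑ m, ∑ p, M.chris m m p * B k p - ∑ m, ∑ p, M.chris p m k * B p m

/-- The scalar curvature. -/
def scal : A := ∑ i, ∑ j, M.gi i j * M.ric i j

/-- The Ricci tensor with its first index raised. -/
def ricUp (k l : ι) : A := ∑ p, M.ric p k * M.gi p l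

theorem ricUp_eq (k l : ι) : M.ricUp k l = ∑ m, M.curvUp m k m l := by
  simp only [ricUp, ric_eq, curvUp, Matrix.mul_apply, Finset.sum_mul]
  exact Finset.sum_comm

theorem scal_eq : M.scal = ∑ l, M.ricUp l l := by
  rw [scal, Finset.sum_comm]
  exact Finset.sum_congr rfl fun l _ => Finset.sum_congr rfl fun p _ => mul_comm _ _

/-- The second Bianchi identity is contracted over both pairs of indices. The derivative in
direction `k` produces the differential of the scalar curvature, and each of the other two cyclic
terms produces minus the divergence of Ricci. Two Christoffel terms drop out as pairings of a
symmetric with an antisymmetric index pair. -/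
theorem contracted_bianchi (k : ι) : M.d k M.scal = 2 * M.div1 M.ricUp k := by
  have h : ∑ m, ∑ l,
      ((M.d k (M.curvUp m l m l) + ∑ p, M.chris m k p * M.curvUp m l p l
        + ∑ p, M.chris l k p * M.curvUp m l m p) +
      (M.d m (M.curvUp l k m l) + ∑ p, M.chris m m p * M.curvUp l k p l
        + ∑ p, M.curvUp l k m p * M.chris l m p) +
      (M.d l (M.curvUp k m m l) + ∑ p, M.curvUp k m p l * M.chris m l p
        + ∑ p, M.chris l l p * M.curvUp k m m p)) = 0 := by
    refine Finset.sum_eq_zero fun m _ => Finset.sum_eq_zero fun l _ => ?_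
    have := congrFun (congrFun (M.second_bianchi_up m l k) m) l
    simp only [Matrix.add_apply, Matrix.mul_apply, Matrix.map_apply, conn, Matrix.of_apply,
      Matrix.transpose_apply, Matrix.zero_apply] at this
    rw [← this]
    simp only [mul_comm]
  have e (m p : ι) : ∑ l, M.curvUp m l p l = M.ricUp m p := by
    rw [ricUp_eq]
    refine Finset.sum_congr rfl fun l _ => ?_
    rw [curvUp_antisymm, curvUp_antisymm', neg_neg]
  have e' (m p : ι) : ∑ l, M.curvUp l m p l = -M.ricUp m p := by
    rw [ricUp_eq, ← Finset.sum_neg_distrib]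
    exact Finset.sum_congr rfl fun l _ => by rw [curvUp_antisymm']
  have e'' (m p : ι) : ∑ l, M.curvUp m l l p = -M.ricUp m p := by
    rw [ricUp_eq, ← Finset.sum_neg_distrib]
    exact Finset.sum_congr rfl fun l _ => by rw [curvUp_antisymm]
  simp only [Finset.sum_add_distrib] at h
  have s1a : ∑ m, ∑ l, M.d k (M.curvUp m l m l) = M.d k M.scal := by
    rw [scal_eq]
    simp only [← map_sum, e]
  have s1b : ∑ m, ∑ l, ∑ p, M.chris m k p * M.curvUp m l p l
      = ∑ m, ∑ p, M.chris p m k * M.ricUp p m := by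
    conv_rhs => rw [Finset.sum_comm]
    refine Finset.sum_congr rfl fun m _ => ?_
    rw [Finset.sum_comm]
    refine Finset.sum_congr rfl fun p _ => ?_
    rw [← Finset.mul_sum, e, M.chris_symm]
  have s1c : ∑ m, ∑ l, ∑ p, M.chris l k p * M.curvUp m l m p
      = ∑ m, ∑ p, M.chris p m k * M.ricUp p m := by
    conv_rhs => rw [Finset.sum_comm]
    rw [Finset.sum_comm]
    refine Finset.sum_congr rfl fun l _ => ?_
    rw [Finset.sum_comm]
    refine Finset.sum_congr rfl fun p _ => ?_
    rw [← Finset.mul_sum, ricUp_eq, M.chris_symm]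
  have s2a : ∑ m, ∑ l, M.d m (M.curvUp l k m l) = -∑ m, M.d m (M.ricUp k m) := by
    simp only [← map_sum, e', map_neg, Finset.sum_neg_distrib]
  have s2b : ∑ m, ∑ l, ∑ p, M.chris m m p * M.curvUp l k p l
      = -∑ m, ∑ p, M.chris m m p * M.ricUp k p := by
    rw [← Finset.sum_neg_distrib]
    refine Finset.sum_congr rfl fun m _ => ?_
    rw [Finset.sum_comm, ← Finset.sum_neg_distrib]
    exact Finset.sum_congr rfl fun p _ => by rw [← Finset.mul_sum, e', mul_neg]
  have s2c : ∑ m, ∑ l, ∑ p, M.curvUp l k m p * M.chris l m p = 0 := by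
    rw [Finset.sum_comm]
    exact Finset.sum_eq_zero fun l _ => sum_antisymm_mul_symm
      (fun _ _ => M.curvUp_antisymm' _ _ _ _) fun _ _ => M.chris_symm _ _ _
  have s3a : ∑ m, ∑ l, M.d l (M.curvUp k m m l) = -∑ m, M.d m (M.ricUp k m) := by
    rw [Finset.sum_comm]
    simp only [← map_sum, e'', map_neg, Finset.sum_neg_distrib]
  have s3b : ∑ m, ∑ l, ∑ p, M.curvUp k m p l * M.chris m l p = 0 := by
    refine Finset.sum_eq_zero fun l _ => ?_
    rw [Finset.sum_comm]
    exact sum_antisymm_mul_symm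
      (fun _ _ => M.curvUp_antisymm' _ _ _ _) fun _ _ => M.chris_symm _ _ _
  have s3c : ∑ m, ∑ l, ∑ p, M.chris l l p * M.curvUp k m m p
      = -∑ m, ∑ p, M.chris m m p * M.ricUp k p := by
    rw [Finset.sum_comm, ← Finset.sum_neg_distrib]
    refine Finset.sum_congr rfl fun l _ => ?_
    rw [Finset.sum_comm, ← Finset.sum_neg_distrib]
    exact Finset.sum_congr rfl fun p _ => by rw [← Finset.mul_sum, e'', mul_neg]
  rw [s1a, s1b, s1c, s2a, s2b, s2c, s3a, s3b, s3c] at h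
  rw [div1]
  linear_combination h

/-- Curvature is skew-adjoint with respect to the metric, so its trace equals its own negative. -/
theorem sum_curvMat_diag (i j : ι) : ∑ m, M.curvMat i j m m = 0 := by
  have h : (M.curvMat i j).trace = -(M.curvMat i j).trace := by
    conv_lhs => rw [← mul_one (M.curvMat i j), ← M.gi_mul_g, ← mul_assoc, M.curvMat_mul_gi,
      Matrix.transpose_mul, M.gi_transpose, neg_mul, Matrix.trace_neg, mul_assoc,
      Matrix.trace_mul_comm, mul_assoc, M.g_mul_gi, mul_one, Matrix.trace_transpose]
  have h2 : 2 * (M.curvMat i j).trace = 2 * 0 := by linear_combination h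
  exact two_mul_cancel h2

/-- This is torsion-freeness: after the symmetry of the Christoffel symbols is used, all terms of
the cyclic sum cancel. -/
theorem first_bianchi (i j l m : ι) :
    M.curvMat i j m l + M.curvMat j l m i + M.curvMat l i m j = 0 := by
  simp only [curvMat, conn, Matrix.sub_apply, Matrix.add_apply, Matrix.map_apply,
    Matrix.mul_apply, Matrix.of_apply]
  simp only [M.chris_symm _ j i, M.chris_symm _ l i, M.chris_symm _ l j]
  ring

/-- Trace the first Bianchi identity; the trace of the curvature endomorphism disappears by
`sum_curvMat_diag`. -/
theorem ric_symm (i j : ι) : M.ric i j = M.ric j i := by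
  have h : ∑ m, (M.curvMat m j m i + M.curvMat j i m m + M.curvMat i m m j) = 0 :=
    Finset.sum_eq_zero fun m _ => M.first_bianchi m j i m
  simp only [Finset.sum_add_distrib, sum_curvMat_diag] at h
  rw [ric_eq, ric_eq]
  have h2 : ∑ m, M.curvMat i m m j = -∑ m, M.curvMat m i m j := by
    rw [← Finset.sum_neg_distrib]
    exact Finset.sum_congr rfl fun m _ => by rw [curvMat_antisymm]; rfl
  rw [h2] at h
  linear_combination h

end MetricRing

theorem sum_rotate {A ι κ l : Type*} [AddCommMonoid A] [Fintype ι] [Fintype κ] [Fintype l]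
    (f : ι → κ → l → A) : ∑ a, ∑ b, ∑ c, f a b c = ∑ c, ∑ a, ∑ b, f a b c := by
  rw [Finset.sum_comm (γ := l)]
  exact Finset.sum_congr rfl fun a _ => Finset.sum_comm

theorem sum_comm_pairs {A ι : Type*} [AddCommMonoid A] [Fintype ι] (f : ι → ι → ι → ι → A) :
    ∑ a, ∑ b, ∑ c, ∑ e, f a b c e = ∑ c, ∑ e, ∑ a, ∑ b, f a b c e := by
  have h (F : ι → ι → ι → ι → A) :
      ∑ a, ∑ b, ∑ c, ∑ e, F a b c e = ∑ x : ι × ι, ∑ y : ι × ι, F x.1 x.2 y.1 y.2 := by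
    simp only [Fintype.sum_prod_type]
  rw [h, h, Finset.sum_comm]

namespace MetricRing

variable {A ι : Type*} [CommRing A] [Algebra ℝ A] [Fintype ι] [DecidableEq ι]
  (M : MetricRing A ι)

/-! ### Covariant derivatives and the Bochner formula -/

/-- The covariant derivative of a vector. -/
def nabla (X : ι → A) (i m : ι) : A := M.d i (X m) + ∑ p, M.chris m i p * X p

theorem div0_eq (X : ι → A) : M.div0 X = ∑ m, M.nabla X m m := by
  simp only [div0, nabla, Finset.sum_add_distrib]

/-- Interchanging the two covariant derivatives costs one contraction with Ricci. This is the only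
place where curvature enters the Bochner formula. -/
theorem div1_nabla (X : ι → A) (i : ι) :
    M.div1 (M.nabla X) i = M.d i (M.div0 X) + ∑ p, M.ric p i * X p := by
  simp only [div1, nabla, div0, ric, map_add, map_sum, Derivation.leibniz, smul_eq_mul, mul_add,
    add_mul, sub_mul, Finset.sum_add_distrib, Finset.sum_sub_distrib, Finset.mul_sum,
    Finset.sum_mul]
  have h1 : ∑ m, ∑ p, M.chris m i p * M.d m (X p) = ∑ m, ∑ p, M.chris p m i * M.d p (X m) := by
    rw [Finset.sum_comm]
    exact Finset.sum_congr rfl fun m _ => Finset.sum_congr rfl fun p _ => by rw [M.chris_symm]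
  have h2 : ∑ m, ∑ p, X p * M.d m (M.chris m i p) = ∑ p, ∑ m, M.d m (M.chris m p i) * X p := by
    rw [Finset.sum_comm]
    exact Finset.sum_congr rfl fun m _ => Finset.sum_congr rfl fun p _ => by
      rw [M.chris_symm, mul_comm]
  have h3 : ∑ m, ∑ p, X p * M.d i (M.chris m m p) = ∑ p, ∑ m, M.d i (M.chris m p m) * X p := by
    rw [Finset.sum_comm]
    exact Finset.sum_congr rfl fun m _ => Finset.sum_congr rfl fun p _ => by
      rw [M.chris_symm _ p m, mul_comm]
  have h4 : ∑ m, ∑ p, ∑ q, M.chris m m p * (M.chris p i q * X q) =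
      ∑ p, ∑ m, ∑ l, M.chris m m l * M.chris l p i * X p := by
    rw [sum_rotate]
    exact Finset.sum_congr rfl fun _ _ => Finset.sum_congr rfl fun _ _ =>
      Finset.sum_congr rfl fun _ _ => by rw [M.chris_symm _ i, mul_assoc]
  have h5 : ∑ m, ∑ p, ∑ q, M.chris p m i * (M.chris m p q * X q) =
      ∑ p, ∑ m, ∑ l, M.chris m i l * M.chris l p m * X p := by
    rw [sum_rotate]
    refine Finset.sum_congr rfl fun q _ => ?_
    rw [Finset.sum_comm]
    exact Finset.sum_congr rfl fun p _ => Finset.sum_congr rfl fun m _ => by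
      rw [M.chris_symm _ m i, M.chris_symm _ p q, mul_assoc]
  have h6 : ∑ m, M.d m (M.d i (X m)) = ∑ m, M.d i (M.d m (X m)) :=
    Finset.sum_congr rfl fun m _ => M.d_comm _ _ _
  linear_combination h1 + h2 - h3 + h4 - h5 + h6

/-- Leibniz rule for the divergence: the connection terms belonging to the contracted index pair
cancel. -/
theorem div0_contract (X : ι → A) (B : ι → ι → A) :
    M.div0 (fun m => ∑ i, X i * B i m) =
      ∑ i, X i * M.div1 B i + ∑ i, ∑ m, M.nabla X m i * B i m := by
  simp only [div1, nabla, div0, map_sum, Derivation.leibniz, smul_eq_mul, mul_add, mul_sub,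
    add_mul, Finset.sum_add_distrib, Finset.sum_sub_distrib, Finset.mul_sum, Finset.sum_mul]
  have h1 : ∑ m, ∑ i, X i * M.d m (B i m) = ∑ i, ∑ m, X i * M.d m (B i m) := Finset.sum_comm
  have h2 : ∑ m, ∑ i, B i m * M.d m (X i) = ∑ i, ∑ m, M.d m (X i) * B i m := by
    rw [Finset.sum_comm]
    simp only [mul_comm]
  have h3 : ∑ m, ∑ p, ∑ i, M.chris m m p * (X i * B i p) =
      ∑ i, ∑ m, ∑ p, X i * (M.chris m m p * B i p) := by
    rw [sum_rotate]
    simp only [mul_left_comm]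
  have h4 : ∑ i, ∑ m, ∑ p, X i * (M.chris p m i * B p m) =
      ∑ i, ∑ m, ∑ p, M.chris i m p * X p * B i m := by
    rw [sum_rotate]
    refine Finset.sum_congr rfl fun i _ => ?_
    rw [Finset.sum_comm]
    exact Finset.sum_congr rfl fun _ _ => Finset.sum_congr rfl fun _ _ => by ring
  linear_combination h1 + h2 + h3 + h4

/-- The vector obtained by raising the index of a covector. -/
def raise (a : ι → A) (m : ι) : A := ∑ k, M.gi m k * a k

/-- The covariant derivative of a covector. -/
def nablaCo (a : ι → A) (i k : ι) : A := M.d i (a k) - ∑ m, M.chris m i k * a m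

/-- By `d_gi` the inverse metric is parallel, so it passes through the covariant derivative. -/
theorem nabla_raise (a : ι → A) (i m : ι) :
    M.nabla (M.raise a) i m = ∑ k, M.gi m k * M.nablaCo a i k := by
  simp only [nabla, raise, nablaCo, map_sum, Derivation.leibniz, smul_eq_mul, mul_sub,
    Finset.sum_add_distrib, Finset.sum_sub_distrib, Finset.mul_sum, d_gi, Finset.mul_sum, mul_neg]
  have h1 : ∑ k, ∑ q, a k * (M.chris m i q * M.gi q k) =
      ∑ q, ∑ k, M.chris m i q * (M.gi q k * a k) := by
    rw [Finset.sum_comm]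
    exact Finset.sum_congr rfl fun _ _ => Finset.sum_congr rfl fun _ _ => by ring
  have h2 : ∑ k, ∑ q, a k * (M.chris k i q * M.gi m q) =
      ∑ q, ∑ k, M.gi m q * (M.chris k i q * a k) := by
    rw [Finset.sum_comm]
    exact Finset.sum_congr rfl fun _ _ => Finset.sum_congr rfl fun _ _ => by ring
  simp only [Finset.sum_neg_distrib]
  linear_combination -h1 - h2

/-- The gradient. -/
def grad (f : A) (m : ι) : A := ∑ k, M.gi m k * M.d k f

/-- The Hessian. -/
def hess (f : A) (i j : ι) : A := M.d i (M.d j f) - ∑ m, M.chris m i j * M.d m f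

/-- The Laplacian. -/
def lap (f : A) : A := ∑ i, ∑ j, M.gi i j * M.hess f i j

/-- The inner product of the gradients. -/
def gradInner (a b : A) : A := ∑ i, ∑ j, M.gi i j * M.d i a * M.d j b

/-- The Hessian with its second index raised. -/
def hessUp (f : A) (i m : ι) : A := ∑ k, M.gi m k * M.hess f i k

theorem hess_symm (f : A) (i j : ι) : M.hess f i j = M.hess f j i := by
  simp only [hess, M.d_comm i j, M.chris_symm _ i j]

theorem gradInner_symm (a b : A) : M.gradInner a b = M.gradInner b a := by
  rw [gradInner, gradInner, Finset.sum_comm]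
  exact Finset.sum_congr rfl fun i _ => Finset.sum_congr rfl fun j _ => by rw [M.gi_symm]; ring

theorem gradInner_eq (a b : A) : M.gradInner a b = ∑ i, M.grad a i * M.d i b := by
  rw [gradInner, Finset.sum_comm]
  simp only [grad, Finset.sum_mul]
  exact Finset.sum_congr rfl fun i _ => Finset.sum_congr rfl fun j _ => by rw [M.gi_symm]

theorem nabla_grad (f : A) (i m : ι) : M.nabla (M.grad f) i m = M.hessUp f i m :=
  M.nabla_raise (fun k => M.d k f) i m

theorem lap_eq_sum (f : A) : M.lap f = ∑ m, M.hessUp f m m := rfl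

theorem lap_eq_div0 (f : A) : M.lap f = M.div0 (M.grad f) := by
  simp only [div0_eq, nabla_grad, lap_eq_sum]

/-- Metric compatibility lets the derivative of a scalar product be distributed over covariant
derivatives, here Hessians. -/
theorem d_gradInner (a b : A) (k : ι) : M.d k (M.gradInner a b) =
    ∑ i, M.grad a i * M.hess b k i + ∑ i, M.grad b i * M.hess a k i := by
  have key (a b : A) : ∑ i, M.nabla (M.grad a) k i * M.d i b = ∑ i, M.grad b i * M.hess a k i := by
    simp only [nabla_grad, hessUp, grad, Finset.sum_mul]
    rw [Finset.sum_comm]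
    exact Finset.sum_congr rfl fun _ _ => Finset.sum_congr rfl fun _ _ => by
      rw [M.gi_symm]; ring
  rw [gradInner_eq, ← key a b]
  simp only [map_sum, Derivation.leibniz, smul_eq_mul, nabla, hess, add_mul, mul_sub,
    Finset.sum_add_distrib, Finset.sum_sub_distrib, Finset.mul_sum, Finset.sum_mul]
  have h : ∑ i, ∑ p, M.grad a i * (M.chris p k i * M.d p b) =
      ∑ i, ∑ p, M.chris i k p * M.grad a p * M.d i b := by
    rw [Finset.sum_comm]
    exact Finset.sum_congr rfl fun _ _ => Finset.sum_congr rfl fun _ _ => by ring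
  have h2 : ∑ i, M.d i b * M.d k (M.grad a i) = ∑ i, M.d k (M.grad a i) * M.d i b := by
    simp only [mul_comm]
  linear_combination h + h2

theorem grad_gradInner_self (f : A) (m : ι) :
    M.grad (M.gradInner f f) m = 2 * ∑ i, M.grad f i * M.hessUp f i m := by
  simp only [grad, d_gradInner, hessUp, ← two_mul, Finset.mul_sum]
  rw [Finset.sum_comm]
  refine Finset.sum_congr rfl fun i _ => Finset.sum_congr rfl fun j _ => ?_
  simp only [Finset.sum_mul, Finset.mul_sum]
  refine Finset.sum_congr rfl fun l _ => ?_
  rw [M.hess_symm]; ring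

theorem div0_const_mul {c : A} (hc : ∀ i, M.d i c = 0) (X : ι → A) :
    M.div0 (fun m => c * X m) = c * M.div0 X := by
  simp [div0, Derivation.leibniz, hc, mul_add, Finset.mul_sum, mul_left_comm]

theorem d_ofNat (n : ℕ) [n.AtLeastTwo] (i : ι) : M.d i (OfNat.ofNat n : A) = 0 :=
  (M.d i).map_natCast n

/-- The Bochner formula. -/
theorem bochner (f : A) : M.lap (M.gradInner f f) =
    2 * ∑ i, ∑ m, M.hessUp f i m * M.hessUp f m i + 2 * M.gradInner f (M.lap f) +
      2 * ∑ i, ∑ j, M.ric i j * M.grad f i * M.grad f j := by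
  rw [lap_eq_div0]
  have h : M.grad (M.gradInner f f) = fun m => 2 *
      ∑ i, M.grad f i * M.nabla (M.grad f) i m := by
    ext m
    rw [grad_gradInner_self]
    simp only [nabla_grad]
  rw [h, M.div0_const_mul (M.d_ofNat 2), div0_contract, gradInner_eq]
  simp only [div1_nabla, nabla_grad, ← lap_eq_div0, mul_add, Finset.sum_add_distrib,
    Finset.mul_sum]
  have h1 : ∑ i, ∑ p, 2 * (M.grad f i * (M.ric p i * M.grad f p)) =
      ∑ i, ∑ j, 2 * (M.ric i j * M.grad f i * M.grad f j) := by
    rw [Finset.sum_comm]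
    exact Finset.sum_congr rfl fun _ _ => Finset.sum_congr rfl fun _ _ => by ring
  have h2 : ∑ i, ∑ m, 2 * (M.hessUp f m i * M.hessUp f i m) =
      ∑ i, ∑ m, 2 * (M.hessUp f i m * M.hessUp f m i) :=
    Finset.sum_congr rfl fun _ _ => Finset.sum_congr rfl fun _ _ => by ring
  linear_combination h1 + h2

/-! ### Variation of the metric -/

section Variation

variable (D : Derivation ℝ A A)

/-- The variation of the metric with one index raised. -/
def varUp (k m : ι) : A := ∑ j, D (M.g k j) * M.gi j m

/-- The variation of the metric with both indices raised. -/
def varUpUp (p m : ι) : A := ∑ k, M.varUp D k p * M.gi k m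

/-- The trace of the variation of the metric. -/
def varTr : A := ∑ i, ∑ j, M.gi i j * D (M.g i j)

theorem varUpUp_eq (p m : ι) : M.varUpUp D p m = (M.gi * M.g.map D * M.gi) p m := by
  simp only [varUpUp, varUp, Matrix.mul_apply, Matrix.map_apply]
  exact Finset.sum_congr rfl fun k _ => congrArg (· * _) <| Finset.sum_congr rfl fun j _ => by
    rw [mul_comm, M.gi_symm, M.g_symm]

theorem D_gi (i j : ι) : D (M.gi i j) = -M.varUpUp D i j := by
  rw [varUpUp_eq]
  exact congrFun (congrFun (M.map_gi_of D) i) j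

theorem varUpUp_symm (i j : ι) : M.varUpUp D i j = M.varUpUp D j i := by
  rw [← neg_inj, ← D_gi, ← D_gi, M.gi_symm]

theorem sum_varUpUp_mul (s : Matrix ι ι A) (hs : ∀ i j, s i j = s j i) :
    ∑ i, ∑ j, M.varUpUp D i j * s i j = (M.gi * M.g.map D * M.gi * s).trace := by
  simp only [Matrix.trace, Matrix.diag_apply, varUpUp_eq]
  refine Finset.sum_congr rfl fun i _ => ?_
  rw [Matrix.mul_apply]
  exact Finset.sum_congr rfl fun j _ => by rw [hs]

/-- Apply `D` to `trace_chris` and commute it with the coordinate derivative. The two terms in which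
the inverse metric is differentiated agree by cyclicity of the trace. -/
theorem two_mul_sum_D_chris (hD : ∀ i x, D (M.d i x) = M.d i (D x)) (k : ι) :
    2 * ∑ m, D (M.chris m m k) = M.d k (M.varTr D) := by
  have h := congrArg D (M.trace_chris k)
  rw [two_mul, map_add, ← two_mul] at h
  rw [← map_sum, ← h, varTr]
  simp only [map_sum, Derivation.leibniz, smul_eq_mul, Finset.sum_add_distrib, hD]
  have e1 : ∑ i, ∑ j, M.d k (M.g i j) * D (M.gi i j) =
      -(M.gi * M.g.map D * M.gi * M.g.map (M.d k)).trace := by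
    rw [← M.sum_varUpUp_mul D (M.g.map (M.d k)) fun i j => congrArg _ (M.g_symm i j)]
    simp only [Matrix.map_apply, D_gi, mul_neg, Finset.sum_neg_distrib, mul_comm (_ : A) (M.varUpUp _ _ _)]
  have e2 : ∑ i, ∑ j, D (M.g i j) * M.d k (M.gi i j) =
      -(M.gi * M.g.map (M.d k) * M.gi * M.g.map D).trace := by
    rw [← M.sum_varUpUp_mul (M.d k) (M.g.map D) fun i j => congrArg _ (M.g_symm i j)]
    simp only [Matrix.map_apply, D_gi, mul_neg, Finset.sum_neg_distrib, mul_comm (_ : A) (M.varUpUp _ _ _)]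
  have e3 : (M.gi * M.g.map D * M.gi * M.g.map (M.d k)).trace =
      (M.gi * M.g.map (M.d k) * M.gi * M.g.map D).trace := by
    rw [mul_assoc (M.gi * _), Matrix.trace_mul_comm, ← mul_assoc]
  rw [e1, e2, e3]

/-- A trace of `d_gi`. It expresses the contracted connection through derivatives of the inverse
metric, so that its variation follows from that of `gi` alone. -/
theorem sum_gi_chris (m : ι) : ∑ i, ∑ j, M.gi i j * M.chris m i j =
    -(∑ p, M.d p (M.gi p m) + ∑ p, ∑ q, M.gi m p * M.chris q q p) := by
  simp only [d_gi, Finset.sum_sub_distrib, Finset.sum_neg_distrib]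
  have h1 : ∑ p, ∑ q, M.chris p p q * M.gi q m = ∑ p, ∑ q, M.gi m p * M.chris q q p := by
    rw [Finset.sum_comm]
    exact Finset.sum_congr rfl fun _ _ => Finset.sum_congr rfl fun _ _ => by
      rw [M.gi_symm, mul_comm]
  have h2 : ∑ p, ∑ q, M.chris m p q * M.gi p q = ∑ i, ∑ j, M.gi i j * M.chris m i j := by
    simp only [mul_comm]
  linear_combination -h1 - h2

/-- Traced variation formula of the connection: the divergence of the metric variation minus half
the gradient of its trace, the latter kept as a contracted variation of Christoffel symbols. It
comes from varying `sum_gi_chris`. -/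
theorem sum_gi_D_chris (hD : ∀ i x, D (M.d i x) = M.d i (D x)) (m : ι) :
    ∑ i, ∑ j, M.gi i j * D (M.chris m i j) =
      ∑ k, M.gi m k * M.div1 (M.varUp D) k - ∑ p, ∑ q, M.gi m p * D (M.chris q q p) := by
  have h := congrArg D (M.sum_gi_chris m)
  simp only [map_neg, map_add, map_sum, Derivation.leibniz, smul_eq_mul, hD, M.D_gi D,
    mul_neg, Finset.sum_add_distrib, Finset.sum_neg_distrib] at h
  have h2 : ∑ p, M.d p (M.varUpUp D p m) =
      ∑ k, ∑ p, M.gi m k * M.d p (M.varUp D k p)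
      - ∑ k, ∑ p, ∑ q, M.gi m k * (M.chris q p k * M.varUp D q p)
      - ∑ i, ∑ j, M.chris m i j * M.varUpUp D i j := by
    simp only [varUpUp, map_sum, Derivation.leibniz, smul_eq_mul, d_gi, Finset.sum_add_distrib,
      mul_sub, mul_neg, Finset.sum_sub_distrib, Finset.sum_neg_distrib, Finset.mul_sum]
    have a1 : ∑ p, ∑ k, M.gi k m * M.d p (M.varUp D k p) =
        ∑ k, ∑ p, M.gi m k * M.d p (M.varUp D k p) := by
      rw [Finset.sum_comm]
      exact Finset.sum_congr rfl fun _ _ => Finset.sum_congr rfl fun _ _ => by rw [M.gi_symm]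
    have a2 : ∑ p, ∑ k, ∑ q, M.varUp D k p * (M.chris k p q * M.gi q m) =
        ∑ k, ∑ p, ∑ q, M.gi m k * (M.chris q p k * M.varUp D q p) := by
      rw [sum_rotate]
      exact Finset.sum_congr rfl fun _ _ => Finset.sum_congr rfl fun _ _ =>
        Finset.sum_congr rfl fun _ _ => by rw [M.gi_symm]; ring
    have a3 : ∑ p, ∑ k, ∑ q, M.varUp D k p * (M.chris m p q * M.gi k q) =
        ∑ i, ∑ j, ∑ k, M.chris m i j * (M.varUp D k i * M.gi k j) := by
      refine Finset.sum_congr rfl fun _ _ => ?_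
      rw [Finset.sum_comm]
      exact Finset.sum_congr rfl fun _ _ => Finset.sum_congr rfl fun _ _ => by ring
    linear_combination a1 - a2 - a3
  have h3 : ∑ p, ∑ q, M.chris q q p * M.varUpUp D m p =
      ∑ k, ∑ p, ∑ q, M.gi m k * (M.chris p p q * M.varUp D k q) := by
    have hs (p : ι) : M.varUpUp D m p = ∑ k, M.varUp D k p * M.gi k m := M.varUpUp_symm D m p
    simp only [hs, Finset.mul_sum]
    rw [sum_rotate]
    refine Finset.sum_congr rfl fun _ _ => ?_
    rw [Finset.sum_comm]
    exact Finset.sum_congr rfl fun _ _ => Finset.sum_congr rfl fun _ _ => by rw [M.gi_symm]; ring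
  simp only [div1, mul_add, mul_sub, Finset.sum_add_distrib, Finset.sum_sub_distrib,
    Finset.mul_sum]
  linear_combination h + h2 + h3

/-- The variation is left in non-covariant form, as derivatives of the varied connection plus
connection terms. Only its trace, in `D_scal`, has to be organised as a divergence. -/
theorem D_ric (hD : ∀ i x, D (M.d i x) = M.d i (D x)) (i j : ι) : D (M.ric i j) =
    ∑ m, M.d m (D (M.chris m i j)) - M.d j (∑ m, D (M.chris m m i))
      + ∑ m, ∑ l, (M.chris m m l * D (M.chris l i j) + D (M.chris m m l) * M.chris l i j)
      - ∑ m, ∑ l, (M.chris m j l * D (M.chris l i m) + D (M.chris m j l) * M.chris l i m) := by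
  simp only [ric, map_add, map_sub, map_sum, Derivation.leibniz, smul_eq_mul, hD,
    Finset.sum_add_distrib, Finset.sum_sub_distrib, M.chris_symm _ i]
  simp only [mul_comm (D _)]
  simp only [M.chris_symm]
  ring

/-- The vector field whose divergence is the second-order part of the variation of the scalar
curvature. -/
def scalFlux (m : ι) : A := ∑ k, M.gi m k * (M.div1 (M.varUp D) k - M.d k (M.varTr D))

/-- The flux written through varied Christoffel symbols, which is how it appears when `D_ric` is
traced. -/
theorem scalFlux_eq (hD : ∀ i x, D (M.d i x) = M.d i (D x)) (m : ι) : M.scalFlux D m =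
    ∑ i, ∑ j, M.gi i j * D (M.chris m i j) - ∑ i, M.gi m i * ∑ l, D (M.chris l l i) := by
  have h := M.sum_gi_D_chris D hD m
  simp only [← Finset.mul_sum] at h ⊢
  simp only [scalFlux, mul_sub, Finset.sum_sub_distrib, ← M.two_mul_sum_D_chris D hD,
    mul_left_comm _ (2 : A), ← Finset.mul_sum]
  linear_combination -h

/-- Palatini's argument: the trace of the varied Ricci tensor is a pure divergence, and the other
term comes from varying the inverse metric. -/
theorem D_scal (hD : ∀ i x, D (M.d i x) = M.d i (D x)) : D M.scal =
    -∑ i, ∑ j, M.varUpUp D i j * M.ric i j + M.div0 (M.scalFlux D) := by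
  have hW : M.scalFlux D = fun m => ∑ i, ∑ j, M.gi i j * D (M.chris m i j)
      - ∑ i, M.gi m i * ∑ l, D (M.chris l l i) := funext (M.scalFlux_eq D hD)
  -- An opaque name for the contracted variation keeps the sum inside it from being distributed.
  obtain ⟨c, hc⟩ : ∃ c : ι → A, ∀ i, ∑ l, D (M.chris l l i) = c i := ⟨_, fun _ => rfl⟩
  simp only [hc] at hW
  rw [hW]
  have h4 (i j : ι) : ∑ m, ∑ l, D (M.chris m m l) * M.chris l i j = ∑ l, c l * M.chris l i j := by
    rw [Finset.sum_comm]
    simp only [← Finset.sum_mul, hc]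
  have hR (i j : ι) := M.D_ric D hD i j
  simp only [Finset.sum_add_distrib, h4, hc] at hR
  simp only [scal, div0, map_sum, map_sub, Derivation.leibniz, smul_eq_mul, hR, M.D_gi D, d_gi, mul_neg,
    Finset.sum_add_distrib, Finset.sum_sub_distrib, Finset.sum_neg_distrib, mul_add, mul_sub,
    Finset.mul_sum]
  have r1 : ∑ i, ∑ j, ∑ m, M.gi i j * M.d m (D (M.chris m i j)) =
      ∑ m, ∑ i, ∑ j, M.gi i j * M.d m (D (M.chris m i j)) := sum_rotate _
  have l0 : ∑ i, ∑ j, M.ric i j * M.varUpUp D i j = ∑ i, ∑ j, M.varUpUp D i j * M.ric i j := by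
    simp only [mul_comm]
  have r4 : ∑ i, ∑ j, M.gi i j * M.d j (c i) = ∑ m, ∑ i, M.gi m i * M.d m (c i) := by
    rw [Finset.sum_comm]
    exact Finset.sum_congr rfl fun _ _ => Finset.sum_congr rfl fun _ _ => by rw [M.gi_symm]
  have r5 : ∑ i, ∑ j, ∑ m, ∑ l, M.gi i j * (M.chris m m l * D (M.chris l i j)) =
      ∑ m, ∑ l, ∑ i, ∑ j, M.chris m m l * (M.gi i j * D (M.chris l i j)) := by
    rw [sum_comm_pairs]
    exact Finset.sum_congr rfl fun _ _ => Finset.sum_congr rfl fun _ _ =>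
      Finset.sum_congr rfl fun _ _ => Finset.sum_congr rfl fun _ _ => by ring
  have l4 : ∑ i, ∑ j, ∑ l, M.gi i j * (c l * M.chris l i j) =
      ∑ m, ∑ i, ∑ q, c i * (M.chris i m q * M.gi m q) := by
    refine Finset.sum_congr rfl fun _ _ => ?_
    rw [Finset.sum_comm]
    exact Finset.sum_congr rfl fun _ _ => Finset.sum_congr rfl fun _ _ => by ring
  have l5 : ∑ i, ∑ j, ∑ m, ∑ l, M.gi i j * (M.chris m j l * D (M.chris l i m)) =
      ∑ m, ∑ i, ∑ j, ∑ q, D (M.chris m i j) * (M.chris j m q * M.gi i q) := by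
    conv_lhs => enter [2, i]; rw [sum_rotate]
    rw [Finset.sum_comm]
    refine Finset.sum_congr rfl fun _ _ => Finset.sum_congr rfl fun _ _ => ?_
    rw [Finset.sum_comm]
    exact Finset.sum_congr rfl fun _ _ => Finset.sum_congr rfl fun _ _ => by
      rw [M.chris_symm _ _ (_ : ι)]; ring
  have l6 : ∑ i, ∑ j, ∑ m, ∑ l, M.gi i j * (D (M.chris m j l) * M.chris l i m) =
      ∑ m, ∑ i, ∑ j, ∑ q, D (M.chris m i j) * (M.chris i m q * M.gi q j) := by
    symm
    conv_lhs => enter [2, i]; rw [sum_rotate]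
    rw [Finset.sum_comm]
    refine Finset.sum_congr rfl fun i _ => ?_
    rw [sum_rotate]
    refine Finset.sum_congr rfl fun j _ => Finset.sum_congr rfl fun m _ =>
      Finset.sum_congr rfl fun l _ => ?_
    rw [M.chris_symm m j l, M.chris_symm l i m]; ring
  have r3 : ∑ m, ∑ i, ∑ q, c i * (M.chris m m q * M.gi q i) =
      ∑ m, ∑ p, ∑ i, M.chris m m p * (M.gi p i * c i) := by
    refine Finset.sum_congr rfl fun _ _ => ?_
    rw [Finset.sum_comm]
    exact Finset.sum_congr rfl fun _ _ => Finset.sum_congr rfl fun _ _ => by ring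
  linear_combination -l0 + r1 - r4 + r5 + l4 - l5 - l6 - r3

/-- Besides `f` itself, both the inverse metric and the Christoffel symbols vary; the latter
contribution is contracted by `sum_gi_D_chris`. -/
theorem D_lap (hD : ∀ i x, D (M.d i x) = M.d i (D x)) (f : A) : D (M.lap f) =
    M.lap (D f) - ∑ i, ∑ j, M.varUpUp D i j * M.hess f i j
      - ∑ m, (M.div1 (M.varUp D) m - (∑ q, D (M.chris q q m))) * M.grad f m := by
  have e : ∑ m, (M.div1 (M.varUp D) m - (∑ q, D (M.chris q q m))) * M.grad f m =
      ∑ i, ∑ j, ∑ m, M.gi i j * (D (M.chris m i j) * M.d m f) := by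
    rw [sum_rotate]
    have (m : ι) : ∑ i, ∑ j, M.gi i j * (D (M.chris m i j) * M.d m f) =
        (∑ k, M.gi m k * (M.div1 (M.varUp D) k - (∑ q, D (M.chris q q k)))) * M.d m f := by
      simp only [mul_sub, Finset.mul_sum, Finset.sum_sub_distrib]
      rw [← M.sum_gi_D_chris D hD m]
      simp only [Finset.sum_mul, mul_assoc]
    simp only [this, grad, Finset.mul_sum, Finset.sum_mul]
    rw [Finset.sum_comm]
    exact Finset.sum_congr rfl fun _ _ => Finset.sum_congr rfl fun _ _ => by
      rw [M.gi_symm]; ring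
  rw [e]
  simp only [lap, hess, map_sum, map_sub, Derivation.leibniz, smul_eq_mul, hD, M.D_gi D, mul_sub,
    mul_add, mul_neg, Finset.sum_sub_distrib, Finset.sum_add_distrib, Finset.mul_sum,
    Finset.sum_neg_distrib]
  have e1 : ∑ i, ∑ j, M.d i (M.d j f) * M.varUpUp D i j =
    ∑ i, ∑ j, M.varUpUp D i j * M.d i (M.d j f) := by simp only [mul_comm]
  have e2 : ∑ i, ∑ j, ∑ m, M.chris m i j * M.d m f * M.varUpUp D i j =
    ∑ i, ∑ j, ∑ m, M.varUpUp D i j * (M.chris m i j * M.d m f) := by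
    simp only [mul_comm]
  have e3 : ∑ i, ∑ j, ∑ m, M.gi i j * (M.d m f * D (M.chris m i j)) =
    ∑ i, ∑ j, ∑ m, M.gi i j * (D (M.chris m i j) * M.d m f) := by
    simp only [mul_comm]
  linear_combination e2 - e1 - e3

theorem D_gradInner (hD : ∀ i x, D (M.d i x) = M.d i (D x)) (f : A) : D (M.gradInner f f) =
    2 * M.gradInner f (D f) - ∑ i, ∑ j, M.varUpUp D i j * M.d i f * M.d j f := by
  have e : ∑ i, ∑ j, M.gi i j * M.d i (D f) * M.d j f = ∑ i, ∑ j, M.gi i j * M.d i f * M.d j (D f) := by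
    rw [Finset.sum_comm]
    exact Finset.sum_congr rfl fun _ _ => Finset.sum_congr rfl fun _ _ => by
      rw [M.gi_symm]; ring
  rw [gradInner, gradInner, two_mul]
  nth_rewrite 2 [← e]
  simp only [map_sum, Derivation.leibniz, smul_eq_mul, hD, M.D_gi D, ← Finset.sum_add_distrib,
    ← Finset.sum_sub_distrib]
  exact Finset.sum_congr rfl fun _ _ => Finset.sum_congr rfl fun _ _ => by ring

end Variation

/-! ### Two-forms -/

variable (F : ι → ι → A)

/-- A two-form with both indices raised. -/
def formUp (m k : ι) : A := ∑ j, M.gi k j * M.raise (fun i => F i j) m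

/-- The tensor `F²`. -/
def formSq (i j : ι) : A := ∑ l, ∑ m, M.gi l m * F i l * F j m

/-- The square norm of a two-form. -/
def formNormSq : A := ∑ i, ∑ j, M.gi i j * M.formSq F i j

/-- The covariant derivative of a two-form. -/
def nablaForm (m i j : ι) : A :=
  M.d m (F i j) - ∑ l, M.chris l m i * F l j - ∑ l, M.chris l m j * F i l

/-- The codifferential of a two-form. -/
def codiff (j : ι) : A := -∑ m, ∑ i, M.gi m i * M.nablaForm F m i j

theorem formUp_eq (m k : ι) : M.formUp F m k = ∑ i, ∑ j, M.gi m i * M.gi k j * F i j := by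
  simp only [formUp, raise, Finset.mul_sum]
  rw [Finset.sum_comm]
  exact Finset.sum_congr rfl fun _ _ => Finset.sum_congr rfl fun _ _ => by ring

variable {F} (hF : ∀ i j, F i j = -F j i)
include hF

theorem formUp_antisymm (m k : ι) : M.formUp F m k = -M.formUp F k m := by
  rw [formUp_eq, formUp_eq, Finset.sum_comm, ← Finset.sum_neg_distrib]
  refine Finset.sum_congr rfl fun i _ => ?_
  rw [← Finset.sum_neg_distrib]
  exact Finset.sum_congr rfl fun j _ => by rw [hF]; ring

/-- For an antisymmetric tensor the connection term of the free index pairs a symmetric with an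
antisymmetric object and vanishes (`h2`). The divergence may therefore be taken as if the other
index were a mere label. -/
theorem div_formUp (k : ι) : M.div0 (fun m => M.formUp F m k) = -M.raise (M.codiff F) k := by
  have h0 (j : ι) : M.div0 (M.raise fun i => F i j) =
      ∑ m, ∑ i, M.gi m i * M.nablaCo (fun i => F i j) m i := by
    rw [div0_eq]
    simp only [nabla_raise]
  have h1 (j : ι) : M.codiff F j = -M.div0 (M.raise fun i => F i j)
      + ∑ m, ∑ l, M.chris l m j * M.raise (fun i => F i l) m := by
    rw [h0]
    simp only [codiff, nablaForm, nablaCo, raise, mul_sub, Finset.mul_sum,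
      Finset.sum_sub_distrib]
    have : ∑ m, ∑ i, ∑ l, M.gi m i * (M.chris l m j * F i l) =
        ∑ m, ∑ l, ∑ i, M.chris l m j * (M.gi m i * F i l) := by
      refine Finset.sum_congr rfl fun _ _ => ?_
      rw [Finset.sum_comm]
      exact Finset.sum_congr rfl fun _ _ => Finset.sum_congr rfl fun _ _ => by ring
    linear_combination this
  have h2 : ∑ m, ∑ q, M.chris k m q * M.formUp F m q = 0 := by
    have := sum_antisymm_mul_symm (M.formUp_antisymm hF) fun i j => M.chris_symm k i j
    simpa only [mul_comm] using this
  have h3 : M.raise (M.codiff F) k = -∑ j, M.gi k j * M.div0 (M.raise fun i => F i j)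
      + ∑ j, ∑ m, ∑ l, M.gi k j * (M.chris l m j * M.raise (fun i => F i l) m) := by
    simp only [raise, h1, mul_add, Finset.sum_add_distrib, Finset.mul_sum, mul_neg,
      Finset.sum_neg_distrib]
  rw [h3]
  simp only [formUp, Finset.mul_sum] at h2
  simp only [div0, formUp, map_sum, Derivation.leibniz, smul_eq_mul, d_gi, mul_add, mul_sub,
    mul_neg, Finset.sum_add_distrib, Finset.sum_sub_distrib, Finset.sum_neg_distrib,
    Finset.mul_sum]
  have t1 : ∑ m, ∑ j, M.gi k j * M.d m (M.raise (fun i => F i j) m) =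
      ∑ j, ∑ m, M.gi k j * M.d m (M.raise (fun i => F i j) m) := Finset.sum_comm
  have t2 : ∑ m, ∑ j, ∑ q, M.raise (fun i => F i j) m * (M.chris k m q * M.gi q j) =
      ∑ m, ∑ q, ∑ j, M.chris k m q * (M.gi q j * M.raise (fun i => F i j) m) := by
    refine Finset.sum_congr rfl fun _ _ => ?_
    rw [Finset.sum_comm]
    exact Finset.sum_congr rfl fun _ _ => Finset.sum_congr rfl fun _ _ => by ring
  have t3 : ∑ m, ∑ j, ∑ q, M.raise (fun i => F i j) m * (M.chris j m q * M.gi k q) =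
      ∑ j, ∑ m, ∑ l, M.gi k j * (M.chris l m j * M.raise (fun i => F i l) m) := by
    rw [sum_rotate]
    exact Finset.sum_congr rfl fun _ _ => Finset.sum_congr rfl fun _ _ =>
      Finset.sum_congr rfl fun _ _ => by ring
  have t4 : ∑ m, ∑ p, ∑ j, M.chris m m p * (M.gi k j * M.raise (fun i => F i j) p) =
      ∑ j, ∑ m, ∑ p, M.gi k j * (M.chris m m p * M.raise (fun i => F i j) p) := by
    rw [sum_rotate]
    exact Finset.sum_congr rfl fun _ _ => Finset.sum_congr rfl fun _ _ =>
      Finset.sum_congr rfl fun _ _ => by ring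
  linear_combination t1 - t2 - h2 - t3 + t4

end MetricRing

namespace MetricRing

variable {A ι : Type*} [CommRing A] [Algebra ℝ A] [Fintype ι] [DecidableEq ι]
  (M : MetricRing A ι)

/-! ### Inner products of tensors -/

/-- The inner product of `(0,2)`-tensors. -/
def tensorInner (S T : ι → ι → A) : A :=
  ∑ i, ∑ j, ∑ k, ∑ l, M.gi i k * M.gi j l * S i j * T k l

/-- The inner product of covectors. -/
def coInner (a b : ι → A) : A := ∑ i, ∑ j, M.gi i j * a i * b j

theorem tensorInner_symm (S T : ι → ι → A) : M.tensorInner S T = M.tensorInner T S := by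
  rw [tensorInner, sum_comm_pairs]
  exact Finset.sum_congr rfl fun k _ => Finset.sum_congr rfl fun l _ =>
    Finset.sum_congr rfl fun i _ => Finset.sum_congr rfl fun j _ => by
      rw [M.gi_symm i k, M.gi_symm j l]; ring

theorem coInner_symm (a b : ι → A) : M.coInner a b = M.coInner b a := by
  rw [coInner, Finset.sum_comm]
  exact Finset.sum_congr rfl fun i _ => Finset.sum_congr rfl fun j _ => by
    rw [M.gi_symm]; ring

theorem coInner_eq (a b : ι → A) : M.coInner a b = ∑ k, M.raise a k * b k := by
  rw [coInner, Finset.sum_comm]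
  simp only [raise, Finset.sum_mul]
  exact Finset.sum_congr rfl fun i _ => Finset.sum_congr rfl fun j _ => by rw [M.gi_symm]

theorem sum_varUpUp (D : Derivation ℝ A A) (T : ι → ι → A) :
    ∑ i, ∑ j, M.varUpUp D i j * T i j = M.tensorInner (fun i j => D (M.g i j)) T := by
  rw [tensorInner, sum_comm_pairs]
  refine Finset.sum_congr rfl fun k _ => Finset.sum_congr rfl fun l _ => ?_
  rw [varUpUp_symm, varUpUp]
  simp only [varUp, Finset.sum_mul]
  exact Finset.sum_congr rfl fun i _ => Finset.sum_congr rfl fun j _ => by ring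

theorem tensorInner_g (T : ι → ι → A) : M.tensorInner (fun i j => M.g i j) T =
    ∑ i, ∑ j, M.gi i j * T i j := by
  rw [tensorInner, sum_comm_pairs]
  refine Finset.sum_congr rfl fun k _ => Finset.sum_congr rfl fun l _ => ?_
  have h (i : ι) : ∑ j, M.gi i k * M.gi j l * M.g i j * T k l =
      if i = l then M.gi i k * T k l else 0 := by
    have := congrFun (congrFun M.g_mul_gi i) l
    rw [Matrix.mul_apply, Matrix.one_apply] at this
    calc _ = (∑ j, M.g i j * M.gi j l) * (M.gi i k * T k l) := by
          rw [Finset.sum_mul]; exact Finset.sum_congr rfl fun _ _ => by ring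
      _ = _ := by rw [this]; split_ifs <;> simp
  simp only [h, Finset.sum_ite_eq', Finset.mem_univ, if_true, M.gi_symm l k]

theorem sum_hessUp (f : A) : ∑ i, ∑ m, M.hessUp f i m * M.hessUp f m i =
    M.tensorInner (M.hess f) (M.hess f) := by
  simp only [hessUp, Finset.sum_mul, Finset.mul_sum, tensorInner]
  refine Finset.sum_congr rfl fun i _ => ?_
  rw [sum_rotate]
  refine Finset.sum_congr rfl fun k _ => ?_
  rw [Finset.sum_comm]
  exact Finset.sum_congr rfl fun l _ => Finset.sum_congr rfl fun m _ => by
    rw [M.hess_symm f m l, M.gi_symm m k]; ring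

theorem tensorInner_add_left (S S' T : ι → ι → A) :
    M.tensorInner (fun i j => S i j + S' i j) T = M.tensorInner S T + M.tensorInner S' T := by
  simp only [tensorInner, mul_add, add_mul, Finset.sum_add_distrib]

theorem tensorInner_mul_left (c : A) (S T : ι → ι → A) :
    M.tensorInner (fun i j => c * S i j) T = c * M.tensorInner S T := by
  simp only [tensorInner, Finset.mul_sum]
  exact Finset.sum_congr rfl fun k _ => Finset.sum_congr rfl fun l _ =>
    Finset.sum_congr rfl fun i _ => Finset.sum_congr rfl fun j _ => by ring

theorem tensorInner_add_right (S S' T : ι → ι → A) :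
    M.tensorInner T (fun i j => S i j + S' i j) = M.tensorInner T S + M.tensorInner T S' := by
  simp only [tensorInner, mul_add, Finset.sum_add_distrib]

theorem tensorInner_mul_right (c : A) (S T : ι → ι → A) :
    M.tensorInner T (fun i j => c * S i j) = c * M.tensorInner T S := by
  rw [tensorInner_symm, tensorInner_mul_left, tensorInner_symm]

theorem tensorInner_combination (a b c : A) (X Y Z : ι → ι → A) :
    M.tensorInner (fun i j => a * X i j + (b * Y i j + c * Z i j))
        (fun i j => a * X i j + (b * Y i j + c * Z i j)) =
      a ^ 2 * M.tensorInner X X + b ^ 2 * M.tensorInner Y Y + c ^ 2 * M.tensorInner Z Z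
      + 2 * a * b * M.tensorInner X Y + 2 * a * c * M.tensorInner X Z
      + 2 * b * c * M.tensorInner Y Z := by
  simp only [tensorInner_add_left, tensorInner_add_right, tensorInner_mul_left,
    tensorInner_mul_right]
  rw [M.tensorInner_symm Y X, M.tensorInner_symm Z X, M.tensorInner_symm Z Y]
  ring

theorem coInner_add_left (a b c : ι → A) :
    M.coInner (fun i => a i + b i) c = M.coInner a c + M.coInner b c := by
  simp only [coInner, mul_add, add_mul, Finset.sum_add_distrib]

theorem coInner_add_right (a b c : ι → A) :
    M.coInner c (fun i => a i + b i) = M.coInner c a + M.coInner c b := by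
  simp only [coInner, mul_add, Finset.sum_add_distrib]

/-! ### Closed two-forms -/

theorem sum_formSq_gi (F : ι → ι → A) (i m : ι) :
    ∑ j, M.formSq F i j * M.gi j m = ∑ l, F i l * M.formUp F m l := by
  simp only [formSq, formUp, raise, Finset.sum_mul, Finset.mul_sum]
  rw [Finset.sum_comm]
  refine Finset.sum_congr rfl fun l _ => ?_
  rw [Finset.sum_comm]
  exact Finset.sum_congr rfl fun p _ => Finset.sum_congr rfl fun j _ => by
    rw [M.gi_symm j m]; ring

theorem formSq_symm (F : ι → ι → A) (i j : ι) : M.formSq F i j = M.formSq F j i := by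
  rw [formSq, formSq, Finset.sum_comm]
  exact Finset.sum_congr rfl fun _ _ => Finset.sum_congr rfl fun _ _ => by
    rw [M.gi_symm]; ring

theorem raise_contract (F : ι → ι → A) (a : ι → A) (m : ι) :
    M.raise (fun k => ∑ l, F k l * M.raise a l) m = ∑ l, M.formUp F m l * a l := by
  simp only [raise, formUp, Finset.sum_mul, Finset.mul_sum]
  rw [sum_rotate]
  refine Finset.sum_congr rfl fun l _ => ?_
  rw [Finset.sum_comm]
  exact Finset.sum_congr rfl fun p _ => Finset.sum_congr rfl fun j _ => by
    rw [M.gi_symm p l]; ring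

theorem sum_formSq_raise (F : ι → ι → A) (X : ι → A) :
    ∑ i, ∑ j, M.formSq F i j * X i * X j =
      M.coInner (fun j => ∑ i, X i * F i j) fun j => ∑ i, X i * F i j := by
  simp only [formSq, coInner, Finset.sum_mul, Finset.mul_sum]
  rw [sum_comm_pairs]
  refine Finset.sum_congr rfl fun l _ => Finset.sum_congr rfl fun p _ => ?_
  rw [Finset.sum_comm]
  exact Finset.sum_congr rfl fun _ _ => Finset.sum_congr rfl fun _ _ => by ring

theorem coInner_raise_contract (F : ι → ι → A) (a X : ι → A) :
    M.coInner a (fun j => ∑ i, X i * F i j) = ∑ i, (∑ l, F i l * M.raise a l) * X i := by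
  rw [coInner_eq]
  simp only [Finset.sum_mul, Finset.mul_sum]
  rw [Finset.sum_comm]
  exact Finset.sum_congr rfl fun _ _ => Finset.sum_congr rfl fun _ _ => by ring

section

variable {F : ι → ι → A} (hF : ∀ i j, F i j = -F j i)
include hF

/-- By antisymmetry the two inverse metrics contribute equally, and so do the two copies of `F`;
this gives both factors `2`. -/
theorem D_formNormSq (D : Derivation ℝ A A) : D (M.formNormSq F) =
    2 * ∑ i, ∑ j, M.formUp F i j * D (F i j) - 2 * ∑ i, ∑ j, M.varUpUp D i j * M.formSq F i j := by
  simp only [formNormSq, formSq, map_sum, Derivation.leibniz, smul_eq_mul, M.D_gi D, mul_add,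
    mul_neg, Finset.sum_add_distrib, Finset.sum_neg_distrib, Finset.mul_sum]
  have e1 : ∑ i, ∑ j, ∑ l, ∑ m, M.gi i j * (F j m * (F i l * M.varUpUp D l m)) =
      ∑ i, ∑ j, ∑ l, ∑ m, M.varUpUp D i j * (M.gi l m * F i l * F j m) := by
    rw [sum_comm_pairs]
    exact Finset.sum_congr rfl fun i _ => Finset.sum_congr rfl fun j _ =>
      Finset.sum_congr rfl fun l _ => Finset.sum_congr rfl fun m _ => by
        rw [hF l i, hF m j]; ring
  have e2 : ∑ i, ∑ j, ∑ l, ∑ m, M.gi i j * (M.gi l m * F i l * D (F j m)) =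
      ∑ i, ∑ j, M.formUp F i j * D (F i j) := by
    simp only [formUp_eq, Finset.sum_mul]
    rw [Finset.sum_comm]
    refine Finset.sum_congr rfl fun j _ => ?_
    conv_lhs => rw [sum_rotate]
    exact Finset.sum_congr rfl fun i _ => Finset.sum_congr rfl fun l _ =>
      Finset.sum_congr rfl fun m _ => by rw [M.gi_symm l j, M.gi_symm m i]; ring
  have e3 : ∑ i, ∑ j, ∑ l, ∑ m, M.gi i j * (F j m * (M.gi l m * D (F i l))) =
      ∑ i, ∑ j, ∑ l, ∑ m, M.gi i j * (M.gi l m * F i l * D (F j m)) := by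
    rw [Finset.sum_comm]
    refine Finset.sum_congr rfl fun j _ => Finset.sum_congr rfl fun i _ => ?_
    rw [Finset.sum_comm]
    exact Finset.sum_congr rfl fun l _ => Finset.sum_congr rfl fun m _ => by
      rw [M.gi_symm l m, M.gi_symm i j]; ring
  have e0 : ∑ i, ∑ j, ∑ l, ∑ m, M.gi l m * F i l * F j m * M.varUpUp D i j =
      ∑ i, ∑ j, ∑ l, ∑ m, M.varUpUp D i j * (M.gi l m * F i l * F j m) := by
    simp only [mul_comm]
  simp only [← Finset.mul_sum] at e0 e1 e2 e3 ⊢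
  simp only [← Finset.sum_mul] at e0 ⊢
  linear_combination -e0 - e1 + 2 * e2 + e3

/-- The divergence of `F²` for a closed two-form. -/
theorem div1_formSq (hcl : ∀ i j k, M.d i (F j k) + M.d j (F k i) + M.d k (F i j) = 0) (k : ι) :
    4 * M.div1 (fun i m => ∑ j, M.formSq F i j * M.gi j m) k =
      M.d k (M.formNormSq F) - 4 * ∑ l, F k l * M.raise (M.codiff F) l := by
  have hdiv (l : ι) := M.div_formUp hF l
  have hN := M.D_formNormSq hF (M.d k)
  -- The derivative of the inverse metric is a sum of two Christoffel terms, which contribute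
  -- equally because `F²` is symmetric.
  have hQ : ∑ i, ∑ j, M.varUpUp (M.d k) i j * M.formSq F i j =
      2 * ∑ m, ∑ p, M.chris p m k * ∑ l, F p l * M.formUp F m l := by
    have h1 (i j : ι) : M.varUpUp (M.d k) i j =
        ∑ q, M.chris i k q * M.gi q j + ∑ q, M.chris j k q * M.gi i q := by
      linear_combination M.D_gi (M.d k) i j - M.d_gi k i j
    have h2 : ∑ i, ∑ j, ∑ q, M.chris i k q * M.gi q j * M.formSq F i j =
        ∑ m, ∑ p, M.chris p m k * ∑ l, F p l * M.formUp F m l := by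
      conv_rhs => rw [Finset.sum_comm]
      refine Finset.sum_congr rfl fun i _ => ?_
      rw [Finset.sum_comm]
      refine Finset.sum_congr rfl fun q _ => ?_
      rw [← sum_formSq_gi, Finset.mul_sum]
      exact Finset.sum_congr rfl fun j _ => by rw [M.chris_symm i k, M.gi_symm q j]; ring
    have h3 : ∑ i, ∑ j, ∑ q, M.chris j k q * M.gi i q * M.formSq F i j =
        ∑ i, ∑ j, ∑ q, M.chris i k q * M.gi q j * M.formSq F i j := by
      rw [Finset.sum_comm]
      exact Finset.sum_congr rfl fun i _ => Finset.sum_congr rfl fun j _ =>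
        Finset.sum_congr rfl fun q _ => by rw [M.gi_symm q j, M.formSq_symm F i j]
    simp only [h1, add_mul, Finset.sum_mul, Finset.sum_add_distrib, h3, h2, two_mul]
  -- Closedness is used here: the antisymmetric part of `d m (F k l)` in `m` and `l` is half of `d k
  -- (F m l)`.
  have hP : 2 * ∑ m, ∑ l, M.formUp F m l * M.d m (F k l) =
      ∑ m, ∑ l, M.formUp F m l * M.d k (F m l) := by
    have h1 : ∑ m, ∑ l, M.formUp F m l * M.d m (F k l) =
        ∑ m, ∑ l, -(M.formUp F m l * M.d l (F k m)) := by
      rw [Finset.sum_comm]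
      exact Finset.sum_congr rfl fun i _ => Finset.sum_congr rfl fun j _ => by
        rw [M.formUp_antisymm hF]; ring
    rw [two_mul]
    nth_rewrite 2 [h1]
    simp only [← Finset.sum_add_distrib]
    refine Finset.sum_congr rfl fun m _ => Finset.sum_congr rfl fun l _ => ?_
    have h2 := hcl m l k
    rw [hF k m, hF l k, map_neg] at *
    simp only [map_neg] at h2 ⊢
    linear_combination -M.formUp F m l * h2
  rw [hQ, ← hP] at hN
  simp only [div1, sum_formSq_gi]
  simp only [div0] at hdiv
  have h4 : ∑ l, F k l * (∑ m, M.d m (M.formUp F m l) +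
      ∑ m, ∑ p, M.chris m m p * M.formUp F p l) = -∑ l, F k l * M.raise (M.codiff F) l := by
    simp only [hdiv, mul_neg, Finset.sum_neg_distrib]
  have h5 : ∑ m, M.d m (∑ l, F k l * M.formUp F m l) =
      ∑ m, ∑ l, M.formUp F m l * M.d m (F k l) + ∑ l, F k l * ∑ m, M.d m (M.formUp F m l) := by
    simp only [map_sum, Derivation.leibniz, smul_eq_mul, Finset.sum_add_distrib, Finset.mul_sum]
    rw [add_comm]
    congr 1
    exact Finset.sum_comm
  have h6 : ∑ m, ∑ p, M.chris m m p * ∑ l, F k l * M.formUp F p l =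
      ∑ l, F k l * ∑ m, ∑ p, M.chris m m p * M.formUp F p l := by
    simp only [Finset.mul_sum]
    rw [sum_rotate]
    simp only [mul_left_comm]
  simp only [mul_add, Finset.sum_add_distrib] at h4
  linear_combination 4 * h5 + 4 * h6 + 4 * h4 - hN

theorem div0_formUp_contract (E : ι → A) : M.div0 (fun m => ∑ k, M.formUp F m k * E k) =
    -M.coInner (M.codiff F) E + ∑ m, ∑ k, M.formUp F m k * M.d m (E k) := by
  have h (k : ι) := M.div_formUp hF k
  rw [coInner_eq, ← Finset.sum_neg_distrib]
  simp only [← neg_mul, ← h]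
  simp only [div0, map_sum, Derivation.leibniz, smul_eq_mul, Finset.sum_add_distrib,
    Finset.mul_sum, Finset.sum_mul, add_mul]
  have h1 : ∑ m, ∑ k, E k * M.d m (M.formUp F m k) = ∑ k, ∑ m, M.d m (M.formUp F m k) * E k := by
    rw [Finset.sum_comm]; simp only [mul_comm]
  have h2 : ∑ m, ∑ p, ∑ k, M.chris m m p * (M.formUp F p k * E k) =
      ∑ k, ∑ m, ∑ p, M.chris m m p * M.formUp F p k * E k := by
    rw [sum_rotate]; simp only [mul_assoc]
  linear_combination h1 + h2

end

end MetricRing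

namespace MetricRing

variable {A ι : Type*} [CommRing A] [Algebra ℝ A] [Fintype ι] [DecidableEq ι]
  (M : MetricRing A ι)

/-! ### Linearity -/

theorem div0_sub (X Y : ι → A) : M.div0 (fun m => X m - Y m) = M.div0 X - M.div0 Y := by
  simp only [div0, map_sub, mul_sub, Finset.sum_sub_distrib]; ring

theorem div0_sum {κ : Type*} [Fintype κ] (X : κ → ι → A) :
    M.div0 (fun m => ∑ a, X a m) = ∑ a, M.div0 (X a) := by
  simp only [div0, map_sum, Finset.mul_sum, Finset.sum_add_distrib]
  rw [Finset.sum_comm, sum_rotate fun m p a => M.chris m m p * X a p]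

theorem div1_add (B C : ι → ι → A) (k : ι) :
    M.div1 (fun i m => B i m + C i m) k = M.div1 B k + M.div1 C k := by
  simp only [div1, map_add, mul_add, Finset.sum_add_distrib]; ring

theorem div1_const_mul {c : A} (hc : ∀ i, M.d i c = 0) (B : ι → ι → A) (k : ι) :
    M.div1 (fun i m => c * B i m) k = c * M.div1 B k := by
  simp [div1, Derivation.leibniz, hc, mul_add, mul_sub, Finset.mul_sum, mul_left_comm]

theorem div1_sum {κ : Type*} [Fintype κ] (B : κ → ι → ι → A) (k : ι) :
    M.div1 (fun i m => ∑ a, B a i m) k = ∑ a, M.div1 (B a) k := by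
  simp only [div1, map_sum, Finset.mul_sum, Finset.sum_add_distrib, Finset.sum_sub_distrib]
  rw [Finset.sum_comm, sum_rotate fun m p a => M.chris m m p * B a k p,
    sum_rotate fun m p a => M.chris p m k * B a p m]

theorem lap_add (a b : A) : M.lap (a + b) = M.lap a + M.lap b := by
  simp only [lap, hess, map_add, mul_add, mul_sub, Finset.sum_add_distrib,
    Finset.sum_sub_distrib]; ring

theorem lap_const_mul {c : A} (hc : ∀ i, M.d i c = 0) (a : A) : M.lap (c * a) = c * M.lap a := by
  simp [lap, hess, Derivation.leibniz, hc, mul_sub, Finset.mul_sum, mul_left_comm,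
    Finset.sum_sub_distrib]

theorem lap_const {c : A} (hc : ∀ i, M.d i c = 0) : M.lap c = 0 := by
  simp [lap, hess, hc]

theorem lap_sum {κ : Type*} [Fintype κ] (a : κ → A) : M.lap (∑ i, a i) = ∑ i, M.lap (a i) := by
  have h := map_sum (AddMonoidHom.mk' M.lap M.lap_add) a Finset.univ
  exact h

theorem gradInner_add_left (a b c : A) :
    M.gradInner (a + b) c = M.gradInner a c + M.gradInner b c := by
  simp only [gradInner, map_add, mul_add, add_mul, Finset.sum_add_distrib]

theorem gradInner_const_mul_left {c : A} (hc : ∀ i, M.d i c = 0) (a b : A) :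
    M.gradInner (c * a) b = c * M.gradInner a b := by
  simp only [gradInner, Derivation.leibniz, hc, smul_eq_mul, mul_zero, add_zero, Finset.mul_sum]
  exact Finset.sum_congr rfl fun _ _ => Finset.sum_congr rfl fun _ _ => by ring

theorem gradInner_const_left {c : A} (hc : ∀ i, M.d i c = 0) (b : A) : M.gradInner c b = 0 := by
  simp [gradInner, hc]

theorem gradInner_add_right (a b c : A) :
    M.gradInner c (a + b) = M.gradInner c a + M.gradInner c b := by
  rw [gradInner_symm, gradInner_add_left, gradInner_symm, M.gradInner_symm b]

theorem gradInner_const_mul_right {c : A} (hc : ∀ i, M.d i c = 0) (a b : A) :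
    M.gradInner b (c * a) = c * M.gradInner b a := by
  rw [gradInner_symm, M.gradInner_const_mul_left hc, gradInner_symm]

theorem lap_mul (a b : A) : M.lap (a * b) =
    a * M.lap b + b * M.lap a + 2 * M.gradInner a b := by
  have h : 2 * M.gradInner a b = M.gradInner a b + M.gradInner b a := by
    rw [M.gradInner_symm b a, two_mul]
  rw [h]
  simp only [lap, hess, gradInner, map_add, Derivation.leibniz, smul_eq_mul, Finset.mul_sum,
    mul_add, mul_sub, Finset.sum_add_distrib, Finset.sum_sub_distrib]
  have e1 : ∑ i, ∑ j, M.gi i j * (M.d j b * M.d i a) = ∑ i, ∑ j, M.gi i j * M.d i a * M.d j b :=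
    Finset.sum_congr rfl fun _ _ => Finset.sum_congr rfl fun _ _ => by ring
  have e2 : ∑ i, ∑ j, M.gi i j * (M.d j a * M.d i b) = ∑ i, ∑ j, M.gi i j * M.d i b * M.d j a :=
    Finset.sum_congr rfl fun _ _ => Finset.sum_congr rfl fun _ _ => by ring
  simp only [mul_left_comm _ a, mul_left_comm _ b]
  linear_combination e1 + e2

/-! ### The Ricci-Yang-Mills flow -/

section Flow

variable (D : Derivation ℝ A A) (hD : ∀ i x, D (M.d i x) = M.d i (D x))
  {κ : Type*} [Fintype κ] {F : κ → ι → ι → A} (hF : ∀ a i j, F a i j = -F a j i)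
  (hcl : ∀ a i j k, M.d i (F a j k) + M.d j (F a k i) + M.d k (F a i j) = 0)
  (hg : ∀ i j, D (M.g i j) = -2 * M.ric i j + ∑ a, M.formSq (F a) i j)
  (hFt : ∀ a i j, D (F a i j) = -(M.d i (M.codiff (F a) j) - M.d j (M.codiff (F a) i)))

include hg in
theorem varTr_flow : M.varTr D = -2 * M.scal + ∑ a, M.formNormSq (F a) := by
  simp only [varTr, hg, mul_add, Finset.sum_add_distrib, scal, formNormSq, Finset.mul_sum]
  congr 1
  · exact Finset.sum_congr rfl fun _ _ => Finset.sum_congr rfl fun _ _ => by ring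
  · exact sum_rotate _

include hF hcl hg in
-- The Ricci part is the contracted Bianchi identity and the bundle part is `div1_formSq`. The
-- factor `4` clears the coefficient `¼` of the gradient of `|F|²`.
theorem div1_varUp_flow (k : ι) : 4 * M.div1 (M.varUp D) k = -4 * M.d k M.scal +
    M.d k (∑ a, M.formNormSq (F a)) - 4 * ∑ a, ∑ l, F a k l * M.raise (M.codiff (F a)) l := by
  have h : M.varUp D = fun k m => -2 * M.ricUp k m +
      ∑ a, ∑ j, M.formSq (F a) k j * M.gi j m := by
    ext k m
    simp only [varUp, hg, add_mul, Finset.sum_add_distrib, ricUp, Finset.mul_sum,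
      Finset.sum_mul]
    rw [Finset.sum_comm (γ := κ)]
    congr 1
    exact Finset.sum_congr rfl fun j _ => by rw [M.ric_symm k j]; ring
  have h2 : ∀ i, M.d i (-2) = 0 := fun i => by rw [map_neg, d_ofNat, neg_zero]
  rw [h, div1_add, M.div1_const_mul h2, div1_sum, mul_add, Finset.mul_sum]
  simp only [fun a => M.div1_formSq (hF a) (hcl a) k, Finset.sum_sub_distrib, map_sum,
    ← Finset.mul_sum]
  linear_combination 4 * M.contracted_bianchi k

include hF in
-- Evaluates the divergence of the term pairing `F` with `d*F` in `div1_varUp_flow`. Differentiating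
-- `F` yields `-|d*F|²`, differentiating `d*F` yields the mixed term that is later matched with the
-- evolution of `|F|²`.
theorem div0_raise_flow :
    M.div0 (M.raise fun k => ∑ a, ∑ l, F a k l * M.raise (M.codiff (F a)) l) =
      -∑ a, M.coInner (M.codiff (F a)) (M.codiff (F a)) +
        ∑ a, ∑ m, ∑ k, M.formUp (F a) m k * M.d m (M.codiff (F a) k) := by
  have h : (M.raise fun k => ∑ a, ∑ l, F a k l * M.raise (M.codiff (F a)) l) =
      fun m => ∑ a, ∑ l, M.formUp (F a) m l * M.codiff (F a) l := by
    ext m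
    simp only [← raise_contract]
    simp only [raise, Finset.mul_sum]
    rw [Finset.sum_comm]
  rw [h, div0_sum]
  simp only [fun a => M.div0_formUp_contract (hF a), Finset.sum_add_distrib,
    Finset.sum_neg_distrib]

include hD hF hcl hg in
-- Insert the trace and the divergence of the flow into the variation of scalar curvature. The
-- coefficient `3` is `4 - 1`: the trace of `F²` contributes a full gradient of `|F|²`, its
-- divergence a quarter of one with the opposite sign.
theorem D_scal_flow : 4 * D M.scal =
    -4 * M.tensorInner (fun i j => D (M.g i j)) M.ric + 4 * M.lap M.scal
      - 3 * M.lap (∑ a, M.formNormSq (F a))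
      + 4 * ∑ a, M.coInner (M.codiff (F a)) (M.codiff (F a))
      - 4 * ∑ a, ∑ m, ∑ k, M.formUp (F a) m k * M.d m (M.codiff (F a) k) := by
  have h : (fun m => 4 * M.scalFlux D m) = fun m => 4 * M.grad M.scal m
      - 3 * M.grad (∑ a, M.formNormSq (F a)) m
      - 4 * M.raise (fun k => ∑ a, ∑ l, F a k l * M.raise (M.codiff (F a)) l) m := by
    ext m
    have h1 := M.div1_varUp_flow D hF hcl hg
    obtain ⟨y, hy⟩ : ∃ y : ι → A, ∀ k, ∑ a, ∑ l, F a k l * M.raise (M.codiff (F a)) l = y k :=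
      ⟨_, fun _ => rfl⟩
    simp only [hy] at h1 ⊢
    simp only [scalFlux, grad, raise, Finset.mul_sum, ← Finset.sum_sub_distrib]
    refine Finset.sum_congr rfl fun k _ => ?_
    have h1 := h1 k
    have h2 := congrArg (M.d k) (M.varTr_flow D hg)
    have d2 : M.d k 2 = 0 := M.d_ofNat 2 k
    simp only [map_add, Derivation.leibniz, map_neg, d2, smul_eq_mul] at h2
    linear_combination M.gi m k * h1 - 4 * M.gi m k * h2
  have h2 := congrArg M.div0 h
  rw [M.div0_const_mul (M.d_ofNat 4), div0_sub, div0_sub, M.div0_const_mul (M.d_ofNat 4),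
    M.div0_const_mul (M.d_ofNat 3), M.div0_const_mul (M.d_ofNat 4), ← lap_eq_div0, ← lap_eq_div0,
    M.div0_raise_flow hF] at h2
  rw [M.D_scal D hD, sum_varUpUp]
  linear_combination h2

include hF hFt in
-- `F` evolves by minus the exterior derivative of `d*F`; paired with an antisymmetric tensor, the
-- two terms of that derivative coincide.
theorem D_formNormSq_flow : D (∑ a, M.formNormSq (F a)) =
    -4 * ∑ a, ∑ m, ∑ k, M.formUp (F a) m k * M.d m (M.codiff (F a) k)
      - 2 * M.tensorInner (fun i j => D (M.g i j)) (fun i j => ∑ a, M.formSq (F a) i j) := by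
  rw [← sum_varUpUp]
  have h (a : κ) : ∑ i, ∑ j, M.formUp (F a) i j * D (F a i j) =
      -2 * ∑ m, ∑ k, M.formUp (F a) m k * M.d m (M.codiff (F a) k) := by
    have h1 : ∑ i, ∑ j, M.formUp (F a) i j * M.d j (M.codiff (F a) i) =
        -∑ m, ∑ k, M.formUp (F a) m k * M.d m (M.codiff (F a) k) := by
      rw [Finset.sum_comm]
      simp only [← Finset.sum_neg_distrib]
      exact Finset.sum_congr rfl fun i _ => Finset.sum_congr rfl fun j _ => by
        rw [M.formUp_antisymm (hF a)]; ring
    simp only [hFt, mul_neg, mul_sub, Finset.sum_neg_distrib, Finset.sum_sub_distrib, h1]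
    ring
  simp only [map_sum, fun a => M.D_formNormSq (hF a) D, h, Finset.sum_sub_distrib,
    Finset.mul_sum]
  congr 1
  · simp only [← Finset.mul_sum]; ring
  · rw [← sum_rotate fun i j a => 2 * (M.varUpUp D i j * M.formSq (F a) i j)]

include hD hF hcl hg in
-- In the divergence of the metric velocity minus half the gradient of its trace, the gradients of
-- scalar curvature cancel by the contracted Bianchi identity. Only terms from the bundle curvature
-- survive.
theorem D_lap_flow (f : A) : 4 * D (M.lap f) = 4 * M.lap (D f)
    - 4 * M.tensorInner (fun i j => D (M.g i j)) (M.hess f)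
    + M.gradInner f (∑ a, M.formNormSq (F a))
    + 4 * ∑ k, (∑ a, ∑ l, F a k l * M.raise (M.codiff (F a)) l) * M.grad f k := by
  have h : 4 * ∑ m, (M.div1 (M.varUp D) m - (∑ q, D (M.chris q q m))) * M.grad f m =
      -M.gradInner f (∑ a, M.formNormSq (F a)) -
      4 * ∑ k, (∑ a, ∑ l, F a k l * M.raise (M.codiff (F a)) l) * M.grad f k := by
    rw [gradInner_eq]
    simp only [Finset.mul_sum (s := (Finset.univ : Finset ι)) (a := (4 : A)),
      ← Finset.sum_neg_distrib, ← Finset.sum_sub_distrib]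
    refine Finset.sum_congr rfl fun k _ => ?_
    have h1 := M.div1_varUp_flow D hF hcl hg k
    have h2 := congrArg (M.d k) (M.varTr_flow D hg)
    rw [← M.two_mul_sum_D_chris D hD] at h2
    have d2 : M.d k 2 = 0 := M.d_ofNat 2 k
    simp only [map_add, Derivation.leibniz, map_neg, d2, smul_eq_mul] at h2
    linear_combination M.grad f k * h1 - 2 * M.grad f k * h2
  rw [M.D_lap D hD, sum_varUpUp]
  linear_combination -h

include hD hg in
theorem D_gradInner_flow (f : A) : D (M.gradInner f f) = 2 * M.gradInner f (D f) +
    2 * ∑ i, ∑ j, M.ric i j * M.grad f i * M.grad f j -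
    ∑ a, M.coInner (fun j => ∑ i, M.grad f i * F a i j) fun j => ∑ i, M.grad f i * F a i j := by
  rw [M.D_gradInner D hD]
  have h : ∑ i, ∑ j, M.varUpUp D i j * M.d i f * M.d j f =
      ∑ i, ∑ j, D (M.g i j) * M.grad f i * M.grad f j := by
    simp only [mul_assoc]
    rw [M.sum_varUpUp D fun i j => M.d i f * M.d j f]
    simp only [tensorInner, grad, Finset.sum_mul, Finset.mul_sum]
    refine Finset.sum_congr rfl fun i _ => Finset.sum_congr rfl fun j _ => ?_
    rw [Finset.sum_comm]
    exact Finset.sum_congr rfl fun k _ => Finset.sum_congr rfl fun l _ => by ring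
  rw [h]
  simp only [← sum_formSq_raise]
  simp only [hg, add_mul, Finset.sum_add_distrib, Finset.sum_mul, Finset.mul_sum]
  rw [sum_rotate fun i j a => M.formSq (F a) i j * M.grad f i * M.grad f j]
  simp only [neg_mul, mul_assoc, Finset.sum_neg_distrib]
  ring

/-- Perelman's pointwise identity for the Ricci-Yang-Mills flow; all quantities are multiplied
by four. -/
theorem entropyIntegrand_flow
    (hD : ∀ i x, D (M.d i x) = M.d i (D x)) (hF : ∀ a i j, F a i j = -F a j i)
    (hcl : ∀ a i j k, M.d i (F a j k) + M.d j (F a k i) + M.d k (F a i j) = 0)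
    (hg : ∀ i j, D (M.g i j) = -2 * M.ric i j + ∑ a, M.formSq (F a) i j)
    (hFt : ∀ a i j, D (F a i j) = -(M.d i (M.codiff (F a) j) - M.d j (M.codiff (F a) i)))
    {f τ θ w : A} (hτ : ∀ i, M.d i τ = 0) (hθ : ∀ i, M.d i θ = 0) (hτθ : 2 * τ * θ = 1)
    (hDτ : D τ = -1)
    (hf : 2 * D f = -2 * M.lap f + 2 * M.gradInner f f - 2 * M.scal + ∑ a, M.formNormSq (F a)
      + 2 * (Fintype.card ι : A) * θ)
    (hw : w = τ * (8 * M.lap f + -4 * M.gradInner f f + 4 * M.scal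
      + -1 * ∑ a, M.formNormSq (F a)) + 4 * f + -4 * (Fintype.card ι : A)) :
    D w + M.lap w - 2 * M.gradInner w f =
      2 * τ * M.tensorInner
        (fun i j => -1 * D (M.g i j) + (2 * M.hess f i j + -2 * θ * M.g i j))
        (fun i j => -1 * D (M.g i j) + (2 * M.hess f i j + -2 * θ * M.g i j))
      + 4 * τ * ∑ a, M.coInner
        (fun j => M.codiff (F a) j + ∑ i, M.grad f i * F a i j)
        (fun j => M.codiff (F a) j + ∑ i, M.grad f i * F a i j)
      - ∑ a, M.formNormSq (F a) := by
  set N := ∑ a, M.formNormSq (F a) with hN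
  have c (n : ℕ) [n.AtLeastTwo] : ∀ i, M.d i (OfNat.ofNat n : A) = 0 := M.d_ofNat n
  have cn (n : ℕ) [n.AtLeastTwo] : ∀ i, M.d i (-OfNat.ofNat n : A) = 0 := fun i => by
    rw [map_neg, M.d_ofNat, neg_zero]
  have c1 : ∀ i, M.d i (-1 : A) = 0 := fun i => by rw [map_neg, Derivation.map_one_eq_zero, neg_zero]
  have cc : ∀ i, M.d i (-4 * (Fintype.card ι : A)) = 0 := fun i => by
    rw [Derivation.leibniz, cn 4, Derivation.map_natCast]; simp
  have Dn (n : ℕ) [n.AtLeastTwo] : D (OfNat.ofNat n : A) = 0 := D.map_natCast n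
  have a1 := M.D_lap_flow D hD hF hcl hg f
  have a2 := M.D_gradInner_flow D hD hg f
  have a3 := M.D_scal_flow D hD hF hcl hg
  have a4 := M.D_formNormSq_flow D hF hFt
  have a6 := M.bochner f
  have a7 := M.varTr_flow D hg
  -- The conjugate heat equation solved for `D f + Δf + R`. Its Laplacian, and in `e3` its
  -- derivative along `∇f`, eliminate `Δ(D f)` and `⟨∇f, ∇(D f)⟩`.
  have e2 := congrArg M.lap (show 2 * D f + 2 * M.lap f + 2 * M.scal =
    2 * M.gradInner f f + N + (2 * (Fintype.card ι : A)) * θ by linear_combination hf)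
  have e3 := congrArg (M.gradInner f) (show 2 * D f + 2 * M.lap f + 2 * M.scal =
    2 * M.gradInner f f + N + (2 * (Fintype.card ι : A)) * θ by linear_combination hf)
  have c2 : ∀ i, M.d i (2 * (Fintype.card ι : A)) = 0 := fun i => by
    rw [Derivation.leibniz, c 2, Derivation.map_natCast]; simp
  have cθ : ∀ i, M.d i (2 * (Fintype.card ι : A) * θ) = 0 := fun i => by
    rw [Derivation.leibniz, c2, hθ]; simp
  simp only [lap_add, M.lap_const_mul (c 2), M.lap_const cθ] at e2
  simp only [gradInner_add_right, M.gradInner_const_mul_right (c 2),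
    M.gradInner_symm _ (2 * (Fintype.card ι : A) * θ), M.gradInner_const_left cθ] at e3
  -- Only one slot of `|∂_t g|²` is opened by the flow equation: the resulting products with Ricci
  -- and with `F²` are the ones occurring in `a3` and `a4`.
  have hvv : M.tensorInner (fun i j => D (M.g i j)) (fun i j => D (M.g i j)) =
      -2 * M.tensorInner (fun i j => D (M.g i j)) M.ric +
        M.tensorInner (fun i j => D (M.g i j)) (fun i j => ∑ a, M.formSq (F a) i j) := by
    rw [← tensorInner_mul_right, ← tensorInner_add_right]
    exact congrArg _ (funext fun i => funext fun j => hg i j)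
  have hvg : M.tensorInner (fun i j => D (M.g i j)) (fun i j => M.g i j) = M.varTr D := by
    rw [tensorInner_symm, tensorInner_g, varTr]
  have hHg : M.tensorInner (M.hess f) (fun i j => M.g i j) = M.lap f := by
    rw [tensorInner_symm, tensorInner_g, lap]
  have hgg : M.tensorInner (fun i j => M.g i j) (fun i j => M.g i j) = (Fintype.card ι : A) := by
    rw [tensorInner_g]
    have h (i : ι) : ∑ j, M.gi i j * M.g i j = 1 := by
      have := congrFun (congrFun M.gi_mul_g i) i
      rw [Matrix.mul_apply, Matrix.one_apply_eq] at this
      rw [← this]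
      exact Finset.sum_congr rfl fun j _ => by rw [M.g_symm]
    simp [h]
  have hS : M.tensorInner
        (fun i j => -1 * D (M.g i j) + (2 * M.hess f i j + -2 * θ * M.g i j))
        (fun i j => -1 * D (M.g i j) + (2 * M.hess f i j + -2 * θ * M.g i j)) =
      M.tensorInner (fun i j => D (M.g i j)) (fun i j => D (M.g i j))
      - 4 * M.tensorInner (fun i j => D (M.g i j)) (M.hess f)
      + 4 * M.tensorInner (M.hess f) (M.hess f) + 4 * θ * M.varTr D - 8 * θ * M.lap f
      + 4 * θ ^ 2 * (Fintype.card ι : A) := by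
    refine (M.tensorInner_combination (-1) 2 (-2 * θ) (fun i j => D (M.g i j)) (M.hess f)
      fun i j => M.g i j).trans ?_
    rw [hvg, hHg, hgg]
    ring
  have hY : ∑ a, M.coInner
        (fun j => M.codiff (F a) j + ∑ i, M.grad f i * F a i j)
        (fun j => M.codiff (F a) j + ∑ i, M.grad f i * F a i j) =
      ∑ a, M.coInner (M.codiff (F a)) (M.codiff (F a))
      + 2 * ∑ k, (∑ a, ∑ l, F a k l * M.raise (M.codiff (F a)) l) * M.grad f k
      + ∑ a, M.coInner (fun j => ∑ i, M.grad f i * F a i j)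
          fun j => ∑ i, M.grad f i * F a i j := by
    have h : ∑ k, (∑ a, ∑ l, F a k l * M.raise (M.codiff (F a)) l) * M.grad f k =
        ∑ a, M.coInner (M.codiff (F a)) fun j => ∑ i, M.grad f i * F a i j := by
      simp only [coInner_raise_contract, Finset.sum_mul (s := (Finset.univ : Finset κ))]
      exact Finset.sum_comm
    rw [h, Finset.mul_sum, ← Finset.sum_add_distrib, ← Finset.sum_add_distrib]
    refine Finset.sum_congr rfl fun a _ => ?_
    rw [coInner_add_left, coInner_add_right, coInner_add_right,
      M.coInner_symm (fun j => ∑ i, M.grad f i * F a i j) (M.codiff (F a))]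
    ring
  rw [hS, hY, hvv, a7, ← hN]
  have hDw : D w = -(8 * M.lap f + -4 * M.gradInner f f + 4 * M.scal + -1 * N)
      + τ * (8 * D (M.lap f) + -4 * D (M.gradInner f f) + 4 * D M.scal + -1 * D N)
      + 4 * D f := by
    have d4 : D 4 = 0 := Dn 4
    have d8 : D 8 = 0 := Dn 8
    rw [hw]
    simp only [map_add, map_neg, Derivation.leibniz, smul_eq_mul, d4, d8,
      Derivation.map_one_eq_zero, Derivation.map_natCast, hDτ]
    ring
  have hLw : M.lap w = τ * (8 * M.lap (M.lap f) + -4 * M.lap (M.gradInner f f)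
      + 4 * M.lap M.scal + -1 * M.lap N) + 4 * M.lap f := by
    rw [hw]
    simp only [lap_add, M.lap_const cc]
    rw [M.lap_const_mul hτ, M.lap_const_mul (c 4)]
    simp only [lap_add]
    rw [M.lap_const_mul (c 8), M.lap_const_mul (cn 4), M.lap_const_mul (c 4),
      M.lap_const_mul c1]
    ring
  have hGw : M.gradInner w f = τ * (8 * M.gradInner f (M.lap f)
      + -4 * M.gradInner f (M.gradInner f f) + 4 * M.gradInner f M.scal
      + -1 * M.gradInner f N) + 4 * M.gradInner f f := by
    rw [hw, gradInner_symm]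
    simp only [gradInner_add_right]
    rw [M.gradInner_symm f (-4 * _), M.gradInner_const_left cc, M.gradInner_const_mul_right hτ,
      M.gradInner_const_mul_right (c 4)]
    simp only [gradInner_add_right]
    rw [M.gradInner_const_mul_right (c 8), M.gradInner_const_mul_right (cn 4),
      M.gradInner_const_mul_right (c 4), M.gradInner_const_mul_right c1]
    ring
  rw [hDw, hLw, hGw]
  rw [M.sum_hessUp] at a6
  rw [← hN] at a1 a3 a4
  -- `a1` to `a4` replace time derivatives, `hf`, `e2` and `e3` insert the conjugate heat equation,
  -- `a6` is the Bochner formula, and `hτθ` evaluates the products of `τ` with its half inverse.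
  linear_combination 2 * τ * a1 - 4 * τ * a2 + τ * a3 - τ * a4 + 2 * hf + 4 * τ * e2 - 4 * τ * e3
    + 4 * τ * a6 - (4 * (-2 * M.scal + N) - 8 * M.lap f + 4 * θ * (Fintype.card ι : A)) * hτθ

/-- The square norm of the gradient of a solution of the heat equation. -/
theorem gradInner_heat_flow
    (hD : ∀ i x, D (M.d i x) = M.d i (D x))
    (hg : ∀ i j, D (M.g i j) = -2 * M.ric i j + ∑ a, M.formSq (F a) i j)
    {f : A} (hf : D f = M.lap f) : D (M.gradInner f f) - M.lap (M.gradInner f f) =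
      -(2 * M.tensorInner (M.hess f) (M.hess f) + ∑ a,
        M.coInner (fun j => ∑ i, M.grad f i * F a i j) fun j => ∑ i, M.grad f i * F a i j) := by
  have h1 := M.D_gradInner_flow D hD hg f
  have h2 := M.bochner f
  rw [hf] at h1
  rw [M.sum_hessUp] at h2
  linear_combination h1 - h2

/-- The hypothesis encodes `u = e^{-f}`, up to a constant factor, by first derivatives; no
exponential is needed inside the ring. -/
theorem gradInner_of_d_eq {f u : A} (hu : ∀ i, M.d i u = -(u * M.d i f)) (w : A) :
    M.gradInner w u = -(u * M.gradInner w f) := by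
  simp only [gradInner, hu, Finset.mul_sum, ← Finset.sum_neg_distrib]
  exact Finset.sum_congr rfl fun _ _ => Finset.sum_congr rfl fun _ _ => by ring

theorem lap_of_d_eq {f u : A} (hu : ∀ i, M.d i u = -(u * M.d i f)) :
    M.lap u = u * (M.gradInner f f - M.lap f) := by
  simp only [lap, gradInner, hess, hu, map_neg, Derivation.leibniz, smul_eq_mul, Finset.mul_sum,
    mul_sub, ← Finset.sum_sub_distrib]
  refine Finset.sum_congr rfl fun _ _ => Finset.sum_congr rfl fun _ _ => ?_
  simp only [mul_neg, Finset.sum_neg_distrib, sub_eq_add_neg]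
  simp only [mul_left_comm _ u]
  ring

/-- The evolution of a function weighted by a solution `u = e^{-f}` of the conjugate heat equation
and by a volume density `σ`. -/
theorem D_weighted_flow
    (hg : ∀ i j, D (M.g i j) = -2 * M.ric i j + ∑ a, M.formSq (F a) i j) {f θ u σ : A}
    (hf : 2 * D f = -2 * M.lap f + 2 * M.gradInner f f - 2 * M.scal + ∑ a, M.formNormSq (F a)
      + 2 * (Fintype.card ι : A) * θ)
    (hu : ∀ i, M.d i u = -(u * M.d i f)) (hDu : D u = u * (-D f + (Fintype.card ι : A) * θ))
    (hσ : 2 * D σ = σ * M.varTr D) (w : A) :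
    D (w * u * σ) = (D w * u - w * M.lap u) * σ := by
  apply two_mul_cancel
  rw [M.varTr_flow D hg] at hσ
  rw [M.lap_of_d_eq hu]
  simp only [Derivation.leibniz, smul_eq_mul, hDu]
  linear_combination w * u * hσ - σ * u * w * hf

/-- The product rule for `Δ(wu)` moves the Laplacian from the weight to `w`, leaving a term `Δ(wu)`
whose integral over a closed manifold is zero. -/
theorem D_weighted_flow'
    (hg : ∀ i j, D (M.g i j) = -2 * M.ric i j + ∑ a, M.formSq (F a) i j) {f θ u σ : A}
    (hf : 2 * D f = -2 * M.lap f + 2 * M.gradInner f f - 2 * M.scal + ∑ a, M.formNormSq (F a)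
      + 2 * (Fintype.card ι : A) * θ)
    (hu : ∀ i, M.d i u = -(u * M.d i f)) (hDu : D u = u * (-D f + (Fintype.card ι : A) * θ))
    (hσ : 2 * D σ = σ * M.varTr D) (w : A) :
    D (w * u * σ) =
      ((D w + M.lap w - 2 * M.gradInner w f) * u - M.lap (w * u)) * σ := by
  rw [M.D_weighted_flow D hg hf hu hDu hσ, lap_mul, M.gradInner_of_d_eq hu]
  ring

end Flow

/-- The Laplacian as a divergence with respect to a volume density `σ`. -/
theorem sum_d_density {σ : A} (hσ : ∀ i, M.d i σ = σ * ∑ m, M.chris m m i) (u w : A) :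
    ∑ i, M.d i (σ * (u * M.grad w i - w * M.grad u i)) = σ * (u * M.lap w - w * M.lap u) := by
  have h (X : ι → A) : ∑ i, M.d i (σ * X i) = σ * M.div0 X := by
    simp only [Derivation.leibniz, smul_eq_mul, hσ, Finset.sum_add_distrib, div0, mul_add,
      Finset.mul_sum]
    rw [Finset.sum_comm (f := fun m p => σ * (M.chris m m p * X p))]
    congr 1
    exact Finset.sum_congr rfl fun _ _ => Finset.sum_congr rfl fun _ _ => by ring
  have hX (u w : A) : M.div0 (fun i => u * M.grad w i) = u * M.lap w + M.gradInner w u := by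
    rw [lap_eq_div0, gradInner_eq]
    simp only [div0, Derivation.leibniz, smul_eq_mul, Finset.sum_add_distrib, mul_add,
      Finset.mul_sum, mul_left_comm _ u]
    ring
  rw [h, div0_sub, hX, hX, M.gradInner_symm u w]
  ring

end MetricRing

/-! ### Change of coordinate frame. -/

namespace MetricRing

/-- Koszul's argument: symmetry in the first two slots together with the compatibility condition
determines `L` completely. -/
theorem two_mul_christoffel {A ι : Type*} [CommRing A] {L : ι → ι → ι → A} {G : ι → ι → ι → A}
    (hs : ∀ a b e, L a b e = L b a e) (hc : ∀ a b e, L a b e + L a e b = G a b e) (a b e : ι) :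
    2 * L a b e = G a b e + G b a e - G e a b := by
  linear_combination hc a b e + hc b a e - hc e a b + hs a b e - hs a e b - hs b e a

variable {A ι : Type*} [CommRing A] [Algebra ℝ A] [Fintype ι] [DecidableEq ι]

/-- `M'` is obtained from `M` by the change of frame `d'_a = P_a^i d_i`, where the `d'_a` are
again coordinate vector fields. -/
structure IsFrameChange (M M' : MetricRing A ι) (P : Matrix ι ι A) : Prop where
  d_eq : ∀ a x, M'.d a x = ∑ i, P a i * M.d i x
  g_eq : M'.g = P * M.g * P.transpose
  symm : ∀ a b k, M'.d a (P b k) = M'.d b (P a k)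

namespace IsFrameChange

variable {M M' : MetricRing A ι} {P : Matrix ι ι A} (h : IsFrameChange M M' P)
include h

/-- Invertibility of the frame matrix comes for free, since the metric in the new frame is
invertible. -/
theorem mul_inv : P * (M.g * P.transpose * M'.gi) = 1 := by
  rw [← mul_assoc, ← mul_assoc, ← h.g_eq, M'.g_mul_gi]

theorem gi_eq : M.gi = P.transpose * M'.gi * P := by
  have h1 := mul_eq_one_comm.mp h.mul_inv
  calc M.gi = M.gi * (M.g * P.transpose * M'.gi * P) := by rw [h1, mul_one]
    _ = _ := by rw [← mul_assoc, ← mul_assoc, ← mul_assoc, M.gi_mul_g, one_mul]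

theorem g_apply (a b : ι) : M'.g a b = ∑ j, ∑ l, P a j * P b l * M.g j l := by
  rw [h.g_eq]
  simp only [Matrix.mul_apply, Matrix.transpose_apply, Finset.sum_mul]
  rw [Finset.sum_comm]
  exact Finset.sum_congr rfl fun _ _ => Finset.sum_congr rfl fun _ _ => by ring

/-- Paired with the metric, both sides are symmetric and compatible with the same metric
derivatives, so `two_mul_christoffel` identifies them. This is uniqueness of the torsion-free metric
connection. -/
theorem chris_eq (a b k : ι) : ∑ c, M'.chris c a b * P c k =
    M'.d a (P b k) + ∑ i, ∑ j, P a i * P b j * M.chris k i j := by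
  set C : ι → ι → ι → A := fun a b k => M'.d a (P b k) +
    ∑ i, ∑ j, P a i * P b j * M.chris k i j with hC
  have Csymm (a b k : ι) : C a b k = C b a k := by
    simp only [hC, h.symm a b]
    rw [Finset.sum_comm]
    congr 1
    exact Finset.sum_congr rfl fun _ _ => Finset.sum_congr rfl fun _ _ => by
      rw [M.chris_symm]; ring
  -- Compatibility of the candidate `C` is the product rule for `P * g * Pᵀ` together with `d_g`.
  have h1 (a b e : ι) : 2 * ∑ k, C a b k * ∑ l, M.g k l * P e l =
      M'.d a (M'.g b e) + M'.d b (M'.g a e) - M'.d e (M'.g a b) := by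
    refine two_mul_christoffel (L := fun a b e => ∑ k, C a b k * ∑ l, M.g k l * P e l)
      (G := fun a b e => M'.d a (M'.g b e)) (fun a b e => by simp only [Csymm a b])
      (fun a b e => ?_) a b e
    simp only [h.g_apply b e, map_sum, Derivation.leibniz, smul_eq_mul, h.d_eq a (M.g _ _),
      M.d_g, Finset.sum_add_distrib, mul_add, Finset.mul_sum, hC, add_mul, Finset.sum_mul]
    have t1 : ∑ k, ∑ l, M'.d a (P b k) * (M.g k l * P e l) =
        ∑ j, ∑ l, M.g j l * (P e l * M'.d a (P b j)) :=
      Finset.sum_congr rfl fun _ _ => Finset.sum_congr rfl fun _ _ => by ring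
    have t2 : ∑ k, ∑ l, M'.d a (P e k) * (M.g k l * P b l) =
        ∑ j, ∑ l, M.g j l * (P b j * M'.d a (P e l)) := by
      rw [Finset.sum_comm]
      exact Finset.sum_congr rfl fun _ _ => Finset.sum_congr rfl fun _ _ => by
        rw [M.g_symm]; ring
    have t3 : ∑ k, ∑ l, ∑ i, ∑ j, P a i * P b j * M.chris k i j * (M.g k l * P e l) =
        ∑ j, ∑ l, ∑ i, ∑ m, P b j * P e l * (P a i * (M.chris m i j * M.g m l)) := by
      have (f : ι → ι → ι → ι → A) : ∑ k, ∑ l, ∑ i, ∑ j, f k l i j =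
          ∑ j, ∑ l, ∑ i, ∑ k, f k l i j := by
        conv_lhs => enter [2, k]; rw [sum_rotate]
        rw [Finset.sum_comm]
        exact Finset.sum_congr rfl fun j _ => by rw [sum_rotate, sum_rotate]
      rw [this]
      exact Finset.sum_congr rfl fun _ _ => Finset.sum_congr rfl fun _ _ =>
        Finset.sum_congr rfl fun _ _ => Finset.sum_congr rfl fun _ _ => by ring
    have t4 : ∑ k, ∑ l, ∑ i, ∑ j, P a i * P e j * M.chris k i j * (M.g k l * P b l) =
        ∑ j, ∑ l, ∑ i, ∑ m, P b j * P e l * (P a i * (M.g j m * M.chris m i l)) := by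
      have (f : ι → ι → ι → ι → A) : ∑ k, ∑ l, ∑ i, ∑ j, f k l i j =
          ∑ l, ∑ j, ∑ i, ∑ k, f k l i j := by
        rw [Finset.sum_comm]
        refine Finset.sum_congr rfl fun l _ => ?_
        rw [sum_rotate]
        exact Finset.sum_congr rfl fun j _ => Finset.sum_comm
      rw [this]
      exact Finset.sum_congr rfl fun l _ => Finset.sum_congr rfl fun _ _ =>
        Finset.sum_congr rfl fun _ _ => Finset.sum_congr rfl fun m _ => by
          rw [M.g_symm m l]; ring
    linear_combination t1 + t2 + t3 + t4
  have h2 (a b e : ι) : 2 * ∑ c, M'.chris c a b * M'.g c e =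
      M'.d a (M'.g b e) + M'.d b (M'.g a e) - M'.d e (M'.g a b) := by
    refine two_mul_christoffel (L := fun a b e => ∑ c, M'.chris c a b * M'.g c e)
      (G := fun a b e => M'.d a (M'.g b e)) (fun a b e => by simp only [M'.chris_symm _ a b])
      (fun a b e => ?_) a b e
    rw [M'.d_g a b e]
    congr 1
    exact Finset.sum_congr rfl fun c _ => by rw [M'.g_symm, mul_comm]
  have h3 : Matrix.of (C a) * (M.g * P.transpose) =
      (Matrix.of fun b c => M'.chris c a b) * P * (M.g * P.transpose) := by
    have e : (Matrix.of fun b c => M'.chris c a b) * P * (M.g * P.transpose) =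
        (Matrix.of fun b c => M'.chris c a b) * M'.g := by
      rw [h.g_eq]; simp only [mul_assoc]
    rw [e]
    ext b e
    refine two_mul_cancel ?_
    have := (h1 a b e).trans (h2 a b e).symm
    simpa only [Matrix.mul_apply, Matrix.of_apply, Matrix.transpose_apply] using this
  -- The common factor `M.g * P.transpose` is cancelled by multiplying with its right inverse `M'.gi
  -- * P`.
  have h4 := congrArg (fun X => X * M'.gi * P) h3
  have h5 : M.g * P.transpose * M'.gi * P = 1 := mul_eq_one_comm.mp h.mul_inv
  simp only [mul_assoc] at h4 h5
  simp only [h5, mul_one] at h4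
  exact (congrFun (congrFun h4 b) k).symm

/-- The derivative of `P` in the second derivative of `f` cancels the inhomogeneous term of
`chris_eq`. -/
theorem hess_eq (f : A) (a b : ι) :
    M'.hess f a b = ∑ i, ∑ j, P a i * P b j * M.hess f i j := by
  have e : ∑ c, M'.chris c a b * M'.d c f = ∑ k, (∑ c, M'.chris c a b * P c k) * M.d k f := by
    simp only [h.d_eq, Finset.mul_sum, Finset.sum_mul]
    rw [Finset.sum_comm]
    simp only [mul_assoc]
  rw [hess, e]
  simp only [h.chris_eq, h.d_eq b f, map_sum, Derivation.leibniz, smul_eq_mul, hess, mul_sub,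
    add_mul, Finset.sum_add_distrib, Finset.sum_sub_distrib, Finset.mul_sum, Finset.sum_mul]
  simp only [h.d_eq a (M.d _ f), Finset.mul_sum]
  have t1 : ∑ k, M.d k f * M'.d a (P b k) = ∑ k, M'.d a (P b k) * M.d k f := by
    simp only [mul_comm]
  have t2 : ∑ k, ∑ i, P b k * (P a i * M.d i (M.d k f)) =
      ∑ i, ∑ j, P a i * P b j * M.d i (M.d j f) := by
    rw [Finset.sum_comm]
    exact Finset.sum_congr rfl fun _ _ => Finset.sum_congr rfl fun _ _ => by ring
  have t3 : ∑ k, ∑ i, ∑ j, P a i * P b j * M.chris k i j * M.d k f =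
      ∑ i, ∑ j, ∑ m, P a i * P b j * (M.chris m i j * M.d m f) := by
    rw [← sum_rotate]
    simp only [mul_assoc]
  linear_combination t1 + t2 - t3

/-- As for the Hessian: each index contributes one derivative of `P`, cancelled by the inhomogeneous
term of the corresponding Christoffel symbol. -/
theorem nablaForm_eq {F F' : ι → ι → A}
    (hF : ∀ a b, F' a b = ∑ i, ∑ j, P a i * P b j * F i j) (c a b : ι) :
    M'.nablaForm F' c a b =
      ∑ k, ∑ i, ∑ j, P c k * P a i * P b j * M.nablaForm F k i j := by
  have e1 : ∑ l, M'.chris l c a * F' l b =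
      ∑ k, (∑ l, M'.chris l c a * P l k) * ∑ j, P b j * F k j := by
    simp only [hF, Finset.mul_sum, Finset.sum_mul]
    rw [Finset.sum_comm]
    refine Finset.sum_congr rfl fun _ _ => ?_
    rw [Finset.sum_comm]
    exact Finset.sum_congr rfl fun _ _ => Finset.sum_congr rfl fun _ _ => by ring
  have e2 : ∑ l, M'.chris l c b * F' a l =
      ∑ k, (∑ l, M'.chris l c b * P l k) * ∑ i, P a i * F i k := by
    simp only [hF, Finset.mul_sum, Finset.sum_mul]
    rw [sum_rotate]
    refine Finset.sum_congr rfl fun _ _ => ?_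
    rw [Finset.sum_comm]
    exact Finset.sum_congr rfl fun _ _ => Finset.sum_congr rfl fun _ _ => by ring
  rw [nablaForm, e1, e2]
  simp only [h.chris_eq, hF a b, map_sum, Derivation.leibniz, smul_eq_mul, nablaForm, mul_sub,
    add_mul, mul_add, Finset.sum_add_distrib, Finset.sum_sub_distrib, Finset.mul_sum,
    Finset.sum_mul]
  simp only [h.d_eq c (F _ _), Finset.mul_sum]
  have t1 : ∑ i, ∑ j, F i j * (P b j * M'.d c (P a i)) =
      ∑ k, ∑ j, M'.d c (P a k) * (P b j * F k j) :=
    Finset.sum_congr rfl fun _ _ => Finset.sum_congr rfl fun _ _ => by ring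
  have t2 : ∑ i, ∑ j, F i j * (P a i * M'.d c (P b j)) =
      ∑ k, ∑ i, M'.d c (P b k) * (P a i * F i k) := by
    rw [Finset.sum_comm]
    exact Finset.sum_congr rfl fun _ _ => Finset.sum_congr rfl fun _ _ => by ring
  have t3 : ∑ i, ∑ j, ∑ k, P a i * P b j * (P c k * M.d k (F i j)) =
      ∑ k, ∑ i, ∑ j, P c k * P a i * P b j * M.d k (F i j) := by
    rw [sum_rotate]
    exact Finset.sum_congr rfl fun _ _ => Finset.sum_congr rfl fun _ _ =>
      Finset.sum_congr rfl fun _ _ => by ring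
  have t4 : ∑ k, ∑ j, ∑ i, ∑ q, P c i * P a q * M.chris k i q * (P b j * F k j) =
      ∑ k, ∑ i, ∑ j, ∑ l, P c k * P a i * P b j * (M.chris l k i * F l j) := by
    rw [sum_comm_pairs]
    refine Finset.sum_congr rfl fun _ _ => Finset.sum_congr rfl fun _ _ => ?_
    rw [Finset.sum_comm]
    exact Finset.sum_congr rfl fun _ _ => Finset.sum_congr rfl fun _ _ => by ring
  have t5 : ∑ k, ∑ i, ∑ q, ∑ j, P c q * P b j * M.chris k q j * (P a i * F i k) =
      ∑ k, ∑ i, ∑ j, ∑ l, P c k * P a i * P b j * (M.chris l k j * F i l) := by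
    rw [Finset.sum_comm]
    conv_lhs => enter [2, i]; rw [← sum_rotate fun q j k => P c q * P b j * M.chris k q j * (P a i * F i k)]
    rw [Finset.sum_comm]
    exact Finset.sum_congr rfl fun _ _ => Finset.sum_congr rfl fun _ _ =>
      Finset.sum_congr rfl fun _ _ => Finset.sum_congr rfl fun _ _ => by ring
  linear_combination t1 + t2 + t3 - t4 - t5

end IsFrameChange
end MetricRing

/-! ### Rings of smooth functions -/

section SmoothRing

variable {E : Type*} [NormedAddCommGroup E] [NormedSpace ℝ E]

/-- The ring of smooth functions on a set. -/
def smoothSubalgebra (D : Set E) : Subalgebra ℝ (D → ℝ) where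
  carrier := {φ | ∃ Φ : E → ℝ, ContDiffOn ℝ ∞ Φ D ∧ ∀ p : D, Φ p = φ p}
  mul_mem' := by
    rintro φ ψ ⟨Φ, h, e⟩ ⟨Ψ, h', e'⟩
    exact ⟨fun p => Φ p * Ψ p, h.mul h', fun p => by simp [e, e']⟩
  add_mem' := by
    rintro φ ψ ⟨Φ, h, e⟩ ⟨Ψ, h', e'⟩
    exact ⟨fun p => Φ p + Ψ p, h.add h', fun p => by simp [e, e']⟩
  algebraMap_mem' c := ⟨fun _ => c, contDiffOn_const, fun p => rfl⟩

/-- The ring of smooth functions on a set, as a type. -/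
def SmoothRing (D : Set E) : Type _ := smoothSubalgebra D

instance (D : Set E) : CommRing (SmoothRing D) := inferInstanceAs (CommRing (smoothSubalgebra D))

instance (D : Set E) : Algebra ℝ (SmoothRing D) :=
  inferInstanceAs (Algebra ℝ (smoothSubalgebra D))

namespace SmoothRing

variable {D : Set E}

/-- A smooth function as an element of the ring. -/
def mk (Φ : E → ℝ) (h : ContDiffOn ℝ ∞ Φ D) : SmoothRing D :=
  ⟨fun p => Φ p, Φ, h, fun _ => rfl⟩

/-- Evaluation at a point, with the value zero outside the domain. -/
def toFun (x : SmoothRing D) (p : E) : ℝ := by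
  classical exact if h : p ∈ D then x.1 ⟨p, h⟩ else 0

theorem toFun_mk {Φ : E → ℝ} (h : ContDiffOn ℝ ∞ Φ D) {p : E} (hp : p ∈ D) :
    (mk Φ h).toFun p = Φ p := by
  simp [toFun, hp, mk]

theorem toFun_add (x y : SmoothRing D) (p : E) : (x + y).toFun p = x.toFun p + y.toFun p := by
  by_cases hp : p ∈ D
  · simp only [toFun, hp, dite_true]; rfl
  · simp [toFun, hp]

theorem toFun_mul (x y : SmoothRing D) (p : E) : (x * y).toFun p = x.toFun p * y.toFun p := by
  by_cases hp : p ∈ D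
  · simp only [toFun, hp, dite_true]; rfl
  · simp [toFun, hp]

theorem toFun_smul (c : ℝ) (x : SmoothRing D) (p : E) : (c • x).toFun p = c * x.toFun p := by
  by_cases hp : p ∈ D
  · simp only [toFun, hp, dite_true]; rfl
  · simp [toFun, hp]

theorem contDiffOn_toFun (x : SmoothRing D) : ContDiffOn ℝ ∞ x.toFun D := by
  obtain ⟨φ, Φ, h, e⟩ := x
  refine h.congr fun p hp => ?_
  simp [toFun, hp, ← e ⟨p, hp⟩]

theorem ext_toFun {x y : SmoothRing D} (h : ∀ p ∈ D, x.toFun p = y.toFun p) : x = y := by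
  apply Subtype.ext
  funext p
  have := h p p.2
  simpa [toFun, p.2] using this

/-- Evaluation at a point of the domain. -/
def eval (p : E) (hp : p ∈ D) : SmoothRing D →ₐ[ℝ] ℝ :=
  (Pi.evalAlgHom ℝ (fun _ : D => ℝ) ⟨p, hp⟩).comp (smoothSubalgebra D).val

theorem eval_apply (p : E) (hp : p ∈ D) (x : SmoothRing D) : eval p hp x = x.toFun p := by
  simp only [toFun, hp, dite_true]; rfl

variable (hD : UniqueDiffOn ℝ D)

/-- The derivative in a direction. -/
def deriv (v : E) : Derivation ℝ (SmoothRing D) (SmoothRing D) :=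
  Derivation.mk'
    { toFun := fun x => mk (fun p => fderivWithin ℝ x.toFun D p v)
        ((x.contDiffOn_toFun.fderivWithin hD (m := ∞) (by simp)).clm_apply contDiffOn_const)
      map_add' := fun x y => ext_toFun fun p hp => by
        have hx := x.contDiffOn_toFun.differentiableOn (by simp) p hp
        have hy := y.contDiffOn_toFun.differentiableOn (by simp) p hp
        rw [toFun_add, toFun_mk _ hp, toFun_mk _ hp, toFun_mk _ hp,
          show (x + y).toFun = x.toFun + y.toFun from funext (toFun_add x y),
          fderivWithin_add (hD p hp) hx hy]
        rfl
      map_smul' := fun c x => ext_toFun fun p hp => by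
        have hx := x.contDiffOn_toFun.differentiableOn (by simp) p hp
        rw [RingHom.id_apply, toFun_smul, toFun_mk _ hp, toFun_mk _ hp,
          show (c • x).toFun = c • x.toFun from funext (toFun_smul c x),
          fderivWithin_const_smul (hD p hp) hx]
        rfl }
    fun x y => ext_toFun fun p hp => by
      have hx := x.contDiffOn_toFun.differentiableOn (by simp) p hp
      have hy := y.contDiffOn_toFun.differentiableOn (by simp) p hp
      simp only [LinearMap.coe_mk, AddHom.coe_mk, smul_eq_mul]
      rw [toFun_add, toFun_mul, toFun_mul, toFun_mk _ hp, toFun_mk _ hp, toFun_mk _ hp,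
        show (x * y).toFun = x.toFun * y.toFun from funext (toFun_mul x y),
        fderivWithin_mul (hD p hp) hx hy]
      rfl

theorem toFun_deriv (v : E) (x : SmoothRing D) {p : E} (hp : p ∈ D) :
    (deriv hD v x).toFun p = fderivWithin ℝ x.toFun D p v := by
  simp [deriv, Derivation.mk', toFun_mk _ hp]

/-- Symmetry of second derivatives. At boundary points, which occur at end points of the time
interval, it is inherited from the interior; this is why each point has to be a limit of interior
points. -/
theorem deriv_comm (hcl : D ⊆ closure (interior D)) (v w : E) (x : SmoothRing D) :
    deriv hD v (deriv hD w x) = deriv hD w (deriv hD v x) := by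
  have key (v w : E) {p : E} (hp : p ∈ D) : (deriv hD v (deriv hD w x)).toFun p =
      fderivWithin ℝ (fderivWithin ℝ x.toFun D) D p v w := by
    rw [toFun_deriv _ _ _ hp, fderivWithin_congr (fun q hq => toFun_deriv hD w x hq)
      (toFun_deriv hD w x hp)]
    have h2 := (x.contDiffOn_toFun.fderivWithin hD (m := ∞) (by simp)).differentiableOn
      (by simp) p hp
    rw [fderivWithin_clm_apply (hD p hp) h2 (differentiableWithinAt_const w)]
    simp
  refine ext_toFun fun p hp => ?_
  rw [key v w hp, key w v hp]
  exact (x.contDiffOn_toFun p hp).isSymmSndFDerivWithinAt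
    (by rw [minSmoothness_of_isRCLikeNormedField]; exact WithTop.coe_le_coe.mpr le_top) hD (hcl hp) hp v w

end SmoothRing

end SmoothRing

/-! ### Functions of time and space -/

/-- The interval may contain its end points. These two facts are what makes one-sided time
derivatives unique and lets them commute with spatial ones. -/
theorem uniqueDiffOn_of_ordConnected {T : Set ℝ} (hT : T.OrdConnected) (hT' : T.Nontrivial) :
    UniqueDiffOn ℝ T ∧ T ⊆ closure (interior T) := by
  have hne : (interior T).Nonempty := by
    obtain ⟨a, ha, b, hb, hab⟩ := hT'.exists_lt
    obtain ⟨c, hc⟩ := exists_between hab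
    exact ⟨c, mem_interior.mpr ⟨Ioo a b, fun x hx => hT.out ha hb ⟨hx.1.le, hx.2.le⟩,
      isOpen_Ioo, hc⟩⟩
  refine ⟨uniqueDiffOn_convex hT.convex hne, ?_⟩
  rw [hT.convex.closure_interior_eq_closure_of_nonempty_interior (𝕜 := ℝ) hne]
  exact subset_closure

section SpaceTime

variable {n : ℕ} {T : Set ℝ} (hT : T.OrdConnected) (hT' : T.Nontrivial) {U : Set (Coord n)}
  (hU : IsOpen U)

include hT hT' hU in
theorem uniqueDiffOn_spaceTime : UniqueDiffOn ℝ (T ×ˢ U) :=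
  (uniqueDiffOn_of_ordConnected hT hT').1.prod hU.uniqueDiffOn

include hT hT' hU in
theorem spaceTime_subset : T ×ˢ U ⊆ closure (interior (T ×ˢ U)) := by
  rw [interior_prod_eq, closure_prod_eq, hU.interior_eq]
  exact prod_mono (uniqueDiffOn_of_ordConnected hT hT').2 subset_closure

/-- The spatial derivatives of functions on `T × U`. -/
def spaceDeriv (i : Fin n) : Derivation ℝ (SmoothRing (T ×ˢ U)) (SmoothRing (T ×ˢ U)) :=
  SmoothRing.deriv (uniqueDiffOn_spaceTime hT hT' hU) (0, EuclideanSpace.single i 1)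

/-- The time derivative of functions on `T × U`. -/
def timeDeriv : Derivation ℝ (SmoothRing (T ×ˢ U)) (SmoothRing (T ×ˢ U)) :=
  SmoothRing.deriv (uniqueDiffOn_spaceTime hT hT' hU) (1, 0)

theorem spaceDeriv_comm (i j : Fin n) (x : SmoothRing (T ×ˢ U)) :
    spaceDeriv hT hT' hU i (spaceDeriv hT hT' hU j x) =
      spaceDeriv hT hT' hU j (spaceDeriv hT hT' hU i x) :=
  SmoothRing.deriv_comm _ (spaceTime_subset hT hT' hU) _ _ _

theorem timeDeriv_comm (i : Fin n) (x : SmoothRing (T ×ˢ U)) :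
    timeDeriv hT hT' hU (spaceDeriv hT hT' hU i x) =
      spaceDeriv hT hT' hU i (timeDeriv hT hT' hU x) :=
  SmoothRing.deriv_comm _ (spaceTime_subset hT hT' hU) _ _ _

/-- Each time slice is open in space, so a derivative within the product in a spatial direction is
an ordinary partial derivative, even at an end point of the interval. -/
theorem pd_eq_spaceDeriv {x : SmoothRing (T ×ˢ U)} {t : ℝ} (ht : t ∈ T) {φ : Coord n → ℝ}
    (hφ : ∀ y ∈ U, φ y = x.toFun (t, y)) (i : Fin n) {y : Coord n} (hy : y ∈ U) :
    pd i φ y = (spaceDeriv hT hT' hU i x).toFun (t, y) := by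
  have hp : (t, y) ∈ T ×ˢ U := ⟨ht, hy⟩
  have h1 := (x.contDiffOn_toFun.differentiableOn (by simp) _ hp).hasFDerivWithinAt
  have h2 : HasFDerivWithinAt (fun z : Coord n => (t, z))
      (ContinuousLinearMap.inr ℝ ℝ (Coord n)) U y := (hasFDerivAt_prodMk_right t y).hasFDerivWithinAt
  have h3 := (h1.comp y h2 fun z hz => ⟨ht, hz⟩).hasFDerivAt (hU.mem_nhds hy)
  have h4 : HasFDerivAt φ _ y := h3.congr_of_eventuallyEq
    (Filter.eventually_of_mem (hU.mem_nhds hy) fun z hz => hφ z hz)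
  rw [pd, h4.fderiv, spaceDeriv, SmoothRing.toFun_deriv _ _ _ hp]
  rfl

theorem hasDerivWithinAt_timeDeriv {x : SmoothRing (T ×ˢ U)} {t : ℝ} (ht : t ∈ T) {φ : ℝ → ℝ}
    {y : Coord n} (hy : y ∈ U) (hφ : ∀ s ∈ T, φ s = x.toFun (s, y)) :
    HasDerivWithinAt φ ((timeDeriv hT hT' hU x).toFun (t, y)) T t := by
  have hp : (t, y) ∈ T ×ˢ U := ⟨ht, hy⟩
  have h1 := (x.contDiffOn_toFun.differentiableOn (by simp) _ hp).hasFDerivWithinAt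
  have h2 : HasFDerivWithinAt (fun s : ℝ => (s, y))
      (ContinuousLinearMap.inl ℝ ℝ (Coord n)) T t := (hasFDerivAt_prodMk_left t y).hasFDerivWithinAt
  have h3 := (h1.comp t h2 fun z (hz : z ∈ T) => (⟨hz, hy⟩ : (z, y) ∈ T ×ˢ U)).hasDerivWithinAt
  rw [timeDeriv, SmoothRing.toFun_deriv _ _ _ hp]
  exact h3.congr (fun s hs => hφ s hs) (hφ t ht)

include hT hT' in
-- Uniqueness of one-sided derivatives converts a pointwise evolution equation into an identity in
-- the ring.
theorem timeDeriv_eq_of_hasDerivWithinAt {x y : SmoothRing (T ×ˢ U)}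
    (h : ∀ t ∈ T, ∀ z ∈ U, HasDerivWithinAt (fun s => x.toFun (s, z)) (y.toFun (t, z)) T t) :
    timeDeriv hT hT' hU x = y :=
  SmoothRing.ext_toFun fun ⟨t, z⟩ hp =>
    ((uniqueDiffOn_of_ordConnected hT hT').1 t hp.1).eq_deriv _
      (hasDerivWithinAt_timeDeriv hT hT' hU hp.1 hp.2 fun _ _ => rfl) (h t hp.1 z hp.2)

end SpaceTime

/-! ### The volume density -/

/-- Jacobi's formula for the derivative of a determinant. -/
theorem derivation_det {A ι : Type*} [CommRing A] [Algebra ℝ A] [Fintype ι] [DecidableEq ι]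
    (D : Derivation ℝ A A) (N : Matrix ι ι A) :
    D N.det = ∑ i, ∑ j, N.adjugate i j * D (N j i) := by
  have hprod (s : Finset ι) (f : ι → A) :
      D (∏ i ∈ s, f i) = ∑ i ∈ s, (∏ j ∈ s.erase i, f j) * D (f i) := by
    induction s using Finset.induction_on with
    | empty => simp
    | insert a s ha ih =>
      rw [Finset.prod_insert ha, Finset.sum_insert ha, Derivation.leibniz, ih,
        Finset.erase_insert ha, smul_eq_mul, smul_eq_mul, Finset.mul_sum, add_comm]
      congr 1
      refine Finset.sum_congr rfl fun i hi => ?_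
      rw [Finset.erase_insert_of_ne (by rintro rfl; exact ha hi),
        Finset.prod_insert (fun h => ha (Finset.mem_of_mem_erase h)), mul_assoc]
  -- By Cramer's rule this sum is the determinant with column `i` differentiated, so the claim
  -- becomes the product rule applied columnwise.
  have h (i : ι) : ∑ j, N.adjugate i j * D (N j i) =
      (N.updateCol i fun j => D (N j i)).det := by
    rw [← Matrix.cramer_apply, Matrix.cramer_eq_adjugate_mulVec]
    rfl
  simp only [h, Matrix.det_apply, map_sum]
  rw [Finset.sum_comm]
  refine Finset.sum_congr rfl fun p _ => ?_
  rw [Units.smul_def, map_zsmul, hprod, Finset.smul_sum]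
  refine Finset.sum_congr rfl fun i _ => ?_
  rw [Units.smul_def, ← Finset.prod_erase_mul _ _ (Finset.mem_univ i), Matrix.updateCol_self]
  congr 2
  refine Finset.prod_congr rfl fun j hj => ?_
  rw [Matrix.updateCol_ne (Finset.ne_of_mem_erase hj)]

namespace MetricRing

section

variable {A ι : Type*} [CommRing A] [Algebra ℝ A] [Fintype ι] [DecidableEq ι]
  (M : MetricRing A ι)

theorem D_det (D : Derivation ℝ A A) : D M.g.det = M.g.det * M.varTr D := by
  have h : M.g.adjugate = M.g.det • M.gi := by
    rw [← mul_one M.g.adjugate, ← M.g_mul_gi, ← mul_assoc, Matrix.adjugate_mul, Matrix.smul_mul,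
      one_mul]
  rw [derivation_det, h, varTr, Finset.mul_sum]
  refine Finset.sum_congr rfl fun i _ => ?_
  rw [Finset.mul_sum]
  refine Finset.sum_congr rfl fun j _ => ?_
  rw [M.g_symm j i, Matrix.smul_apply, smul_eq_mul, mul_assoc]

/-- The volume density enters only as a unit whose square is the determinant, so Jacobi's formula
`D_det` can be divided by it. -/
theorem two_mul_D_density (D : Derivation ℝ A A) {σ : A} (hσ : IsUnit σ)
    (h : σ ^ 2 = M.g.det) : 2 * D σ = σ * M.varTr D := by
  have h1 := M.D_det D
  rw [← h, sq, Derivation.leibniz, smul_eq_mul] at h1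
  exact hσ.mul_left_cancel (by linear_combination h1)

theorem d_density {σ : A} (hσ : IsUnit σ) (h : σ ^ 2 = M.g.det) (i : ι) :
    M.d i σ = σ * ∑ m, M.chris m m i := by
  have h1 := M.two_mul_D_density (M.d i) hσ h
  have h2 := M.trace_chris i
  rw [varTr, h2] at h1
  exact two_mul_cancel (by linear_combination h1)

end

/-- Reorders contractions with `Bᵀ * B` so that the orthonormal frame index `c` becomes the outer
sum. -/
theorem sum_five_comm {A κ ι : Type*} [AddCommMonoid A] [Fintype κ] [Fintype ι]
    (f : κ → κ → ι → ι → κ → A) :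
    ∑ a, ∑ b, ∑ i, ∑ j, ∑ c, f a b i j c = ∑ c, ∑ i, ∑ j, ∑ b, ∑ a, f a b i j c := by
  have h (F : κ → κ → ι → ι → κ → A) : ∑ a, ∑ b, ∑ i, ∑ j, ∑ c, F a b i j c =
      ∑ x : κ × κ, ∑ y : (ι × ι) × κ, F x.1 x.2 y.1.1 y.1.2 y.2 := by
    simp only [Fintype.sum_prod_type]
  have h' (F : κ → κ → ι → ι → κ → A) : ∑ c, ∑ i, ∑ j, ∑ b, ∑ a, F a b i j c =
      ∑ y : (ι × ι) × κ, ∑ x : κ × κ, F x.1 x.2 y.1.1 y.1.2 y.2 := by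
    simp only [Fintype.sum_prod_type, Fintype.sum_prod_type_right (f := fun x : (ι × ι) × κ => _),
      Fintype.sum_prod_type_right (f := fun x : κ × κ => _)]
  rw [h, h', Finset.sum_comm]

/-! ### Realization of local tensor calculus -/

section Realizes

variable {A : Type*} [CommRing A] [Algebra ℝ A] {n k : ℕ}

/-- The ring `A` with its derivations and metric is evaluated, at the points of `U`, to functions
on `U` with their partial derivatives and the metric `G`. -/
structure Realizes (M : MetricRing A (Fin n)) (U : Set (Coord n)) (ev : U → A →ₐ[ℝ] ℝ)
    (G : Coord n → Matrix (Fin n) (Fin n) ℝ) : Prop where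
  pd_eq : ∀ (φ : Coord n → ℝ) (x : A), (∀ y : U, φ y = ev y x) →
    ∀ (i : Fin n) (y : U), pd i φ y = ev y (M.d i x)
  g_eq : ∀ (y : U) (i j : Fin n), G y i j = ev y (M.g i j)

namespace Realizes

variable {M : MetricRing A (Fin n)} {U : Set (Coord n)} {ev : U → A →ₐ[ℝ] ℝ}
  {G : Coord n → Matrix (Fin n) (Fin n) ℝ} (R : M.Realizes U ev G)
include R

/-- Evaluating `g * gi = 1` at a point exhibits a right inverse of the metric matrix, which is its
only inverse. -/
theorem inv_eq (y : U) (i j : Fin n) : (G y)⁻¹ i j = ev y (M.gi i j) := by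
  have h : G y * Matrix.of (fun i j => ev y (M.gi i j)) = 1 := by
    ext i j
    have := congrArg (ev y) (congrFun (congrFun M.g_mul_gi i) j)
    rw [Matrix.mul_apply, map_sum] at this
    simp only [map_mul, ← R.g_eq] at this
    rw [Matrix.mul_apply]
    simp only [Matrix.of_apply]
    rw [this]
    by_cases hij : i = j
    · subst hij; simp
    · simp [Matrix.one_apply_ne hij]
  rw [Matrix.inv_eq_right_inv h]
  rfl

theorem chris_eq (m i j : Fin n) (y : U) : Loc.chris G m i j y = ev y (M.chris m i j) := by
  rw [Loc.chris, chris, map_smul, map_sum, smul_eq_mul]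
  congr 1
  refine Finset.sum_congr rfl fun l _ => ?_
  rw [R.inv_eq, map_mul, map_sub, map_add, R.pd_eq _ _ (fun y => R.g_eq y j l),
    R.pd_eq _ _ (fun y => R.g_eq y i l), R.pd_eq _ _ (fun y => R.g_eq y i j)]

theorem ric_eq (i j : Fin n) (y : U) : Loc.ric G i j y = ev y (M.ric i j) := by
  rw [Loc.ric, MetricRing.ric]
  simp only [map_add, map_sum, map_sub, map_mul, R.chris_eq]
  congr 1
  refine Finset.sum_congr rfl fun m _ => ?_
  rw [R.pd_eq _ _ (fun y => R.chris_eq m i j y), R.pd_eq _ _ (fun y => R.chris_eq m i m y)]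

theorem scal_eq (y : U) : Loc.scal G y = ev y M.scal := by
  simp only [Loc.scal, scal, map_sum, map_mul, R.inv_eq, R.ric_eq]

section

variable {φ : Coord n → ℝ} {x : A} (hφ : ∀ y : U, φ y = ev y x)
include hφ

theorem hess_eq (i j : Fin n) (y : U) : Loc.hess G φ i j y = ev y (M.hess x i j) := by
  simp only [Loc.hess, hess, map_sum, map_mul, map_sub, R.chris_eq, R.pd_eq _ _ hφ,
    R.pd_eq _ _ (fun y => R.pd_eq _ _ hφ j y)]

theorem lap_eq (y : U) : Loc.lap G φ y = ev y (M.lap x) := by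
  simp only [Loc.lap, lap, map_sum, map_mul, R.inv_eq, R.hess_eq hφ]

theorem gradSq_eq (y : U) : Loc.gradSq G φ y = ev y (M.gradInner x x) := by
  simp only [Loc.gradSq, gradInner, map_sum, map_mul, R.inv_eq, R.pd_eq _ _ hφ]

end

theorem tensorNormSq_eq (y : U) {S : Fin n → Fin n → ℝ} {X : Fin n → Fin n → A}
    (h : ∀ i j, S i j = ev y (X i j)) : Loc.tensorNormSq G y S = ev y (M.tensorInner X X) := by
  simp only [Loc.tensorNormSq, tensorInner, map_sum, map_mul, R.inv_eq, h]

/-- A frame of `𝔱ᵏ` that is orthonormal for `h`. -/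
theorem covecNormSq_eq (B : Matrix (Fin k) (Fin k) ℝ) (y : U) {α : Fin k → Fin n → ℝ}
    {X : Fin k → Fin n → A} (hX : ∀ c i, ev y (X c i) = ∑ a, B c a * α a i) :
    Loc.covecNormSq (B.transpose * B) G y α = ev y (∑ c, M.coInner (X c) (X c)) := by
  simp only [Loc.covecNormSq, coInner, map_sum, map_mul, hX, ← R.inv_eq, Matrix.mul_apply,
    Matrix.transpose_apply, Finset.sum_mul, Finset.mul_sum]
  rw [sum_five_comm]
  refine Finset.sum_congr rfl fun c _ => Finset.sum_congr rfl fun i _ =>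
    Finset.sum_congr rfl fun j _ => Finset.sum_congr rfl fun b _ =>
    Finset.sum_congr rfl fun a _ => ?_
  ring

section

variable {F : Fin k → Fin n → Fin n → Coord n → ℝ} {X : Fin k → Fin n → Fin n → A}
  (hF : ∀ (a : Fin k) (i j : Fin n) (y : U), F a i j y = ev y (X a i j))
include hF

theorem codiff_eq (a : Fin k) (j : Fin n) (y : U) :
    Loc.codiff G F a j y = ev y (M.codiff (X a) j) := by
  simp only [Loc.codiff, codiff, Loc.covF, nablaForm, map_neg, map_sum, map_mul, map_sub,
    R.inv_eq, R.chris_eq, R.pd_eq _ _ (fun y => hF a _ _ y), hF]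

theorem gradContract_eq {φ : Coord n → ℝ} {x : A} (hφ : ∀ y : U, φ y = ev y x) (a : Fin k)
    (j : Fin n) (y : U) :
    Loc.gradContract G φ F a j y = ev y (∑ i, M.grad x i * X a i j) := by
  simp only [Loc.gradContract, grad, map_sum, map_mul, R.inv_eq, R.pd_eq _ _ hφ, hF,
    Finset.sum_mul]
  rw [Finset.sum_comm]
  simp only [fun i j y => show ev y (M.gi i j) = ev y (M.gi j i) from by rw [M.gi_symm]]

/-- With the inner product factored as `Bᵀ * B`, its contraction splits into a sum of squares of
real two-forms, the setting of the algebraic lemmas. -/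
theorem curvSq_eq (B : Matrix (Fin k) (Fin k) ℝ) (i j : Fin n) (y : U) :
    Loc.curvSq (B.transpose * B) G F i j y =
      ev y (∑ c, M.formSq (fun i j => ∑ a, B c a • X a i j) i j) := by
  simp only [Loc.curvSq, formSq, map_sum, map_mul, map_smul, smul_eq_mul, ← R.inv_eq,
    Matrix.mul_apply, Matrix.transpose_apply, Finset.sum_mul, Finset.mul_sum, ← hF]
  rw [sum_five_comm]
  refine Finset.sum_congr rfl fun c _ => Finset.sum_congr rfl fun l _ =>
    Finset.sum_congr rfl fun m _ => Finset.sum_congr rfl fun b _ =>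
    Finset.sum_congr rfl fun a _ => ?_
  ring

theorem curvNormSq_eq (B : Matrix (Fin k) (Fin k) ℝ) (y : U) :
    Loc.curvNormSq (B.transpose * B) G F y =
      ev y (∑ c, M.formNormSq (fun i j => ∑ a, B c a • X a i j)) := by
  simp only [Loc.curvNormSq, R.curvSq_eq hF, R.inv_eq, formNormSq, map_sum, map_mul,
    Finset.mul_sum]
  exact (sum_rotate _)

end
end Realizes
end Realizes

/-- The codifferential is linear over the constants. -/
theorem codiff_sum_smul {A ι : Type*} [CommRing A] [Algebra ℝ A] [Fintype ι] [DecidableEq ι]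
    (M : MetricRing A ι) {κ : Type*} [Fintype κ] (b : κ → ℝ) (X : κ → ι → ι → A) (j : ι) :
    M.codiff (fun i j => ∑ a, b a • X a i j) j = ∑ a, b a • M.codiff (X a) j := by
  simp only [codiff, nablaForm, map_sum, Derivation.map_smul, Finset.mul_sum, smul_neg,
    Finset.smul_sum, Finset.sum_neg_distrib, mul_smul_comm, smul_sub, mul_sub,
    Finset.sum_sub_distrib]
  congr 1
  simp only [← Finset.sum_sub_distrib]
  rw [← sum_rotate]
  refine Finset.sum_congr rfl fun m _ => Finset.sum_congr rfl fun i _ => ?_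
  simp only [Finset.sum_sub_distrib]
  rw [Finset.sum_comm (f := fun x a => b a • (M.gi m i * (M.chris x m i * X a x j))),
    Finset.sum_comm (f := fun x a => b a • (M.gi m i * (M.chris x m j * X a i x)))]

end MetricRing

/-! ### Smooth families of metrics on an open set of `ℝⁿ` -/

theorem contDiffOn_det {E ι : Type*} [NormedAddCommGroup E] [NormedSpace ℝ E] [Fintype ι]
    [DecidableEq ι] {D : Set E} {N : E → Matrix ι ι ℝ}
    (hN : ∀ i j, ContDiffOn ℝ ∞ (fun p => N p i j) D) :
    ContDiffOn ℝ ∞ (fun p => (N p).det) D := by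
  simp only [Matrix.det_apply]
  refine ContDiffOn.sum fun s _ => ContDiffOn.const_smul _ ?_
  exact contDiffOn_prod fun i _ => hN _ _

theorem contDiffOn_matrix_inv {E ι : Type*} [NormedAddCommGroup E] [NormedSpace ℝ E] [Fintype ι]
    [DecidableEq ι] {D : Set E} {N : E → Matrix ι ι ℝ}
    (hN : ∀ i j, ContDiffOn ℝ ∞ (fun p => N p i j) D) (h0 : ∀ p ∈ D, (N p).det ≠ 0) (i j : ι) :
    ContDiffOn ℝ ∞ (fun p => (N p)⁻¹ i j) D := by
  have h : ContDiffOn ℝ ∞ (fun p => (N p).det⁻¹ * (N p).adjugate i j) D := by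
    refine ((contDiffOn_det hN).inv h0).mul ?_
    simp only [Matrix.adjugate_apply]
    refine contDiffOn_det fun a b => ?_
    by_cases hb : a = j
    · subst hb; simp only [Matrix.updateRow_self]; exact contDiffOn_const
    · simp only [Matrix.updateRow_ne hb]; exact hN a b
  refine h.congr fun p _ => ?_
  rw [Matrix.inv_def, Ring.inverse_eq_inv', Matrix.smul_apply, smul_eq_mul]

section OfSmooth

variable {n : ℕ} {T : Set ℝ} (hT : T.OrdConnected) (hT' : T.Nontrivial) {U : Set (Coord n)}
  (hU : IsOpen U) {G : ℝ → Coord n → Matrix (Fin n) (Fin n) ℝ}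
  (hG : ∀ i j, ContDiffOn ℝ ∞ (fun q : ℝ × Coord n => G q.1 q.2 i j) (T ×ˢ U))
  (hs : ∀ t ∈ T, ∀ y ∈ U, ∀ i j, G t y i j = G t y j i)
  (hd : ∀ t ∈ T, ∀ y ∈ U, 0 < (G t y).det)

/-- The metric ring of a smooth family of metrics on an open set. -/
def MetricRing.ofSmooth : MetricRing (SmoothRing (T ×ˢ U)) (Fin n) where
  d := spaceDeriv hT hT' hU
  d_comm := spaceDeriv_comm hT hT' hU
  g := Matrix.of fun i j => SmoothRing.mk _ (hG i j)
  gi := Matrix.of fun i j => SmoothRing.mk _ (contDiffOn_matrix_inv (N := fun q => G q.1 q.2) hG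
    (fun q hq => (hd q.1 hq.1 q.2 hq.2).ne') i j)
  g_symm i j := SmoothRing.ext_toFun fun p hp => by
    simp only [Matrix.of_apply]
    rw [SmoothRing.toFun_mk _ hp, SmoothRing.toFun_mk _ hp, hs p.1 hp.1 p.2 hp.2]
  g_mul_gi := by
    ext i j
    refine SmoothRing.ext_toFun fun p hp => ?_
    have h := congrFun (congrFun (Matrix.mul_nonsing_inv (G p.1 p.2)
      (isUnit_iff_ne_zero.mpr (hd p.1 hp.1 p.2 hp.2).ne')) i) j
    rw [← SmoothRing.eval_apply p hp, ← SmoothRing.eval_apply p hp, Matrix.mul_apply, map_sum]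
    simp only [map_mul, SmoothRing.eval_apply, Matrix.of_apply, SmoothRing.toFun_mk _ hp]
    rw [Matrix.mul_apply] at h
    rw [h, ← SmoothRing.eval_apply p hp]
    by_cases hij : i = j
    · subst hij; simp
    · simp [Matrix.one_apply_ne hij]

/-- Evaluation of functions on `T × U` at a fixed time. -/
def slice {t : ℝ} (ht : t ∈ T) (y : U) : SmoothRing (T ×ˢ U) →ₐ[ℝ] ℝ :=
  SmoothRing.eval (t, (y : Coord n)) ⟨ht, y.2⟩

theorem slice_apply {t : ℝ} (ht : t ∈ T) (y : U) (x : SmoothRing (T ×ˢ U)) :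
    slice ht y x = x.toFun (t, y) := SmoothRing.eval_apply _ _ _

theorem slice_mk {t : ℝ} (ht : t ∈ T) (y : U) {Φ : ℝ × Coord n → ℝ}
    (h : ContDiffOn ℝ ∞ Φ (T ×ˢ U)) : slice ht y (SmoothRing.mk Φ h) = Φ (t, y) := by
  rw [slice_apply, SmoothRing.toFun_mk h (p := (t, (y : Coord n))) ⟨ht, y.2⟩]

theorem ext_slice {x z : SmoothRing (T ×ˢ U)} (h : ∀ (t : ℝ) (ht : t ∈ T) (y : U),
    slice ht y x = slice ht y z) : x = z :=
  SmoothRing.ext_toFun fun p hp => by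
    simpa only [slice_apply] using h p.1 hp.1 ⟨p.2, hp.2⟩

theorem MetricRing.ofSmooth_realizes {t : ℝ} (ht : t ∈ T) :
    (MetricRing.ofSmooth hT hT' hU hG hs hd).Realizes U (slice ht) (G t) where
  pd_eq φ x hφ i y := by
    rw [slice_apply]
    exact pd_eq_spaceDeriv hT hT' hU ht (fun z hz => by rw [hφ ⟨z, hz⟩, slice_apply]) i y.2
  g_eq y i j := by
    rw [slice_apply]
    exact (SmoothRing.toFun_mk (hG i j) (p := (t, (y : Coord n))) ⟨ht, y.2⟩).symm

end OfSmooth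

/-! ### Change of coordinates -/

theorem sum_smul_derivation_apply {A ι : Type*} [CommRing A] [Algebra ℝ A] [Fintype ι]
    (p : ι → A) (d : ι → Derivation ℝ A A) (x : A) :
    (∑ i, p i • d i) x = ∑ i, p i * d i x := by
  have := congrFun (map_sum (Derivation.coeFnAddMonoidHom (R := ℝ) (A := A) (M := A))
    (fun i => p i • d i) Finset.univ) x
  rw [Finset.sum_apply] at this
  exact this

/-- A coordinate change on a metric ring, given by its Jacobi matrix and the inverse. -/
def MetricRing.changeFrame {A ι : Type*} [CommRing A] [Algebra ℝ A] [Fintype ι] [DecidableEq ι]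
    (M : MetricRing A ι) (P Q : Matrix ι ι A) (hPQ : P * Q = 1)
    (hP : ∀ a b k, ∑ i, P a i * M.d i (P b k) = ∑ i, P b i * M.d i (P a k)) : MetricRing A ι where
  d a := ∑ i, P a i • M.d i
  d_comm a b x := by
    simp only [sum_smul_derivation_apply, smul_eq_mul, map_sum, Derivation.leibniz, Finset.sum_add_distrib, Finset.mul_sum]
    have h1 : ∑ j, ∑ i, P b j * (P a i * M.d i (M.d j x)) =
        ∑ j, ∑ i, P a j * (P b i * M.d i (M.d j x)) := by
      rw [Finset.sum_comm]
      exact Finset.sum_congr rfl fun i _ => Finset.sum_congr rfl fun j _ => by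
        rw [M.d_comm]; ring
    have h2 (a b : ι) : ∑ j, ∑ i, M.d j x * (P a i * M.d i (P b j)) =
        ∑ j, M.d j x * ∑ i, P a i * M.d i (P b j) := by
      simp only [Finset.mul_sum]
    rw [h1, h2, h2]
    simp only [hP a b]
  g := P * M.g * P.transpose
  gi := Q.transpose * M.gi * Q
  g_symm i j := by
    have : (P * M.g * P.transpose).transpose = P * M.g * P.transpose := by
      rw [Matrix.transpose_mul, Matrix.transpose_mul, Matrix.transpose_transpose, M.g_transpose,
        mul_assoc]
    exact (congrFun (congrFun this i) j).symm
  g_mul_gi := by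
    have h2 : P.transpose * Q.transpose = 1 := by
      rw [← Matrix.transpose_mul, mul_eq_one_comm.mp hPQ, Matrix.transpose_one]
    calc P * M.g * P.transpose * (Q.transpose * M.gi * Q)
        = P * M.g * (P.transpose * Q.transpose) * M.gi * Q := by simp only [mul_assoc]
      _ = P * (M.g * M.gi) * Q := by rw [h2, mul_one]; simp only [mul_assoc]
      _ = 1 := by rw [M.g_mul_gi, mul_one, hPQ]

theorem MetricRing.changeFrame_isFrameChange {A ι : Type*} [CommRing A] [Algebra ℝ A] [Fintype ι]
    [DecidableEq ι] (M : MetricRing A ι) (P Q : Matrix ι ι A) (hPQ : P * Q = 1)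
    (hP : ∀ a b k, ∑ i, P a i * M.d i (P b k) = ∑ i, P b i * M.d i (P a k)) :
    IsFrameChange M (M.changeFrame P Q hPQ hP) P where
  d_eq a x := by
    exact sum_smul_derivation_apply _ _ _
  g_eq := rfl
  symm a b k := by
    simp only [changeFrame, sum_smul_derivation_apply]
    exact hP a b k

theorem pd_comp {n m : ℕ} {φ : Coord m → ℝ} {ψ : Coord n → Coord m} {y : Coord n}
    (hφ : DifferentiableAt ℝ φ (ψ y)) (hψ : DifferentiableAt ℝ ψ y) (a : Fin n) :
    pd a (fun z => φ (ψ z)) y = ∑ i, pd a (fun z => ψ z i) y * pd i φ (ψ y) := by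
  have h1 : pd a (fun z => φ (ψ z)) y = fderiv ℝ φ (ψ y) (fderiv ℝ ψ y (EuclideanSpace.single a 1)) := by
    rw [pd, show (fun z => φ (ψ z)) = φ ∘ ψ from rfl, fderiv_comp y hφ hψ]; rfl
  have h2 (i : Fin m) : pd a (fun z => ψ z i) y = fderiv ℝ ψ y (EuclideanSpace.single a 1) i := by
    have := ((EuclideanSpace.proj i : Coord m →L[ℝ] ℝ).hasFDerivAt.comp y hψ.hasFDerivAt).fderiv
    rw [pd]
    exact congrArg (fun L => L (EuclideanSpace.single a (1 : ℝ))) this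
  rw [h1]
  set v : Coord m := fderiv ℝ ψ y (EuclideanSpace.single a 1) with hv
  have h3 : v = ∑ i, v i • EuclideanSpace.single i (1 : ℝ) := by
    ext j; simp [Finset.sum_apply, Pi.single_apply]
  rw [h3, map_sum]
  simp only [map_smul, smul_eq_mul, h2]
  rfl

/-- The Jacobi matrix of the inverse of a coordinate change. -/
def jac {n : ℕ} (ψ : Coord n → Coord n) (y : Coord n) : Matrix (Fin n) (Fin n) ℝ :=
  Matrix.of fun a i => pd a (fun z => ψ z i) y

theorem contDiffOn_pd {n : ℕ} {φ : Coord n → ℝ} {U : Set (Coord n)} (hU : IsOpen U)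
    (hφ : ContDiffOn ℝ ∞ φ U) (i : Fin n) : ContDiffOn ℝ ∞ (pd i φ) U :=
  (hφ.fderiv_of_isOpen hU (by simp)).clm_apply contDiffOn_const

theorem pd_comm {n : ℕ} {φ : Coord n → ℝ} {U : Set (Coord n)} (hU : IsOpen U)
    (hφ : ContDiffOn ℝ ∞ φ U) (i j : Fin n) {y : Coord n} (hy : y ∈ U) :
    pd i (pd j φ) y = pd j (pd i φ) y := by
  have key (v w : Coord n) : fderiv ℝ (fun z => fderiv ℝ φ z v) y w = fderiv ℝ (fderiv ℝ φ) y w v := by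
    have h2 := ((hφ.fderiv_of_isOpen hU (m := ∞) (by simp)).contDiffAt
      (hU.mem_nhds hy)).differentiableAt (by simp)
    rw [fderiv_clm_apply h2 (differentiableAt_const v)]
    simp
  have h := (hφ.contDiffAt (hU.mem_nhds hy)).isSymmSndFDerivAt
    (by rw [minSmoothness_of_isRCLikeNormedField]; exact WithTop.coe_le_coe.mpr le_top)
  exact (key _ _).trans ((h _ _).trans (key _ _).symm)

theorem pd_congr {n : ℕ} {φ χ : Coord n → ℝ} {U : Set (Coord n)} (hU : IsOpen U)
    (h : ∀ y ∈ U, φ y = χ y) (i : Fin n) {y : Coord n} (hy : y ∈ U) : pd i φ y = pd i χ y := by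
  rw [pd, pd, Filter.EventuallyEq.fderiv_eq (Filter.eventually_of_mem (hU.mem_nhds hy) h)]

theorem pd_coord {n : ℕ} (a b : Fin n) (y : Coord n) :
    pd a (fun z => z b) y = (1 : Matrix (Fin n) (Fin n) ℝ) a b := by
  have := (EuclideanSpace.proj b : Coord n →L[ℝ] ℝ).fderiv (x := y)
  have h : pd a (fun z => z b) y = (EuclideanSpace.single a (1 : ℝ) : Coord n) b :=
    congrArg (fun L => L (EuclideanSpace.single a (1 : ℝ))) this
  rw [h, Matrix.one_apply]
  simp [eq_comm]

section Transition

variable {n : ℕ} {e : OpenPartialHomeomorph (Coord n) (Coord n)}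
  (he : ContDiffOn ℝ ∞ e e.source) (he' : ContDiffOn ℝ ∞ e.symm e.target)

include he he' in
theorem jac_symm_mul_jac {y : Coord n} (hy : y ∈ e.target) :
    jac e.symm y * jac e (e.symm y) = 1 := by
  ext a b
  have h1 := ((he'.contDiffAt (e.open_target.mem_nhds hy)).differentiableAt (by simp))
  have h2 := (he.contDiffAt (e.open_source.mem_nhds (e.map_target hy))).differentiableAt (by simp)
  have h3 : DifferentiableAt ℝ (fun z => e z b) (e.symm y) :=
    (EuclideanSpace.proj b : Coord n →L[ℝ] ℝ).differentiableAt.comp _ h2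
  have h4 := pd_comp h3 h1 a
  rw [pd_congr e.open_target (χ := fun z => z b) (fun z hz => by rw [e.right_inv hz]) a hy,
    pd_coord] at h4
  rw [Matrix.mul_apply, h4]
  rfl

variable {G G' : Coord n → Matrix (Fin n) (Fin n) ℝ}
  (hG : ∀ i j, ContDiffOn ℝ ∞ (fun y => G y i j) e.source)
  (hs : ∀ y ∈ e.source, ∀ i j, G y i j = G y j i)
  (hd : ∀ y ∈ e.source, 0 < (G y).det)
  (hG' : ∀ y ∈ e.target,
    G' y = jac e.symm y * G (e.symm y) * (jac e.symm y).transpose)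

include he he' hG hs hd hG' in
/-- A coordinate change is realized by a change of frame. -/
theorem exists_isFrameChange : ∃ (M M' : MetricRing (SmoothRing ((univ : Set ℝ) ×ˢ e.source)) (Fin n))
    (P : Matrix (Fin n) (Fin n) (SmoothRing ((univ : Set ℝ) ×ˢ e.source))),
    M.IsFrameChange M' P ∧
    M.Realizes e.source (slice (mem_univ 0)) G ∧
    M'.Realizes e.target (fun y => slice (mem_univ 0) ⟨e.symm y, e.map_target y.2⟩) G' ∧
    ∀ (y : e.target) a i, slice (mem_univ 0) ⟨e.symm y, e.map_target y.2⟩ (P a i) =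
      jac e.symm y a i := by
  -- A static metric is treated as a constant family over the whole time axis, so that the
  -- space-time rings can be reused.
  have hT : (univ : Set ℝ).OrdConnected := ordConnected_univ
  have hT' : (univ : Set ℝ).Nontrivial := nontrivial_univ
  have lift {φ : Coord n → ℝ} (hφ : ContDiffOn ℝ ∞ φ e.source) :
      ContDiffOn ℝ ∞ (fun q : ℝ × Coord n => φ q.2) ((univ : Set ℝ) ×ˢ e.source) :=
    hφ.comp contDiff_snd.contDiffOn fun q hq => hq.2
  have hP (a i : Fin n) : ContDiffOn ℝ ∞ (fun y => jac e.symm (e y) a i) e.source :=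
    (contDiffOn_pd e.open_target ((EuclideanSpace.proj i : Coord n →L[ℝ] ℝ).contDiff.comp_contDiffOn
      he') a).comp he e.mapsTo
  have hQ (a i : Fin n) : ContDiffOn ℝ ∞ (fun y => jac e y a i) e.source :=
    contDiffOn_pd e.open_source ((EuclideanSpace.proj i : Coord n →L[ℝ] ℝ).contDiff.comp_contDiffOn
      he) a
  let P : Matrix (Fin n) (Fin n) (SmoothRing ((univ : Set ℝ) ×ˢ e.source)) :=
    Matrix.of fun a i => SmoothRing.mk _ (lift (hP a i))
  let Q : Matrix (Fin n) (Fin n) (SmoothRing ((univ : Set ℝ) ×ˢ e.source)) :=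
    Matrix.of fun a i => SmoothRing.mk _ (lift (hQ a i))
  have Ps (t : ℝ) (y : e.source) (a i) : slice (mem_univ t) y (P a i) = jac e.symm (e y) a i :=
    slice_mk (mem_univ t) y (lift (hP a i))
  have Qs (t : ℝ) (y : e.source) (a i) : slice (mem_univ t) y (Q a i) = jac e y a i :=
    slice_mk (mem_univ t) y (lift (hQ a i))
  have hPQ : P * Q = 1 := by
    ext a b
    refine ext_slice fun t ht y => ?_
    rw [Matrix.mul_apply, map_sum]
    simp only [map_mul, Ps, Qs]
    have := congrFun (congrFun (jac_symm_mul_jac he he' (e.map_source y.2)) a) b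
    rw [Matrix.mul_apply, e.left_inv y.2] at this
    rw [this]
    by_cases hij : a = b
    · subst hij; simp
    · simp [Matrix.one_apply_ne hij]
  let M := MetricRing.ofSmooth hT hT' e.open_source (G := fun _ => G) (fun i j => lift (hG i j))
    (fun _ _ => hs) (fun _ _ => hd)
  have R (t : ℝ) : M.Realizes e.source (slice (mem_univ t)) G :=
    MetricRing.ofSmooth_realizes hT hT' e.open_source (G := fun _ => G) (fun i j => lift (hG i j))
      (fun _ _ => hs) (fun _ _ => hd) (mem_univ t)
  -- Functions in the new coordinates are represented in the ring of the old ones; by the chain rule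
  -- the new partial derivatives act there through the Jacobi matrix.
  have chain (t : ℝ) (φ : Coord n → ℝ) (x : SmoothRing ((univ : Set ℝ) ×ˢ e.source))
      (hφ : ∀ y (hy : y ∈ e.target), φ y = slice (mem_univ t) ⟨e.symm y, e.map_target hy⟩ x)
      (a : Fin n) {y : Coord n} (hy : y ∈ e.target) : pd a φ y =
        slice (mem_univ t) ⟨e.symm y, e.map_target hy⟩ (∑ i, P a i * M.d i x) := by
    have h1 := ((he'.contDiffAt (e.open_target.mem_nhds hy)).differentiableAt (by simp))
    have h2 : ContDiffOn ℝ ∞ (fun z => x.toFun (t, z)) e.source :=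
      x.contDiffOn_toFun.comp (contDiffOn_const.prodMk contDiffOn_id) fun z hz => ⟨mem_univ _, hz⟩
    have h3 := (h2.contDiffAt (e.open_source.mem_nhds (e.map_target hy))).differentiableAt (by simp)
    have h4 := pd_comp (ψ := e.symm) h3 h1 a
    rw [pd_congr e.open_target (χ := fun z => x.toFun (t, e.symm z))
      (fun z hz => by rw [hφ z hz, slice_apply]) a hy, h4, map_sum]
    refine Finset.sum_congr rfl fun i _ => ?_
    rw [map_mul, Ps, ← (R t).pd_eq (fun z => x.toFun (t, z)) x (fun z => by rw [slice_apply])]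
    simp only [e.right_inv hy]
    rfl
  -- Entries of `P` are first derivatives of the transition map, so this is equality of its mixed
  -- second derivatives.
  have hsymm (a b k) : ∑ i, P a i * M.d i (P b k) = ∑ i, P b i * M.d i (P a k) := by
    refine ext_slice fun t ht y => ?_
    have h (a b : Fin n) : slice ht y (∑ i, P a i * M.d i (P b k)) =
        pd a (pd b fun z => e.symm z k) (e y) := by
      have := chain t (pd b fun z => e.symm z k) (P b k) (fun z hz => by
        rw [Ps]; simp only [e.right_inv hz]; rfl) a (e.map_source y.2)
      rw [this]
      simp only [e.left_inv y.2]
    rw [h, h]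
    exact pd_comm e.open_target
      ((EuclideanSpace.proj k : Coord n →L[ℝ] ℝ).contDiff.comp_contDiffOn he') a b
      (e.map_source y.2)
  have hFC := M.changeFrame_isFrameChange P Q hPQ hsymm
  refine ⟨M, M.changeFrame P Q hPQ hsymm, P, hFC, R 0, ⟨?_, ?_⟩, ?_⟩
  · intro φ x hφ a y
    rw [hFC.d_eq]
    exact chain 0 φ x (fun z hz => hφ ⟨z, hz⟩) a y.2
  · intro y a b
    rw [hFC.g_apply, hG' y y.2]
    simp only [map_sum, map_mul, ← (R 0).g_eq, Ps, e.right_inv y.2, Matrix.mul_apply,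
      Matrix.transpose_apply, Finset.sum_mul]
    rw [Finset.sum_comm]
    exact Finset.sum_congr rfl fun _ _ => Finset.sum_congr rfl fun _ _ => by ring
  · intro y a i
    rw [Ps]
    simp only [e.right_inv y.2]

end Transition

/-! ### Invariance of contractions -/

section Contraction

variable {n k : ℕ} {P : Matrix (Fin n) (Fin n) ℝ}

/-- The two frame matrices belonging to the lower indices are absorbed by the transformation of the
inverse metric. -/
theorem contract_change {X X' : Matrix (Fin n) (Fin n) ℝ} (hX : X = P.transpose * X' * P)
    (T : Fin n → Fin n → ℝ) :
    ∑ a, ∑ b, X' a b * ∑ i, ∑ j, P a i * P b j * T i j = ∑ i, ∑ j, X i j * T i j := by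
  simp only [hX, Matrix.mul_apply, Matrix.transpose_apply, Finset.mul_sum, Finset.sum_mul]
  rw [sum_comm_pairs]
  refine Finset.sum_congr rfl fun i _ => Finset.sum_congr rfl fun j _ => ?_
  rw [Finset.sum_comm]
  exact Finset.sum_congr rfl fun _ _ => Finset.sum_congr rfl fun _ _ => by ring

theorem bilin_change {X X' : Matrix (Fin n) (Fin n) ℝ} (hX : X = P.transpose * X' * P)
    (α β : Fin n → ℝ) :
    ∑ a, ∑ b, X' a b * (∑ i, P a i * α i) * (∑ j, P b j * β j) =
      ∑ i, ∑ j, X i j * α i * β j := by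
  simp only [mul_assoc (X _ _)]
  rw [← contract_change hX]
  refine Finset.sum_congr rfl fun a _ => Finset.sum_congr rfl fun b _ => ?_
  rw [mul_assoc, Finset.sum_mul_sum]
  congr 1
  exact Finset.sum_congr rfl fun _ _ => Finset.sum_congr rfl fun _ _ => by ring

variable {G G' : Coord n → Matrix (Fin n) (Fin n) ℝ} {y y' : Coord n}
  (hX : (G y)⁻¹ = P.transpose * (G' y')⁻¹ * P)
include hX

theorem covecNormSq_change (h : Matrix (Fin k) (Fin k) ℝ) {α α' : Fin k → Fin n → ℝ}
    (hα : ∀ c a, α' c a = ∑ i, P a i * α c i) :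
    Loc.covecNormSq h G' y' α' = Loc.covecNormSq h G y α := by
  refine Finset.sum_congr rfl fun c _ => Finset.sum_congr rfl fun d _ => ?_
  have := congrArg (fun x => h c d * x) (bilin_change hX (α c) (α d))
  simpa only [← hα, Finset.mul_sum, mul_assoc] using this

theorem tensorNormSq_change {S S' : Fin n → Fin n → ℝ}
    (hS : ∀ a b, S' a b = ∑ i, ∑ j, P a i * P b j * S i j) :
    Loc.tensorNormSq G' y' S' = Loc.tensorNormSq G y S := by
  have e (X : Matrix (Fin n) (Fin n) ℝ) (S : Fin n → Fin n → ℝ) :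
      ∑ i, ∑ j, ∑ k, ∑ l, X i k * X j l * S i j * S k l =
      ∑ i, ∑ k, X i k * ∑ j, ∑ l, X j l * S i j * S k l := by
    refine Finset.sum_congr rfl fun i _ => ?_
    rw [Finset.sum_comm]
    simp only [Finset.mul_sum, mul_assoc]
  have hS' (a b) : S' a b = ∑ j, P b j * ∑ i, P a i * S i j := by
    rw [hS, Finset.sum_comm]
    simp only [Finset.mul_sum]
    exact Finset.sum_congr rfl fun _ _ => Finset.sum_congr rfl fun _ _ => by ring
  rw [Loc.tensorNormSq, Loc.tensorNormSq, e, e, ← contract_change hX]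
  refine Finset.sum_congr rfl fun a _ => Finset.sum_congr rfl fun c _ => ?_
  congr 1
  simp only [hS']
  rw [bilin_change hX]
  simp only [Finset.sum_mul, Finset.mul_sum]
  rw [sum_comm_pairs, Finset.sum_comm]
  exact Finset.sum_congr rfl fun _ _ => Finset.sum_congr rfl fun _ _ =>
    Finset.sum_congr rfl fun _ _ => Finset.sum_congr rfl fun _ _ => by ring

section

variable {F F' : Fin k → Fin n → Fin n → Coord n → ℝ}
  (hF : ∀ c a b, F' c a b y' = ∑ i, ∑ j, P a i * P b j * F c i j y)
include hF

theorem curvSq_change (h : Matrix (Fin k) (Fin k) ℝ) (a b : Fin n) :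
    Loc.curvSq h G' F' a b y' = ∑ i, ∑ j, P a i * P b j * Loc.curvSq h G F i j y := by
  have hF' (c a b) : F' c a b y' = ∑ j, P b j * ∑ i, P a i * F c i j y := by
    rw [hF, Finset.sum_comm]
    simp only [Finset.mul_sum]
    exact Finset.sum_congr rfl fun _ _ => Finset.sum_congr rfl fun _ _ => by ring
  have e (c d) : ∑ l, ∑ m, h c d * (G' y')⁻¹ l m * F' c a l y' * F' d b m y' =
      ∑ i, ∑ j, P a i * P b j * ∑ l, ∑ m, h c d * (G y)⁻¹ l m * F c i l y * F d j m y := by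
    calc _ = h c d * ∑ l, ∑ m, (G' y')⁻¹ l m * F' c a l y' * F' d b m y' := by
          simp only [Finset.mul_sum, mul_assoc]
      _ = h c d * ∑ l, ∑ m, (G y)⁻¹ l m * (∑ i, P a i * F c i l y) * ∑ j, P b j * F d j m y := by
          simp only [hF']
          rw [bilin_change hX]
      _ = _ := by
          simp only [Finset.sum_mul, Finset.mul_sum]
          rw [sum_comm_pairs, Finset.sum_comm]
          exact Finset.sum_congr rfl fun _ _ => Finset.sum_congr rfl fun _ _ =>
            Finset.sum_congr rfl fun _ _ => Finset.sum_congr rfl fun _ _ => by ring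
  simp only [Loc.curvSq, e]
  simp only [Finset.mul_sum (s := (Finset.univ : Finset (Fin k)))]
  have hcomm (f : Fin k → Fin k → Fin n → Fin n → ℝ) :
      ∑ c, ∑ d, ∑ i, ∑ j, f c d i j = ∑ i, ∑ j, ∑ c, ∑ d, f c d i j := by
    rw [Finset.sum_congr rfl fun c _ => (sum_rotate fun i j d => f c d i j).symm]
    exact (sum_rotate fun i j c => ∑ d, f c d i j).symm
  exact hcomm _

theorem curvNormSq_change (h : Matrix (Fin k) (Fin k) ℝ) :
    Loc.curvNormSq h G' F' y' = Loc.curvNormSq h G F y := by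
  simp only [Loc.curvNormSq, curvSq_change hX hF]
  exact contract_change hX _

theorem gradContract_change {φ φ' : Coord n → ℝ}
    (hφ : ∀ a, pd a φ' y' = ∑ i, P a i * pd i φ y) (c : Fin k) (b : Fin n) :
    Loc.gradContract G' φ' F' c b y' = ∑ j, P b j * Loc.gradContract G φ F c j y := by
  have hF' (a) : F' c a b y' = ∑ i, P a i * ∑ j, P b j * F c i j y := by
    rw [hF]
    simp only [Finset.mul_sum, mul_assoc]
  simp only [Loc.gradContract, hF', hφ]
  rw [bilin_change hX]
  simp only [Finset.mul_sum]
  rw [sum_rotate]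
  exact Finset.sum_congr rfl fun _ _ => Finset.sum_congr rfl fun _ _ =>
    Finset.sum_congr rfl fun _ _ => by ring

end
end Contraction

/-! ### Transformation of the Hessian and the codifferential under transition maps. -/

section Transition

variable {n k : ℕ} {e : OpenPartialHomeomorph (Coord n) (Coord n)}
  (he : ContDiffOn ℝ ∞ e e.source) (he' : ContDiffOn ℝ ∞ e.symm e.target)
  {G G' : Coord n → Matrix (Fin n) (Fin n) ℝ}
  (hG : ∀ i j, ContDiffOn ℝ ∞ (fun y => G y i j) e.source)
  (hs : ∀ y ∈ e.source, ∀ i j, G y i j = G y j i)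
  (hd : ∀ y ∈ e.source, 0 < (G y).det)
  (hG' : ∀ y ∈ e.target,
    G' y = jac e.symm y * G (e.symm y) * (jac e.symm y).transpose)
include he he' hG hs hd hG'

theorem inv_change {y : Coord n} (hy : y ∈ e.target) :
    (G (e.symm y))⁻¹ = (jac e.symm y).transpose * (G' y)⁻¹ * jac e.symm y := by
  obtain ⟨M, M', P, h, R, R', hP⟩ := exists_isFrameChange he he' hG hs hd hG'
  ext i j
  rw [R.inv_eq ⟨e.symm y, e.map_target hy⟩, h.gi_eq]
  simp only [Matrix.mul_apply, Matrix.transpose_apply, map_sum, map_mul, hP ⟨y, hy⟩,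
    R'.inv_eq ⟨y, hy⟩]

theorem hess_change {φ : Coord n → ℝ} (hφ : ContDiffOn ℝ ∞ φ e.source) {y : Coord n}
    (hy : y ∈ e.target) (a b : Fin n) :
    Loc.hess G' (φ ∘ e.symm) a b y =
      ∑ i, ∑ j, jac e.symm y a i * jac e.symm y b j * Loc.hess G φ i j (e.symm y) := by
  obtain ⟨M, M', P, h, R, R', hP⟩ := exists_isFrameChange he he' hG hs hd hG'
  let x : SmoothRing ((univ : Set ℝ) ×ˢ e.source) := SmoothRing.mk (fun q => φ q.2)
    (hφ.comp contDiff_snd.contDiffOn fun q hq => hq.2)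
  have hx (y : e.source) : φ y = slice (mem_univ 0) y x :=
    (slice_mk (mem_univ (0 : ℝ)) y (Φ := fun q => φ q.2) _).symm
  rw [R'.hess_eq (x := x) (fun y => hx ⟨e.symm y, e.map_target y.2⟩) a b ⟨y, hy⟩, h.hess_eq]
  simp only [map_sum, map_mul, hP ⟨y, hy⟩, R.hess_eq hx _ _ ⟨e.symm y, e.map_target hy⟩]

theorem codiff_change {F F' : Fin k → Fin n → Fin n → Coord n → ℝ}
    (hFs : ∀ c i j, ContDiffOn ℝ ∞ (F c i j) e.source)
    (hF : ∀ y ∈ e.target, ∀ c a b, F' c a b y =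
      ∑ i, ∑ j, jac e.symm y a i * jac e.symm y b j * F c i j (e.symm y)) {y : Coord n}
    (hy : y ∈ e.target) (c : Fin k) (b : Fin n) :
    Loc.codiff G' F' c b y = ∑ j, jac e.symm y b j * Loc.codiff G F c j (e.symm y) := by
  have hX := inv_change he he' hG hs hd hG' hy
  obtain ⟨M, M', P, h, R, R', hP⟩ := exists_isFrameChange he he' hG hs hd hG'
  let x (c i j) : SmoothRing ((univ : Set ℝ) ×ˢ e.source) := SmoothRing.mk (fun q => F c i j q.2)
    ((hFs c i j).comp contDiff_snd.contDiffOn fun q hq => hq.2)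
  have hx (c i j) (y : e.source) : F c i j y = slice (mem_univ 0) y (x c i j) :=
    (slice_mk (mem_univ (0 : ℝ)) y (Φ := fun q => F c i j q.2) _).symm
  -- The components in the new chart, represented in the ring of the old one, are the transformed
  -- components by definition; `nablaForm_eq` then applies to them.
  let x' (c a b) : SmoothRing ((univ : Set ℝ) ×ˢ e.source) :=
    ∑ i, ∑ j, P a i * P b j * x c i j
  have hx' (c a b) (y : e.target) : F' c a b y =
      slice (mem_univ 0) ⟨e.symm y, e.map_target y.2⟩ (x' c a b) := by
    simp only [x', map_sum, map_mul, hP, ← hx]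
    exact hF y y.2 c a b
  rw [R'.codiff_eq hx' c b ⟨y, hy⟩]
  simp only [MetricRing.codiff, h.nablaForm_eq (F := x c) (F' := x' c) fun _ _ => rfl,
    map_neg, map_sum, map_mul, hP ⟨y, hy⟩, ← R'.inv_eq ⟨y, hy⟩, Loc.codiff,
    mul_neg, Finset.sum_neg_distrib]
  simp only [R.inv_eq ⟨e.symm y, e.map_target hy⟩]
  have e1 (m i j) : Loc.covF G F c m i j (e.symm y) =
      slice (mem_univ 0) ⟨e.symm y, e.map_target hy⟩ (M.nablaForm (x c) m i j) := by
    simp only [Loc.covF, MetricRing.nablaForm, map_sum, map_mul, map_sub,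
      R.chris_eq _ _ _ ⟨e.symm y, e.map_target hy⟩,
      R.pd_eq _ _ (hx c _ _) _ ⟨e.symm y, e.map_target hy⟩,
      hx c _ _ ⟨e.symm y, e.map_target hy⟩]
  simp only [e1, ← R.inv_eq ⟨e.symm y, e.map_target hy⟩]
  congr 1
  have := contract_change hX fun m i => ∑ j, jac e.symm y b j *
    slice (mem_univ 0) ⟨e.symm y, e.map_target hy⟩ (M.nablaForm (x c) m i j)
  simp only [Finset.mul_sum (s := (Finset.univ : Finset (Fin n)))] at this ⊢
  conv_rhs => rw [← sum_rotate]
  refine Eq.trans ?_ (this.trans ?_)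
  · exact Finset.sum_congr rfl fun _ _ => Finset.sum_congr rfl fun _ _ =>
      Finset.sum_congr rfl fun _ _ => Finset.sum_congr rfl fun _ _ =>
      Finset.sum_congr rfl fun _ _ => by ring
  · exact Finset.sum_congr rfl fun _ _ => Finset.sum_congr rfl fun _ _ =>
      Finset.sum_congr rfl fun _ _ => by ring

end Transition

/-! ### Charts -/

section Transition

variable {n : ℕ} {S : Type*} [TopologicalSpace S] {c c' : OpenPartialHomeomorph S (Coord n)}

theorem trans_symm_apply (y : Coord n) : (c.symm ≫ₕ c').symm y = c (c'.symm y) := rfl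

theorem mem_transition_target {y : Coord n} :
    y ∈ (c.symm ≫ₕ c').target ↔ y ∈ c'.target ∧ c'.symm y ∈ c.source := by
  rw [OpenPartialHomeomorph.trans_target]
  simp

theorem mem_transition_source {y : Coord n} :
    y ∈ (c.symm ≫ₕ c').source ↔ y ∈ c.target ∧ c.symm y ∈ c'.source := by
  rw [OpenPartialHomeomorph.trans_source]
  simp

end Transition

section Charts

variable {n k : ℕ} {S : Type*} [TopologicalSpace S] [ChartedSpace (Coord n) S]
  {c c' : OpenPartialHomeomorph S (Coord n)}
  (hc : c ∈ atlas (Coord n) S) (hc' : c' ∈ atlas (Coord n) S)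

theorem sum_coord_smul (v : Coord n) : v = ∑ i, v i • EuclideanSpace.single i (1 : ℝ) := by
  ext j; simp [Finset.sum_apply, Pi.single_apply]

/-- The derivative of a chart, between model spaces. -/
def chartDeriv (c : OpenPartialHomeomorph S (Coord n)) (x : S) : Coord n →L[ℝ] Coord n :=
  mfderiv (𝓡 n) (𝓡 n) c x

/-- The derivative of an inverse chart, between model spaces. -/
def chartSymmDeriv (c : OpenPartialHomeomorph S (Coord n)) (y : Coord n) : Coord n →L[ℝ] Coord n :=
  mfderiv (𝓡 n) (𝓡 n) c.symm y

/-- The coordinate vectors as elements of the model space. -/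
def frameVec (c : OpenPartialHomeomorph S (Coord n)) (y : Coord n) (i : Fin n) : Coord n :=
  chartSymmDeriv c y (EuclideanSpace.single i 1)

theorem chartSymmDeriv_eq_sum (y v : Coord n) :
    chartSymmDeriv c y v = ∑ i, v i • frameVec c y i := by
  conv_lhs => rw [sum_coord_smul v]
  simp only [map_sum, map_smul, frameVec]

variable [IsManifold (𝓡 n) ∞ S]

include hc in
theorem mdifferentiable_chart : c.MDifferentiable (𝓡 n) (𝓡 n) :=
  haveI : IsManifold (𝓡 n) 1 S := IsManifold.of_le (n := ∞) (by simp)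
  mdifferentiable_of_mem_atlas hc

include hc hc' in
theorem contDiffOn_transition :
    ContDiffOn ℝ ∞ (c.symm ≫ₕ c') (c.symm ≫ₕ c').source := by
  have h := contMDiffOn_of_mem_contDiffGroupoid ((contDiffGroupoid ∞ (𝓡 n)).compatible hc hc')
  rwa [contMDiffOn_iff_contDiffOn] at h

include hc hc' in
theorem contDiffOn_transition_symm :
    ContDiffOn ℝ ∞ (c.symm ≫ₕ c').symm (c.symm ≫ₕ c').target := by
  have h := contDiffOn_transition hc' hc
  rw [← OpenPartialHomeomorph.symm_source, OpenPartialHomeomorph.trans_symm_eq_symm_trans_symm,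
    OpenPartialHomeomorph.symm_symm]
  exact h

include hc in
theorem chartSymmDeriv_chartDeriv {x : S} (hx : x ∈ c.source) (v : Coord n) :
    chartSymmDeriv c (c x) (chartDeriv c x v) = v :=
  congrArg (fun L => L v) ((mdifferentiable_chart hc).symm_comp_deriv hx)

include hc in
theorem chartDeriv_chartSymmDeriv {y : Coord n} (hy : y ∈ c.target) (v : Coord n) :
    chartDeriv c (c.symm y) (chartSymmDeriv c y v) = v :=
  congrArg (fun L => L v) ((mdifferentiable_chart hc).comp_symm_deriv hy)

include hc in
theorem chartDeriv_frameVec {y : Coord n} (hy : y ∈ c.target) (i j : Fin n) :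
    chartDeriv c (c.symm y) (frameVec c y i) j = (1 : Matrix (Fin n) (Fin n) ℝ) i j := by
  rw [frameVec, chartDeriv_chartSymmDeriv hc hy, Matrix.one_apply]
  simp [eq_comm]

include hc in
theorem eq_sum_frameVec {x : S} (hx : x ∈ c.source) (v : Coord n) :
    v = ∑ i, chartDeriv c x v i • frameVec c (c x) i := by
  rw [← chartSymmDeriv_eq_sum, chartSymmDeriv_chartDeriv hc hx]

include hc hc' in
theorem differentiableAt_transition_symm {y : Coord n} (hy : y ∈ (c.symm ≫ₕ c').target) :
    DifferentiableAt ℝ (c.symm ≫ₕ c').symm y :=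
  ((contDiffOn_transition_symm hc hc').contDiffAt
    ((c.symm ≫ₕ c').open_target.mem_nhds hy)).differentiableAt (by simp)

include hc hc' in
-- Near `y` the inverse of `c'` factors through `c.symm` and the transition map; the chain rule does
-- the rest.
theorem chartSymmDeriv_change {y : Coord n} (hy : y ∈ (c.symm ≫ₕ c').target) :
    chartSymmDeriv c' y = (chartSymmDeriv c ((c.symm ≫ₕ c').symm y)).comp
        (fderiv ℝ (c.symm ≫ₕ c').symm y) := by
  have e3 := (mdifferentiable_chart hc).mdifferentiableAt_symm
    (c.map_source (mem_transition_target.mp hy).2)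
  have hd := differentiableAt_transition_symm hc hc' hy
  have e4 : fderiv ℝ (c.symm ≫ₕ c').symm y = mfderiv (𝓡 n) (𝓡 n) (c.symm ≫ₕ c').symm y :=
    mfderiv_eq_fderiv.symm
  rw [e4]
  refine Eq.trans ?_ (mfderiv_comp y (I' := 𝓡 n) e3 hd.mdifferentiableAt)
  refine Filter.EventuallyEq.mfderiv_eq ?_
  filter_upwards [(c.symm ≫ₕ c').open_target.mem_nhds hy] with z hz
  exact (c.left_inv (mem_transition_target.mp hz).2).symm

include hc hc' in
theorem frameVec_change {y : Coord n} (hy : y ∈ (c.symm ≫ₕ c').target) (a : Fin n) :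
    frameVec c' y a = ∑ i, jac (c.symm ≫ₕ c').symm y a i •
      frameVec c ((c.symm ≫ₕ c').symm y) i := by
  have hd := differentiableAt_transition_symm hc hc' hy
  rw [frameVec, chartSymmDeriv_change hc hc' hy, ContinuousLinearMap.comp_apply,
    chartSymmDeriv_eq_sum]
  refine Finset.sum_congr rfl fun i _ => ?_
  congr 1
  have := ((EuclideanSpace.proj i : Coord n →L[ℝ] ℝ).hasFDerivAt.comp y hd.hasFDerivAt).fderiv
  exact (congrArg (fun L => L (EuclideanSpace.single a (1 : ℝ))) this).symm

include hc hc' in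
theorem chartDeriv_change {x : S} (hx : x ∈ c.source) (hx' : x ∈ c'.source)
    (v : Coord n) (j : Fin n) : chartDeriv c x v j =
      ∑ a, chartDeriv c' x v a * jac (c.symm ≫ₕ c').symm (c' x) a j := by
  have hy : c' x ∈ (c.symm ≫ₕ c').target :=
    mem_transition_target.mpr ⟨c'.map_source hx', by rwa [c'.left_inv hx']⟩
  have hy' : (c.symm ≫ₕ c').symm (c' x) = c x := by rw [trans_symm_apply, c'.left_inv hx']
  have h1 (i) : chartDeriv c x (frameVec c (c x) i) j = (1 : Matrix (Fin n) (Fin n) ℝ) i j := by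
    rw [← chartDeriv_frameVec hc (c.map_source hx) i j, c.left_inv hx]
  conv_lhs => rw [eq_sum_frameVec hc' hx' v]
  simp only [frameVec_change hc hc' hy, hy', map_sum, map_smul, smul_eq_mul, h1, WithLp.ofLp_sum, WithLp.ofLp_smul, Finset.sum_apply, Pi.smul_apply,
    Matrix.one_apply]
  simp

/-! ### Metrics in charts -/

variable (g : Metric n S)

/-- The metric at a point, as a bilinear form on the model space. -/
def innerAt (x : S) : Coord n →L[ℝ] Coord n →L[ℝ] ℝ := g.inner x

theorem innerAt_symm (x : S) (v w : Coord n) : innerAt g x v w = innerAt g x w v :=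
  g.symm _ _ _

theorem metricComp_apply (y : Coord n) (i j : Fin n) :
    metricComp g c y i j = innerAt g (c.symm y) (frameVec c y i) (frameVec c y j) := rfl

include hc hc' in
theorem metricComp_change {y : Coord n} (hy : y ∈ (c.symm ≫ₕ c').target) :
    metricComp g c' y = jac (c.symm ≫ₕ c').symm y * metricComp g c ((c.symm ≫ₕ c').symm y) *
      (jac (c.symm ≫ₕ c').symm y).transpose := by
  ext a b
  have hx : c'.symm y = c.symm ((c.symm ≫ₕ c').symm y) :=
    (c.left_inv (mem_transition_target.mp hy).2).symm
  rw [metricComp_apply, frameVec_change hc hc' hy, frameVec_change hc hc' hy, hx]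
  simp only [map_sum, map_smul, sum_apply, smul_apply,
    smul_eq_mul, Matrix.mul_apply, Matrix.transpose_apply, Finset.sum_mul, Finset.mul_sum]
  refine Finset.sum_congr rfl fun i _ => Finset.sum_congr rfl fun j _ => ?_
  rw [metricComp_apply, innerAt_symm]
  ring

theorem metricComp_symm (y : Coord n) (i j : Fin n) :
    metricComp g c y i j = metricComp g c y j i := g.symm _ _ _

include hc in
theorem metricComp_posDef {y : Coord n} (hy : y ∈ c.target) : (metricComp g c y).PosDef := by
  refine Matrix.PosDef.of_dotProduct_mulVec_pos ?_ fun v hv => ?_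
  · ext i j
    simpa using metricComp_symm g y j i
  · set V : Coord n := chartSymmDeriv c y (WithLp.toLp 2 v) with hV
    -- The derivative of the chart recovers the coordinates of `V`, so a nonzero coefficient vector
    -- gives a nonzero tangent vector.
    have hV0 : V ≠ 0 := by
      intro h0
      have h1 := chartDeriv_chartSymmDeriv hc hy (WithLp.toLp 2 v)
      rw [← hV, h0, map_zero] at h1
      exact hv (by simpa using h1.symm)
    have hpos : 0 < innerAt g (c.symm y) V V := g.pos _ V hV0
    have e : innerAt g (c.symm y) V V = star v ⬝ᵥ (metricComp g c y).mulVec v := by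
      rw [hV, chartSymmDeriv_eq_sum]
      simp only [map_sum, map_smul, sum_apply, smul_apply, smul_eq_mul, dotProduct, Matrix.mulVec,
        Finset.mul_sum]
      rw [Finset.sum_comm]
      refine Finset.sum_congr rfl fun i _ => Finset.sum_congr rfl fun j _ => ?_
      rw [metricComp_apply]
      simp
      ring
    rwa [e] at hpos

include hc in
theorem metricComp_det_pos {y : Coord n} (hy : y ∈ c.target) : 0 < (metricComp g c y).det :=
  (metricComp_posDef hc g hy).det_pos

end Charts

/-! ### Curvature as an exterior derivative in a chart -/

section Derivative

variable {E' H' : Type*} [NormedAddCommGroup E'] [NormedSpace ℝ E'] [TopologicalSpace H']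
  {M : Type*} [TopologicalSpace M] [ChartedSpace H' M] (I' : ModelWithCorners ℝ E' H')
  {F' : Type*} [NormedAddCommGroup F'] [NormedSpace ℝ F']
  {F : Type*} [NormedAddCommGroup F] [NormedSpace ℝ F]

/-- The derivative of a map from a normed space to a manifold, with values in the model space. -/
def dmap (f : F → M) (q : F) : F →L[ℝ] E' := mfderiv 𝓘(ℝ, F) I' f q

variable {I'}

theorem dmap_comp {f : F → M} {φ : F' → F} {q : F'} (hf : MDifferentiableAt 𝓘(ℝ, F) I' f (φ q))
    (hφ : DifferentiableAt ℝ φ q) : dmap I' (f ∘ φ) q = (dmap I' f (φ q)).comp (fderiv ℝ φ q) := by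
  have e : fderiv ℝ φ q = mfderiv 𝓘(ℝ, F') 𝓘(ℝ, F) φ q := mfderiv_eq_fderiv.symm
  rw [e]
  exact mfderiv_comp q hf hφ.mdifferentiableAt

theorem dmap_congr {f f' : F → M} {q : F} (h : f =ᶠ[nhds q] f') : dmap I' f q = dmap I' f' q :=
  h.mfderiv_eq

variable {N H'' E'' : Type*} [NormedAddCommGroup E''] [NormedSpace ℝ E''] [TopologicalSpace H'']
  {I'' : ModelWithCorners ℝ E'' H''} [TopologicalSpace N] [ChartedSpace H'' N]

/-- The derivative of a map between manifolds, as a map between model spaces. -/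
def tmap (I' : ModelWithCorners ℝ E' H') (I'' : ModelWithCorners ℝ E'' H'') (f : M → N) (p : M) :
    E' →L[ℝ] E'' := mfderiv I' I'' f p

theorem dmap_comp_left {f : M → N} {φ : F → M} {q : F} (hf : MDifferentiableAt I' I'' f (φ q))
    (hφ : MDifferentiableAt 𝓘(ℝ, F) I' φ q) :
    dmap I'' (f ∘ φ) q = (tmap I' I'' f (φ q)).comp (dmap I' φ q) :=
  mfderiv_comp q hf hφ

theorem dmap_self (f : F → F') (q : F) : dmap 𝓘(ℝ, F') f q = fderiv ℝ f q := mfderiv_eq_fderiv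

end Derivative

/-- The exterior derivative of the pull-back of a one-form. -/
theorem fderiv_pullback {E' F V : Type*} [NormedAddCommGroup E'] [NormedSpace ℝ E']
    [NormedAddCommGroup F] [NormedSpace ℝ F] [NormedAddCommGroup V] [NormedSpace ℝ V]
    {θ : E' → E' →L[ℝ] V} {Γ : F → E'} {q : F} (hθ : DifferentiableAt ℝ θ (Γ q))
    (hΓ : ContDiffAt ℝ ∞ Γ q) (u v : F) :
    fderiv ℝ (fun p => (θ (Γ p)).comp (fderiv ℝ Γ p)) q u v -
      fderiv ℝ (fun p => (θ (Γ p)).comp (fderiv ℝ Γ p)) q v u =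
    fderiv ℝ θ (Γ q) (fderiv ℝ Γ q u) (fderiv ℝ Γ q v) -
      fderiv ℝ θ (Γ q) (fderiv ℝ Γ q v) (fderiv ℝ Γ q u) := by
  have h1 : DifferentiableAt ℝ Γ q := hΓ.differentiableAt (by simp)
  have h2 : DifferentiableAt ℝ (fderiv ℝ Γ) q :=
    (hΓ.fderiv_right (m := ∞) (by simp)).differentiableAt (by simp)
  have h3 : HasFDerivAt (fun p => θ (Γ p)) ((fderiv ℝ θ (Γ q)).comp (fderiv ℝ Γ q)) q :=
    hθ.hasFDerivAt.comp q h1.hasFDerivAt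
  have h4 := (h3.clm_comp h2.hasFDerivAt).fderiv
  -- The second derivative of `Γ` is symmetric and drops out of the antisymmetrisation: exterior
  -- derivative commutes with pull-back.
  have h5 := hΓ.isSymmSndFDerivAt
    (by rw [minSmoothness_of_isRCLikeNormedField]; exact WithTop.coe_le_coe.mpr le_top) u v
  rw [h4]
  simp only [add_apply, ContinuousLinearMap.comp_apply, ContinuousLinearMap.compL_apply,
    ContinuousLinearMap.flip_apply]
  rw [h5]
  abel

/-! ### Connection forms in local sections. -/

section Bundle

variable {n k : ℕ} {S : Type*} [TopologicalSpace S] [ChartedSpace (Coord n) S]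
  {E' H' : Type*} [NormedAddCommGroup E'] [NormedSpace ℝ E'] [TopologicalSpace H']
  {I' : ModelWithCorners ℝ E' H'} {M : Type*} [TopologicalSpace M] [ChartedSpace H' M]
  {P : TorusBundle n k S M I'} {σ : Coord n → M} {V : Set (Coord n)}

/-- A connection form, on the model space. -/
def PrincipalConnection.formAt (μ : PrincipalConnection P) (p : M) : E' →L[ℝ] (Fin k → ℝ) :=
  μ.form p

/-- The connection form of a connection in a local section, as a form on `ℝⁿ`. -/
def PrincipalConnection.gauge (μ : PrincipalConnection P) (σ : Coord n → M) (y : Coord n) :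
    Coord n →L[ℝ] (Fin k → ℝ) := (μ.formAt (σ y)).comp (dmap I' σ y)

/-- The chart of the total space and its inverse cancel in the chain rule, so the pull-back of the
form does not see which chart expresses it. -/
theorem oneFormIn_comp_fderiv [IsManifold I' ∞ M] [I'.Boundaryless] {F : Type*}
    [NormedAddCommGroup F] [NormedSpace ℝ F]
    (μ : PrincipalConnection P) {p : M} {Φ : F → M} {q : F}
    (hq : Φ q ∈ (extChartAt I' p).source) (hΦ : ContMDiffAt 𝓘(ℝ, F) I' ∞ Φ q) :
    (oneFormIn μ.form p (extChartAt I' p (Φ q))).comp (fderiv ℝ (extChartAt I' p ∘ Φ) q) =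
      (μ.formAt (Φ q)).comp (dmap I' Φ q) := by
  have : IsManifold I' 1 M := IsManifold.of_le (n := ∞) (by simp)
  set χ := extChartAt I' p with hχ
  have h1 : χ.symm (χ (Φ q)) = Φ q := χ.left_inv hq
  have h2 : oneFormIn μ.form p (χ (Φ q)) =
      (μ.formAt (χ.symm (χ (Φ q)))).comp (dmap I' χ.symm (χ (Φ q))) := rfl
  have h3 : MDifferentiableAt 𝓘(ℝ, F) I' Φ q := hΦ.mdifferentiableAt (by simp)
  have h4 : MDifferentiableAt I' 𝓘(ℝ, E') χ (Φ q) := by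
    rw [hχ]; exact mdifferentiableAt_extChartAt (by rwa [← extChartAt_source I'])
  have h5 : DifferentiableAt ℝ (χ ∘ Φ) q := (h4.comp q h3).differentiableAt
  have h6 : MDifferentiableAt 𝓘(ℝ, E') I' χ.symm (χ (Φ q)) := by
    have := mdifferentiableWithinAt_extChartAt_symm (I := I') (x := p) (χ.map_source hq)
    rwa [I'.range_eq_univ, mdifferentiableWithinAt_univ] at this
  have h7 : dmap I' (χ.symm ∘ (χ ∘ Φ)) q = dmap I' Φ q := by
    refine dmap_congr ?_
    have hopen : (extChartAt I' p).source ∈ nhds (Φ q) :=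
      (isOpen_extChartAt_source p).mem_nhds hq
    filter_upwards [hΦ.continuousAt hopen] with z hz
    exact χ.left_inv hz
  rw [h2, h1, ← h7, dmap_comp (f := χ.symm) (φ := χ ∘ Φ) h6 h5]
  rfl

variable (P) in
/-- The action of the torus on a local section. -/
def actSection (σ : Coord n → M) (q : (Fin k → ℝ) × Coord n) : M := P.act q.1 (σ q.2)

variable (hV : IsOpen V)
  (hσ : ContMDiffOn 𝓘(ℝ, Coord n) I' ∞ σ V)

include hV hσ in
theorem contMDiffAt_actSection (v : Fin k → ℝ) {y : Coord n} (hy : y ∈ V) :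
    ContMDiffAt 𝓘(ℝ, (Fin k → ℝ) × Coord n) I' ∞ (actSection P σ) (v, y) := by
  have h1 : ContMDiffAt 𝓘(ℝ, (Fin k → ℝ) × Coord n) 𝓘(ℝ, Fin k → ℝ) ∞
    (Prod.fst : (Fin k → ℝ) × Coord n → _) (v, y) := contDiff_fst.contMDiff.contMDiffAt
  have h2 : ContMDiffAt 𝓘(ℝ, (Fin k → ℝ) × Coord n) 𝓘(ℝ, Coord n) ∞
    (Prod.snd : (Fin k → ℝ) × Coord n → _) (v, y) := contDiff_snd.contMDiff.contMDiffAt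
  have h3 : ContMDiffAt 𝓘(ℝ, (Fin k → ℝ) × Coord n) I' ∞
      (fun q : (Fin k → ℝ) × Coord n => σ q.2) (v, y) :=
    ContMDiffAt.comp (v, y) (hσ.contMDiffAt (hV.mem_nhds hy)) h2
  exact ContMDiffAt.comp (v, y) P.contMDiff_act.contMDiffAt (h1.prodMk h3)

include hV hσ in
-- In the parametrisation `(v, y) ↦ v · σ(y)` a connection has the form `dv + A(y) dy`. The first
-- term is the condition on fundamental vector fields, the second is invariance under the torus.
theorem formAt_actSection [IsManifold I' ∞ M] (μ : PrincipalConnection P) (v : Fin k → ℝ)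
    {y : Coord n} (hy : y ∈ V) :
    (μ.formAt (actSection P σ (v, y))).comp (dmap I' (actSection P σ) (v, y)) =
      ContinuousLinearMap.fst ℝ _ _ + (μ.gauge σ y).comp (ContinuousLinearMap.snd ℝ _ _) := by
  have hΦ := (contMDiffAt_actSection (P := P) hV hσ v hy).mdifferentiableAt (by simp)
  have hact (v) : MDifferentiable I' I' (P.act v) := by
    have : ContMDiff I' I' ∞ (P.act v) :=
      P.contMDiff_act.comp ((contMDiff_const (c := v)).prodMk contMDiff_id)
    exact this.mdifferentiable (by simp)
  have hact' (p : M) : MDifferentiable 𝓘(ℝ, Fin k → ℝ) I' (fun v => P.act v p) := by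
    have : ContMDiff 𝓘(ℝ, Fin k → ℝ) I' ∞ (fun v => P.act v p) :=
      P.contMDiff_act.comp (contMDiff_id.prodMk (contMDiff_const (c := p)))
    exact this.mdifferentiable (by simp)
  have hvert (ξ : Fin k → ℝ) : μ.formAt (actSection P σ (v, y))
      (dmap I' (actSection P σ) (v, y) (ξ, 0)) = ξ := by
    have h1 : dmap I' (actSection P σ ∘ fun w => (w, y)) v =
        (dmap I' (actSection P σ) (v, y)).comp (fderiv ℝ (fun w : Fin k → ℝ => (w, y)) v) :=
      dmap_comp (φ := fun w : Fin k → ℝ => (w, y)) hΦ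
        ((hasFDerivAt_prodMk_left v y).differentiableAt)
    rw [(hasFDerivAt_prodMk_left v y).fderiv] at h1
    set p : M := P.act v (σ y) with hp
    -- Shifting the group parameter reduces the vertical derivative at `v` to that of an orbit map
    -- at `0`, where `fundamental` applies.
    have h2 : (actSection P σ ∘ fun w => (w, y)) = (fun w => P.act w p) ∘ fun w => w - v := by
      funext w
      simp only [actSection, Function.comp, hp]
      rw [← P.act_add, sub_add_cancel]
    have h3 : dmap I' ((fun w => P.act w p) ∘ fun w : Fin k → ℝ => w - v) v =
        dmap I' (fun w => P.act w p) 0 := by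
      rw [dmap_comp (hact' p _) (by fun_prop)]
      have e1 : fderiv ℝ (fun w : Fin k → ℝ => w - v) v = ContinuousLinearMap.id ℝ _ := by
        rw [fderiv_sub_const]; exact fderiv_fun_id
      rw [e1, sub_self]
      rfl
    have h4 : dmap I' (actSection P σ) (v, y) (ξ, 0) = dmap I' (fun w => P.act w p) 0 ξ := by
      rw [← h3, ← h2, h1]; rfl
    have h5 : μ.formAt (P.act 0 p) (dmap I' (fun w => P.act w p) 0 ξ) = ξ := μ.fundamental p ξ
    rw [P.act_zero] at h5
    rw [h4]
    exact h5
  have hhor (w : Coord n) : μ.formAt (actSection P σ (v, y))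
      (dmap I' (actSection P σ) (v, y) (0, w)) = μ.gauge σ y w := by
    have h1 : dmap I' (actSection P σ ∘ fun z => (v, z)) y =
        (dmap I' (actSection P σ) (v, y)).comp (fderiv ℝ (fun z : Coord n => (v, z)) y) :=
      dmap_comp (φ := fun z : Coord n => (v, z)) hΦ ((hasFDerivAt_prodMk_right v y).differentiableAt)
    rw [(hasFDerivAt_prodMk_right v y).fderiv] at h1
    have h2 : dmap I' (P.act v ∘ σ) y = (tmap I' I' (P.act v) (σ y)).comp (dmap I' σ y) :=
      dmap_comp_left (hact v _) ((hσ.contMDiffAt (hV.mem_nhds hy)).mdifferentiableAt (by simp))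
    have h3 : dmap I' (actSection P σ) (v, y) (0, w) =
        tmap I' I' (P.act v) (σ y) (dmap I' σ y w) := by
      rw [← ContinuousLinearMap.comp_apply, ← h2]
      exact (congrArg (fun L => L w) h1).symm
    rw [h3]
    exact μ.invariant v (σ y) (dmap I' σ y w)
  refine ContinuousLinearMap.ext fun u => ?_
  have hu : u = (u.1, 0) + (0, u.2) := by simp
  conv_lhs => rw [hu]
  rw [map_add, ContinuousLinearMap.comp_apply, ContinuousLinearMap.comp_apply, hvert, hhor]
  rfl

variable [IsManifold I' ∞ M] [I'.Boundaryless]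

include hV hσ in
-- Smoothness is local, and near a given point the section stays in a single chart of the total
-- space.
theorem contDiffOn_gauge {T : Set ℝ} (μ : ℝ → PrincipalConnection P)
    (hμ : ∀ p : M, ContDiffOn ℝ ∞ (fun q : ℝ × E' => oneFormIn (μ q.1).form p q.2)
      (T ×ˢ (extChartAt I' p).target)) :
    ContDiffOn ℝ ∞ (fun q : ℝ × Coord n => (μ q.1).gauge σ q.2) (T ×ˢ V) := by
  rintro ⟨t, y⟩ ⟨ht, hy⟩
  set p := σ y
  set χ := extChartAt I' p with hχ
  have hσy : ContinuousAt σ y := (hσ.contMDiffAt (hV.mem_nhds hy)).continuousAt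
  have hopen : χ.source ∈ nhds (σ y) := (isOpen_extChartAt_source p).mem_nhds (mem_extChartAt_source p)
  obtain ⟨W, hW, hWo, hyW⟩ := mem_nhds_iff.mp (Filter.inter_mem (hσy hopen) (hV.mem_nhds hy))
  have hΓ : ContDiffOn ℝ ∞ (χ ∘ σ) W := by
    rw [← contMDiffOn_iff_contDiffOn]
    exact (contMDiffOn_extChartAt (n := ∞) (I := I') (x := p)).comp (hσ.mono fun z hz => (hW hz).2)
      fun z hz => by rw [← extChartAt_source I']; exact (hW hz).1
  have h1 : ContDiffOn ℝ ∞ (fun q : ℝ × Coord n =>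
      (oneFormIn (μ q.1).form p (χ (σ q.2))).comp (fderiv ℝ (χ ∘ σ) q.2)) (T ×ˢ W) := by
    refine ContDiffOn.clm_comp ?_ ?_
    · exact (hμ p).comp (g := fun q : ℝ × E' => oneFormIn (μ q.1).form p q.2)
        (f := fun q : ℝ × Coord n => (q.1, χ (σ q.2)))
        (contDiff_fst.contDiffOn.prodMk (hΓ.comp contDiff_snd.contDiffOn fun q hq => hq.2))
        fun q hq => ⟨hq.1, χ.map_source (hW hq.2).1⟩
    · exact (hΓ.fderiv_of_isOpen hWo (m := ∞) (by simp)).comp contDiff_snd.contDiffOn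
        fun q hq => hq.2
  have h2 : ContDiffOn ℝ ∞ (fun q : ℝ × Coord n => (μ q.1).gauge σ q.2) (T ×ˢ W) :=
    h1.congr fun q hq => (oneFormIn_comp_fderiv (μ q.1) (hW hq.2).1
      (hσ.contMDiffAt (hV.mem_nhds (hW hq.2).2))).symm
  refine (h2 (t, y) ⟨ht, hyW⟩).mono_of_mem_nhdsWithin ?_
  exact mem_nhdsWithin.mpr ⟨univ ×ˢ W, isOpen_univ.prod hWo, ⟨mem_univ _, hyW⟩,
    fun q hq => ⟨hq.2.1, hq.1.2⟩⟩

include hV hσ in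
theorem differentiableAt_gauge (μ : PrincipalConnection P) {y : Coord n} (hy : y ∈ V) :
    DifferentiableAt ℝ (μ.gauge σ) y := by
  have h := contDiffOn_gauge (T := univ) hV hσ (fun _ => μ) fun p =>
    (μ.smooth p).comp contDiff_snd.contDiffOn fun q hq => hq.2
  have h2 : ContDiffOn ℝ ∞ (μ.gauge σ) V :=
    h.comp (f := fun z : Coord n => ((0 : ℝ), z)) (contDiff_const.prodMk contDiff_id).contDiffOn
      fun z hz => ⟨mem_univ _, hz⟩
  exact (h2.contDiffAt (hV.mem_nhds hy)).differentiableAt (by simp)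

/-- The exterior derivative of a connection form, on the model space. -/
def PrincipalConnection.extDerivAt (μ : PrincipalConnection P) (p : M) (X Y : E') : Fin k → ℝ :=
  fderiv ℝ (oneFormIn μ.form p) (extChartAt I' p p) (tmap I' 𝓘(ℝ, E') (extChartAt I' p) p X)
      (tmap I' 𝓘(ℝ, E') (extChartAt I' p) p Y) -
    fderiv ℝ (oneFormIn μ.form p) (extChartAt I' p p) (tmap I' 𝓘(ℝ, E') (extChartAt I' p) p Y)
      (tmap I' 𝓘(ℝ, E') (extChartAt I' p) p X)

include hV hσ in
-- Pull-back commutes with the exterior derivative, and the pulled-back form is `dv + A`; only `dA`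
-- remains. In particular vertical components of the two vectors do not matter.
theorem extDerivAt_actSection (μ : PrincipalConnection P) (v : Fin k → ℝ) {y : Coord n}
    (hy : y ∈ V) (u w : (Fin k → ℝ) × Coord n) :
    μ.extDerivAt (actSection P σ (v, y)) (dmap I' (actSection P σ) (v, y) u)
      (dmap I' (actSection P σ) (v, y) w) =
    fderiv ℝ (μ.gauge σ) y u.2 w.2 - fderiv ℝ (μ.gauge σ) y w.2 u.2 := by
  have hM : IsManifold I' 1 M := IsManifold.of_le (n := ∞) (by simp)
  set p := actSection P σ (v, y) with hp
  set χ := extChartAt I' p with hχ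
  have hΦ := contMDiffAt_actSection (P := P) hV hσ v hy
  have hcont : ∀ᶠ q in nhds (v, y), actSection P σ q ∈ χ.source ∧ q.2 ∈ V :=
    Filter.Eventually.and
      (hΦ.continuousAt ((isOpen_extChartAt_source p).mem_nhds (mem_extChartAt_source p)))
      (continuous_snd.continuousAt (hV.mem_nhds hy))
  have hχd : MDifferentiableAt I' 𝓘(ℝ, E') χ p := mdifferentiableAt_extChartAt (mem_chart_source _ _)
  have hΓ : ContDiffAt ℝ ∞ (χ ∘ actSection P σ) (v, y) :=
    (ContMDiffAt.comp (v, y) (contMDiffAt_extChartAt (n := ∞) (I := I') (x := p)) hΦ).contDiffAt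
  have hder : fderiv ℝ (χ ∘ actSection P σ) (v, y) =
      (tmap I' 𝓘(ℝ, E') χ p).comp (dmap I' (actSection P σ) (v, y)) := by
    rw [← dmap_self]
    exact dmap_comp_left hχd (hΦ.mdifferentiableAt (by simp))
  have hθ : DifferentiableAt ℝ (oneFormIn μ.form p) ((χ ∘ actSection P σ) (v, y)) :=
    ((μ.smooth p).contDiffAt ((isOpen_extChartAt_target p).mem_nhds
      (mem_extChartAt_target p))).differentiableAt (by simp)
  have h1 := fderiv_pullback hθ hΓ u w
  have h2 : (fun q => (oneFormIn μ.form p ((χ ∘ actSection P σ) q)).comp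
      (fderiv ℝ (χ ∘ actSection P σ) q)) =ᶠ[nhds (v, y)]
      fun q => ContinuousLinearMap.fst ℝ _ _ +
        (μ.gauge σ q.2).comp (ContinuousLinearMap.snd ℝ _ _) := by
    filter_upwards [hcont] with q hq
    exact (oneFormIn_comp_fderiv μ hq.1 (contMDiffAt_actSection hV hσ q.1 hq.2)).trans
      (formAt_actSection hV hσ μ q.1 hq.2)
  have h3 : HasFDerivAt (fun q : (Fin k → ℝ) × Coord n => μ.gauge σ q.2)
      ((fderiv ℝ (μ.gauge σ) y).comp (ContinuousLinearMap.snd ℝ _ _)) (v, y) :=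
    HasFDerivAt.comp (f := (Prod.snd : (Fin k → ℝ) × Coord n → Coord n)) (v, y)
      (differentiableAt_gauge hV hσ μ hy).hasFDerivAt hasFDerivAt_snd
  have h4 := ((h3.clm_comp (hasFDerivAt_const (ContinuousLinearMap.snd ℝ (Fin k → ℝ) (Coord n))
    (v, y))).const_add (ContinuousLinearMap.fst ℝ (Fin k → ℝ) (Coord n))).fderiv
  rw [h2.fderiv_eq, h4, hder] at h1
  refine Eq.trans ?_ (h1.symm.trans ?_)
  · rfl
  · simp

variable {c : OpenPartialHomeomorph S (Coord n)} (hVc : V ⊆ c.target)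
  (hs : ∀ z ∈ V, P.proj (σ z) = c.symm z)

include hV hσ hs in
omit [IsManifold I' ∞ M] [I'.Boundaryless] in
theorem tmap_proj_section {y : Coord n} (hy : y ∈ V) (w : Coord n) :
    tmap I' (𝓡 n) P.proj (σ y) (dmap I' σ y w) = chartSymmDeriv c y w := by
  have h1 : dmap (𝓡 n) (P.proj ∘ σ) y = (tmap I' (𝓡 n) P.proj (σ y)).comp (dmap I' σ y) :=
    dmap_comp_left (P.contMDiff_proj.mdifferentiable (by simp) _)
      ((hσ.contMDiffAt (hV.mem_nhds hy)).mdifferentiableAt (by simp))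
  have h2 : dmap (𝓡 n) (P.proj ∘ σ) y = dmap (𝓡 n) c.symm y :=
    dmap_congr (Filter.eventually_of_mem (hV.mem_nhds hy) hs)
  rw [← ContinuousLinearMap.comp_apply, ← h1, h2]
  rfl

variable [IsManifold (𝓡 n) ∞ S] (hc : c ∈ atlas (Coord n) S)

include hV hσ hs hVc hc in
omit [IsManifold I' ∞ M] [I'.Boundaryless] in
theorem tmap_proj_actSection (v : Fin k → ℝ) {y : Coord n} (hy : y ∈ V)
    (u : (Fin k → ℝ) × Coord n) :
    tmap I' (𝓡 n) P.proj (actSection P σ (v, y)) (dmap I' (actSection P σ) (v, y) u) =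
      chartSymmDeriv c y u.2 := by
  have hΦ := contMDiffAt_actSection (P := P) hV hσ v hy
  have h1 : dmap (𝓡 n) (P.proj ∘ actSection P σ) (v, y) =
      (tmap I' (𝓡 n) P.proj (actSection P σ (v, y))).comp (dmap I' (actSection P σ) (v, y)) :=
    dmap_comp_left (P.contMDiff_proj.mdifferentiable (by simp) _) (hΦ.mdifferentiableAt (by simp))
  have h2 : dmap (𝓡 n) (P.proj ∘ actSection P σ) (v, y) =
      dmap (𝓡 n) (c.symm ∘ (Prod.snd : (Fin k → ℝ) × Coord n → Coord n)) (v, y) := by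
    refine dmap_congr ?_
    filter_upwards [continuous_snd.continuousAt (hV.mem_nhds hy)] with q hq
    have : P.proj (P.act q.1 (σ q.2)) = P.proj (σ q.2) :=
      ((P.proj_eq_iff _ _).mpr ⟨q.1, rfl⟩).symm
    simp only [Function.comp, actSection]
    rw [this, hs _ hq]
  have h3 : dmap (𝓡 n) (c.symm ∘ (Prod.snd : (Fin k → ℝ) × Coord n → Coord n)) (v, y) =
      (dmap (𝓡 n) c.symm y).comp (fderiv ℝ (Prod.snd : (Fin k → ℝ) × Coord n → Coord n) (v, y)) :=
    dmap_comp (q := (v, y)) ((mdifferentiable_chart hc).mdifferentiableAt_symm (hVc hy))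
      differentiableAt_snd
  rw [← ContinuousLinearMap.comp_apply, ← h1, h2, h3, fderiv_snd]
  rfl

variable [FiniteDimensional ℝ E']

include hV hσ hs hVc hc in
omit [I'.Boundaryless] in
-- A vector in the kernel has zero base component, seen by projecting, and then zero fibre
-- component, seen by the connection form. Equality of dimensions turns injectivity into
-- surjectivity.
theorem surjective_dmap_actSection (μ : PrincipalConnection P) (v : Fin k → ℝ) {y : Coord n}
    (hy : y ∈ V) : Function.Surjective (dmap I' (actSection P σ) (v, y)) := by
  have hinj : Function.Injective (dmap I' (actSection P σ) (v, y)).toLinearMap := by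
    rw [← LinearMap.ker_eq_bot, LinearMap.ker_eq_bot']
    intro u hu
    have hu' : dmap I' (actSection P σ) (v, y) u = 0 := hu
    have h1 := tmap_proj_actSection hV hσ hVc hs hc v hy u
    have h2 := congrArg (fun L => L u) (formAt_actSection hV hσ μ v hy)
    rw [hu', map_zero] at h1
    have h3 := chartDeriv_chartSymmDeriv hc (hVc hy) u.2
    rw [← h1, map_zero] at h3
    have h4 : (0 : Fin k → ℝ) = u.1 + μ.gauge σ y u.2 := by
      refine Eq.trans ?_ h2
      simp only [ContinuousLinearMap.comp_apply, hu', map_zero]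
    rw [← h3, map_zero, add_zero] at h4
    exact Prod.ext h4.symm h3.symm
  have hfr : Module.finrank ℝ ((Fin k → ℝ) × Coord n) = Module.finrank ℝ E' := by
    rw [P.finrank_eq, Module.finrank_prod]
    simp [add_comm]
  exact (LinearMap.injective_iff_surjective_of_finrank_eq_finrank hfr).mp hinj

/-- The curvature, on the model space. -/
def PrincipalConnection.curvAt (μ : PrincipalConnection P) (x : S) (v w : Coord n) : Fin k → ℝ :=
  μ.curv x v w

omit [FiniteDimensional ℝ E'] [IsManifold I' ∞ M] [I'.Boundaryless] [IsManifold (𝓡 n) ∞ S] in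
theorem curvAt_eq (μ : PrincipalConnection P) (x : S) (v w : Coord n) :
    μ.curvAt x v w = μ.extDerivAt (P.localSection x x) (tmap (𝓡 n) I' (P.localSection x) x v)
      (tmap (𝓡 n) I' (P.localSection x) x w) := rfl

include hV hσ hs hVc hc in
/-- In a chart, the curvature is the exterior derivative of the connection form in a section. -/
theorem formComp_curv (μ : PrincipalConnection P) {y : Coord n} (hy : y ∈ V) (a : Fin k)
    (i j : Fin n) : formComp μ.curv c a i j y =
      pd i (fun z => μ.gauge σ z (EuclideanSpace.single j 1) a) y -
        pd j (fun z => μ.gauge σ z (EuclideanSpace.single i 1) a) y := by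
  set x := c.symm y with hx
  obtain ⟨U, hU, hxU, hsm, hsU⟩ := (P.exists_section x).choose_spec
  change ContMDiffOn (𝓡 n) I' ∞ (P.localSection x) U at hsm
  change ∀ z ∈ U, P.proj (P.localSection x z) = z at hsU
  -- The section used to define the curvature meets the fibre at another point, related to `σ y` by
  -- a torus element `v`.
  obtain ⟨v, hv⟩ := (P.proj_eq_iff (σ y) (P.localSection x x)).mp
    ((hs y hy).trans (hsU x hxU).symm)
  have hv' : P.localSection x x = actSection P σ (v, y) := hv.symm
  have hproj (w : Coord n) : tmap I' (𝓡 n) P.proj (P.localSection x x)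
      (tmap (𝓡 n) I' (P.localSection x) x w) = w := by
    have h1 : mfderiv (𝓡 n) (𝓡 n) (P.proj ∘ P.localSection x) x =
        (mfderiv I' (𝓡 n) P.proj (P.localSection x x)).comp
          (mfderiv (𝓡 n) I' (P.localSection x) x) :=
      mfderiv_comp x (P.contMDiff_proj.mdifferentiable (by simp) _)
        ((hsm.contMDiffAt (hU.mem_nhds hxU)).mdifferentiableAt (by simp))
    have h2 : mfderiv (𝓡 n) (𝓡 n) (P.proj ∘ P.localSection x) x =
        mfderiv (𝓡 n) (𝓡 n) (id : S → S) x :=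
      Filter.EventuallyEq.mfderiv_eq (Filter.eventually_of_mem (hU.mem_nhds hxU) hsU)
    rw [mfderiv_id] at h2
    exact congrArg (fun L : Coord n →L[ℝ] Coord n => L w) (h1.symm.trans h2)
  -- Lifts of a coordinate vector through the two sections differ by the torus action and a vertical
  -- vector; neither affects `extDerivAt_actSection`.
  have key (i : Fin n) : ∃ u : (Fin k → ℝ) × Coord n, u.2 = EuclideanSpace.single i 1 ∧
      dmap I' (actSection P σ) (v, y) u = tmap (𝓡 n) I' (P.localSection x) x (frameVec c y i) := by
    obtain ⟨u, hu⟩ := surjective_dmap_actSection hV hσ hVc hs hc μ v hy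
      (tmap (𝓡 n) I' (P.localSection x) x (frameVec c y i))
    refine ⟨u, ?_, hu⟩
    have h1 := tmap_proj_actSection hV hσ hVc hs hc v hy u
    rw [hu, ← hv', hproj] at h1
    rw [← chartDeriv_chartSymmDeriv hc (hVc hy) u.2, ← h1]
    exact (chartDeriv_chartSymmDeriv hc (hVc hy) _)
  obtain ⟨u, hu, hu'⟩ := key i
  obtain ⟨w, hw, hw'⟩ := key j
  have h1 : formComp μ.curv c a i j y = μ.curvAt x (frameVec c y i) (frameVec c y j) a := rfl
  rw [h1, curvAt_eq, ← hu', ← hw', hv', extDerivAt_actSection hV hσ μ v hy, hu, hw]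
  have h2 (i j : Fin n) : pd i (fun z => μ.gauge σ z (EuclideanSpace.single j 1) a) y =
      fderiv ℝ (μ.gauge σ) y (EuclideanSpace.single i 1) (EuclideanSpace.single j 1) a := by
    have h3 := (differentiableAt_gauge hV hσ μ hy).hasFDerivAt.clm_apply
      (hasFDerivAt_const (EuclideanSpace.single j (1 : ℝ) : Coord n) y)
    have h4 := ((ContinuousLinearMap.proj (R := ℝ) (φ := fun _ : Fin k => ℝ) a).hasFDerivAt.comp y
      h3).fderiv
    have h5 := congrArg (fun L => L (EuclideanSpace.single i (1 : ℝ) : Coord n)) h4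
    exact h5.trans (by simp)
  rw [h2, h2]
  rfl

omit [FiniteDimensional ℝ E'] [IsManifold I' ∞ M] [I'.Boundaryless] [IsManifold (𝓡 n) ∞ S] in
/-- Smooth sections of the bundle over small open sets of a chart. -/
theorem exists_chart_section (hc : c ∈ atlas (Coord n) S) [IsManifold (𝓡 n) ∞ S] {y : Coord n}
    (hy : y ∈ c.target) : ∃ (V : Set (Coord n)) (σ : Coord n → M), IsOpen V ∧ y ∈ V ∧
      V ⊆ c.target ∧ ContMDiffOn 𝓘(ℝ, Coord n) I' ∞ σ V ∧ ∀ z ∈ V, P.proj (σ z) = c.symm z := by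
  obtain ⟨s, U, hU, hxU, hsm, hsU⟩ := P.exists_section (c.symm y)
  refine ⟨c.target ∩ c.symm ⁻¹' U, s ∘ c.symm, c.isOpen_inter_preimage_symm hU, ⟨hy, hxU⟩,
    inter_subset_left, ?_, fun z hz => hsU _ hz.2⟩
  exact hsm.comp ((contMDiffOn_symm_of_mem_maximalAtlas
    (IsManifold.subset_maximalAtlas (I := 𝓡 n) (n := ∞) hc)).mono inter_subset_left) fun z hz => hz.2

end Bundle

/-! ### Independence of the chart -/

theorem Loc.hess_congr {n : ℕ} {G : Coord n → Matrix (Fin n) (Fin n) ℝ} {φ χ : Coord n → ℝ}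
    {U : Set (Coord n)} (hU : IsOpen U) (h : ∀ y ∈ U, φ y = χ y) (i j : Fin n) {y : Coord n}
    (hy : y ∈ U) : Loc.hess G φ i j y = Loc.hess G χ i j y := by
  simp only [Loc.hess, pd_congr hU h _ hy]
  rw [pd_congr hU (fun z hz => pd_congr hU h j hz) i hy]

section Transition

variable {n : ℕ} {S : Type*} [TopologicalSpace S] {c c' : OpenPartialHomeomorph S (Coord n)}

theorem transition_source_subset : (c.symm ≫ₕ c').source ⊆ c.target :=
  fun _ hy => (mem_transition_source.mp hy).1

theorem mem_transition_target_of_mem {x : S} (hx : x ∈ c.source) (hx' : x ∈ c'.source) :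
    c' x ∈ (c.symm ≫ₕ c').target :=
  mem_transition_target.mpr ⟨c'.map_source hx', by rwa [c'.left_inv hx']⟩

theorem transition_symm_apply {x : S} (hx' : x ∈ c'.source) :
    (c.symm ≫ₕ c').symm (c' x) = c x := by rw [trans_symm_apply, c'.left_inv hx']

theorem comp_transition_symm (φ : S → ℝ) {y : Coord n} (hy : y ∈ (c.symm ≫ₕ c').target) :
    (φ ∘ c'.symm) y = ((φ ∘ c.symm) ∘ (c.symm ≫ₕ c').symm) y := by
  simp only [Function.comp, trans_symm_apply, c.left_inv (mem_transition_target.mp hy).2]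

end Transition

section Invariance

variable {n k : ℕ} {S : Type*} [TopologicalSpace S] [ChartedSpace (Coord n) S]

/-- Smoothness of a function in all charts. -/
def SmoothFun (n : ℕ) {S : Type*} [TopologicalSpace S] [ChartedSpace (Coord n) S]
    (φ : S → ℝ) : Prop :=
  ∀ c ∈ atlas (Coord n) S, ContDiffOn ℝ ∞ (φ ∘ c.symm) c.target

/-- Smoothness of a `𝔱ᵏ`-valued form in all charts. -/
def SmoothForm (F : (x : S) → TangentSpace (𝓡 n) x → TangentSpace (𝓡 n) x → (Fin k → ℝ)) : Prop :=
  ∀ c ∈ atlas (Coord n) S, ∀ a i j, ContDiffOn ℝ ∞ (formComp F c a i j) c.target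

variable [IsManifold (𝓡 n) ∞ S]

/-- Smoothness of a metric in all charts. -/
def SmoothMetric (g : Metric n S) : Prop :=
  ∀ c ∈ atlas (Coord n) S, ∀ i j : Fin n, ContDiffOn ℝ ∞ (fun y => metricComp g c y i j) c.target

/-- The transformation law of the components of a two-form. -/
def Tensorial (F : (x : S) → TangentSpace (𝓡 n) x → TangentSpace (𝓡 n) x → (Fin k → ℝ)) : Prop :=
  ∀ c ∈ atlas (Coord n) S, ∀ c' ∈ atlas (Coord n) S, ∀ y ∈ (c.symm ≫ₕ c').target, ∀ a i j,
    formComp F c' a i j y = ∑ p, ∑ q, jac (c.symm ≫ₕ c').symm y i p *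
      jac (c.symm ≫ₕ c').symm y j q * formComp F c a p q ((c.symm ≫ₕ c').symm y)

variable {c c' : OpenPartialHomeomorph S (Coord n)}
  (hc : c ∈ atlas (Coord n) S) (hc' : c' ∈ atlas (Coord n) S)

include hc hc' in
theorem pd_change {φ : S → ℝ} (hφ : SmoothFun n φ) {x : S} (hx : x ∈ c.source)
    (hx' : x ∈ c'.source) (a : Fin n) : pd a (φ ∘ c'.symm) (c' x) =
      ∑ i, jac (c.symm ≫ₕ c').symm (c' x) a i * pd i (φ ∘ c.symm) (c x) := by
  have hy := mem_transition_target_of_mem hx hx'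
  rw [pd_congr (c.symm ≫ₕ c').open_target (fun y hy => comp_transition_symm φ hy) a hy]
  have h := pd_comp (φ := φ ∘ c.symm) (ψ := (c.symm ≫ₕ c').symm) (y := c' x)
    (by
      rw [transition_symm_apply hx']
      exact ((hφ c hc).contDiffAt (c.open_target.mem_nhds (c.map_source hx))).differentiableAt
        (by simp))
    (differentiableAt_transition_symm hc hc' hy) a
  rw [transition_symm_apply hx'] at h
  exact h

variable {g : Metric n S} (hg : SmoothMetric g)

section

variable {x : S} (hx : x ∈ c.source) (hx' : x ∈ c'.source)
include hc hc' hg hx hx'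

theorem metricComp_inv_change : (metricComp g c (c x))⁻¹ =
    (jac (c.symm ≫ₕ c').symm (c' x)).transpose * (metricComp g c' (c' x))⁻¹ *
      jac (c.symm ≫ₕ c').symm (c' x) := by
  have h := inv_change (contDiffOn_transition hc hc') (contDiffOn_transition_symm hc hc')
    (fun i j => (hg c hc i j).mono transition_source_subset)
    (fun y _ i j => metricComp_symm g y i j)
    (fun y hy => metricComp_det_pos hc g (transition_source_subset hy))
    (fun y hy => metricComp_change hc hc' g hy) (mem_transition_target_of_mem hx hx')
  rwa [transition_symm_apply hx'] at h

theorem hess_metricComp_change {φ : S → ℝ} (hφ : SmoothFun n φ) (a b : Fin n) :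
    Loc.hess (metricComp g c') (φ ∘ c'.symm) a b (c' x) =
      ∑ i, ∑ j, jac (c.symm ≫ₕ c').symm (c' x) a i * jac (c.symm ≫ₕ c').symm (c' x) b j *
        Loc.hess (metricComp g c) (φ ∘ c.symm) i j (c x) := by
  have hy := mem_transition_target_of_mem hx hx'
  have h := hess_change (contDiffOn_transition hc hc') (contDiffOn_transition_symm hc hc')
    (fun i j => (hg c hc i j).mono transition_source_subset)
    (fun y _ i j => metricComp_symm g y i j)
    (fun y hy => metricComp_det_pos hc g (transition_source_subset hy))
    (fun y hy => metricComp_change hc hc' g hy) ((hφ c hc).mono transition_source_subset) hy a b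
  rw [transition_symm_apply hx'] at h
  rw [Loc.hess_congr (c.symm ≫ₕ c').open_target (fun y hy => comp_transition_symm φ hy) a b hy]
  exact h

theorem codiff_metricComp_change
    {F : (x : S) → TangentSpace (𝓡 n) x → TangentSpace (𝓡 n) x → (Fin k → ℝ)}
    (hF : SmoothForm F) (hF' : Tensorial F) (a : Fin k) (b : Fin n) :
    Loc.codiff (metricComp g c') (formComp F c') a b (c' x) =
      ∑ j, jac (c.symm ≫ₕ c').symm (c' x) b j *
        Loc.codiff (metricComp g c) (formComp F c) a j (c x) := by
  have hy := mem_transition_target_of_mem hx hx'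
  have h := codiff_change (contDiffOn_transition hc hc') (contDiffOn_transition_symm hc hc')
    (fun i j => (hg c hc i j).mono transition_source_subset)
    (fun y _ i j => metricComp_symm g y i j)
    (fun y hy => metricComp_det_pos hc g (transition_source_subset hy))
    (fun y hy => metricComp_change hc hc' g hy)
    (fun a i j => (hF c hc a i j).mono transition_source_subset)
    (fun y hy => hF' c hc c' hc' y hy) hy a b
  rwa [transition_symm_apply hx'] at h

end

section

variable {x : S} (hx : x ∈ c.source)
include hc hg hx

/-- Invariant scalars are defined in the preferred chart of each point, whereas derivatives and
integrals need them in one fixed chart. -/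
theorem gradSqAt_eq {φ : S → ℝ} (hφ : SmoothFun n φ) :
    gradSqAt g φ x = Loc.gradSq (metricComp g c) (φ ∘ c.symm) (c x) := by
  have hc' := chart_mem_atlas (Coord n) x
  have hx' := mem_chart_source (Coord n) x
  rw [gradSqAt, Loc.gradSq]
  simp only [pd_change hc hc' hφ hx hx']
  exact bilin_change (metricComp_inv_change hc hc' hg hx hx') _ _

theorem lapAt_eq {φ : S → ℝ} (hφ : SmoothFun n φ) :
    lapAt g φ x = Loc.lap (metricComp g c) (φ ∘ c.symm) (c x) := by
  have hc' := chart_mem_atlas (Coord n) x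
  have hx' := mem_chart_source (Coord n) x
  rw [lapAt, Loc.lap]
  simp only [hess_metricComp_change hc hc' hg hx hx' hφ]
  exact contract_change (metricComp_inv_change hc hc' hg hx hx') _

variable {F : (x : S) → TangentSpace (𝓡 n) x → TangentSpace (𝓡 n) x → (Fin k → ℝ)}
  (hF' : Tensorial F)
include hF'

omit hg [IsManifold (𝓡 n) ∞ S] in
theorem formComp_change (hx' : x ∈ c'.source) (hc' : c' ∈ atlas (Coord n) S) (a i j) :
    formComp F c' a i j (c' x) = ∑ p, ∑ q, jac (c.symm ≫ₕ c').symm (c' x) i p *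
      jac (c.symm ≫ₕ c').symm (c' x) j q * formComp F c a p q (c x) := by
  have h := hF' c hc c' hc' _ (mem_transition_target_of_mem hx hx') a i j
  rwa [transition_symm_apply hx'] at h

theorem curvNormSqAt_eq (h : Matrix (Fin k) (Fin k) ℝ) :
    curvNormSqAt h g F x = Loc.curvNormSq h (metricComp g c) (formComp F c) (c x) :=
  curvNormSq_change (metricComp_inv_change hc (chart_mem_atlas (Coord n) x) hg hx
    (mem_chart_source (Coord n) x)) (formComp_change hc hx hF'
      (mem_chart_source (Coord n) x) (chart_mem_atlas (Coord n) x)) h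

theorem yangMillsSqAt_eq (h : Matrix (Fin k) (Fin k) ℝ) (hF : SmoothForm F) {φ : S → ℝ}
    (hφ : SmoothFun n φ) :
    yangMillsSqAt h g F φ x = Loc.covecNormSq h (metricComp g c) (c x) fun a j =>
      Loc.codiff (metricComp g c) (formComp F c) a j (c x)
        + Loc.gradContract (metricComp g c) (φ ∘ c.symm) (formComp F c) a j (c x) := by
  have hc' := chart_mem_atlas (Coord n) x
  have hx' := mem_chart_source (Coord n) x
  have hX := metricComp_inv_change hc hc' hg hx hx'
  refine covecNormSq_change hX h fun a b => ?_
  rw [codiff_metricComp_change hc hc' hg hx hx' hF hF', gradContract_change hX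
    (formComp_change hc hx hF' hx' hc') (pd_change hc hc' hφ hx hx')]
  simp only [mul_add, Finset.sum_add_distrib]

/-- The Jacobi matrix transforming the codifferential and the coordinates of the vector in the
preferred chart combine, by `chartDeriv_change`, into coordinates in `c`. -/
theorem codiffAt_frameVec (hF : SmoothForm F) (a : Fin k) (j : Fin n) :
    codiffAt g F x (frameVec c (c x) j) a =
      Loc.codiff (metricComp g c) (formComp F c) a j (c x) := by
  have hc' := chart_mem_atlas (Coord n) x
  have hx' := mem_chart_source (Coord n) x
  have h1 : codiffAt g F x (frameVec c (c x) j) a = ∑ b, Loc.codiff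
      (metricComp g (chartAt (Coord n) x)) (formComp F (chartAt (Coord n) x)) a b
        (chartAt (Coord n) x x) * chartDeriv (chartAt (Coord n) x) x (frameVec c (c x) j) b := rfl
  have h2 (i) : chartDeriv c x (frameVec c (c x) j) i = (1 : Matrix (Fin n) (Fin n) ℝ) j i := by
    rw [← chartDeriv_frameVec hc (c.map_source hx) j i, c.left_inv hx]
  rw [h1]
  simp only [codiff_metricComp_change hc hc' hg hx hx' hF hF', Finset.sum_mul]
  rw [Finset.sum_comm]
  have h3 (i) : ∑ b, jac (c.symm ≫ₕ chartAt (Coord n) x).symm (chartAt (Coord n) x x) b i *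
      Loc.codiff (metricComp g c) (formComp F c) a i (c x) *
      chartDeriv (chartAt (Coord n) x) x (frameVec c (c x) j) b =
      Loc.codiff (metricComp g c) (formComp F c) a i (c x) *
        chartDeriv c x (frameVec c (c x) j) i := by
    rw [chartDeriv_change hc hc' hx hx', Finset.mul_sum]
    exact Finset.sum_congr rfl fun _ _ => by ring
  simp only [h3, h2, Matrix.one_apply]
  simp

end
end Invariance

section Flow

variable {n k : ℕ} {S : Type*} [TopologicalSpace S] [ChartedSpace (Coord n) S]
  {E' H' : Type*} [NormedAddCommGroup E'] [NormedSpace ℝ E']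
  [TopologicalSpace H'] {I' : ModelWithCorners ℝ E' H'}
  {M : Type*} [TopologicalSpace M] [ChartedSpace H' M]
  {P : TorusBundle n k S M I'}

/-- Bilinearity is not built into the type of the curvature; it comes from the formula for the
exterior derivative. -/
theorem curvAt_sum (μ : PrincipalConnection P) (x : S) (α β : Fin n → ℝ) (v w : Fin n → Coord n)
    (a : Fin k) : μ.curvAt x (∑ i, α i • v i) (∑ j, β j • w j) a =
      ∑ i, ∑ j, α i * β j * μ.curvAt x (v i) (w j) a := by
  simp only [curvAt_eq, PrincipalConnection.extDerivAt, map_sum, map_smul, sum_apply, smul_apply,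
    Pi.sub_apply, Finset.sum_apply, Pi.smul_apply, smul_eq_mul, mul_sub, Finset.sum_sub_distrib,
    Finset.mul_sum]
  congr 1
  · rw [Finset.sum_comm]
    exact Finset.sum_congr rfl fun _ _ => Finset.sum_congr rfl fun _ _ => by ring
  · exact Finset.sum_congr rfl fun _ _ => Finset.sum_congr rfl fun _ _ => by ring

variable [IsManifold (𝓡 n) ∞ S]

theorem tensorial_curv (μ : PrincipalConnection P) : Tensorial μ.curv := by
  intro c hc c' hc' y hy a i j
  have h1 (c : OpenPartialHomeomorph S (Coord n)) (y i j) : formComp μ.curv c a i j y =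
    μ.curvAt (c.symm y) (frameVec c y i) (frameVec c y j) a := rfl
  have hx : c'.symm y = c.symm ((c.symm ≫ₕ c').symm y) :=
    (c.left_inv (mem_transition_target.mp hy).2).symm
  simp only [h1]
  rw [frameVec_change hc hc' hy, frameVec_change hc hc' hy, hx, curvAt_sum]

end Flow

/-! ### The flow in charts -/

section Flow

variable {n k : ℕ} {S : Type*} [TopologicalSpace S] [ChartedSpace (Coord n) S]
  [IsManifold (𝓡 n) ∞ S]
  {E' H' : Type*} [NormedAddCommGroup E'] [NormedSpace ℝ E'] [FiniteDimensional ℝ E']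
  [TopologicalSpace H'] {I' : ModelWithCorners ℝ E' H'} [I'.Boundaryless]
  {M : Type*} [TopologicalSpace M] [ChartedSpace H' M] [IsManifold I' ∞ M]
  {P : TorusBundle n k S M I'} {h : Matrix (Fin k) (Fin k) ℝ}
  {T : Set ℝ} (hT : T.OrdConnected) (hT' : T.Nontrivial)
  {g : ℝ → Metric n S} {μ : ℝ → PrincipalConnection P} (hflow : IsRYMFlow P h T g μ)
  {c : OpenPartialHomeomorph S (Coord n)} (hc : c ∈ atlas (Coord n) S)

section Gauge

variable {V : Set (Coord n)} (hV : IsOpen V) (hVc : V ⊆ c.target) {σ : Coord n → M}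
  (hσ : ContMDiffOn 𝓘(ℝ, Coord n) I' ∞ σ V) (hs : ∀ z ∈ V, P.proj (σ z) = c.symm z)

include hflow hV hσ in
omit [FiniteDimensional ℝ E'] in
theorem contDiffOn_gaugeComp (j : Fin n) (a : Fin k) :
    ContDiffOn ℝ ∞ (fun q : ℝ × Coord n => (μ q.1).gauge σ q.2 (EuclideanSpace.single j 1) a)
      (T ×ˢ V) := by
  have h1 := contDiffOn_gauge hV hσ μ hflow.smooth_connection
  have h2 : ContDiffOn ℝ ∞ (fun q : ℝ × Coord n =>
      (μ q.1).gauge σ q.2 (EuclideanSpace.single j 1)) (T ×ˢ V) := h1.clm_apply contDiffOn_const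
  exact (contDiffOn_pi.mp h2) a

/-- The components of the connection form in a local section, as smooth functions. -/
def gaugeElem (j : Fin n) (a : Fin k) : SmoothRing (T ×ˢ V) :=
  SmoothRing.mk _ (contDiffOn_gaugeComp hflow hV hσ j a)

/-- The components of the curvature, as smooth functions. -/
def curvElem (a : Fin k) (i j : Fin n) : SmoothRing (T ×ˢ V) :=
  spaceDeriv hT hT' hV i (gaugeElem hflow hV hσ j a) -
    spaceDeriv hT hT' hV j (gaugeElem hflow hV hσ i a)

include hc hVc hs in
theorem formComp_eq_curvElem {t : ℝ} (ht : t ∈ T) (a : Fin k) (i j : Fin n) (y : V) :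
    formComp (μ t).curv c a i j y =
      slice ht y (curvElem hT hT' hflow hV hσ a i j) := by
  have h1 (i j : Fin n) : pd i (fun z => (μ t).gauge σ z (EuclideanSpace.single j 1) a) y =
      slice ht y (spaceDeriv hT hT' hV i (gaugeElem hflow hV hσ j a)) := by
    rw [slice_apply]
    exact pd_eq_spaceDeriv hT hT' hV ht (fun z hz =>
      (SmoothRing.toFun_mk (contDiffOn_gaugeComp hflow hV hσ j a) (p := (t, z)) ⟨ht, hz⟩).symm) i y.2
  rw [formComp_curv hV hσ hVc hs hc (μ t) y.2, h1, h1, curvElem, map_sub]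

end Gauge

include hT hT' hflow hc in
-- Locally the curvature is `dA`, and `A` is smooth jointly in time and space.
theorem contDiffOn_formComp (a : Fin k) (i j : Fin n) :
    ContDiffOn ℝ ∞ (fun q : ℝ × Coord n => formComp (μ q.1).curv c a i j q.2) (T ×ˢ c.target) := by
  rintro ⟨t, y⟩ ⟨ht, hy⟩
  obtain ⟨V, σ, hV, hyV, hVc, hσ, hs⟩ := exists_chart_section (P := P) hc hy
  have h1 : ContDiffOn ℝ ∞ (fun q : ℝ × Coord n => formComp (μ q.1).curv c a i j q.2) (T ×ˢ V) :=
    (SmoothRing.contDiffOn_toFun (curvElem hT hT' hflow hV hσ a i j)).congr fun q hq => by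
      rw [formComp_eq_curvElem hT hT' hflow hc hV hVc hσ hs hq.1 a i j ⟨q.2, hq.2⟩, slice_apply]
  refine (h1 (t, y) ⟨ht, hyV⟩).mono_of_mem_nhdsWithin ?_
  exact mem_nhdsWithin.mpr ⟨univ ×ˢ V, isOpen_univ.prod hV, ⟨mem_univ _, hyV⟩,
    fun q hq => ⟨hq.2.1, hq.1.2⟩⟩

theorem ContDiffOn.slice {U : Set (Coord n)} {Φ : ℝ × Coord n → ℝ}
    (hΦ : ContDiffOn ℝ ∞ Φ (T ×ˢ U)) {t : ℝ} (ht : t ∈ T) :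
    ContDiffOn ℝ ∞ (fun y => Φ (t, y)) U :=
  hΦ.comp (contDiffOn_const.prodMk contDiffOn_id) fun _ hy => ⟨ht, hy⟩

include hflow in
omit [FiniteDimensional ℝ E'] [I'.Boundaryless] [IsManifold I' ∞ M] in
theorem IsRYMFlow.smoothMetric {t : ℝ} (ht : t ∈ T) : SmoothMetric (g t) := fun _ hc i j =>
  ContDiffOn.slice (hflow.smooth_metric _ hc i j) ht

include hT hT' hflow in
theorem IsRYMFlow.smoothForm {t : ℝ} (ht : t ∈ T) : SmoothForm (μ t).curv := fun _ hc a i j =>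
  ContDiffOn.slice (contDiffOn_formComp hT hT' hflow hc a i j) ht

include hT hT' hflow hc in
-- The connection equation is evaluated on tangent vectors of the section, which project to
-- coordinate vectors; it becomes `∂_t A = -d*F` in components.
theorem hasDerivWithinAt_gauge {V : Set (Coord n)} (hV : IsOpen V) (hVc : V ⊆ c.target)
    {σ : Coord n → M} (hσ : ContMDiffOn 𝓘(ℝ, Coord n) I' ∞ σ V)
    (hs : ∀ z ∈ V, P.proj (σ z) = c.symm z) {t : ℝ} (ht : t ∈ T) {y : Coord n} (hy : y ∈ V)
    (a : Fin k) (j : Fin n) :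
    HasDerivWithinAt (fun s => (μ s).gauge σ y (EuclideanSpace.single j 1) a)
      (-Loc.codiff (metricComp (g t) c) (formComp (μ t).curv c) a j y) T t := by
  have h1 := (hasDerivWithinAt_pi.mp
    (hflow.connection_eq t ht (σ y) (dmap I' σ y (EuclideanSpace.single j 1)))) a
  have hyc := hVc hy
  have h2 : codiffAt (g t) (μ t).curv (P.proj (σ y))
      (tmap I' (𝓡 n) P.proj (σ y) (dmap I' σ y (EuclideanSpace.single j 1))) a =
      Loc.codiff (metricComp (g t) c) (formComp (μ t).curv c) a j y := by
    rw [tmap_proj_section hV hσ hs hy, hs y hy]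
    have h3 := codiffAt_frameVec hc (hflow.smoothMetric ht) (c.map_target hyc)
      (tensorial_curv (μ t)) (hflow.smoothForm hT hT' ht) a j
    rw [c.right_inv hyc] at h3
    exact h3
  have h4 : HasDerivWithinAt (fun s => (μ s).gauge σ y (EuclideanSpace.single j 1) a)
      (-codiffAt (g t) (μ t).curv (P.proj (σ y))
        (tmap I' (𝓡 n) P.proj (σ y) (dmap I' σ y (EuclideanSpace.single j 1))) a) T t := h1
  rwa [h2] at h4

section Ricci

variable {c' : OpenPartialHomeomorph S (Coord n)} (hc' : c' ∈ atlas (Coord n) S)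
  {t : ℝ} (ht : t ∈ T) {x : S} (hx : x ∈ c.source)

omit [FiniteDimensional ℝ E'] [I'.Boundaryless] [IsManifold I' ∞ M] in
include hT hT' hflow hc hc' ht hx in
/-- The Ricci tensor transforms as a tensor, because it is determined by the flow. -/
theorem ric_change (hx' : x ∈ c'.source) (a b : Fin n) :
    Loc.ric (metricComp (g t) c') a b (c' x) =
      ∑ i, ∑ j, jac (c.symm ≫ₕ c').symm (c' x) a i * jac (c.symm ≫ₕ c').symm (c' x) b j *
        Loc.ric (metricComp (g t) c) i j (c x) := by
  have hy := mem_transition_target_of_mem hx hx'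
  set J := jac (c.symm ≫ₕ c').symm (c' x) with hJ
  have h1 := hflow.metric_eq t ht c' hc' (c' x) (c'.map_source hx') a b
  have h2 : HasDerivWithinAt (fun s => metricComp (g s) c' (c' x) a b)
      (∑ i, ∑ j, J a i * J b j * (-2 * Loc.ric (metricComp (g t) c) i j (c x)
        + Loc.curvSq h (metricComp (g t) c) (formComp (μ t).curv c) i j (c x))) T t := by
    have h3 (s : ℝ) : metricComp (g s) c' (c' x) a b =
        ∑ i, ∑ j, J a i * J b j * metricComp (g s) c (c x) i j := by
      rw [metricComp_change hc hc' (g s) hy, transition_symm_apply hx']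
      simp only [Matrix.mul_apply, Matrix.transpose_apply, Finset.sum_mul]
      rw [Finset.sum_comm]
      exact Finset.sum_congr rfl fun _ _ => Finset.sum_congr rfl fun _ _ => by ring
    simp only [h3]
    refine HasDerivWithinAt.fun_sum fun i _ => HasDerivWithinAt.fun_sum fun j _ => ?_
    exact (hflow.metric_eq t ht c hc (c x) (c.map_source hx) i j).const_mul _
  have h4 := ((uniqueDiffOn_of_ordConnected hT hT').1 t ht).eq_deriv _ h1 h2
  rw [curvSq_change (metricComp_inv_change hc hc' (hflow.smoothMetric ht) hx hx')
    (formComp_change hc hx (tensorial_curv (μ t)) hx' hc')] at h4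
  simp only [mul_add, Finset.sum_add_distrib] at h4
  have h5 := add_right_cancel h4
  have h6 : ∑ i, ∑ j, J a i * J b j * (-2 * Loc.ric (metricComp (g t) c) i j (c x)) =
      -2 * ∑ i, ∑ j, J a i * J b j * Loc.ric (metricComp (g t) c) i j (c x) := by
    simp only [Finset.mul_sum]
    exact Finset.sum_congr rfl fun _ _ => Finset.sum_congr rfl fun _ _ => by ring
  rw [h6] at h5
  linarith

include hT hT' hflow hc ht hx

omit [FiniteDimensional ℝ E'] [I'.Boundaryless] [IsManifold I' ∞ M] in
theorem scalAt_eq : scalAt (g t) x = Loc.scal (metricComp (g t) c) (c x) := by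
  have hc' := chart_mem_atlas (Coord n) x
  have hx' := mem_chart_source (Coord n) x
  rw [scalAt, Loc.scal]
  simp only [ric_change hT hT' hflow hc hc' ht hx hx']
  exact contract_change (metricComp_inv_change hc hc' (hflow.smoothMetric ht) hx hx') _

omit [FiniteDimensional ℝ E'] [I'.Boundaryless] [IsManifold I' ∞ M] in
theorem solitonSqAt_eq {φ : S → ℝ} (hφ : SmoothFun n φ) (τ : ℝ) :
    solitonSqAt h (g t) (μ t).curv φ τ x = Loc.tensorNormSq (metricComp (g t) c) (c x) fun i j =>
      Loc.ric (metricComp (g t) c) i j (c x)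
        - (1 / 2) * Loc.curvSq h (metricComp (g t) c) (formComp (μ t).curv c) i j (c x)
        + Loc.hess (metricComp (g t) c) (φ ∘ c.symm) i j (c x)
        - metricComp (g t) c (c x) i j / (2 * τ) := by
  have hc' := chart_mem_atlas (Coord n) x
  have hx' := mem_chart_source (Coord n) x
  have hX := metricComp_inv_change hc hc' (hflow.smoothMetric ht) hx hx'
  refine tensorNormSq_change hX fun a b => ?_
  rw [ric_change hT hT' hflow hc hc' ht hx hx', curvSq_change hX
    (formComp_change hc hx (tensorial_curv (μ t)) hx' hc'),
    hess_metricComp_change hc hc' (hflow.smoothMetric ht) hx hx' hφ,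
    metricComp_change hc hc' (g t) (mem_transition_target_of_mem hx hx'),
    transition_symm_apply hx']
  simp only [Matrix.mul_apply, Matrix.transpose_apply, Finset.sum_mul, Finset.mul_sum,
    Finset.sum_div]
  rw [Finset.sum_comm (f := fun i j => jac (c.symm ≫ₕ chartAt (Coord n) x).symm
    (chartAt (Coord n) x x) a j * metricComp (g t) c (c x) j i *
    jac (c.symm ≫ₕ chartAt (Coord n) x).symm (chartAt (Coord n) x x) b i / (2 * τ))]
  simp only [← Finset.sum_add_distrib, ← Finset.sum_sub_distrib]
  exact Finset.sum_congr rfl fun _ _ => Finset.sum_congr rfl fun _ _ => by ring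

end Ricci
end Flow

/-! ### The flow as a derivation on a metric ring -/

section Families

variable {n : ℕ} {S : Type*} [TopologicalSpace S] [ChartedSpace (Coord n) S]

/-- Smoothness of a family of functions in all charts. -/
def SmoothFamily (n : ℕ) {S : Type*} [TopologicalSpace S] [ChartedSpace (Coord n) S]
    (T : Set ℝ) (Φ : ℝ → S → ℝ) : Prop :=
  ∀ c ∈ atlas (Coord n) S,
    ContDiffOn ℝ ∞ (fun q : ℝ × Coord n => Φ q.1 (c.symm q.2)) (T ×ˢ c.target)

theorem SmoothFamily.smoothFun {T : Set ℝ} {Φ : ℝ → S → ℝ} (h : SmoothFamily n T Φ) {t : ℝ}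
    (ht : t ∈ T) : SmoothFun n (Φ t) := fun c hc => ContDiffOn.slice (h c hc) ht

variable [IsManifold (𝓡 n) ∞ S]

theorem contDiffOn_chart_of_contMDiffOn {V : Type*} [NormedAddCommGroup V] [NormedSpace ℝ V]
    {T : Set ℝ} {Φ : ℝ → S → V}
    (h : ContMDiffOn (𝓘(ℝ, ℝ).prod (𝓡 n)) 𝓘(ℝ, V) ∞ (fun q : ℝ × S => Φ q.1 q.2) (T ×ˢ univ))
    {c : OpenPartialHomeomorph S (Coord n)} (hc : c ∈ atlas (Coord n) S) :
    ContDiffOn ℝ ∞ (fun q : ℝ × Coord n => Φ q.1 (c.symm q.2)) (T ×ˢ c.target) := by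
  rw [← contMDiffOn_iff_contDiffOn]
  have h1 : ContMDiffOn 𝓘(ℝ, ℝ × Coord n) 𝓘(ℝ, ℝ) ∞ (Prod.fst : ℝ × Coord n → ℝ) (T ×ˢ c.target) :=
    contDiff_fst.contMDiff.contMDiffOn
  have h2 : ContMDiffOn 𝓘(ℝ, ℝ × Coord n) (𝓡 n) ∞ (fun q : ℝ × Coord n => c.symm q.2)
      (T ×ˢ c.target) :=
    (contMDiffOn_symm_of_mem_maximalAtlas
      (IsManifold.subset_maximalAtlas (I := 𝓡 n) (n := ∞) hc)).comp
      contDiff_snd.contMDiff.contMDiffOn fun q hq => hq.2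
  exact h.comp (h1.prodMk h2) fun q hq => ⟨hq.1, mem_univ _⟩

end Families

section Flow

variable {n k : ℕ} {S : Type*} [TopologicalSpace S] [ChartedSpace (Coord n) S]
  [IsManifold (𝓡 n) ∞ S]
  {E' H' : Type*} [NormedAddCommGroup E'] [NormedSpace ℝ E']
  [TopologicalSpace H'] {I' : ModelWithCorners ℝ E' H'}
  {M : Type*} [TopologicalSpace M] [ChartedSpace H' M]
  {P : TorusBundle n k S M I'} {T : Set ℝ} (hT : T.OrdConnected) (hT' : T.Nontrivial)

/-- The flow on an open set of a chart, as a derivation of a metric ring. -/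
structure LocalFlow (B : Matrix (Fin k) (Fin k) ℝ) (g : ℝ → Metric n S)
    (μ : ℝ → PrincipalConnection P) (c : OpenPartialHomeomorph S (Coord n)) {V : Set (Coord n)}
    (hV : IsOpen V) where
  R : MetricRing (SmoothRing (T ×ˢ V)) (Fin n)
  d_eq : R.d = spaceDeriv hT hT' hV
  realizes : ∀ {t : ℝ} (ht : t ∈ T), R.Realizes V (slice ht) (metricComp (g t) c)
  X : Fin k → Fin n → Fin n → SmoothRing (T ×ˢ V)
  X_eq : ∀ {t : ℝ} (ht : t ∈ T) (a : Fin k) (i j : Fin n) (y : V),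
    formComp (μ t).curv c a i j y = slice ht y (X a i j)
  X_antisymm : ∀ a i j, X a i j = -X a j i
  X_closed : ∀ a i j l, R.d i (X a j l) + R.d j (X a l i) + R.d l (X a i j) = 0
  D_X : ∀ a i j, timeDeriv hT hT' hV (X a i j) =
    -(R.d i (R.codiff (X a) j) - R.d j (R.codiff (X a) i))
  D_g : ∀ i j, timeDeriv hT hT' hV (R.g i j) =
    -2 * R.ric i j + ∑ b, R.formSq (fun i j => ∑ a, B b a • X a i j) i j

namespace LocalFlow

variable {hT hT'} {B : Matrix (Fin k) (Fin k) ℝ} {g : ℝ → Metric n S}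
  {μ : ℝ → PrincipalConnection P} {c : OpenPartialHomeomorph S (Coord n)} {V : Set (Coord n)}
  {hV : IsOpen V} (L : LocalFlow hT hT' B g μ c hV)

/-- The curvature in an orthonormal frame of `𝔱ᵏ`. -/
def F (b : Fin k) (i j : Fin n) : SmoothRing (T ×ˢ V) := ∑ a, B b a • L.X a i j

theorem D_comm (i : Fin n) (x : SmoothRing (T ×ˢ V)) :
    timeDeriv hT hT' hV (L.R.d i x) = L.R.d i (timeDeriv hT hT' hV x) := by
  rw [L.d_eq]; exact timeDeriv_comm hT hT' hV i x

theorem F_antisymm (b i j) : L.F b i j = -L.F b j i := by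
  simp only [F, ← Finset.sum_neg_distrib]
  exact Finset.sum_congr rfl fun a _ => by rw [L.X_antisymm a i j, smul_neg]

theorem F_closed (b i j l) :
    L.R.d i (L.F b j l) + L.R.d j (L.F b l i) + L.R.d l (L.F b i j) = 0 := by
  simp only [F, map_sum, Derivation.map_smul, ← Finset.sum_add_distrib, ← smul_add, L.X_closed,
    smul_zero, Finset.sum_const_zero]

theorem codiff_F (b j) : L.R.codiff (L.F b) j = ∑ a, B b a • L.R.codiff (L.X a) j :=
  L.R.codiff_sum_smul (B b) L.X j

theorem D_F (b i j) : timeDeriv hT hT' hV (L.F b i j) =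
    -(L.R.d i (L.R.codiff (L.F b) j) - L.R.d j (L.R.codiff (L.F b) i)) := by
  simp only [codiff_F, F, map_sum, Derivation.map_smul, L.D_X, smul_neg, smul_sub,
    Finset.sum_neg_distrib, Finset.sum_sub_distrib]

end LocalFlow

end Flow

/-! ### Existence of the local algebraic flow. -/

section Existence

variable {n k : ℕ} {S : Type*} [TopologicalSpace S] [ChartedSpace (Coord n) S]
  [IsManifold (𝓡 n) ∞ S]
  {E' H' : Type*} [NormedAddCommGroup E'] [NormedSpace ℝ E'] [FiniteDimensional ℝ E']
  [TopologicalSpace H'] {I' : ModelWithCorners ℝ E' H'} [I'.Boundaryless]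
  {M : Type*} [TopologicalSpace M] [ChartedSpace H' M] [IsManifold I' ∞ M]
  {P : TorusBundle n k S M I'} {B : Matrix (Fin k) (Fin k) ℝ}
  {T : Set ℝ} (hT : T.OrdConnected) (hT' : T.Nontrivial)
  {g : ℝ → Metric n S} {μ : ℝ → PrincipalConnection P}
  (hflow : IsRYMFlow P (B.transpose * B) T g μ)
  {c : OpenPartialHomeomorph S (Coord n)} (hc : c ∈ atlas (Coord n) S)

include hflow hc in
-- On a small set carrying a section everything derives from the components of `A`: `F = dA` is
-- antisymmetric and closed since derivations commute, and `∂_t A = -d*F` gives its evolution.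
theorem exists_localFlow {y : Coord n} (hy : y ∈ c.target) :
    ∃ (V : Set (Coord n)) (hV : IsOpen V), y ∈ V ∧ V ⊆ c.target ∧
      Nonempty (LocalFlow hT hT' B g μ c hV) := by
  obtain ⟨V, σ, hV, hyV, hVc, hσ, hs⟩ := exists_chart_section (P := P) hc hy
  refine ⟨V, hV, hyV, hVc, ?_⟩
  have hG (i j : Fin n) : ContDiffOn ℝ ∞ (fun q : ℝ × Coord n => metricComp (g q.1) c q.2 i j)
      (T ×ˢ V) := (hflow.smooth_metric c hc i j).mono (prod_mono subset_rfl hVc)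
  have hsym : ∀ t ∈ T, ∀ y ∈ V, ∀ i j, metricComp (g t) c y i j = metricComp (g t) c y j i :=
    fun t _ y _ i j => metricComp_symm (g t) y i j
  have hd : ∀ t ∈ T, ∀ y ∈ V, 0 < (metricComp (g t) c y).det :=
    fun t _ y hy => metricComp_det_pos hc (g t) (hVc hy)
  let R := MetricRing.ofSmooth hT hT' hV (G := fun t y => metricComp (g t) c y) hG hsym hd
  have hR {t : ℝ} (ht : t ∈ T) : R.Realizes V (slice ht) (metricComp (g t) c) :=
    MetricRing.ofSmooth_realizes hT hT' hV hG hsym hd ht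
  have hX {t : ℝ} (ht : t ∈ T) (a : Fin k) (i j : Fin n) (y : V) :=
    formComp_eq_curvElem hT hT' hflow hc hV hVc hσ hs ht a i j y
  have hA (a : Fin k) (j : Fin n) : timeDeriv hT hT' hV (gaugeElem hflow hV hσ j a) =
      -R.codiff (curvElem hT hT' hflow hV hσ a) j := by
    refine timeDeriv_eq_of_hasDerivWithinAt hT hT' hV fun t ht z hz => ?_
    have h1 := hasDerivWithinAt_gauge hT hT' hflow hc hV hVc hσ hs ht hz a j
    rw [(hR ht).codiff_eq (hX ht) a j ⟨z, hz⟩, ← map_neg, slice_apply] at h1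
    exact h1.congr (fun s hs' => SmoothRing.toFun_mk (contDiffOn_gaugeComp hflow hV hσ j a)
      (p := (s, z)) ⟨hs', hz⟩) (SmoothRing.toFun_mk (contDiffOn_gaugeComp hflow hV hσ j a)
      (p := (t, z)) ⟨ht, hz⟩)
  refine ⟨⟨R, rfl, hR, curvElem hT hT' hflow hV hσ, hX, ?_, ?_, ?_, ?_⟩⟩
  · intro a i j
    simp only [curvElem, neg_sub]
  · intro a i j l
    have hcomm := spaceDeriv_comm hT hT' hV
    change spaceDeriv hT hT' hV i _ + spaceDeriv hT hT' hV j _ + spaceDeriv hT hT' hV l _ = 0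
    simp only [curvElem, map_sub]
    rw [hcomm i j, hcomm i l, hcomm j l]
    abel
  · intro a i j
    change _ = -(spaceDeriv hT hT' hV i _ - spaceDeriv hT hT' hV j _)
    rw [curvElem, map_sub, timeDeriv_comm, timeDeriv_comm, hA, hA, map_neg, map_neg]
    abel
  · intro i j
    refine timeDeriv_eq_of_hasDerivWithinAt hT hT' hV fun t ht z hz => ?_
    have h1 := hflow.metric_eq t ht c hc z (hVc hz) i j
    rw [(hR ht).ric_eq i j ⟨z, hz⟩, (hR ht).curvSq_eq (hX ht) B i j ⟨z, hz⟩] at h1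
    have h2 : (-2 * R.ric i j + ∑ b, R.formSq (fun i j => ∑ a, B b a •
        curvElem hT hT' hflow hV hσ a i j) i j).toFun (t, z) =
        -2 * slice ht ⟨z, hz⟩ (R.ric i j) + slice ht ⟨z, hz⟩ (∑ b, R.formSq (fun i j => ∑ a, B b a •
        curvElem hT hT' hflow hV hσ a i j) i j) := by
      have := slice_apply ht ⟨z, hz⟩ (-2 * R.ric i j + ∑ b, R.formSq (fun i j => ∑ a, B b a •
        curvElem hT hT' hflow hV hσ a i j) i j)
      rw [← this, map_add, map_mul, map_neg, map_ofNat]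
    rw [h2]
    exact h1.congr (fun s hs' => SmoothRing.toFun_mk (hG i j) (p := (s, z)) ⟨hs', hz⟩)
      (SmoothRing.toFun_mk (hG i j) (p := (t, z)) ⟨ht, hz⟩)

end Existence

/-! ### The conjugate heat equation in a chart -/

section Mk

variable {n : ℕ} {T : Set ℝ} (hT : T.OrdConnected) (hT' : T.Nontrivial) {U : Set (Coord n)}
  (hU : IsOpen U) {Φ : ℝ × Coord n → ℝ} (hΦ : ContDiffOn ℝ ∞ Φ (T ×ˢ U))

theorem slice_spaceDeriv_mk {t : ℝ} (ht : t ∈ T) (y : U) (i : Fin n) :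
    slice ht y (spaceDeriv hT hT' hU i (SmoothRing.mk Φ hΦ)) = pd i (fun z => Φ (t, z)) y := by
  rw [slice_apply]
  exact (pd_eq_spaceDeriv hT hT' hU ht (fun z hz =>
    (SmoothRing.toFun_mk hΦ (p := (t, z)) ⟨ht, hz⟩).symm) i y.2).symm

theorem slice_timeDeriv {t : ℝ} (ht : t ∈ T) (y : U) {x : SmoothRing (T ×ˢ U)} {ψ : ℝ → ℝ} {d : ℝ}
    (hψ : ∀ (s : ℝ) (hs : s ∈ T), ψ s = slice hs y x) (hd : HasDerivWithinAt ψ d T t) :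
    slice ht y (timeDeriv hT hT' hU x) = d := by
  rw [slice_apply]
  exact ((uniqueDiffOn_of_ordConnected hT hT').1 t ht).eq_deriv _
    (hasDerivWithinAt_timeDeriv hT hT' hU ht y.2 fun s hs => by rw [hψ s hs, slice_apply]) hd

theorem hasDerivWithinAt_slice {t : ℝ} (ht : t ∈ T) (y : U) {x : SmoothRing (T ×ˢ U)} {ψ : ℝ → ℝ}
    (hψ : ∀ (s : ℝ) (hs : s ∈ T), ψ s = slice hs y x) :
    HasDerivWithinAt ψ (slice ht y (timeDeriv hT hT' hU x)) T t := by
  rw [slice_apply]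
  exact hasDerivWithinAt_timeDeriv hT hT' hU ht y.2 fun s hs => by rw [hψ s hs, slice_apply]

/-- Functions that are locally given by elements of the rings of smooth functions are smooth. -/
theorem contDiffOn_of_local {T : Set ℝ} {W : Set (Coord n)} {Φ : ℝ → Coord n → ℝ}
    (h : ∀ y ∈ W, ∃ (V : Set (Coord n)) (x : SmoothRing (T ×ˢ V)), IsOpen V ∧ y ∈ V ∧
      ∀ (t : ℝ) (ht : t ∈ T) (z : V), Φ t z = slice ht z x) :
    ContDiffOn ℝ ∞ (fun q : ℝ × Coord n => Φ q.1 q.2) (T ×ˢ W) := by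
  rintro ⟨t, y⟩ ⟨ht, hy⟩
  obtain ⟨V, x, hV, hyV, hx⟩ := h y hy
  have h1 : ContDiffOn ℝ ∞ (fun q : ℝ × Coord n => Φ q.1 q.2) (T ×ˢ V) :=
    x.contDiffOn_toFun.congr fun q hq => by
      rw [hx q.1 hq.1 ⟨q.2, hq.2⟩, slice_apply]
  refine (h1 (t, y) ⟨ht, hyV⟩).mono_of_mem_nhdsWithin ?_
  exact mem_nhdsWithin.mpr ⟨univ ×ˢ V, isOpen_univ.prod hV, ⟨mem_univ _, hyV⟩,
    fun q hq => ⟨hq.2.1, hq.1.2⟩⟩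

end Mk

section Density

variable {n : ℕ} {S : Type*}

theorem density_pos (φ : S → ℝ) {τ : ℝ} (hτ : 0 < τ) (x : S) : 0 < density n φ τ x :=
  div_pos (Real.exp_pos _) (Real.rpow_pos_of_pos (by positivity) _)

theorem contDiffOn_density {E : Type*} [NormedAddCommGroup E] [NormedSpace ℝ E] {D : Set E}
    {f τ : E → ℝ} (hf : ContDiffOn ℝ ∞ f D) (hτ : ContDiffOn ℝ ∞ τ D) (h0 : ∀ p ∈ D, 0 < τ p) :
    ContDiffOn ℝ ∞ (fun p => Real.exp (-f p) / (4 * Real.pi * τ p) ^ ((n : ℝ) / 2)) D := by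
  have hpos (p) (hp : p ∈ D) : 0 < 4 * Real.pi * τ p := by
    have := h0 p hp; positivity
  refine ContDiffOn.div hf.neg.exp ?_ fun p hp => (Real.rpow_pos_of_pos (hpos p hp) _).ne'
  exact (contDiffOn_const.mul hτ).rpow_const_of_ne fun p hp => (hpos p hp).ne'

/-- The power of `4πτ` contributes the summand `n/(2τ)`, which will cancel the one in the conjugate
heat equation. -/
theorem hasDerivWithinAt_density {φ : ℝ → ℝ} {φ' T₁ t : ℝ} {T : Set ℝ} (ht : t < T₁)
    (hφ : HasDerivWithinAt φ φ' T t) :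
    HasDerivWithinAt
      (fun s => Real.exp (-φ s) / (4 * Real.pi * (T₁ - s)) ^ ((n : ℝ) / 2))
      (Real.exp (-φ t) / (4 * Real.pi * (T₁ - t)) ^ ((n : ℝ) / 2) *
        (-φ' + n * (1 / (2 * (T₁ - t))))) T t := by
  have hτ : 0 < T₁ - t := sub_pos.mpr ht
  have hpos : 0 < 4 * Real.pi * (T₁ - t) := by positivity
  have h1 : HasDerivWithinAt (fun s => 4 * Real.pi * (T₁ - s)) (4 * Real.pi * -1) T t :=
    ((hasDerivWithinAt_id t T).const_sub T₁).const_mul _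
  have h2 := h1.rpow_const (p := (n : ℝ) / 2) (Or.inl hpos.ne')
  have h3 := hφ.neg.exp.div h2 (Real.rpow_pos_of_pos hpos _).ne'
  refine h3.congr_deriv ?_
  have hC := (Real.rpow_pos_of_pos hpos ((n : ℝ) / 2)).ne'
  simp only [Pi.neg_apply]
  rw [Real.rpow_sub_one hpos.ne']
  field_simp
  ring

end Density

section Heat

variable {n k : ℕ} {S : Type*} [TopologicalSpace S] [ChartedSpace (Coord n) S]
  [IsManifold (𝓡 n) ∞ S]
  {E' H' : Type*} [NormedAddCommGroup E'] [NormedSpace ℝ E'] [FiniteDimensional ℝ E']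
  [TopologicalSpace H'] {I' : ModelWithCorners ℝ E' H'} [I'.Boundaryless]
  {M : Type*} [TopologicalSpace M] [ChartedSpace H' M] [IsManifold I' ∞ M]
  {P : TorusBundle n k S M I'} {B : Matrix (Fin k) (Fin k) ℝ}
  {T : Set ℝ} {hT : T.OrdConnected} {hT' : T.Nontrivial} {T₁ : ℝ} (hT₁ : ∀ t ∈ T, t < T₁)
  {g : ℝ → Metric n S} {μ : ℝ → PrincipalConnection P}
  {φ : ℝ → S → ℝ}
  {c : OpenPartialHomeomorph S (Coord n)} {V : Set (Coord n)} {hV : IsOpen V}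

namespace LocalFlow

variable (L : LocalFlow hT hT' B g μ c hV)

/-- The remaining time. -/
def tau (T₁ : ℝ) : SmoothRing (T ×ˢ V) :=
  SmoothRing.mk (fun q => T₁ - q.1) (contDiffOn_const.sub contDiff_fst.contDiffOn)

/-- The inverse of twice the remaining time. -/
def theta : SmoothRing (T ×ˢ V) :=
  SmoothRing.mk (fun q => 1 / (2 * (T₁ - q.1))) (contDiffOn_const.div
    (contDiffOn_const.mul (contDiffOn_const.sub contDiff_fst.contDiffOn))
    fun q hq => by have := sub_pos.mpr (hT₁ q.1 hq.1); positivity)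

theorem slice_tau {t : ℝ} (ht : t ∈ T) (y : V) : slice ht y (tau T₁) = T₁ - t := slice_mk ht y _

theorem slice_theta {t : ℝ} (ht : t ∈ T) (y : V) :
    slice ht y (theta hT₁) = 1 / (2 * (T₁ - t)) := slice_mk ht y _

theorem pd_const (r : ℝ) (i : Fin n) (y : Coord n) : pd i (fun _ => r) y = 0 := by
  rw [pd, fderiv_fun_const]; rfl

omit [FiniteDimensional ℝ E'] [I'.Boundaryless] [IsManifold I' ∞ M]

theorem d_tau (i : Fin n) : L.R.d i (tau T₁) = 0 := by
  rw [L.d_eq]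
  refine ext_slice fun t ht y => ?_
  rw [map_zero, tau, slice_spaceDeriv_mk]
  exact pd_const (T₁ - t) i y

theorem d_theta (i : Fin n) : L.R.d i (theta hT₁) = 0 := by
  rw [L.d_eq]
  refine ext_slice fun t ht y => ?_
  rw [map_zero, theta, slice_spaceDeriv_mk]
  exact pd_const (1 / (2 * (T₁ - t))) i y

theorem two_mul_tau_mul_theta : 2 * tau T₁ * theta (V := V) hT₁ = 1 := by
  refine ext_slice fun t ht y => ?_
  rw [map_mul, map_mul, map_ofNat, map_one, slice_tau, slice_theta]
  have := sub_pos.mpr (hT₁ t ht)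
  field_simp

theorem D_tau : timeDeriv hT hT' hV (tau T₁) = -1 := by
  refine ext_slice fun t ht y => ?_
  rw [map_neg, map_one]
  refine slice_timeDeriv hT hT' hV ht y (ψ := fun s => T₁ - s) (fun s hs => (slice_tau hs y).symm) ?_
  exact (hasDerivWithinAt_id t T).const_sub T₁

variable (hc : c ∈ atlas (Coord n) S) (hVc : V ⊆ c.target)

section Function

variable (hφ : SmoothFamily n T φ)

/-- A smooth family of functions, as an element of the ring. -/
def elem : SmoothRing (T ×ˢ V) :=
  SmoothRing.mk (fun q => φ q.1 (c.symm q.2)) ((hφ c hc).mono (prod_mono subset_rfl hVc))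

omit [IsManifold (𝓡 n) ∞ S] in
theorem slice_elem {t : ℝ} (ht : t ∈ T) (y : V) :
    slice ht y (elem hc hVc hφ) = φ t (c.symm y) := slice_mk ht y _

include hT₁ hφ in
omit [IsManifold (𝓡 n) ∞ S] in
theorem smoothFamily_density : SmoothFamily n T fun s => density n (φ s) (T₁ - s) :=
  fun c hc => contDiffOn_density (hφ c hc) (contDiffOn_const.sub contDiff_fst.contDiffOn)
    fun q hq => sub_pos.mpr (hT₁ q.1 hq.1)

/-- The density of the weight, as an element of the ring. -/
abbrev weight : SmoothRing (T ×ˢ V) := elem hc hVc (smoothFamily_density hT₁ hφ)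

/-- The relation through which the exponential weight is visible to the algebraic lemmas. -/
theorem d_weight (i : Fin n) : L.R.d i (weight hT₁ hc hVc hφ) =
    -(weight hT₁ hc hVc hφ * L.R.d i (elem hc hVc hφ)) := by
  rw [L.d_eq]
  refine ext_slice fun t ht y => ?_
  rw [map_neg, map_mul, slice_elem, weight, elem, elem, slice_spaceDeriv_mk, slice_spaceDeriv_mk]
  have hd : DifferentiableAt ℝ (fun z => φ t (c.symm z)) y :=
    ((hφ.smoothFun ht c hc).contDiffAt (c.open_target.mem_nhds (hVc y.2))).differentiableAt
      (by simp)
  have h1 := (hd.hasFDerivAt.neg.exp.mul_const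
    ((4 * Real.pi * (T₁ - t)) ^ ((n : ℝ) / 2))⁻¹).fderiv
  have h2 := congrArg (fun A => A (EuclideanSpace.single i (1 : ℝ) : Coord n)) h1
  refine h2.trans ?_
  simp only [density, pd, smul_apply, neg_apply, Pi.neg_apply, smul_eq_mul, div_eq_mul_inv]
  ring

omit [IsManifold (𝓡 n) ∞ S] in
theorem D_weight : timeDeriv hT hT' hV (weight hT₁ hc hVc hφ) = weight hT₁ hc hVc hφ *
    (-timeDeriv hT hT' hV (elem hc hVc hφ) + (n : SmoothRing (T ×ˢ V)) * theta hT₁) := by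
  refine ext_slice fun t ht y => ?_
  refine slice_timeDeriv hT hT' hV ht y (fun s hs => (slice_elem hc hVc _ hs y).symm) ?_
  rw [map_mul, map_add, map_neg, map_mul, map_natCast, slice_theta, slice_elem]
  exact hasDerivWithinAt_density (hT₁ t ht) (hasDerivWithinAt_slice hT hT' hV ht y
    fun s hs => (slice_elem hc hVc hφ hs y).symm)

end Function

include hc hVc in
theorem slice_det_pos {t : ℝ} (ht : t ∈ T) (y : V) :
    slice ht y L.R.g.det = (metricComp (g t) c y).det ∧ 0 < (metricComp (g t) c y).det := by
  refine ⟨?_, metricComp_det_pos hc (g t) (hVc y.2)⟩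
  rw [AlgHom.map_det]
  congr 1
  ext i j
  exact ((L.realizes ht).g_eq y i j).symm

/-- The Riemannian volume density, as an element of the ring. -/
def vol : SmoothRing (T ×ˢ V) :=
  SmoothRing.mk (fun q => √(metricComp (g q.1) c q.2).det) (by
    have h1 : ContDiffOn ℝ ∞ (fun q : ℝ × Coord n => (metricComp (g q.1) c q.2).det) (T ×ˢ V) :=
      L.R.g.det.contDiffOn_toFun.congr fun q hq => by
        have := (L.slice_det_pos hc hVc hq.1 ⟨q.2, hq.2⟩).1
        rw [slice_apply] at this
        exact this.symm
    exact h1.sqrt fun q hq => (L.slice_det_pos hc hVc hq.1 ⟨q.2, hq.2⟩).2.ne')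

theorem slice_vol {t : ℝ} (ht : t ∈ T) (y : V) :
    slice ht y (L.vol hc hVc) = √(metricComp (g t) c y).det := slice_mk ht y _

theorem vol_sq : L.vol hc hVc ^ 2 = L.R.g.det := by
  refine ext_slice fun t ht y => ?_
  rw [map_pow, slice_vol, (L.slice_det_pos hc hVc ht y).1,
    Real.sq_sqrt (L.slice_det_pos hc hVc ht y).2.le]

/-- A smooth function without zeros has a smooth reciprocal; positivity of the metric supplies this.
-/
theorem isUnit_vol : IsUnit (L.vol hc hVc) := by
  have h1 : ContDiffOn ℝ ∞ (fun q => ((L.vol hc hVc).toFun q)⁻¹) (T ×ˢ V) :=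
    (L.vol hc hVc).contDiffOn_toFun.inv fun q hq => by
      have := L.slice_vol hc hVc hq.1 ⟨q.2, hq.2⟩
      rw [slice_apply] at this
      rw [this]
      exact (Real.sqrt_pos.mpr (L.slice_det_pos hc hVc hq.1 ⟨q.2, hq.2⟩).2).ne'
  refine IsUnit.of_mul_eq_one (SmoothRing.mk _ h1) (ext_slice fun t ht y => ?_)
  rw [map_mul, slice_mk, map_one, ← slice_apply ht y]
  rw [slice_vol]
  exact mul_inv_cancel₀ (Real.sqrt_pos.mpr (L.slice_det_pos hc hVc ht y).2).ne'

theorem two_mul_D_vol : 2 * timeDeriv hT hT' hV (L.vol hc hVc) =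
    L.vol hc hVc * L.R.varTr (timeDeriv hT hT' hV) :=
  L.R.two_mul_D_density _ (L.isUnit_vol hc hVc) (L.vol_sq hc hVc)

end LocalFlow
end Heat

/-! ### The evolution of the entropy density -/

section Heat

variable {n k : ℕ} {S : Type*} [TopologicalSpace S] [ChartedSpace (Coord n) S]
  [IsManifold (𝓡 n) ∞ S]
  {E' H' : Type*} [NormedAddCommGroup E'] [NormedSpace ℝ E'] [FiniteDimensional ℝ E']
  [TopologicalSpace H'] {I' : ModelWithCorners ℝ E' H'} [I'.Boundaryless]
  {M : Type*} [TopologicalSpace M] [ChartedSpace H' M] [IsManifold I' ∞ M]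
  {P : TorusBundle n k S M I'} {B : Matrix (Fin k) (Fin k) ℝ}
  {T : Set ℝ} {hT : T.OrdConnected} {hT' : T.Nontrivial} {T₁ : ℝ} (hT₁ : ∀ t ∈ T, t < T₁)
  {g : ℝ → Metric n S} {μ : ℝ → PrincipalConnection P}
  (hflow : IsRYMFlow P (B.transpose * B) T g μ)
  {φ : ℝ → S → ℝ}
  {c : OpenPartialHomeomorph S (Coord n)} {V : Set (Coord n)} {hV : IsOpen V}

theorem IsConjugateHeat.smoothFamily {h : Matrix (Fin k) (Fin k) ℝ}
    (hφ : IsConjugateHeat h T T₁ g μ φ) : SmoothFamily n T φ :=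
  fun _ hc => contDiffOn_chart_of_contMDiffOn hφ.smooth hc

/-- The integrand of the entropy, up to a divergence. -/
def entropyIntegrand (h : Matrix (Fin k) (Fin k) ℝ) (g : Metric n S)
    (F : (x : S) → TangentSpace (𝓡 n) x → TangentSpace (𝓡 n) x → (Fin k → ℝ)) (φ : S → ℝ)
    (τ : ℝ) (x : S) : ℝ :=
  τ * (2 * lapAt g φ x - gradSqAt g φ x + scalAt g x - (1 / 4) * curvNormSqAt h g F x) + φ x - n

namespace LocalFlow

variable (L : LocalFlow hT hT' B g μ c hV) (hc : c ∈ atlas (Coord n) S) (hVc : V ⊆ c.target)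

section Values

variable {t : ℝ} (ht : t ∈ T) (y : V)

section

variable {φ : ℝ → S → ℝ} (hφ : SmoothFamily n T φ)

include hflow

theorem slice_lap : lapAt (g t) (φ t) (c.symm y) =
    slice ht y (L.R.lap (elem hc hVc hφ)) := by
  rw [lapAt_eq hc (hflow.smoothMetric ht) (c.map_target (hVc y.2)) (hφ.smoothFun ht),
    c.right_inv (hVc y.2)]
  exact (L.realizes ht).lap_eq (fun z => (slice_elem hc hVc hφ ht z).symm) y

theorem slice_gradInner : gradSqAt (g t) (φ t) (c.symm y) =
    slice ht y (L.R.gradInner (elem hc hVc hφ) (elem hc hVc hφ)) := by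
  rw [gradSqAt_eq hc (hflow.smoothMetric ht) (c.map_target (hVc y.2)) (hφ.smoothFun ht),
    c.right_inv (hVc y.2)]
  exact (L.realizes ht).gradSq_eq (fun z => (slice_elem hc hVc hφ ht z).symm) y

include hT hT'

theorem slice_yangMills : yangMillsSqAt (B.transpose * B) (g t) (μ t).curv (φ t) (c.symm y) =
    slice ht y (∑ a, L.R.coInner
      (fun j => L.R.codiff (L.F a) j + ∑ i, L.R.grad (elem hc hVc hφ) i * L.F a i j)
      (fun j => L.R.codiff (L.F a) j + ∑ i, L.R.grad (elem hc hVc hφ) i * L.F a i j)) := by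
  rw [yangMillsSqAt_eq hc (hflow.smoothMetric ht) (c.map_target (hVc y.2)) (tensorial_curv (μ t))
    _ (hflow.smoothForm hT hT' ht) (hφ.smoothFun ht), c.right_inv (hVc y.2)]
  refine (L.realizes ht).covecNormSq_eq B y fun b j => ?_
  rw [map_add, codiff_F, map_sum]
  have hG := (L.realizes ht).gradContract_eq (φ := φ t ∘ c.symm) (L.X_eq ht)
    (fun z => (slice_elem hc hVc hφ ht z).symm)
  simp only [F, Finset.mul_sum, (L.realizes ht).codiff_eq (L.X_eq ht), hG, map_smul, map_sum, map_mul, smul_eq_mul, mul_add, Finset.sum_add_distrib]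
  congr 1
  rw [Finset.sum_comm]
  exact Finset.sum_congr rfl fun _ _ => Finset.sum_congr rfl fun _ _ => by ring

/-- By the flow equation `2Rc - F²` is `-∂_t g`, so the ring tensor is twice the soliton tensor. The
factor `4` is its square. -/
theorem slice_soliton :
    4 * solitonSqAt (B.transpose * B) (g t) (μ t).curv (φ t) (T₁ - t) (c.symm y) =
    slice ht y (L.R.tensorInner
      (fun i j => -1 * timeDeriv hT hT' hV (L.R.g i j) +
        (2 * L.R.hess (elem hc hVc hφ) i j + -2 * theta hT₁ * L.R.g i j))
      (fun i j => -1 * timeDeriv hT hT' hV (L.R.g i j) +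
        (2 * L.R.hess (elem hc hVc hφ) i j + -2 * theta hT₁ * L.R.g i j))) := by
  rw [solitonSqAt_eq hT hT' hflow hc ht (c.map_target (hVc y.2)) (hφ.smoothFun ht),
    c.right_inv (hVc y.2)]
  have hS (i j : Fin n) : 2 * (Loc.ric (metricComp (g t) c) i j y
        - (1 / 2) * Loc.curvSq (B.transpose * B) (metricComp (g t) c)
          (formComp (μ t).curv c) i j y
        + Loc.hess (metricComp (g t) c) (φ t ∘ c.symm) i j y
        - metricComp (g t) c y i j / (2 * (T₁ - t))) =
      slice ht y (-1 * timeDeriv hT hT' hV (L.R.g i j) +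
        (2 * L.R.hess (elem hc hVc hφ) i j + -2 * theta hT₁ * L.R.g i j)) := by
    rw [L.D_g, (L.realizes ht).ric_eq, (L.realizes ht).curvSq_eq (L.X_eq ht) B,
      (L.realizes ht).hess_eq (fun z => (slice_elem hc hVc hφ ht z).symm), (L.realizes ht).g_eq]
    simp only [map_add, map_mul, map_neg, map_ofNat, map_one, slice_theta]
    ring
  rw [← (L.realizes ht).tensorNormSq_eq y hS]
  simp only [Loc.tensorNormSq, Finset.mul_sum]
  exact Finset.sum_congr rfl fun _ _ => Finset.sum_congr rfl fun _ _ =>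
    Finset.sum_congr rfl fun _ _ => Finset.sum_congr rfl fun _ _ => by ring

end

include hflow

include hT hT' hc hVc in
theorem slice_scal : scalAt (g t) (c.symm y) = slice ht y L.R.scal := by
  rw [scalAt_eq hT hT' hflow hc ht (c.map_target (hVc y.2)), c.right_inv (hVc y.2)]
  exact (L.realizes ht).scal_eq y

include hc hVc in
theorem slice_formNormSq : curvNormSqAt (B.transpose * B) (g t) (μ t).curv (c.symm y) =
    slice ht y (∑ a, L.R.formNormSq (L.F a)) := by
  rw [curvNormSqAt_eq hc (hflow.smoothMetric ht) (c.map_target (hVc y.2)) (tensorial_curv (μ t)),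
    c.right_inv (hVc y.2)]
  exact (L.realizes ht).curvNormSq_eq (L.X_eq ht) B y

end Values

variable (hφ : IsConjugateHeat (B.transpose * B) T T₁ g μ φ)

include hflow in
theorem D_elem : 2 * timeDeriv hT hT' hV (elem hc hVc hφ.smoothFamily) =
    -2 * L.R.lap (elem hc hVc hφ.smoothFamily)
      + 2 * L.R.gradInner (elem hc hVc hφ.smoothFamily) (elem hc hVc hφ.smoothFamily)
      - 2 * L.R.scal + ∑ a, L.R.formNormSq (L.F a)
      + 2 * (Fintype.card (Fin n) : SmoothRing (T ×ˢ V)) * theta hT₁ := by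
  refine ext_slice fun t ht y => ?_
  rw [map_mul, slice_timeDeriv hT hT' hV ht y
    (fun s hs => (slice_elem hc hVc hφ.smoothFamily hs y).symm) (hφ.eq t ht (c.symm y)),
    L.slice_lap hflow hc hVc ht y hφ.smoothFamily,
    L.slice_gradInner hflow hc hVc ht y hφ.smoothFamily,
    L.slice_scal hflow hc hVc ht y, L.slice_formNormSq hflow hc hVc ht y]
  simp only [map_add, map_sub, map_mul, map_neg, map_ofNat, map_natCast, slice_theta,
    Fintype.card_fin]
  ring

/-- Four times the integrand of the entropy. -/
def integrandElem : SmoothRing (T ×ˢ V) :=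
  tau T₁ * (8 * L.R.lap (elem hc hVc hφ.smoothFamily)
    + -4 * L.R.gradInner (elem hc hVc hφ.smoothFamily) (elem hc hVc hφ.smoothFamily)
    + 4 * L.R.scal + -1 * ∑ a, L.R.formNormSq (L.F a)) + 4 * elem hc hVc hφ.smoothFamily
    + -4 * (Fintype.card (Fin n) : SmoothRing (T ×ˢ V))

include hflow in
theorem slice_integrandElem {t : ℝ} (ht : t ∈ T) (y : V) :
    entropyIntegrand (B.transpose * B) (g t) (μ t).curv (φ t) (T₁ - t) (c.symm y) =
      1 / 4 * slice ht y (L.integrandElem hc hVc hφ) := by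
  rw [entropyIntegrand, L.slice_lap hflow hc hVc ht y hφ.smoothFamily,
    L.slice_gradInner hflow hc hVc ht y hφ.smoothFamily,
    L.slice_scal hflow hc hVc ht y, L.slice_formNormSq hflow hc hVc ht y, integrandElem]
  simp only [map_add, map_mul, map_neg, map_one, map_ofNat, map_natCast, slice_tau,
    slice_elem, Fintype.card_fin]
  ring

end LocalFlow

variable (hT hT') (hφ : IsConjugateHeat (B.transpose * B) T T₁ g μ φ)

include hT hT' hflow hφ in
theorem smoothFamily_entropyIntegrand : SmoothFamily n T fun s =>
    entropyIntegrand (B.transpose * B) (g s) (μ s).curv (φ s) (T₁ - s) := by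
  intro c hc
  refine contDiffOn_of_local (Φ := fun s y => entropyIntegrand (B.transpose * B) (g s) (μ s).curv
    (φ s) (T₁ - s) (c.symm y)) fun y hy => ?_
  obtain ⟨V, hV, hyV, hVc, ⟨L⟩⟩ := exists_localFlow hT hT' hflow hc hy
  refine ⟨V, (1 / 4 : ℝ) • L.integrandElem hc hVc hφ, hV, hyV, fun t ht z => ?_⟩
  rw [L.slice_integrandElem hflow hc hVc hφ ht z, map_smul, smul_eq_mul]

/-- The product of two smooth families. -/
theorem SmoothFamily.mul {Φ Ψ : ℝ → S → ℝ} (h : SmoothFamily n T Φ) (h' : SmoothFamily n T Ψ) :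
    SmoothFamily n T fun s x => Φ s x * Ψ s x := fun c hc => (h c hc).mul (h' c hc)

include hT hT' hT₁ hflow hφ in
-- `D_weighted_flow'` followed by the pointwise identity `entropyIntegrand_flow`, evaluated at a
-- point. The factor `1/4` undoes the normalisation of the ring element.
theorem hasDerivWithinAt_entropyIntegrand (hc : c ∈ atlas (Coord n) S) {y : Coord n}
    (hy : y ∈ c.target) {t : ℝ} (ht : t ∈ T) :
    HasDerivWithinAt (fun s =>
      entropyIntegrand (B.transpose * B) (g s) (μ s).curv (φ s) (T₁ - s) (c.symm y)
        * density n (φ s) (T₁ - s) (c.symm y) * √(metricComp (g s) c y).det)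
      (((2 * (T₁ - t) * solitonSqAt (B.transpose * B) (g t) (μ t).curv (φ t) (T₁ - t) (c.symm y)
        + (T₁ - t) * yangMillsSqAt (B.transpose * B) (g t) (μ t).curv (φ t) (c.symm y)
        - (1 / 4) * curvNormSqAt (B.transpose * B) (g t) (μ t).curv (c.symm y))
        * density n (φ t) (T₁ - t) (c.symm y)
        - lapAt (g t) (fun x => entropyIntegrand (B.transpose * B) (g t) (μ t).curv (φ t) (T₁ - t) x
          * density n (φ t) (T₁ - t) x) (c.symm y)) * √(metricComp (g t) c y).det) T t := by
  obtain ⟨V, hV, hyV, hVc, ⟨L⟩⟩ := exists_localFlow hT hT' hflow hc hy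
  set u := LocalFlow.weight hT₁ hc hVc hφ.smoothFamily with hu
  set σ := L.vol hc hVc with hσ
  set w := L.integrandElem hc hVc hφ with hw
  have hsm := smoothFamily_entropyIntegrand hT hT' hflow hφ
  have hsmu := LocalFlow.smoothFamily_density hT₁ hφ.smoothFamily
  have h1 := L.R.D_weighted_flow' (timeDeriv hT hT' hV) L.D_g (L.D_elem hT₁ hflow hc hVc hφ)
    (L.d_weight hT₁ hc hVc hφ.smoothFamily)
    (by rw [Fintype.card_fin]; exact LocalFlow.D_weight hT₁ hc hVc hφ.smoothFamily)
    (L.two_mul_D_vol hc hVc) w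
  rw [L.R.entropyIntegrand_flow (timeDeriv hT hT' hV) L.D_comm L.F_antisymm L.F_closed L.D_g L.D_F
    (L.d_tau) (L.d_theta hT₁) (LocalFlow.two_mul_tau_mul_theta hT₁) LocalFlow.D_tau
    (L.D_elem hT₁ hflow hc hVc hφ) hw] at h1
  have hWu : LocalFlow.elem hc hVc (hsm.mul hsmu) = (1 / 4 : ℝ) • (w * u) := by
    refine ext_slice fun s hs z => ?_
    rw [LocalFlow.slice_elem, map_smul, map_mul, hu, LocalFlow.slice_elem,
      L.slice_integrandElem hflow hc hVc hφ hs z, smul_eq_mul, mul_assoc]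
  have hlap := L.slice_lap hflow hc hVc ht ⟨y, hyV⟩ (hsm.mul hsmu)
  rw [hWu] at hlap
  have hsmul : L.R.lap ((1 / 4 : ℝ) • (w * u)) = (1 / 4 : ℝ) • L.R.lap (w * u) := by
    rw [Algebra.smul_def, L.R.lap_const_mul fun i => (L.R.d i).map_algebraMap _, ← Algebra.smul_def]
  rw [hsmul, map_smul, smul_eq_mul] at hlap
  have h2 := hasDerivWithinAt_slice hT hT' hV ht ⟨y, hyV⟩ (x := (1 / 4 : ℝ) • (w * u * σ))
    (ψ := fun s =>
      entropyIntegrand (B.transpose * B) (g s) (μ s).curv (φ s) (T₁ - s) (c.symm y)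
        * density n (φ s) (T₁ - s) (c.symm y) * √(metricComp (g s) c y).det) (by
      intro s hs
      simp only [map_smul, map_mul, smul_eq_mul]
      rw [hσ, L.slice_vol, hu, LocalFlow.slice_elem,
        L.slice_integrandElem hflow hc hVc hφ hs ⟨y, hyV⟩]
      ring)
  refine h2.congr_deriv ?_
  rw [Derivation.map_smul, map_smul, smul_eq_mul, h1, hlap]
  have hs := L.slice_soliton hT₁ hflow hc hVc ht ⟨y, hyV⟩ hφ.smoothFamily
  have hy' := L.slice_yangMills hflow hc hVc ht ⟨y, hyV⟩ hφ.smoothFamily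
  have hn := L.slice_formNormSq hflow hc hVc ht ⟨y, hyV⟩
  simp only [map_mul, map_sub, map_add, map_ofNat, LocalFlow.slice_tau, ← hs, ← hy', ← hn]
  rw [L.slice_vol, LocalFlow.slice_elem]
  ring

end Heat

/-! ### The Riemannian measure in a chart -/

section Volume

variable {n : ℕ} {S : Type*} [TopologicalSpace S] [ChartedSpace (Coord n) S]
  [IsManifold (𝓡 n) ∞ S] [MeasurableSpace S] [BorelSpace S] {g : Metric n S}
  (hg : SmoothMetric g) {c c' : OpenPartialHomeomorph S (Coord n)}
  (hc : c ∈ atlas (Coord n) S) (hc' : c' ∈ atlas (Coord n) S)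

omit [MeasurableSpace S] [BorelSpace S] in
include hg hc in
theorem contDiffOn_sqrt_det :
    ContDiffOn ℝ ∞ (fun y => √(metricComp g c y).det) c.target :=
  (contDiffOn_det (hg c hc)).sqrt fun _ hy => (metricComp_det_pos hc g hy).ne'

omit [IsManifold (𝓡 n) ∞ S] [ChartedSpace (Coord n) S] in
theorem aemeasurable_chart_symm (c : OpenPartialHomeomorph S (Coord n)) :
    AEMeasurable c.symm (volume.restrict c.target) :=
  c.continuousOn_symm.aemeasurable c.open_target.measurableSet

include hg hc in
theorem aemeasurable_sqrt_det :
    AEMeasurable (fun y => ENNReal.ofReal (√(metricComp g c y).det)) (volume.restrict c.target) :=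
  ((contDiffOn_sqrt_det hg hc).continuousOn.aemeasurable c.open_target.measurableSet).ennreal_ofReal

include hg hc in
theorem chartVolume_apply {A : Set S} (hA : MeasurableSet A) :
    chartVolume g c A = ∫⁻ y in c.target,
      ENNReal.ofReal (√(metricComp g c y).det) * A.indicator 1 (c.symm y) := by
  have h1 : AEMeasurable c.symm ((volume.restrict c.target).withDensity
      fun y => ENNReal.ofReal (√(metricComp g c y).det)) :=
    (aemeasurable_chart_symm c).mono_ac (withDensity_absolutelyContinuous _ _)
  rw [← lintegral_indicator_one hA, chartVolume, lintegral_map' (measurable_one.indicator hA).aemeasurable h1,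
    lintegral_withDensity_eq_lintegral_mul₀ (aemeasurable_sqrt_det hg hc)]
  · rfl
  · exact (measurable_one.indicator hA).comp_aemeasurable (aemeasurable_chart_symm c)

theorem det_fderiv {ψ : Coord n → Coord n} {y : Coord n} (hψ : DifferentiableAt ℝ ψ y) :
    (fderiv ℝ ψ y).det = (jac ψ y).det := by
  have h : jac ψ y = (LinearMap.toMatrix (EuclideanSpace.basisFun (Fin n) ℝ).toBasis
      (EuclideanSpace.basisFun (Fin n) ℝ).toBasis (fderiv ℝ ψ y : Coord n →ₗ[ℝ] Coord n)).transpose := by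
    ext a i
    rw [Matrix.transpose_apply, LinearMap.toMatrix_apply]
    simp only [jac, Matrix.of_apply, pd, OrthonormalBasis.coe_toBasis,
      EuclideanSpace.basisFun_apply, OrthonormalBasis.coe_toBasis_repr_apply,
      EuclideanSpace.basisFun_repr, ContinuousLinearMap.coe_coe]
    have h2 := (EuclideanSpace.proj i : Coord n →L[ℝ] ℝ).hasFDerivAt.comp y hψ.hasFDerivAt
    exact congrArg (fun A => A (EuclideanSpace.single a (1 : ℝ) : Coord n)) h2.fderiv
  rw [h, Matrix.det_transpose, LinearMap.det_toMatrix]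

include hc hc' in
theorem sqrt_det_change (g : Metric n S) {y : Coord n} (hy : y ∈ (c.symm ≫ₕ c').target) :
    √(metricComp g c' y).det = |(fderiv ℝ (c.symm ≫ₕ c').symm y).det| *
      √(metricComp g c ((c.symm ≫ₕ c').symm y)).det := by
  rw [metricComp_change hc hc' g hy, det_fderiv (differentiableAt_transition_symm hc hc' hy),
    Matrix.det_mul, Matrix.det_mul, Matrix.det_transpose, mul_right_comm, ← sq, Real.sqrt_mul
    (sq_nonneg _), Real.sqrt_sq_eq_abs]

theorem setLIntegral_of_subset {s t : Set (Coord n)} (hs : MeasurableSet s) (ht : MeasurableSet t)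
    (hst : s ⊆ t) {f : Coord n → ENNReal} (h : ∀ y ∈ t, y ∉ s → f y = 0) :
    ∫⁻ y in t, f y = ∫⁻ y in s, f y := by
  rw [← lintegral_indicator ht, ← lintegral_indicator hs]
  congr 1
  ext y
  by_cases hy : y ∈ s
  · rw [indicator_of_mem hy, indicator_of_mem (hst hy)]
  · rw [indicator_of_notMem hy]
    by_cases hy' : y ∈ t
    · rw [indicator_of_mem hy', h y hy' hy]
    · rw [indicator_of_notMem hy']

include hg hc hc' in
-- Change of variables on the overlap, with the Jacobian absorbed by `sqrt_det_change`. It is only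
-- an inequality because the part of `A` outside the domain of `c'` is seen by `c` alone.
theorem chartVolume_le {A : Set S} (hA : MeasurableSet A) (hAc : A ⊆ c.source) :
    chartVolume g c' A ≤ chartVolume g c A := by
  rw [chartVolume_apply hg hc hA, chartVolume_apply hg hc' hA]
  set e := c.symm ≫ₕ c' with he
  have hsub : e.target ⊆ c'.target := fun y hy => (mem_transition_target.mp hy).1
  have h1 := lintegral_image_eq_lintegral_abs_det_fderiv_mul volume e.open_target.measurableSet
    (fun y hy => (differentiableAt_transition_symm hc hc' hy).hasFDerivAt.hasFDerivWithinAt)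
    e.symm.injOn fun y => ENNReal.ofReal (√(metricComp g c y).det) * A.indicator 1 (c.symm y)
  rw [setLIntegral_of_subset e.open_target.measurableSet c'.open_target.measurableSet hsub]
  · calc _ = ∫⁻ y in e.target, ENNReal.ofReal |(fderiv ℝ e.symm y).det| *
          (ENNReal.ofReal (√(metricComp g c (e.symm y)).det) *
            A.indicator 1 (c.symm (e.symm y))) := by
          refine setLIntegral_congr_fun e.open_target.measurableSet fun y hy => ?_
          rw [sqrt_det_change hc hc' g hy, ENNReal.ofReal_mul (abs_nonneg _), mul_assoc,
            trans_symm_apply, c.left_inv (mem_transition_target.mp hy).2]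
      _ = _ := h1.symm
      _ ≤ _ := lintegral_mono_set (by
          rintro _ ⟨y, hy, rfl⟩
          exact transition_source_subset (e.mapsTo_symm hy))
  · intro y hy hy'
    rw [indicator_of_notMem, mul_zero]
    exact fun hyA => hy' (mem_transition_target.mpr ⟨hy, hAc hyA⟩)

include hg hc in
theorem chartVolume_compl_source : chartVolume g c c.sourceᶜ = 0 := by
  rw [chartVolume_apply hg hc c.open_source.measurableSet.compl]
  refine (setLIntegral_congr_fun c.open_target.measurableSet fun y hy => ?_).trans lintegral_zero
  rw [indicator_of_notMem, mul_zero]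
  exact fun h => h (c.map_target hy)

include hg hc in
/-- The Riemannian measure restricts, on the domain of a chart, to the measure of the chart. -/
theorem riemannianVolume_restrict :
    (riemannianVolume g).restrict c.source = chartVolume g c := by
  have hle : chartVolume g c ≤ riemannianVolume g :=
    le_iSup₂ (f := fun c (_ : c ∈ atlas (Coord n) S) => chartVolume g c) c hc
  have hms := c.open_source.measurableSet
  -- The right side dominates each chart measure, on the domain of `c` by `chartVolume_le` and
  -- outside it trivially; hence it dominates their supremum.
  have hge : riemannianVolume g ≤
      chartVolume g c + (riemannianVolume g).restrict c.sourceᶜ := by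
    refine iSup₂_le fun c' hc' => Measure.le_iff.mpr fun A hA => ?_
    rw [Measure.add_apply, Measure.restrict_apply hA, ← measure_inter_add_sdiff A hms]
    refine add_le_add ?_ ?_
    · exact (chartVolume_le hg hc hc' (hA.inter hms) inter_subset_right).trans
        (measure_mono inter_subset_left)
    · exact (le_iSup₂ (f := fun c (_ : c ∈ atlas (Coord n) S) => chartVolume g c) c' hc')
        (A \ c.source)
  refine le_antisymm (Measure.le_iff.mpr fun A hA => ?_) (Measure.le_iff.mpr fun A hA => ?_)
  · rw [Measure.restrict_apply hA]
    refine (hge _).trans ?_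
    rw [Measure.add_apply, Measure.restrict_apply (hA.inter hms), inter_assoc,
      inter_compl_self, inter_empty, measure_empty, add_zero]
    exact measure_mono inter_subset_left
  · rw [Measure.restrict_apply hA, ← measure_inter_add_sdiff A hms,
      measure_mono_null (s := A \ c.source) (fun x hx => hx.2) (chartVolume_compl_source hg hc), add_zero]
    exact hle _

include hg in
-- The density is bounded on a compact coordinate neighbourhood, so the measure is locally finite,
-- and the manifold is compact.
theorem isFiniteMeasure_riemannianVolume [CompactSpace S] :
    IsFiniteMeasure (riemannianVolume g) := by
  have : IsLocallyFiniteMeasure (riemannianVolume g) := by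
    refine ⟨fun x => ?_⟩
    set c := chartAt (Coord n) x with hc_def
    have hc : c ∈ atlas (Coord n) S := chart_mem_atlas _ x
    have hx : x ∈ c.source := mem_chart_source _ x
    obtain ⟨K, hK, hKx, hKc⟩ := exists_compact_subset c.open_target (c.map_source hx)
    refine ⟨c.source ∩ c ⁻¹' interior K, (c.isOpen_inter_preimage isOpen_interior).mem_nhds
      ⟨hx, hKx⟩, ?_⟩
    have hm := (c.isOpen_inter_preimage (isOpen_interior (s := K))).measurableSet
    rw [← inter_eq_left.mpr (inter_subset_left (s := c.source) (t := c ⁻¹' interior K)),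
      ← Measure.restrict_apply hm, riemannianVolume_restrict hg hc, chartVolume_apply hg hc hm,
      setLIntegral_of_subset hK.measurableSet c.open_target.measurableSet hKc]
    · have hint : IntegrableOn (fun y => √(metricComp g c y).det) K :=
        ((contDiffOn_sqrt_det hg hc).continuousOn.mono hKc).integrableOn_compact hK
      refine lt_of_le_of_lt (lintegral_mono fun y => ?_) hint.lintegral_lt_top
      exact mul_le_of_le_one_right' (indicator_le_self' (fun _ _ => zero_le) _)
    · intro y _ hyK
      rw [indicator_of_notMem, mul_zero]
      intro h
      have hh := h.2
      rw [mem_preimage, c.right_inv ‹_›] at hh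
      exact hyK (interior_subset hh)
  exact ⟨isCompact_univ.measure_lt_top⟩

include hg hc in
/-- Integration of a function supported in the domain of a chart. -/
theorem integral_riemannianVolume_of_subset {Φ : S → ℝ} (hΦ : Continuous Φ) {K : Set (Coord n)}
    (hKc : K ⊆ c.target)
    (h0 : ∀ x, (x ∈ c.source → c x ∉ K) → Φ x = 0) :
    ∫ x, Φ x ∂(riemannianVolume g) = ∫ y in K, Φ (c.symm y) * √(metricComp g c y).det := by
  have h1 : AEMeasurable c.symm ((volume.restrict c.target).withDensity
      fun y => ENNReal.ofReal (√(metricComp g c y).det)) :=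
    (aemeasurable_chart_symm c).mono_ac (withDensity_absolutelyContinuous _ _)
  rw [← setIntegral_eq_integral_of_forall_compl_eq_zero (s := c.source)
    (fun x hx => h0 x fun h => absurd h hx), riemannianVolume_restrict hg hc, chartVolume,
    integral_map h1 hΦ.aestronglyMeasurable,
    integral_withDensity_eq_integral_toReal_smul₀ (aemeasurable_sqrt_det hg hc)
      (Filter.Eventually.of_forall fun _ => ENNReal.ofReal_lt_top)]
  simp only [ENNReal.toReal_ofReal (Real.sqrt_nonneg _), smul_eq_mul, mul_comm _ (Φ _)]
  refine setIntegral_eq_of_subset_of_forall_sdiff_eq_zero c.open_target.measurableSet hKc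
    fun y hy => ?_
  rw [h0 _ fun _ => by rw [c.right_inv hy.1]; exact hy.2, zero_mul]

end Volume

/-! ### Differentiation of integrals over the manifold -/

section Parameter

open Filter Topology

variable {n : ℕ} {T : Set ℝ} (hT : Convex ℝ T) {t : ℝ} (ht : t ∈ T) {U : Set (Coord n)}
  (hU : IsOpen U) {K : Set (Coord n)} (hK : IsCompact K) (hKU : K ⊆ U) {H : ℝ × Coord n → ℝ}
  (hH : ContDiffOn ℝ 1 H (T ×ˢ U))

include hT ht hU hK hKU hH

/-- Provides the dominating constant for differentiation under the integral. A `C¹` function is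
Lipschitz near each point of the convex sets `T × ball`, and compactness of `K` makes the constant
uniform. -/
theorem exists_uniform_lipschitz : ∃ C : ℝ, ∀ᶠ s in 𝓝[T] t, ∀ y ∈ K,
    |H (s, y) - H (t, y)| ≤ C * |s - t| := by
  refine hK.induction_on (p := fun A => ∃ C : ℝ, ∀ᶠ s in 𝓝[T] t, ∀ y ∈ A,
    |H (s, y) - H (t, y)| ≤ C * |s - t|) ⟨0, by simp⟩ ?_ ?_ ?_
  · rintro A A' hA ⟨C, hC⟩
    exact ⟨C, hC.mono fun s hs y hy => hs y (hA hy)⟩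
  · rintro A A' ⟨C, hC⟩ ⟨C', hC'⟩
    refine ⟨max C C', ?_⟩
    filter_upwards [hC, hC'] with s hs hs' y hy
    rcases hy with hy | hy
    · exact (hs y hy).trans (mul_le_mul_of_nonneg_right (le_max_left _ _) (abs_nonneg _))
    · exact (hs' y hy).trans (mul_le_mul_of_nonneg_right (le_max_right _ _) (abs_nonneg _))
  · intro y hy
    obtain ⟨r, hr, hrU⟩ := Metric.isOpen_iff.mp hU y (hKU hy)
    have h1 : ContDiffWithinAt ℝ 1 H (T ×ˢ Metric.ball y r) (t, y) :=
      (hH.mono (prod_mono subset_rfl hrU)) (t, y) ⟨ht, Metric.mem_ball_self hr⟩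
    obtain ⟨C, N, hN, hC⟩ := h1.exists_lipschitzOnWith (hT.prod (convex_ball y r))
    rw [nhdsWithin_prod_eq, Filter.mem_prod_iff] at hN
    obtain ⟨N₁, hN₁, N₂, hN₂, hN⟩ := hN
    rw [Metric.isOpen_ball.nhdsWithin_eq (Metric.mem_ball_self hr)] at hN₂
    refine ⟨N₂, mem_nhdsWithin_of_mem_nhds hN₂, C, ?_⟩
    filter_upwards [hN₁] with s hs z hz
    have h2 := hC.dist_le_mul (s, z) (hN ⟨hs, hz⟩) (t, z) (hN ⟨mem_of_mem_nhdsWithin ht hN₁, hz⟩)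
    simpa [Real.dist_eq, Prod.dist_eq] using h2

/-- Differentiation of an integral over a compact set with respect to a parameter. -/
theorem hasDerivWithinAt_setIntegral {H' : Coord n → ℝ}
    (hd : ∀ y ∈ K, HasDerivWithinAt (fun s => H (s, y)) (H' y) T t) :
    HasDerivWithinAt (fun s => ∫ y in K, H (s, y)) (∫ y in K, H' y) T t := by
  obtain ⟨C, hC⟩ := exists_uniform_lipschitz hT ht hU hK hKU hH
  have hcont (s : ℝ) (hs : s ∈ T) : ContinuousOn (fun y => H (s, y)) K :=
    hH.continuousOn.comp (by fun_prop) fun y hy => ⟨hs, hKU hy⟩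
  have hint (s : ℝ) (hs : s ∈ T) : IntegrableOn (fun y => H (s, y)) K :=
    (hcont s hs).integrableOn_compact hK
  have hT' : ∀ᶠ s in 𝓝[T \ {t}] t, s ∈ T ∧ s ≠ t :=
    eventually_mem_nhdsWithin.mono fun s hs => hs
  rw [hasDerivWithinAt_iff_tendsto_slope]
  -- Dominated convergence for the difference quotients, with the Lipschitz constant as bound on a
  -- set of finite measure.
  have h1 : Tendsto (fun s => ∫ y in K, slope (fun s => H (s, y)) t s) (𝓝[T \ {t}] t)
      (𝓝 (∫ y in K, H' y)) := by
    refine tendsto_integral_filter_of_dominated_convergence (fun _ => C) ?_ ?_ ?_ ?_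
    · filter_upwards [hT'] with s hs
      exact (((hcont s hs.1).sub (hcont t ht)).const_smul (s - t)⁻¹).aestronglyMeasurable
        hK.measurableSet
    · filter_upwards [hT', nhdsWithin_mono t sdiff_subset hC] with s hs hs'
      filter_upwards [ae_restrict_mem hK.measurableSet] with y hy
      rw [slope_def_field, norm_div, Real.norm_eq_abs, Real.norm_eq_abs,
        div_le_iff₀ (abs_pos.mpr (sub_ne_zero.mpr hs.2))]
      exact hs' y hy
    · exact integrableOn_const hK.measure_lt_top.ne
    · filter_upwards [ae_restrict_mem hK.measurableSet] with y hy
      exact hasDerivWithinAt_iff_tendsto_slope.mp (hd y hy)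
  refine h1.congr' ?_
  filter_upwards [hT'] with s hs
  simp only [slope_def_field]
  rw [integral_div, integral_sub (hint s hs.1) (hint t ht)]

end Parameter

/-! ### Partitions of unity. -/

section Partition

variable {n : ℕ} {S : Type*} [TopologicalSpace S] [ChartedSpace (Coord n) S]

theorem SmoothFun.continuous {φ : S → ℝ} (h : SmoothFun n φ) : Continuous φ := by
  refine continuous_iff_continuousAt.mpr fun x => ?_
  have hx := mem_chart_source (Coord n) x
  set c := chartAt (Coord n) x
  have h1 : ContinuousAt ((φ ∘ c.symm) ∘ c) x := ContinuousAt.comp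
    ((h c (chart_mem_atlas _ x)).continuousOn.continuousAt
      (c.open_target.mem_nhds (c.map_source hx))) (c.continuousAt hx)
  refine h1.congr ?_
  filter_upwards [c.open_source.mem_nhds hx] with z hz
  simp only [Function.comp, c.left_inv hz]

theorem SmoothFun.mul {φ ψ : S → ℝ} (h : SmoothFun n φ) (h' : SmoothFun n ψ) :
    SmoothFun n fun x => φ x * ψ x := fun c hc => (h c hc).mul (h' c hc)

variable [IsManifold (𝓡 n) ∞ S]

/-- A finite smooth partition of unity subordinate to the charts. -/
theorem exists_partition (n : ℕ) (S : Type*) [TopologicalSpace S] [ChartedSpace (Coord n) S]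
    [IsManifold (𝓡 n) ∞ S] [T2Space S] [CompactSpace S] :
    ∃ (s : Finset S) (χ : s → S → ℝ), (∀ i, SmoothFun n (χ i)) ∧
      (∀ i : s, tsupport (χ i) ⊆ (chartAt (Coord n) (i : S)).source) ∧ ∀ x, ∑ i, χ i x = 1 := by
  obtain ⟨s, hs⟩ := isCompact_univ.elim_finite_subcover
    (fun x : S => (chartAt (Coord n) x).source) (fun x => (chartAt (Coord n) x).open_source)
    (fun x _ => mem_iUnion.mpr ⟨x, mem_chart_source _ x⟩)
  obtain ⟨χ, hχ⟩ := SmoothPartitionOfUnity.exists_isSubordinate (𝓡 n) (isClosed_univ (X := S))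
    (fun x : s => (chartAt (Coord n) (x : S)).source) (fun x => (chartAt (Coord n) (x : S)).open_source)
    (by
      intro x hx
      obtain ⟨i, hi, hx'⟩ := mem_iUnion₂.mp (hs hx)
      exact mem_iUnion.mpr ⟨⟨i, hi⟩, hx'⟩)
  refine ⟨s, fun i => χ i, fun i c hc => ?_, hχ, fun x => ?_⟩
  · rw [← contMDiffOn_iff_contDiffOn]
    exact (χ i).contMDiff.comp_contMDiffOn (contMDiffOn_symm_of_mem_maximalAtlas
      (IsManifold.subset_maximalAtlas (I := 𝓡 n) (n := ∞) hc))
  · rw [← finsum_eq_sum_of_fintype]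
    exact χ.sum_eq_one (mem_univ x)

end Partition

section Integral

variable {n : ℕ} {S : Type*} [TopologicalSpace S] [ChartedSpace (Coord n) S]
  [IsManifold (𝓡 n) ∞ S] [T2Space S] [CompactSpace S] [MeasurableSpace S] [BorelSpace S]

theorem integrable_riemannianVolume {g : Metric n S} (hg : SmoothMetric g) {Φ : S → ℝ}
    (hΦ : Continuous Φ) : Integrable Φ (riemannianVolume g) := by
  have := isFiniteMeasure_riemannianVolume hg
  exact hΦ.integrable_of_hasCompactSupport (HasCompactSupport.of_compactSpace _)

/-- The image of the support of a function in a chart. -/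
theorem isCompact_image_tsupport {χ : S → ℝ} {c : OpenPartialHomeomorph S (Coord n)}
    (h : tsupport χ ⊆ c.source) : IsCompact (c '' tsupport χ) :=
  (isClosed_tsupport χ).isCompact.image_of_continuousOn (c.continuousOn.mono h)

theorem image_tsupport_subset {χ : S → ℝ} {c : OpenPartialHomeomorph S (Coord n)}
    (h : tsupport χ ⊆ c.source) : c '' tsupport χ ⊆ c.target := by
  rintro _ ⟨x, hx, rfl⟩
  exact c.map_source (h hx)

/-- The coordinate sets over which one integrates depend on the partition only and not on the
metric. In a smooth family they are fixed in time, so only integrands vary. -/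
theorem integral_eq_sum {g : Metric n S} (hg : SmoothMetric g) {s : Finset S} {χ : s → S → ℝ}
    (hχ : ∀ i, SmoothFun n (χ i))
    (hχs : ∀ i : s, tsupport (χ i) ⊆ (chartAt (Coord n) (i : S)).source)
    (hχ1 : ∀ x, ∑ i, χ i x = 1) {Φ : S → ℝ} (hΦ : Continuous Φ) :
    ∫ x, Φ x ∂(riemannianVolume g) = ∑ i : s, ∫ y in chartAt (Coord n) (i : S) '' tsupport (χ i),
      χ i ((chartAt (Coord n) (i : S)).symm y) * (Φ ((chartAt (Coord n) (i : S)).symm y) *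
        √(metricComp g (chartAt (Coord n) (i : S)) y).det) := by
  have h1 (x : S) : Φ x = ∑ i, χ i x * Φ x := by rw [← Finset.sum_mul, hχ1, one_mul]
  have h2 (i : s) : Integrable (fun x => χ i x * Φ x) (riemannianVolume g) :=
    integrable_riemannianVolume hg ((hχ i).continuous.mul hΦ)
  rw [integral_congr_ae (Filter.Eventually.of_forall h1), integral_finsetSum _ fun i _ => h2 i]
  refine Finset.sum_congr rfl fun i _ => ?_
  rw [integral_riemannianVolume_of_subset hg (chart_mem_atlas (Coord n) (i : S))
    (Φ := fun x => χ i x * Φ x) ((hχ i).continuous.mul hΦ) (image_tsupport_subset (hχs i))]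
  · simp only [mul_assoc]
  · intro x hx
    by_contra h
    have hx' : x ∈ tsupport (χ i) := subset_tsupport _ (left_ne_zero_of_mul h)
    exact hx (hχs i hx') ⟨x, hx', rfl⟩

/-- Differentiation of the integral of a smooth family of functions with respect to the measures
of a smooth family of metrics. -/
theorem hasDerivWithinAt_integral {T : Set ℝ} (hT : T.OrdConnected) {g : ℝ → Metric n S}
    (hg : ∀ c ∈ atlas (Coord n) S, ∀ i j : Fin n,
      ContDiffOn ℝ ∞ (fun q : ℝ × Coord n => metricComp (g q.1) c q.2 i j) (T ×ˢ c.target))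
    {Φ : ℝ → S → ℝ} (hΦ : SmoothFamily n T Φ) {t : ℝ} (ht : t ∈ T) {Ψ : S → ℝ} (hΨ : Continuous Ψ)
    (hd : ∀ c ∈ atlas (Coord n) S, ∀ y ∈ c.target,
      HasDerivWithinAt (fun s => Φ s (c.symm y) * √(metricComp (g s) c y).det)
        (Ψ (c.symm y) * √(metricComp (g t) c y).det) T t) :
    HasDerivWithinAt (fun s => ∫ x, Φ s x ∂(riemannianVolume (g s)))
      (∫ x, Ψ x ∂(riemannianVolume (g t))) T t := by
  have hg' {s : ℝ} (hs : s ∈ T) : SmoothMetric (g s) := fun c hc i j =>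
    ContDiffOn.slice (hg c hc i j) hs
  obtain ⟨s, χ, hχ, hχs, hχ1⟩ := exists_partition n S
  rw [integral_eq_sum (hg' ht) hχ hχs hχ1 hΨ]
  refine HasDerivWithinAt.congr (HasDerivWithinAt.fun_sum fun i _ => ?_)
    (fun r hr => integral_eq_sum (hg' hr) hχ hχs hχ1 (hΦ.smoothFun hr).continuous)
    (integral_eq_sum (hg' ht) hχ hχs hχ1 (hΦ.smoothFun ht).continuous)
  set c := chartAt (Coord n) (i : S)
  have hc : c ∈ atlas (Coord n) S := chart_mem_atlas _ _
  refine hasDerivWithinAt_setIntegral (H := fun q => χ i (c.symm q.2) * (Φ q.1 (c.symm q.2) *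
    √(metricComp (g q.1) c q.2).det)) hT.convex ht c.open_target
    (isCompact_image_tsupport (hχs i)) (image_tsupport_subset (hχs i)) ?_ fun y hy => by
      have := (hd c hc y (image_tsupport_subset (hχs i) hy)).const_mul (χ i (c.symm y))
      exact this
  have h1 : ContDiffOn ℝ ∞ (fun q : ℝ × Coord n => χ i (c.symm q.2)) (T ×ˢ c.target) :=
    (hχ i c hc).comp contDiff_snd.contDiffOn fun q hq => hq.2
  have h2 : ContDiffOn ℝ ∞ (fun q : ℝ × Coord n => √(metricComp (g q.1) c q.2).det)
      (T ×ˢ c.target) :=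
    (contDiffOn_det (hg c hc)).sqrt fun q hq => (metricComp_det_pos hc (g q.1) hq.2).ne'
  exact (h1.mul ((hΦ c hc).mul h2)).of_le (by simp)

end Integral

/-! ### Green's formula -/

section Divergence

variable {n : ℕ}

/-- Integration by parts against the constant function `1`. -/
theorem integral_pd_eq_zero {Y : Coord n → ℝ} (hY : ContDiff ℝ ∞ Y) (hs : HasCompactSupport Y)
    (i : Fin n) : ∫ y, pd i Y y = 0 := by
  have hc : Continuous fun y => fderiv ℝ Y y (EuclideanSpace.single i 1) :=
    (hY.continuous_fderiv (by simp)).clm_apply continuous_const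
  have hint : Integrable fun y => fderiv ℝ Y y (EuclideanSpace.single i 1) :=
    hc.integrable_of_hasCompactSupport (hs.fderiv_apply ℝ _)
  have h := integral_mul_fderiv_eq_neg_fderiv_mul_of_integrable (μ := (volume : Measure (Coord n)))
    (f := fun _ => (1 : ℝ)) (g := Y) (v := EuclideanSpace.single i 1) (by simp) (by simpa using hint)
    (by simpa using hY.continuous.integrable_of_hasCompactSupport hs)
    (fun _ _ => differentiableAt_const _) (fun _ _ => hY.differentiable (by simp) _)
  simpa [pd] using h

end Divergence

/-! ### A fixed metric in a chart. -/

section Static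

variable {n : ℕ} {S : Type*} [TopologicalSpace S] [ChartedSpace (Coord n) S]
  [IsManifold (𝓡 n) ∞ S] {g : Metric n S} (hg : SmoothMetric g)
  {c : OpenPartialHomeomorph S (Coord n)} (hc : c ∈ atlas (Coord n) S)

/-- The metric ring of a metric in a chart. -/
def chartRing : MetricRing (SmoothRing ((univ : Set ℝ) ×ˢ c.target)) (Fin n) :=
  MetricRing.ofSmooth ordConnected_univ nontrivial_univ c.open_target
    (G := fun _ y => metricComp g c y)
    (fun i j => (hg c hc i j).comp contDiff_snd.contDiffOn fun _ hq => hq.2)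
    (fun _ _ y _ i j => metricComp_symm g y i j) (fun _ _ _ hy => metricComp_det_pos hc g hy)

/-- Evaluation at a point of the chart. -/
abbrev chartEval (c : OpenPartialHomeomorph S (Coord n)) (y : c.target) :
    SmoothRing ((univ : Set ℝ) ×ˢ c.target) →ₐ[ℝ] ℝ := slice (mem_univ 0) y

theorem chartRing_realizes :
    (chartRing hg hc).Realizes c.target (chartEval c) (metricComp g c) :=
  MetricRing.ofSmooth_realizes ordConnected_univ nontrivial_univ c.open_target _ _ _ (mem_univ 0)

omit [IsManifold (𝓡 n) ∞ S] in
theorem contDiffOn_chartEval (x : SmoothRing ((univ : Set ℝ) ×ˢ c.target)) :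
    ContDiffOn ℝ ∞ (fun y => x.toFun (0, y)) c.target :=
  ContDiffOn.slice x.contDiffOn_toFun (mem_univ 0)

/-- A smooth function in a chart. -/
def chartElem {φ : S → ℝ} (hφ : SmoothFun n φ) : SmoothRing ((univ : Set ℝ) ×ˢ c.target) :=
  SmoothRing.mk (fun q => φ (c.symm q.2))
    ((hφ c hc).comp contDiff_snd.contDiffOn fun _ hq => hq.2)

omit [IsManifold (𝓡 n) ∞ S] in
theorem chartEval_chartElem {φ : S → ℝ} (hφ : SmoothFun n φ) (y : c.target) :
    chartEval c y (chartElem hc hφ) = φ (c.symm y) := slice_mk (mem_univ 0) y _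

omit [IsManifold (𝓡 n) ∞ S] in
theorem chartElem_eq {φ : S → ℝ} (hφ : SmoothFun n φ)
    {x : SmoothRing ((univ : Set ℝ) ×ˢ c.target)}
    (h : ∀ (t : ℝ) (y : c.target), slice (mem_univ t) y x = φ (c.symm y)) :
    chartElem hc hφ = x :=
  ext_slice fun t _ y => (slice_mk (mem_univ t) y _).trans (h t y).symm

theorem lapAt_chart {φ : S → ℝ} (hφ : SmoothFun n φ) (y : c.target) :
    lapAt g φ (c.symm y) = chartEval c y ((chartRing hg hc).lap (chartElem hc hφ)) := by
  rw [lapAt_eq hc hg (c.map_target y.2) hφ, c.right_inv y.2]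
  exact (chartRing_realizes hg hc).lap_eq (fun z => (chartEval_chartElem hc hφ z).symm) y

include hg in
theorem SmoothFun.lapAt {φ : S → ℝ} (hφ : SmoothFun n φ) : SmoothFun n (lapAt g φ) :=
  fun c hc => (contDiffOn_chartEval ((chartRing hg hc).lap (chartElem hc hφ))).congr fun y hy => by
    have := lapAt_chart hg hc hφ ⟨y, hy⟩
    rw [slice_apply] at this
    exact this

/-- The volume density in a chart. -/
def chartDensity : SmoothRing ((univ : Set ℝ) ×ˢ c.target) :=
  SmoothRing.mk (fun q => √(metricComp g c q.2).det)
    ((contDiffOn_sqrt_det hg hc).comp contDiff_snd.contDiffOn fun _ hq => hq.2)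

theorem slice_chartDensity (t : ℝ) (y : c.target) :
    slice (mem_univ t) y (chartDensity hg hc) = √(metricComp g c y).det := slice_mk _ y _

theorem d_chartDensity (i : Fin n) : (chartRing hg hc).d i (chartDensity hg hc) =
    chartDensity hg hc * ∑ m, (chartRing hg hc).chris m m i := by
  refine (chartRing hg hc).d_density ?_ ?_ i
  · refine IsUnit.of_mul_eq_one (SmoothRing.mk (fun q => (√(metricComp g c q.2).det)⁻¹)
      (((contDiffOn_sqrt_det hg hc).inv fun y hy =>
        (Real.sqrt_pos.mpr (metricComp_det_pos hc g hy)).ne').comp contDiff_snd.contDiffOn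
          fun _ hq => hq.2)) (ext_slice fun t ht y => ?_)
    rw [map_mul, slice_mk, slice_chartDensity, map_one]
    exact mul_inv_cancel₀ (Real.sqrt_pos.mpr (metricComp_det_pos hc g y.2)).ne'
  · refine ext_slice fun t ht y => ?_
    rw [map_pow, slice_chartDensity, Real.sq_sqrt (metricComp_det_pos hc g y.2).le,
      AlgHom.map_det]
    congr 1

theorem lapAt_eq_zero {φ : S → ℝ} {x : S} (hx : x ∉ tsupport φ) : lapAt g φ x = 0 := by
  set c := chartAt (Coord n) x with hc
  have hxc : x ∈ c.source := mem_chart_source _ x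
  have hU : IsOpen (c.target ∩ c.symm ⁻¹' (tsupport φ)ᶜ) :=
    c.symm.isOpen_inter_preimage (isClosed_tsupport φ).isOpen_compl
  have hmem : c x ∈ c.target ∩ c.symm ⁻¹' (tsupport φ)ᶜ :=
    ⟨c.map_source hxc, by rw [mem_preimage, c.left_inv hxc]; exact hx⟩
  have h0 : ∀ y ∈ c.target ∩ c.symm ⁻¹' (tsupport φ)ᶜ, (φ ∘ c.symm) y = (fun _ => (0 : ℝ)) y :=
    fun y hy => image_eq_zero_of_notMem_tsupport (f := φ) hy.2
  have hpd (i : Fin n) : pd i (fun _ : Coord n => (0 : ℝ)) = fun _ => 0 := by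
    ext y; exact LocalFlow.pd_const 0 i y
  rw [lapAt, Loc.lap]
  simp only [← hc, Loc.hess_congr hU h0 _ _ hmem]
  simp [Loc.hess, hpd]

include hg hc in
/-- The divergence in Green's formula. -/
theorem exists_flux {u w : S → ℝ} (hu : SmoothFun n u) (hw : SmoothFun n w) :
    ∃ Y : Fin n → Coord n → ℝ, (∀ i, ContDiffOn ℝ ∞ (Y i) c.target) ∧
      (∀ y ∈ c.target, c.symm y ∉ tsupport u → ∀ i, Y i y = 0) ∧
      ∀ y ∈ c.target, ∑ i, pd i (Y i) y =
        (u (c.symm y) * lapAt g w (c.symm y) - w (c.symm y) * lapAt g u (c.symm y)) *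
          √(metricComp g c y).det := by
  set R := chartRing hg hc with hR
  have hRe := chartRing_realizes hg hc
  set U := chartElem hc hu with hU
  set W := chartElem hc hw with hW
  set σ := chartDensity hg hc with hσ
  have key := R.sum_d_density (d_chartDensity hg hc) U W
  refine ⟨fun i y => (σ * (U * R.grad W i - W * R.grad U i)).toFun (0, y),
    fun i => contDiffOn_chartEval _, fun y hy hys i => ?_, fun y hy => ?_⟩
  · refine (slice_apply (mem_univ 0) ⟨y, hy⟩ _).symm.trans ?_
    have hopen : IsOpen (c.target ∩ c.symm ⁻¹' (tsupport u)ᶜ) :=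
      c.symm.isOpen_inter_preimage (isClosed_tsupport u).isOpen_compl
    have h1 : chartEval c ⟨y, hy⟩ U = 0 := by
      rw [chartEval_chartElem]; exact image_eq_zero_of_notMem_tsupport hys
    have h2 (j : Fin n) : chartEval c ⟨y, hy⟩ (R.d j U) = 0 := by
      rw [← hRe.pd_eq (fun z => u (c.symm z)) U (fun z => (chartEval_chartElem hc hu z).symm)]
      exact (pd_congr hopen (χ := fun _ => 0)
        (fun z hz => image_eq_zero_of_notMem_tsupport hz.2) j ⟨hy, hys⟩).trans
          (LocalFlow.pd_const 0 j y)
    simp only [map_mul, map_sub, h1, MetricRing.grad, map_sum, h2]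
    simp
  · have h1 := congrArg (chartEval c ⟨y, hy⟩) key
    rw [map_sum, map_mul, map_sub, map_mul, map_mul, ← lapAt_chart, ← lapAt_chart,
      chartEval_chartElem, chartEval_chartElem, slice_chartDensity] at h1
    refine (Finset.sum_congr rfl fun i _ => ?_).trans (h1.trans (mul_comm _ _))
    exact hRe.pd_eq _ _ (fun z => (slice_apply (mem_univ 0) z _).symm) i ⟨y, hy⟩

end Static

section Green

variable {n : ℕ} {S : Type*} [TopologicalSpace S] [ChartedSpace (Coord n) S]
  [IsManifold (𝓡 n) ∞ S] [T2Space S] [CompactSpace S] [MeasurableSpace S] [BorelSpace S]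
  {g : Metric n S} (hg : SmoothMetric g) {u w : S → ℝ} (hu : SmoothFun n u) (hw : SmoothFun n w)

include hg hu hw

theorem continuous_green : Continuous fun x => u x * lapAt g w x - w x * lapAt g u x :=
  (hu.continuous.mul (hw.lapAt hg).continuous).sub (hw.continuous.mul (hu.lapAt hg).continuous)

/-- The integrand is a coordinate divergence of a flux vanishing off the support of `u`. Extended by
zero, the flux is smooth with compact support on `ℝⁿ`, so `integral_pd_eq_zero` applies; `w` need
not be localised. -/
theorem integral_green_of_subset {c : OpenPartialHomeomorph S (Coord n)}
    (hc : c ∈ atlas (Coord n) S) (hs : tsupport u ⊆ c.source) :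
    ∫ x, (u x * lapAt g w x - w x * lapAt g u x) ∂(riemannianVolume g) = 0 := by
  set K := c '' tsupport u with hKdef
  have hK : IsCompact K := isCompact_image_tsupport hs
  have hKc : K ⊆ c.target := image_tsupport_subset hs
  have hnot {y : Coord n} (hy : y ∈ c.target) (hyK : y ∉ K) : c.symm y ∉ tsupport u :=
    fun h => hyK ⟨_, h, c.right_inv hy⟩
  obtain ⟨Y, hY, hY0, hdiv⟩ := exists_flux hg hc hu hw
  have hZ0 (i : Fin n) {y : Coord n} (hy : y ∉ K) : c.target.indicator (Y i) y = 0 := by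
    by_cases hyc : y ∈ c.target
    · rw [indicator_of_mem hyc]; exact hY0 y hyc (hnot hyc hy) i
    · exact indicator_of_notMem hyc _
  have hZ (i : Fin n) : ContDiff ℝ ∞ (c.target.indicator (Y i)) := by
    refine contDiff_iff_contDiffAt.mpr fun y => ?_
    by_cases hy : y ∈ c.target
    · refine ((hY i).contDiffAt (c.open_target.mem_nhds hy)).congr_of_eventuallyEq ?_
      filter_upwards [c.open_target.mem_nhds hy] with z hz using indicator_of_mem hz _
    · refine (contDiffAt_const (c := (0 : ℝ))).congr_of_eventuallyEq ?_
      filter_upwards [hK.isClosed.isOpen_compl.mem_nhds fun h => hy (hKc h)] with z hz using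
        hZ0 i hz
  have hZs (i : Fin n) : HasCompactSupport (c.target.indicator (Y i)) :=
    HasCompactSupport.intro hK fun y hy => hZ0 i hy
  rw [integral_riemannianVolume_of_subset hg hc (continuous_green hg hu hw) hKc]
  · have h1 : ∀ y ∈ K, (u (c.symm y) * lapAt g w (c.symm y) - w (c.symm y) * lapAt g u (c.symm y)) *
        √(metricComp g c y).det = ∑ i, pd i (c.target.indicator (Y i)) y := by
      intro y hy
      rw [← hdiv y (hKc hy)]
      exact Finset.sum_congr rfl fun i _ => pd_congr c.open_target
        (fun z hz => (indicator_of_mem hz _).symm) i (hKc hy)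
    have h2 (i : Fin n) : ∀ y ∉ K, pd i (c.target.indicator (Y i)) y = 0 := fun y hy =>
      (pd_congr hK.isClosed.isOpen_compl (χ := fun _ => 0) (fun z hz => hZ0 i hz) i hy).trans
        (LocalFlow.pd_const 0 i y)
    rw [setIntegral_congr_fun hK.measurableSet h1,
      setIntegral_eq_integral_of_forall_compl_eq_zero fun y hy =>
        Finset.sum_eq_zero fun i _ => h2 i y hy, integral_finsetSum]
    · exact Finset.sum_eq_zero fun i _ => integral_pd_eq_zero (hZ i) (hZs i) i
    · intro i _
      exact (((hZ i).continuous_fderiv (by simp)).clm_apply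
        continuous_const).integrable_of_hasCompactSupport ((hZs i).fderiv_apply ℝ _)
  · intro x hx
    have hxs : x ∉ tsupport u := fun h => hx (hs h) ⟨x, h, rfl⟩
    rw [image_eq_zero_of_notMem_tsupport hxs, lapAt_eq_zero hxs]
    ring

/-- Green's formula on a closed manifold. -/
theorem integral_green :
    ∫ x, (u x * lapAt g w x - w x * lapAt g u x) ∂(riemannianVolume g) = 0 := by
  obtain ⟨s, χ, hχ, hχs, hχ1⟩ := exists_partition n S
  have hχu (i : s) : SmoothFun n fun x => χ i x * u x := (hχ i).mul hu
  have hsum (x : S) : u x = ∑ i, χ i x * u x := by rw [← Finset.sum_mul, hχ1, one_mul]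
  -- Green's expression is linear in `u`, so it suffices to cut off this one function.
  have hlap (x : S) : lapAt g u x = ∑ i, lapAt g (fun x => χ i x * u x) x := by
    set c := chartAt (Coord n) x
    have hc : c ∈ atlas (Coord n) S := chart_mem_atlas _ x
    have hx : x ∈ c.source := mem_chart_source _ x
    have hu' : chartElem hc hu = ∑ i, chartElem hc (hχu i) :=
      chartElem_eq hc hu fun t y => by
        rw [map_sum, hsum]
        exact Finset.sum_congr rfl fun i _ => slice_mk (mem_univ t) y _
    have h1 := lapAt_chart hg hc hu ⟨c x, c.map_source hx⟩
    have h2 (i : s) := lapAt_chart hg hc (hχu i) ⟨c x, c.map_source hx⟩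
    simp only [c.left_inv hx] at h1 h2
    rw [h1, hu', MetricRing.lap_sum, map_sum]
    exact Finset.sum_congr rfl fun i _ => (h2 i).symm
  have h1 (x : S) : u x * lapAt g w x - w x * lapAt g u x = ∑ i, ((χ i x * u x) * lapAt g w x -
      w x * lapAt g (fun x => χ i x * u x) x) := by
    rw [Finset.sum_sub_distrib, ← Finset.sum_mul, ← Finset.mul_sum, ← hsum, ← hlap]
  simp only [h1]
  rw [integral_finsetSum _ fun i _ =>
    integrable_riemannianVolume hg (continuous_green hg (hχu i) hw)]
  refine Finset.sum_eq_zero fun i _ => integral_green_of_subset hg (hχu i) hw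
    (chart_mem_atlas (Coord n) (i : S)) ?_
  exact (closure_mono (Function.support_mul_subset_left _ _)).trans (hχs i)

end Green

/-! ### Surfaces -/

namespace MetricRing

section Surface

variable {A : Type*} [CommRing A] [Algebra ℝ A] (M : MetricRing A (Fin 2))

/-- The determinant of the inverse metric of a surface. -/
def detInv : A := M.gi 0 0 * M.gi 1 1 - M.gi 0 1 * M.gi 0 1

/-- In dimension two the inverse is the cofactor matrix up to the factor `detInv`. This and the next
two identities make `F²` a multiple of the metric. -/
theorem gi_one_one : M.gi 1 1 = M.detInv * M.g 0 0 := by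
  have h0 := congrFun (congrFun M.g_mul_gi 0) 0
  have h1 := congrFun (congrFun M.g_mul_gi 0) 1
  simp only [Matrix.mul_apply, Fin.sum_univ_two, Matrix.one_apply_eq, ne_eq, zero_ne_one,
    not_false_eq_true, Matrix.one_apply_ne] at h0 h1
  rw [M.gi_symm 1 0] at h0
  rw [detInv]
  linear_combination -M.gi 1 1 * h0 + M.gi 0 1 * h1

theorem gi_zero_one : M.gi 0 1 = -(M.detInv * M.g 0 1) := by
  have h0 := congrFun (congrFun M.g_mul_gi 0) 0
  have h1 := congrFun (congrFun M.g_mul_gi 0) 1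
  simp only [Matrix.mul_apply, Fin.sum_univ_two, Matrix.one_apply_eq, ne_eq, zero_ne_one,
    not_false_eq_true, Matrix.one_apply_ne] at h0 h1
  rw [M.gi_symm 1 0] at h0
  rw [detInv]
  linear_combination -M.gi 0 1 * h0 + M.gi 0 0 * h1

theorem gi_zero_zero : M.gi 0 0 = M.detInv * M.g 1 1 := by
  have h0 := congrFun (congrFun M.g_mul_gi 1) 0
  have h1 := congrFun (congrFun M.g_mul_gi 1) 1
  simp only [Matrix.mul_apply, Fin.sum_univ_two, Matrix.one_apply_eq, ne_eq, one_ne_zero,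
    not_false_eq_true, Matrix.one_apply_ne] at h0 h1
  rw [M.gi_symm 1 0] at h0
  rw [detInv]
  linear_combination -M.gi 0 0 * h1 + M.gi 0 1 * h0

theorem detInv_mul_det : M.detInv * (M.g 0 0 * M.g 1 1 - M.g 0 1 * M.g 0 1) = 1 := by
  have h0 := congrFun (congrFun M.g_mul_gi 0) 0
  simp only [Matrix.mul_apply, Fin.sum_univ_two, Matrix.one_apply_eq] at h0
  rw [M.gi_symm 1 0, gi_zero_zero, gi_zero_one] at h0
  linear_combination h0

/-- Antisymmetry in both index pairs leaves a single curvature component, so raised Ricci is a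
multiple of the identity. -/
theorem ric_surface : ∃ κ : A, ∀ i j, M.ric i j = κ * M.g i j := by
  have hd (i j l : Fin 2) : M.curvUp i j l l = 0 := by
    have h := M.curvUp_antisymm' i j l l
    exact two_mul_cancel (by linear_combination h)
  have hd' (i l m : Fin 2) : M.curvUp i i l m = 0 := by
    have h := M.curvUp_antisymm i i l m
    exact two_mul_cancel (by linear_combination h)
  have hU : ∀ k l, M.ricUp k l = M.curvUp 0 1 0 1 * (1 : Matrix (Fin 2) (Fin 2) A) k l := by
    intro k l
    rw [ricUp_eq, Fin.sum_univ_two]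
    fin_cases k <;> fin_cases l
    · simp [hd', M.curvUp_antisymm 1 0, M.curvUp_antisymm' 0 1 1 0]
    · simp [hd, hd']
    · simp [hd, hd']
    · simp [hd']
  refine ⟨M.curvUp 0 1 0 1, fun i j => ?_⟩
  have h1 : ∑ l, M.ricUp j l * M.g l i = M.ric i j := by
    simp only [ricUp, Finset.sum_mul]
    rw [Finset.sum_comm]
    have h2 (p : Fin 2) : ∑ l, M.ric p j * M.gi p l * M.g l i =
        M.ric p j * (1 : Matrix (Fin 2) (Fin 2) A) p i := by
      rw [← M.gi_mul_g, Matrix.mul_apply, Finset.mul_sum]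
      exact Finset.sum_congr rfl fun _ _ => mul_assoc _ _ _
    simp only [h2, Matrix.one_apply, mul_ite, mul_one, mul_zero, Finset.sum_ite_eq',
      Finset.mem_univ, if_true]
  rw [← h1]
  simp only [hU, Matrix.one_apply, mul_ite, mul_one, mul_zero, ite_mul, zero_mul,
    Finset.sum_ite_eq, Finset.mem_univ, if_true]
  rw [M.g_symm]

variable {F : Fin 2 → Fin 2 → A} (hF : ∀ i j, F i j = -F j i)
include hF

theorem form_diag (i : Fin 2) : F i i = 0 :=
  two_mul_cancel (by linear_combination hF i i)

/-- A two-form on a surface has one component; what remains of the inverse metric is the cofactor of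
an entry of `g`. -/
theorem formSq_surface (i j : Fin 2) :
    M.formSq F i j = F 0 1 ^ 2 * M.detInv * M.g i j := by
  have h0 := form_diag hF 0
  have h1 := form_diag hF 1
  have h10 := hF 1 0
  simp only [formSq, Fin.sum_univ_two]
  fin_cases i <;> fin_cases j
  · simp [h0, M.gi_one_one]; ring
  · simp [h0, h1, h10, M.gi_symm 1 0, M.gi_zero_one]; ring
  · simp [h0, h1, h10, M.gi_symm 1 0, M.gi_zero_one, M.g_symm 1 0]; ring
  · simp [h1, h10, M.gi_zero_zero]; ring

theorem formNormSq_surface : M.formNormSq F = 2 * (F 0 1 ^ 2 * M.detInv) := by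
  have h := M.detInv_mul_det
  simp only [formNormSq, M.formSq_surface hF, Fin.sum_univ_two, M.gi_symm 1 0, M.g_symm 1 0,
    M.gi_zero_zero, M.gi_zero_one, M.gi_one_one]
  linear_combination 2 * F 0 1 ^ 2 * M.detInv * h

omit hF

/-- The area form of a Hermitian metric. -/
theorem exists_areaForm {J : Matrix (Fin 2) (Fin 2) A} (hJ : J * J = -1)
    (hg : J * M.g * J.transpose = M.g) : ∃ α : A, IsUnit α ∧ α ^ 2 = M.g.det ∧
      (∀ k, J 0 k = α * M.gi 1 k) ∧ ∀ k, J 1 k = -(α * M.gi 0 k) := by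
  set w := J * M.g with hw
  -- `J g = J (J g Jᵀ) = -g Jᵀ`, so `J g` is antisymmetric, and its only component `w 0 1` serves as
  -- the area form.
  have hanti : w = -w.transpose := by
    rw [hw, Matrix.transpose_mul, M.g_transpose]
    have h1 : J * (J * M.g * J.transpose) = J * M.g := by rw [hg]
    rw [← h1, ← mul_assoc, ← mul_assoc, hJ]
    noncomm_ring
  have hw' (i j : Fin 2) : w i j = -w j i := congrFun (congrFun hanti i) j
  have h0 := form_diag hw' 0
  have h1 := form_diag hw' 1
  have h10 := hw' 1 0
  have hJw : J = w * M.gi := by rw [hw, mul_assoc, M.g_mul_gi, mul_one]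
  have hJ0 (k : Fin 2) : J 0 k = w 0 1 * M.gi 1 k := by
    rw [hJw, Matrix.mul_apply, Fin.sum_univ_two, h0]; ring
  have hJ1 (k : Fin 2) : J 1 k = -(w 0 1 * M.gi 0 k) := by
    rw [hJw, Matrix.mul_apply, Fin.sum_univ_two, h1, h10]; ring
  -- The upper left entry of `J² = -1` says that the square of the area form times the determinant
  -- of the inverse metric is `1`.
  have h2 := congrFun (congrFun hJ 0) 0
  rw [Matrix.mul_apply, Fin.sum_univ_two, hJ0, hJ0, hJ1, Matrix.neg_apply, Matrix.one_apply_eq,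
    M.gi_symm 1 0] at h2
  have h3 : w 0 1 ^ 2 * M.detInv = 1 := by rw [detInv]; linear_combination -h2
  have h4 := M.detInv_mul_det
  refine ⟨w 0 1, IsUnit.of_mul_eq_one (w 0 1 * M.detInv) (by linear_combination h3), ?_, hJ0, hJ1⟩
  rw [Matrix.det_fin_two, M.g_symm 1 0]
  linear_combination (M.g 0 0 * M.g 1 1 - M.g 0 1 * M.g 0 1) * h3 - w 0 1 ^ 2 * h4

/-- The curvature of the connection `d^c f` on a surface. -/
theorem curl_dc {J : Matrix (Fin 2) (Fin 2) A} {α : A} (hu : IsUnit α) (hα : α ^ 2 = M.g.det)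
    (h0 : ∀ k, J 0 k = α * M.gi 1 k) (h1 : ∀ k, J 1 k = -(α * M.gi 0 k)) (f : A) :
    M.d 0 (-∑ k, J 1 k * M.d k f) - M.d 1 (-∑ k, J 0 k * M.d k f) = α * M.lap f := by
  -- With the constant `1` as first function this is the Laplacian in divergence form, whose flux is
  -- the rotated differential of `f`.
  have h := M.sum_d_density (M.d_density hu hα) 1 f
  have hone (i : Fin 2) : M.d i (1 : A) = 0 := (M.d i).map_one_eq_zero
  have hgrad (i : Fin 2) : M.grad (1 : A) i = 0 := by simp [grad, hone]
  rw [M.lap_const hone] at h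
  simp only [hgrad, mul_zero, sub_zero, one_mul, Fin.sum_univ_two] at h
  rw [← h]
  have e0 : -∑ k, J 1 k * M.d k f = α * M.grad f 0 := by
    simp only [h1, grad, Finset.mul_sum, ← Finset.sum_neg_distrib]
    exact Finset.sum_congr rfl fun _ _ => by ring
  have e1 : -∑ k, J 0 k * M.d k f = -(α * M.grad f 1) := by
    simp only [h0, grad, Finset.mul_sum]
    congr 1
    exact Finset.sum_congr rfl fun _ _ => by ring
  rw [e0, e1, map_neg]
  ring

theorem formNormSq_eq_lap (hF : ∀ i j, F i j = -F j i) {α : A} (hα : α ^ 2 = M.g.det) {f : A}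
    (h : F 0 1 = α * M.lap f) : M.formNormSq F = 2 * M.lap f ^ 2 := by
  have h1 := M.detInv_mul_det
  rw [Matrix.det_fin_two, M.g_symm 1 0] at hα
  rw [M.formNormSq_surface hF, h]
  linear_combination 2 * M.lap f ^ 2 * h1 + 2 * M.lap f ^ 2 * M.detInv * hα

end Surface

end MetricRing

/-! ### Positivity -/

/-- The rows of `B` are coordinates in an orthonormal frame, in which contractions with `h` turn
into sums of squares. -/
theorem exists_eq_transpose_mul {k : ℕ} {h : Matrix (Fin k) (Fin k) ℝ} (hh : h.PosSemidef) :
    ∃ B : Matrix (Fin k) (Fin k) ℝ, h = B.transpose * B := by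
  open scoped MatrixOrder in
  obtain ⟨B, hB⟩ := CStarAlgebra.nonneg_iff_eq_star_mul_self.mp hh.nonneg
  exact ⟨B, hB⟩

section Positivity

variable {n : ℕ} {A : Type*} [CommRing A] [Algebra ℝ A] {M : MetricRing A (Fin n)}
  {G : Matrix (Fin n) (Fin n) ℝ} (hG : G.PosDef) {e : A →ₐ[ℝ] ℝ}
  (he : ∀ i j, G⁻¹ i j = e (M.gi i j))

include hG in
theorem exists_inv_eq_mul : ∃ C : Matrix (Fin n) (Fin n) ℝ, G⁻¹ = C.transpose * C :=
  exists_eq_transpose_mul hG.inv.posSemidef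

include hG he

theorem coInner_self_nonneg (a : Fin n → A) : 0 ≤ e (M.coInner a a) := by
  have h := hG.inv.posSemidef.dotProduct_mulVec_nonneg fun i => e (a i)
  have h2 : e (M.coInner a a) = star (fun i => e (a i)) ⬝ᵥ G⁻¹.mulVec fun i => e (a i) := by
    simp only [MetricRing.coInner, map_sum, map_mul, ← he, dotProduct, Matrix.mulVec,
      Finset.mul_sum]
    exact Finset.sum_congr rfl fun _ _ => Finset.sum_congr rfl fun _ _ => by
      simp only [Pi.star_apply, star_trivial]; ring
  rw [h2]
  exact h

/-- Writing `G⁻¹ = Cᵀ C`, the norm becomes the sum of the squared entries of `C s Cᵀ`. -/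
theorem tensorInner_self_nonneg (S : Fin n → Fin n → A) : 0 ≤ e (M.tensorInner S S) := by
  obtain ⟨C, hC⟩ := exists_inv_eq_mul hG
  set s : Matrix (Fin n) (Fin n) ℝ := Matrix.of fun i j => e (S i j) with hs
  have h1 : e (M.tensorInner S S) = (s * G⁻¹ * (s.transpose * G⁻¹)).trace := by
    simp only [MetricRing.tensorInner, map_sum, map_mul, Matrix.trace, Matrix.diag_apply,
      Matrix.mul_apply, Finset.sum_mul_sum, Matrix.transpose_apply, he, hs, Matrix.of_apply]
    refine Finset.sum_congr rfl fun i _ => ?_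
    rw [Finset.sum_comm_cycle]
    exact Finset.sum_congr rfl fun l _ => Finset.sum_congr rfl fun j _ =>
      Finset.sum_congr rfl fun k _ => by rw [M.gi_symm k i]; ring
  have h2 : (s * G⁻¹ * (s.transpose * G⁻¹)).trace =
      ((C * s * C.transpose) * (C * s * C.transpose).transpose).trace := by
    rw [hC, Matrix.transpose_mul, Matrix.transpose_mul, Matrix.transpose_transpose,
      Matrix.mul_assoc C s, Matrix.mul_assoc C, Matrix.trace_mul_comm C]
    simp only [Matrix.mul_assoc]
  have h3 : ((C * s * C.transpose) * (C * s * C.transpose).transpose).trace =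
      ∑ p, ∑ q, (C * s * C.transpose) p q ^ 2 := by
    rw [Matrix.trace]
    refine Finset.sum_congr rfl fun p _ => ?_
    rw [Matrix.diag_apply, Matrix.mul_apply]
    exact Finset.sum_congr rfl fun q _ => by rw [Matrix.transpose_apply, sq]
  rw [h1, h2, h3]
  exact Finset.sum_nonneg fun _ _ => Finset.sum_nonneg fun _ _ => sq_nonneg _

end Positivity

section PositivitySurface

variable {A : Type*} [CommRing A] [Algebra ℝ A] {M : MetricRing A (Fin 2)}
  {G : Matrix (Fin 2) (Fin 2) ℝ} (hG : G.PosDef) {e : A →ₐ[ℝ] ℝ}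
  (he : ∀ i j, G⁻¹ i j = e (M.gi i j))
include hG he

/-- The trace inequality in dimension two: expand the nonnegative norm of `2∇²f - (Δf) g`, using
`|g|² = 2` and that the trace of the Hessian is `Δf`. -/
theorem lap_sq_le (f : A) :
    e (M.lap f) ^ 2 ≤ 2 * e (M.tensorInner (M.hess f) (M.hess f)) := by
  -- The summand with coefficient zero is there to match the three-term expansion
  -- `tensorInner_combination`.
  have h := tensorInner_self_nonneg hG he fun i j =>
    2 * M.hess f i j + (-M.lap f * M.g i j + 0 * M.hess f i j)
  have hgg : M.tensorInner (fun i j => M.g i j) (fun i j => M.g i j) = 2 := by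
    have h0 := congrFun (congrFun M.gi_mul_g 0) 0
    have h1 := congrFun (congrFun M.gi_mul_g 1) 1
    simp only [Matrix.mul_apply, Fin.sum_univ_two, Matrix.one_apply_eq] at h0 h1
    rw [M.tensorInner_g, Fin.sum_univ_two, Fin.sum_univ_two, Fin.sum_univ_two]
    linear_combination h0 + h1 + (M.gi 0 1 - M.gi 1 0) * M.g_symm 0 1
  have hhg : M.tensorInner (fun i j => M.hess f i j) (fun i j => M.g i j) = M.lap f := by
    rw [M.tensorInner_symm, M.tensorInner_g]; rfl
  rw [M.tensorInner_combination 2 (-M.lap f) 0 (fun i j => M.hess f i j) (fun i j => M.g i j)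
    (fun i j => M.hess f i j), hgg, hhg] at h
  simp only [map_add, map_mul, map_neg, map_pow, map_ofNat, map_zero] at h
  linarith

end PositivitySurface

/-! ### The derivative of the entropy -/

section Entropy

variable {n k : ℕ} {S : Type*} [TopologicalSpace S] [ChartedSpace (Coord n) S]
  [IsManifold (𝓡 n) ∞ S]
  {E' H' : Type*} [NormedAddCommGroup E'] [NormedSpace ℝ E'] [FiniteDimensional ℝ E']
  [TopologicalSpace H'] {I' : ModelWithCorners ℝ E' H'} [I'.Boundaryless]
  {M : Type*} [TopologicalSpace M] [ChartedSpace H' M] [IsManifold I' ∞ M]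
  {P : TorusBundle n k S M I'} {B : Matrix (Fin k) (Fin k) ℝ}
  {T : Set ℝ} (hT : T.OrdConnected) (hT' : T.Nontrivial) {T₁ : ℝ} (hT₁ : ∀ t ∈ T, t < T₁)
  {g : ℝ → Metric n S} {μ : ℝ → PrincipalConnection P}
  (hflow : IsRYMFlow P (B.transpose * B) T g μ)
  {φ : ℝ → S → ℝ}

include hflow in
/-- A family of functions is smooth if it is given in charts by elements of the metric rings. -/
theorem smoothFamily_of_localFlow {Φ : ℝ → S → ℝ}
    (h : ∀ (c : OpenPartialHomeomorph S (Coord n)), c ∈ atlas (Coord n) S →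
      ∀ (V : Set (Coord n)) (hV : IsOpen V), V ⊆ c.target → ∀ _ : LocalFlow hT hT' B g μ c hV,
      ∃ x : SmoothRing (T ×ˢ V), ∀ (t : ℝ) (ht : t ∈ T) (y : V), Φ t (c.symm y) = slice ht y x) :
    SmoothFamily n T Φ := by
  intro c hc
  refine contDiffOn_of_local (Φ := fun s y => Φ s (c.symm y)) fun y hy => ?_
  obtain ⟨V, hV, hyV, hVc, ⟨L⟩⟩ := exists_localFlow hT hT' hflow hc hy
  obtain ⟨x, hx⟩ := h c hc V hV hVc L
  exact ⟨V, x, hV, hyV, hx⟩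

include hT hT' hflow in
theorem smoothFamily_curvNormSqAt : SmoothFamily n T fun s =>
    curvNormSqAt (B.transpose * B) (g s) (μ s).curv :=
  smoothFamily_of_localFlow hT hT' hflow fun _ hc _ _ hVc L =>
    ⟨_, fun _ ht y => L.slice_formNormSq hflow hc hVc ht y⟩

include hT hT' hflow in
theorem smoothFamily_yangMillsSqAt (hφ : SmoothFamily n T φ) : SmoothFamily n T fun s =>
    yangMillsSqAt (B.transpose * B) (g s) (μ s).curv (φ s) :=
  smoothFamily_of_localFlow hT hT' hflow fun _ hc _ _ hVc L =>
    ⟨_, fun _ ht y => L.slice_yangMills hflow hc hVc ht y hφ⟩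

include hT hT' hT₁ hflow in
theorem smoothFamily_solitonSqAt (hφ : SmoothFamily n T φ) : SmoothFamily n T fun s =>
    solitonSqAt (B.transpose * B) (g s) (μ s).curv (φ s) (T₁ - s) :=
  smoothFamily_of_localFlow hT hT' hflow fun _ hc _ _ hVc L =>
    ⟨(1 / 4 : ℝ) • _, fun _ ht y => by
      rw [map_smul, ← L.slice_soliton hT₁ hflow hc hVc ht y hφ, smul_eq_mul]; ring⟩

include hT hT' hT₁ hflow in
theorem lapAt_density (hφ : SmoothFamily n T φ) {t : ℝ} (ht : t ∈ T) (x : S) :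
    lapAt (g t) (density n (φ t) (T₁ - t)) x = density n (φ t) (T₁ - t) x *
      (gradSqAt (g t) (φ t) x - lapAt (g t) (φ t) x) := by
  set c := chartAt (Coord n) x
  have hc : c ∈ atlas (Coord n) S := chart_mem_atlas _ x
  have hx : x ∈ c.source := mem_chart_source _ x
  obtain ⟨V, hV, hyV, hVc, ⟨L⟩⟩ := exists_localFlow hT hT' hflow hc (c.map_source hx)
  have h1 := L.slice_lap hflow hc hVc ht ⟨_, hyV⟩ (LocalFlow.smoothFamily_density hT₁ hφ)
  have h2 := L.slice_lap hflow hc hVc ht ⟨_, hyV⟩ hφ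
  have h3 := L.slice_gradInner hflow hc hVc ht ⟨_, hyV⟩ hφ
  have h4 := LocalFlow.slice_elem hc hVc (LocalFlow.smoothFamily_density hT₁ hφ) ht ⟨_, hyV⟩
  simp only [c.left_inv hx] at h1 h2 h3 h4
  rw [h1, h2, h3, ← h4, L.R.lap_of_d_eq (L.d_weight hT₁ hc hVc hφ), map_mul, map_sub]

variable [T2Space S] [CompactSpace S] [MeasurableSpace S] [BorelSpace S]

/-- Green's formula against the constant function `1`. -/
theorem integral_lapAt {g : Metric n S} (hg : SmoothMetric g) {w : S → ℝ} (hw : SmoothFun n w) :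
    ∫ x, lapAt g w x ∂(riemannianVolume g) = 0 := by
  have h1 : SmoothFun n fun _ : S => (1 : ℝ) := fun _ _ => contDiffOn_const
  have h := integral_green hg h1 hw
  have h2 (x : S) : lapAt g (fun _ => 1) x = 0 := by
    have hpd (i : Fin n) (r : ℝ) : pd i (fun _ : Coord n => r) = fun _ => 0 := by
      ext y; exact LocalFlow.pd_const r i y
    simp [lapAt, Loc.lap, Loc.hess, hpd, Function.comp_def]
  simpa [h2] using h

include hT hT' hT₁ hflow

/-- The two integrands differ by `2τ Δu`, which is invisible to the integral. The version with `2Δf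
- |∇f|²` is the one obeying a pointwise evolution identity. -/
theorem entropy_eq_integral (hφ : IsConjugateHeat (B.transpose * B) T T₁ g μ φ) {t : ℝ} (ht : t ∈ T) :
    entropy (B.transpose * B) (g t) (μ t).curv (φ t) (T₁ - t) =
      ∫ x, entropyIntegrand (B.transpose * B) (g t) (μ t).curv (φ t) (T₁ - t) x *
        density n (φ t) (T₁ - t) x ∂(riemannianVolume (g t)) := by
  have hφ' := hφ.smoothFamily
  have hg := hflow.smoothMetric ht
  have hu := (LocalFlow.smoothFamily_density hT₁ hφ').smoothFun ht
  have hW := ((smoothFamily_entropyIntegrand hT hT' hflow hφ).mul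
    (LocalFlow.smoothFamily_density hT₁ hφ')).smoothFun ht
  have h1 (x : S) : ((T₁ - t) * (gradSqAt (g t) (φ t) x + scalAt (g t) x
      - (1 / 4) * curvNormSqAt (B.transpose * B) (g t) (μ t).curv x) + φ t x - n)
      * density n (φ t) (T₁ - t) x =
      entropyIntegrand (B.transpose * B) (g t) (μ t).curv (φ t) (T₁ - t) x *
        density n (φ t) (T₁ - t) x + 2 * (T₁ - t) * lapAt (g t) (density n (φ t) (T₁ - t)) x := by
    rw [lapAt_density hT hT' hT₁ hflow hφ' ht, entropyIntegrand]
    ring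
  rw [entropy, integral_congr_ae (Filter.Eventually.of_forall h1),
    integral_add (integrable_riemannianVolume hg hW.continuous)
      ((integrable_riemannianVolume hg (hu.lapAt hg).continuous).const_mul _),
    integral_const_mul, integral_lapAt hg hu, mul_zero, add_zero]

/-- The derivative of the entropy. -/
theorem hasDerivWithinAt_entropy (hφ : IsConjugateHeat (B.transpose * B) T T₁ g μ φ) {t : ℝ}
    (ht : t ∈ T) :
    HasDerivWithinAt (fun s => entropy (B.transpose * B) (g s) (μ s).curv (φ s) (T₁ - s))
      (∫ x, (2 * (T₁ - t) * solitonSqAt (B.transpose * B) (g t) (μ t).curv (φ t) (T₁ - t) x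
          + (T₁ - t) * yangMillsSqAt (B.transpose * B) (g t) (μ t).curv (φ t) x
          - (1 / 4) * curvNormSqAt (B.transpose * B) (g t) (μ t).curv x)
        * density n (φ t) (T₁ - t) x ∂(riemannianVolume (g t))) T t := by
  have hφ' := hφ.smoothFamily
  have hg := hflow.smoothMetric ht
  have hu := LocalFlow.smoothFamily_density hT₁ hφ'
  have hW := (smoothFamily_entropyIntegrand hT hT' hflow hφ).mul hu
  have hA : Continuous fun x =>
      (2 * (T₁ - t) * solitonSqAt (B.transpose * B) (g t) (μ t).curv (φ t) (T₁ - t) x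
        + (T₁ - t) * yangMillsSqAt (B.transpose * B) (g t) (μ t).curv (φ t) x
        - (1 / 4) * curvNormSqAt (B.transpose * B) (g t) (μ t).curv x)
      * density n (φ t) (T₁ - t) x :=
    (((continuous_const.mul
      ((smoothFamily_solitonSqAt hT hT' hT₁ hflow hφ').smoothFun ht).continuous).add
      (continuous_const.mul
        ((smoothFamily_yangMillsSqAt hT hT' hflow hφ').smoothFun ht).continuous)).sub
      (continuous_const.mul
        ((smoothFamily_curvNormSqAt hT hT' hflow).smoothFun ht).continuous)).mul
      (hu.smoothFun ht).continuous
  have hΔ := ((hW.smoothFun ht).lapAt hg)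
  have h1 := hasDerivWithinAt_integral hT hflow.smooth_metric hW ht (hA.sub hΔ.continuous)
    fun c hc y hy => hasDerivWithinAt_entropyIntegrand hT hT' hT₁ hflow hφ hc hy ht
  have h2 := h1.congr (fun s hs => entropy_eq_integral hT hT' hT₁ hflow hφ hs)
    (entropy_eq_integral hT hT' hT₁ hflow hφ ht)
  refine h2.congr_deriv ?_
  have h3 := integral_sub (integrable_riemannianVolume hg hA)
    (integrable_riemannianVolume hg hΔ.continuous)
  rw [integral_lapAt hg (hW.smoothFun ht), sub_zero] at h3
  exact h3

end Entropy

/-! ### The Dirichlet energy of a solution of the heat equation -/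

section Energy

variable {n k : ℕ} {S : Type*} [TopologicalSpace S] [ChartedSpace (Coord n) S]
  [IsManifold (𝓡 n) ∞ S]
  {E' H' : Type*} [NormedAddCommGroup E'] [NormedSpace ℝ E'] [FiniteDimensional ℝ E']
  [TopologicalSpace H'] {I' : ModelWithCorners ℝ E' H'} [I'.Boundaryless]
  {M : Type*} [TopologicalSpace M] [ChartedSpace H' M] [IsManifold I' ∞ M]
  {P : TorusBundle n k S M I'} {B : Matrix (Fin k) (Fin k) ℝ}
  {T : Set ℝ} {hT : T.OrdConnected} {hT' : T.Nontrivial} {T₁ : ℝ} (hT₁ : ∀ t ∈ T, t < T₁)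
  {g : ℝ → Metric n S} {μ : ℝ → PrincipalConnection P}
  (hflow : IsRYMFlow P (B.transpose * B) T g μ)
  {φ : ℝ → S → ℝ}
  {c : OpenPartialHomeomorph S (Coord n)} {V : Set (Coord n)} {hV : IsOpen V}

/-- `(Δ - ∂_t) |∇ψ|²`. -/
def gradDecay (T : Set ℝ) (g : ℝ → Metric n S) (ψ : ℝ → S → ℝ) (t : ℝ) (x : S) : ℝ :=
  lapAt (g t) (gradSqAt (g t) (ψ t)) x - derivWithin (fun s => gradSqAt (g s) (ψ s) x) T t

/-- Smooth solutions of the heat equation. -/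
structure IsHeat (T : Set ℝ) (g : ℝ → Metric n S) (ψ : ℝ → S → ℝ) : Prop where
  smooth : SmoothFamily n T ψ
  eq : ∀ t ∈ T, ∀ x, HasDerivWithinAt (fun s => ψ s x) (lapAt (g t) (ψ t) x) T t

variable {ψ : ℝ → S → ℝ} (hψ : IsHeat T g ψ)

namespace LocalFlow

variable (L : LocalFlow hT hT' B g μ c hV) (hc : c ∈ atlas (Coord n) S) (hVc : V ⊆ c.target)

/-- `2 |∇²ψ|² + F²(∇ψ, ∇ψ)`. -/
def decayElem (f : SmoothRing (T ×ˢ V)) : SmoothRing (T ×ˢ V) :=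
  2 * L.R.tensorInner (L.R.hess f) (L.R.hess f) + ∑ a,
    L.R.coInner (fun j => ∑ i, L.R.grad f i * L.F a i j) fun j => ∑ i, L.R.grad f i * L.F a i j

include hflow in
-- The Ricci term of the Bochner formula cancels the one created by the evolving metric, so what is
-- left has a sign.
theorem D_gradInner_heat : timeDeriv hT hT' hV (L.R.gradInner (elem hc hVc hψ.smooth)
      (elem hc hVc hψ.smooth)) =
    L.R.lap (L.R.gradInner (elem hc hVc hψ.smooth) (elem hc hVc hψ.smooth)) -
      L.decayElem (elem hc hVc hψ.smooth) := by
  have hf : timeDeriv hT hT' hV (elem hc hVc hψ.smooth) = L.R.lap (elem hc hVc hψ.smooth) := by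
    refine ext_slice fun t ht y => ?_
    rw [slice_timeDeriv hT hT' hV ht y (fun s hs => (slice_elem hc hVc hψ.smooth hs y).symm)
      (hψ.eq t ht (c.symm y)), L.slice_lap hflow hc hVc ht y hψ.smooth]
  have h := L.R.gradInner_heat_flow (F := L.F) (timeDeriv hT hT' hV) L.D_comm L.D_g hf
  rw [decayElem]
  linear_combination h

end LocalFlow

include hT hT' hflow in
theorem smoothFamily_gradSqAt (hψ : SmoothFamily n T ψ) :
    SmoothFamily n T fun s => gradSqAt (g s) (ψ s) :=
  smoothFamily_of_localFlow hT hT' hflow fun _ hc _ _ hVc L =>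
    ⟨_, fun _ ht y => L.slice_gradInner hflow hc hVc ht y hψ⟩

namespace LocalFlow

variable (L : LocalFlow hT hT' B g μ c hV) (hc : c ∈ atlas (Coord n) S) (hVc : V ⊆ c.target)

theorem elem_gradSqAt : elem hc hVc (smoothFamily_gradSqAt (hT := hT) (hT' := hT') hflow hψ.smooth) =
    L.R.gradInner (elem hc hVc hψ.smooth) (elem hc hVc hψ.smooth) :=
  ext_slice fun _ ht y => by
    rw [slice_elem, L.slice_gradInner hflow hc hVc ht y hψ.smooth]

include hflow in
-- `gradDecay` is defined without reference to charts, hence can be integrated; locally it is the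
-- manifestly nonnegative expression `decayElem`.
theorem slice_gradDecay {t : ℝ} (ht : t ∈ T) (y : V) :
    gradDecay T g ψ t (c.symm y) = slice ht y (L.decayElem (elem hc hVc hψ.smooth)) := by
  have h1 := L.slice_lap hflow hc hVc ht y (smoothFamily_gradSqAt (hT := hT) (hT' := hT') hflow hψ.smooth)
  rw [L.elem_gradSqAt hflow hψ hc hVc] at h1
  have h2 := hasDerivWithinAt_slice hT hT' hV ht y
    (ψ := fun s => gradSqAt (g s) (ψ s) (c.symm y)) fun s hs =>
      L.slice_gradInner hflow hc hVc hs y hψ.smooth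
  rw [gradDecay, h1, h2.derivWithin ((uniqueDiffOn_of_ordConnected hT hT').1 t ht),
    L.D_gradInner_heat hflow hψ hc hVc, map_sub]
  ring

end LocalFlow

variable (hT hT')

include hT hT' hflow hψ in
theorem smoothFamily_gradDecay : SmoothFamily n T fun s => gradDecay T g ψ s :=
  smoothFamily_of_localFlow hT hT' hflow fun _ hc _ _ hVc L =>
    ⟨_, fun _ ht y => L.slice_gradDecay hflow hψ hc hVc ht y⟩

include hT hT' hT₁ hflow hψ in
-- The Laplacian of the energy density and that of the weight are kept together in the antisymmetric
-- form to which Green's formula applies.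
theorem hasDerivWithinAt_gradSqAt (hφ : IsConjugateHeat (B.transpose * B) T T₁ g μ φ)
    (hc : c ∈ atlas (Coord n) S) {y : Coord n} (hy : y ∈ c.target) {t : ℝ} (ht : t ∈ T) :
    HasDerivWithinAt (fun s => gradSqAt (g s) (ψ s) (c.symm y) *
        density n (φ s) (T₁ - s) (c.symm y) * √(metricComp (g s) c y).det)
      ((-(gradDecay T g ψ t (c.symm y) * density n (φ t) (T₁ - t) (c.symm y)) +
        (density n (φ t) (T₁ - t) (c.symm y) * lapAt (g t) (gradSqAt (g t) (ψ t)) (c.symm y) -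
        gradSqAt (g t) (ψ t) (c.symm y) * lapAt (g t) (density n (φ t) (T₁ - t)) (c.symm y))) *
        √(metricComp (g t) c y).det) T t := by
  obtain ⟨V, hV, hyV, hVc, ⟨L⟩⟩ := exists_localFlow hT hT' hflow hc hy
  have hsmu := LocalFlow.smoothFamily_density hT₁ hφ.smoothFamily
  have hgs := smoothFamily_gradSqAt (hT := hT) (hT' := hT') hflow hψ.smooth
  have h1 := L.R.D_weighted_flow (timeDeriv hT hT' hV) L.D_g (L.D_elem hT₁ hflow hc hVc hφ)
    (L.d_weight hT₁ hc hVc hφ.smoothFamily)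
    (by rw [Fintype.card_fin]; exact LocalFlow.D_weight hT₁ hc hVc hφ.smoothFamily)
    (L.two_mul_D_vol hc hVc) (LocalFlow.elem hc hVc hgs)
  have h2 := hasDerivWithinAt_slice hT hT' hV ht ⟨y, hyV⟩
    (x := LocalFlow.elem hc hVc hgs * LocalFlow.weight hT₁ hc hVc hφ.smoothFamily * L.vol hc hVc)
    (ψ := fun s => gradSqAt (g s) (ψ s) (c.symm y) *
        density n (φ s) (T₁ - s) (c.symm y) * √(metricComp (g s) c y).det) (by
      intro s hs
      rw [map_mul, map_mul, L.slice_vol, LocalFlow.slice_elem, LocalFlow.slice_elem])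
  refine h2.congr_deriv ?_
  have h3 := L.D_gradInner_heat hflow hψ hc hVc
  rw [← L.elem_gradSqAt hflow hψ hc hVc] at h3
  rw [h1, h3]
  have h4 := L.slice_gradDecay hflow hψ hc hVc ht ⟨y, hyV⟩
  have h5 := L.slice_lap hflow hc hVc ht ⟨y, hyV⟩ hgs
  have h6 := L.slice_lap hflow hc hVc ht ⟨y, hyV⟩ hsmu
  simp only [map_mul, map_sub]
  rw [L.slice_vol, LocalFlow.slice_elem, LocalFlow.slice_elem, ← h4, ← h5, ← h6]
  ring

variable [T2Space S] [CompactSpace S] [MeasurableSpace S] [BorelSpace S]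

include hT hT' hT₁ hflow hψ in
theorem hasDerivWithinAt_integral_gradSqAt (hφ : IsConjugateHeat (B.transpose * B) T T₁ g μ φ)
    {t : ℝ} (ht : t ∈ T) :
    HasDerivWithinAt (fun s => ∫ x, gradSqAt (g s) (ψ s) x * density n (φ s) (T₁ - s) x
        ∂(riemannianVolume (g s)))
      (-∫ x, gradDecay T g ψ t x * density n (φ t) (T₁ - t) x ∂(riemannianVolume (g t))) T t := by
  have hg := hflow.smoothMetric ht
  have hu := LocalFlow.smoothFamily_density hT₁ hφ.smoothFamily
  have hw := smoothFamily_gradSqAt (hT := hT) (hT' := hT') hflow hψ.smooth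
  have hA : Continuous fun x => gradDecay T g ψ t x * density n (φ t) (T₁ - t) x :=
    ((smoothFamily_gradDecay hT hT' hflow hψ).smoothFun ht).continuous.mul
      (hu.smoothFun ht).continuous
  have hB := continuous_green hg (hu.smoothFun ht) (hw.smoothFun ht)
  have h1 := hasDerivWithinAt_integral hT hflow.smooth_metric (hw.mul hu) ht (hA.neg.add hB)
    fun c hc y hy => hasDerivWithinAt_gradSqAt hT hT' hT₁ hflow hψ hφ hc hy ht
  refine h1.congr_deriv ?_
  have h2 := integral_add (integrable_riemannianVolume hg hA).neg
    (integrable_riemannianVolume hg hB)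
  rw [integral_green hg (hu.smoothFun ht) (hw.smoothFun ht), add_zero, integral_neg'] at h2
  exact h2

end Energy

/-! ### Complex structures in charts -/

section ComplexStructure

variable {n k : ℕ} {S : Type*} [TopologicalSpace S] [ChartedSpace (Coord n) S]

/-- A complex structure at a point, on the model space. -/
def ComplexStructure.endAt (C : ComplexStructure n S) (x : S) : Coord n →L[ℝ] Coord n := C.J x

/-- The form `d^c f` at a point, on the model space. -/
def dcAt (C : ComplexStructure n S) (f : S → (Fin k → ℝ)) (x : S) (v : Coord n) : Fin k → ℝ :=
  -tmap (𝓡 n) 𝓘(ℝ, Fin k → ℝ) f x (C.endAt x v)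

/-- The components of a complex structure in a chart. -/
def ComplexStructure.comp (C : ComplexStructure n S) (c : OpenPartialHomeomorph S (Coord n))
    (y : Coord n) : Matrix (Fin n) (Fin n) ℝ :=
  Matrix.of fun i l => vecCoord c (c.symm y) (C.J (c.symm y) (coordVec c y i)) l

variable [IsManifold (𝓡 n) ∞ S] {c : OpenPartialHomeomorph S (Coord n)}
  (hc : c ∈ atlas (Coord n) S) (C : ComplexStructure n S) {y : Coord n} (hy : y ∈ c.target)

include hc hy

theorem ComplexStructure.endAt_frameVec (i : Fin n) :
    C.endAt (c.symm y) (frameVec c y i) = ∑ l, C.comp c y i l • frameVec c y l := by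
  have h := eq_sum_frameVec hc (c.map_target hy) (C.endAt (c.symm y) (frameVec c y i))
  rw [c.right_inv hy] at h
  exact h

theorem ComplexStructure.comp_mul_comp : C.comp c y * C.comp c y = -1 := by
  ext i j
  have h1 : C.endAt (c.symm y) (C.endAt (c.symm y) (frameVec c y i)) = -frameVec c y i := C.sq _ _
  rw [C.endAt_frameVec hc hy, map_sum] at h1
  simp only [map_smul, C.endAt_frameVec hc hy] at h1
  have h2 := congrArg (fun v => chartDeriv c (c.symm y) v j) h1
  simp only [map_sum, map_smul, map_neg, WithLp.ofLp_sum, WithLp.ofLp_smul, WithLp.ofLp_neg,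
    Finset.sum_apply, Pi.smul_apply, Pi.neg_apply, smul_eq_mul, chartDeriv_frameVec hc hy] at h2
  rw [Matrix.mul_apply, Matrix.neg_apply, ← h2]
  simp [Matrix.one_apply]

theorem IsHermitian.comp_mul {C : ComplexStructure n S} {g : Metric n S} (h : IsHermitian C g) :
    C.comp c y * metricComp g c y * (C.comp c y).transpose = metricComp g c y := by
  ext i j
  have h1 : innerAt g (c.symm y) (C.endAt (c.symm y) (frameVec c y i))
      (C.endAt (c.symm y) (frameVec c y j)) = innerAt g (c.symm y) (frameVec c y i) (frameVec c y j) :=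
    h _ _ _
  rw [← metricComp_apply] at h1
  rw [← h1, C.endAt_frameVec hc hy, C.endAt_frameVec hc hy]
  simp only [map_sum, map_smul, sum_apply, smul_apply, smul_eq_mul, Matrix.mul_apply,
    Matrix.transpose_apply, Finset.sum_mul, Finset.mul_sum, ← metricComp_apply]
  refine Finset.sum_congr rfl fun p _ => Finset.sum_congr rfl fun q _ => ?_
  ring

theorem dcAt_frameVec {f : S → (Fin k → ℝ)}
    (hf : MDifferentiableAt (𝓡 n) 𝓘(ℝ, Fin k → ℝ) f (c.symm y)) (j : Fin n) (a : Fin k) :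
    dcAt C f (c.symm y) (frameVec c y j) a =
      -∑ l, C.comp c y j l * pd l (fun z => f (c.symm z) a) y := by
  have hs := (mdifferentiable_chart hc).mdifferentiableAt_symm hy
  have h1 : dmap 𝓘(ℝ, Fin k → ℝ) (f ∘ c.symm) y =
      (tmap (𝓡 n) 𝓘(ℝ, Fin k → ℝ) f (c.symm y)).comp (dmap (𝓡 n) c.symm y) :=
    dmap_comp_left hf hs
  rw [dmap_self] at h1
  have hd : DifferentiableAt ℝ (f ∘ c.symm) y := (hf.comp y hs).differentiableAt
  have h2 (l : Fin n) : pd l (fun z => f (c.symm z) a) y =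
      tmap (𝓡 n) 𝓘(ℝ, Fin k → ℝ) f (c.symm y) (frameVec c y l) a := by
    have h3 := ((ContinuousLinearMap.proj (R := ℝ) (φ := fun _ : Fin k => ℝ) a).hasFDerivAt.comp y
      hd.hasFDerivAt).fderiv
    rw [h1] at h3
    exact congrArg (fun L => L (EuclideanSpace.single l (1 : ℝ) : Coord n)) h3
  rw [dcAt, C.endAt_frameVec hc hy, map_sum, Pi.neg_apply, Finset.sum_apply]
  simp only [map_smul, Pi.smul_apply, smul_eq_mul, h2]

end ComplexStructure

/-! ### The flow on surfaces -/

section Surface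

variable {k : ℕ} {S : Type*} [TopologicalSpace S] [ChartedSpace (Coord 2) S]
  [IsManifold (𝓡 2) ∞ S]
  {E' H' : Type*} [NormedAddCommGroup E'] [NormedSpace ℝ E'] [FiniteDimensional ℝ E']
  [TopologicalSpace H'] {I' : ModelWithCorners ℝ E' H'} [I'.Boundaryless]
  {M : Type*} [TopologicalSpace M] [ChartedSpace H' M] [IsManifold I' ∞ M]
  {P : TorusBundle 2 k S M I'} {B : Matrix (Fin k) (Fin k) ℝ}
  {T : Set ℝ} {hT : T.OrdConnected} {hT' : T.Nontrivial}
  {g : ℝ → Metric 2 S} {μ : ℝ → PrincipalConnection P}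
  (hflow : IsRYMFlow P (B.transpose * B) T g μ)
  {c : OpenPartialHomeomorph S (Coord 2)} (hc : c ∈ atlas (Coord 2) S)
  {V : Set (Coord 2)} {hV : IsOpen V} (hVc : V ⊆ c.target)

namespace LocalFlow

variable (L : LocalFlow hT hT' B g μ c hV)

/-- On a surface both Ricci and `F²` are multiples of the metric, so the flow moves the metric
conformally. -/
theorem exists_D_g_eq_mul : ∃ ρ, ∀ i j, timeDeriv hT hT' hV (L.R.g i j) = ρ * L.R.g i j := by
  obtain ⟨κ, hκ⟩ := L.R.ric_surface
  refine ⟨-2 * κ + ∑ b, L.F b 0 1 ^ 2 * L.R.detInv, fun i j => ?_⟩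
  have h (b : Fin k) : L.R.formSq (fun i j => ∑ a, B b a • L.X a i j) i j =
      L.F b 0 1 ^ 2 * L.R.detInv * L.R.g i j := L.R.formSq_surface (L.F_antisymm b) i j
  rw [L.D_g, hκ, Finset.sum_congr rfl fun b _ => h b, ← Finset.sum_mul]
  ring

include hc hVc

include L in
/-- The conformal class is preserved. -/
theorem metricComp_mul_comm {s t : ℝ} (hs : s ∈ T) (ht : t ∈ T) {y : Coord 2} (hy : y ∈ V)
    (i j : Fin 2) : metricComp (g t) c y i j * metricComp (g s) c y 0 0 =
      metricComp (g s) c y i j * metricComp (g t) c y 0 0 := by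
  obtain ⟨ρ, hρ⟩ := L.exists_D_g_eq_mul
  have hpos (t : ℝ) : metricComp (g t) c y 0 0 ≠ 0 :=
    (metricComp_posDef hc (g t) (hVc hy)).diag_pos.ne'
  have hd (t) (ht : t ∈ T) (i j) : HasDerivWithinAt (fun s => metricComp (g s) c y i j)
      (slice ht ⟨y, hy⟩ ρ * metricComp (g t) c y i j) T t := by
    have h := hasDerivWithinAt_slice hT hT' hV ht ⟨y, hy⟩
      (ψ := fun s => metricComp (g s) c y i j) fun s hs => (L.realizes hs).g_eq ⟨y, hy⟩ i j
    rwa [hρ, map_mul, ← (L.realizes ht).g_eq ⟨y, hy⟩ i j] at h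
  -- Both components solve the same linear equation in time, so their quotient has derivative zero;
  -- the mean value inequality with constant `0` then makes it constant.
  have hq (t) (ht : t ∈ T) : HasDerivWithinAt
      (fun s => metricComp (g s) c y i j / metricComp (g s) c y 0 0) 0 T t :=
    ((hd t ht i j).div (hd t ht 0 0) (hpos t)).congr_deriv (by
      rw [div_eq_zero_iff]; left; ring)
  have h := hT.convex.norm_image_sub_le_of_norm_hasDerivWithin_le (C := 0) hq (by simp) hs ht
  rw [zero_mul] at h
  exact (div_eq_div_iff (hpos t) (hpos s)).mp (sub_eq_zero.mp (norm_le_zero_iff.mp h))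

/-- The components of a complex structure, as smooth functions. -/
def complexElem (C : ComplexStructure 2 S) : Matrix (Fin 2) (Fin 2) (SmoothRing (T ×ˢ V)) :=
  Matrix.of fun i l => SmoothRing.mk (fun q => C.comp c q.2 i l)
    ((C.smooth c hc i l).comp contDiffOn_snd fun _ hq => hVc hq.2)

omit [IsManifold (𝓡 2) ∞ S] in
theorem slice_complexElem (C : ComplexStructure 2 S) {t : ℝ} (ht : t ∈ T) (y : V) (i l : Fin 2) :
    slice ht y (complexElem hc hVc C i l) = C.comp c y i l := by
  exact slice_mk ht y (Φ := fun q => C.comp c q.2 i l)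
    ((C.smooth c hc i l).comp contDiffOn_snd fun _ hq => hVc hq.2)

theorem complexElem_mul_self (C : ComplexStructure 2 S) :
    complexElem (T := T) hc hVc C * complexElem hc hVc C = -1 := by
  ext i j
  refine ext_slice fun t ht y => ?_
  have h := congrFun (congrFun (C.comp_mul_comp hc (hVc y.2)) i) j
  rw [Matrix.mul_apply] at h
  rw [Matrix.mul_apply, map_sum]
  simp only [map_mul, slice_complexElem, h, Matrix.neg_apply, map_neg, Matrix.one_apply]
  split_ifs <;> simp

/-- Compatibility with a complex structure depends on the conformal class alone, so it passes from
time `s` to every time. -/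
theorem complexElem_mul_g {C : ComplexStructure 2 S} {s : ℝ} (hs : s ∈ T)
    (hC : IsHermitian C (g s)) :
    complexElem hc hVc C * L.R.g * (complexElem hc hVc C).transpose = L.R.g := by
  ext i j
  refine ext_slice fun t ht y => ?_
  have hpos (t : ℝ) : metricComp (g t) c y 0 0 ≠ 0 :=
    (metricComp_posDef hc (g t) (hVc y.2)).diag_pos.ne'
  have h1 : metricComp (g t) c y =
      (metricComp (g t) c y 0 0 / metricComp (g s) c y 0 0) • metricComp (g s) c y := by
    ext i j
    rw [Matrix.smul_apply, smul_eq_mul, div_mul_eq_mul_div, eq_div_iff (hpos s),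
      L.metricComp_mul_comm hc hVc hs ht y.2]
    ring
  have h2 : C.comp c y * metricComp (g t) c y * (C.comp c y).transpose = metricComp (g t) c y := by
    rw [h1, Matrix.mul_smul, Matrix.smul_mul, hC.comp_mul hc (hVc y.2)]
  have h3 := congrFun (congrFun h2 i) j
  rw [← (L.realizes ht).g_eq y i j, ← h3]
  simp only [Matrix.mul_apply, Matrix.transpose_apply, map_sum, map_mul, slice_complexElem,
    (L.realizes ht).g_eq]

end LocalFlow

end Surface

/-! ### Potential functions -/

section Potential

variable {k : ℕ} {S : Type*} [TopologicalSpace S] [ChartedSpace (Coord 2) S]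
  [IsManifold (𝓡 2) ∞ S]
  {E' H' : Type*} [NormedAddCommGroup E'] [NormedSpace ℝ E'] [FiniteDimensional ℝ E']
  [TopologicalSpace H'] {I' : ModelWithCorners ℝ E' H'} [I'.Boundaryless]
  {M : Type*} [TopologicalSpace M] [ChartedSpace H' M] [IsManifold I' ∞ M]
  {P : TorusBundle 2 k S M I'} {B : Matrix (Fin k) (Fin k) ℝ}
  {T : Set ℝ} {hT : T.OrdConnected} {hT' : T.Nontrivial}
  {g : ℝ → Metric 2 S} {μ : ℝ → PrincipalConnection P}
  (hflow : IsRYMFlow P (B.transpose * B) T g μ)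
  {C : ComplexStructure 2 S} {μ₀ : PrincipalConnection P} {f : ℝ → S → (Fin k → ℝ)}
  (hf : IsPotential C T g μ μ₀ f)
  {c : OpenPartialHomeomorph S (Coord 2)} (hc : c ∈ atlas (Coord 2) S)
  {V : Set (Coord 2)} {hV : IsOpen V} (hVc : V ⊆ c.target)

/-- The components of the potential functions in an orthonormal frame of `𝔱ᵏ`. -/
def frameComp (B : Matrix (Fin k) (Fin k) ℝ) (f : ℝ → S → (Fin k → ℝ)) (b : Fin k) (t : ℝ)
    (x : S) : ℝ := ∑ a, B b a * f t x a

namespace IsPotential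

include hf

theorem smoothFamily (a : Fin k) : SmoothFamily 2 T fun s x => f s x a :=
  fun _ hc => contDiffOn_pi.mp (contDiffOn_chart_of_contMDiffOn hf.smooth hc) a

theorem mdifferentiableAt {t : ℝ} (ht : t ∈ T) (x : S) :
    MDifferentiableAt (𝓡 2) 𝓘(ℝ, Fin k → ℝ) (f t) x := by
  have h : ContMDiff (𝓡 2) 𝓘(ℝ, Fin k → ℝ) ∞ (f t) := by
    have h1 : ContMDiff (𝓡 2) (𝓘(ℝ, ℝ).prod (𝓡 2)) ∞ fun x : S => (t, x) :=
      contMDiff_const.prodMk contMDiff_id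
    exact hf.smooth.comp_contMDiff h1 fun x => ⟨ht, mem_univ x⟩
  exact h.mdifferentiable (by simp) x

theorem gauge_sub {σ : Coord 2 → M} (hV : IsOpen V)
    (hσ : ContMDiffOn 𝓘(ℝ, Coord 2) I' ∞ σ V) (hs : ∀ z ∈ V, P.proj (σ z) = c.symm z)
    {t : ℝ} (ht : t ∈ T) {y : Coord 2} (hy : y ∈ V) (j : Fin 2) (a : Fin k) :
    (μ t).gauge σ y (EuclideanSpace.single j 1) a - μ₀.gauge σ y (EuclideanSpace.single j 1) a =
      dcAt C (f t) (c.symm y) (frameVec c y j) a := by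
  have h1 : (μ t).gauge σ y (EuclideanSpace.single j 1) =
      μ₀.gauge σ y (EuclideanSpace.single j 1) + dcAt C (f t) (P.proj (σ y))
        (tmap I' (𝓡 2) P.proj (σ y) (dmap I' σ y (EuclideanSpace.single j 1))) :=
    hf.connection_eq t ht (σ y) (dmap I' σ y (EuclideanSpace.single j 1))
  rw [tmap_proj_section hV hσ hs hy, hs y hy] at h1
  rw [h1, Pi.add_apply, add_sub_cancel_left]
  rfl

end IsPotential

namespace LocalFlow

variable (L : LocalFlow hT hT' B g μ c hV)

/-- The difference of the two connection forms in a section is `d^c f`. Taking exterior derivatives,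
the background contributes nothing because it is flat. -/
theorem X_eq_curl (a : Fin k) : L.X a 0 1 =
    L.R.d 0 (-∑ l, complexElem hc hVc C 1 l * L.R.d l (elem hc hVc (hf.smoothFamily a))) -
      L.R.d 1 (-∑ l, complexElem hc hVc C 0 l * L.R.d l (elem hc hVc (hf.smoothFamily a))) := by
  refine ext_slice fun t ht y => ?_
  obtain ⟨W, σ, hW, hyW, hWc, hσ, hs⟩ := exists_chart_section (P := P) hc (hVc y.2)
  set θ : Fin 2 → SmoothRing (T ×ˢ V) := fun j =>
    -∑ l, complexElem hc hVc C j l * L.R.d l (elem hc hVc (hf.smoothFamily a)) with hθ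
  have h0 : formComp μ₀.curv c a 0 1 y = 0 := by rw [formComp, hf.flat]; rfl
  have h1 (i j : Fin 2) : pd i (fun z => (μ t).gauge σ z (EuclideanSpace.single j 1) a) y -
      pd i (fun z => μ₀.gauge σ z (EuclideanSpace.single j 1) a) y =
      slice ht y (L.R.d i (θ j)) := by
    have hd (ν : PrincipalConnection P) : DifferentiableAt ℝ
        (fun z => ν.gauge σ z (EuclideanSpace.single j 1) a) y := by
      have h := (differentiableAt_gauge hW hσ ν hyW).clm_apply
        (differentiableAt_const (EuclideanSpace.single j (1 : ℝ) : Coord 2))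
      exact differentiableAt_pi.mp h a
    have h2 := fderiv_fun_sub (hd (μ t)) (hd μ₀)
    have h3 := congrArg (fun A => A (EuclideanSpace.single i (1 : ℝ) : Coord 2)) h2
    refine h3.symm.trans ?_
    rw [← (L.realizes ht).pd_eq (fun z => (θ j).toFun (t, z)) (θ j)
      (fun z => (slice_apply ht z _).symm) i y]
    refine pd_congr (hV.inter hW) (fun z hz => ?_) i ⟨y.2, hyW⟩
    rw [hf.gauge_sub hW hσ hs ht hz.2, dcAt_frameVec hc C (hVc hz.1) (hf.mdifferentiableAt ht _),
      ← slice_apply ht ⟨z, hz.1⟩, hθ, map_neg, map_sum]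
    simp only [map_mul, slice_complexElem]
    congr 1
    refine Finset.sum_congr rfl fun l _ => ?_
    rw [(L.realizes ht).pd_eq (fun z => f t (c.symm z) a) _
      (fun z => (slice_elem hc hVc (hf.smoothFamily a) ht z).symm) l ⟨z, hz.1⟩]
  rw [← L.X_eq ht, map_sub, ← h1, ← h1, formComp_curv hW hσ hWc hs hc (μ t) hyW]
  rw [formComp_curv hW hσ hWc hs hc μ₀ hyW] at h0
  linear_combination h0

end LocalFlow

include hf in
theorem smoothFamily_frameComp (b : Fin k) : SmoothFamily 2 T (frameComp B f b) :=
  fun c hc => ContDiffOn.sum fun a _ => contDiffOn_const.mul (hf.smoothFamily a c hc)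

namespace LocalFlow

variable (L : LocalFlow hT hT' B g μ c hV)

theorem elem_frameComp (b : Fin k) : elem hc hVc (smoothFamily_frameComp (B := B) hf b) =
    ∑ a, B b a • elem hc hVc (hf.smoothFamily a) := by
  refine ext_slice fun t ht y => ?_
  rw [slice_elem, map_sum]
  simp only [map_smul, slice_elem, smul_eq_mul, frameComp]

theorem lap_frameComp (b : Fin k) : L.R.lap (elem hc hVc (smoothFamily_frameComp (B := B) hf b)) =
    ∑ a, B b a • L.R.lap (elem hc hVc (hf.smoothFamily a)) := by
  rw [elem_frameComp hf hc hVc b, L.R.lap_sum]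
  refine Finset.sum_congr rfl fun a _ => ?_
  rw [Algebra.smul_def, L.R.lap_const_mul fun i => (L.R.d i).map_algebraMap _, ← Algebra.smul_def]

/-- On a surface, the norm of the curvature is given by the Laplacians of the potentials. -/
theorem formNormSq_F {s : ℝ} (hs : s ∈ T) (hC : IsHermitian C (g s)) (b : Fin k) :
    L.R.formNormSq (L.F b) =
      2 * L.R.lap (elem hc hVc (smoothFamily_frameComp (B := B) hf b)) ^ 2 := by
  obtain ⟨α, hu, hα, h0, h1⟩ := L.R.exists_areaForm (complexElem_mul_self hc hVc C)
    (L.complexElem_mul_g hc hVc hs hC)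
  refine L.R.formNormSq_eq_lap (L.F_antisymm b) hα ?_
  rw [L.lap_frameComp hf hc hVc, F, Finset.mul_sum]
  refine Finset.sum_congr rfl fun a _ => ?_
  rw [L.X_eq_curl hf hc hVc, L.R.curl_dc hu hα h0 h1, mul_smul_comm]

end LocalFlow

include hT hT' hflow hf in
theorem isHeat_frameComp (b : Fin k) : IsHeat T g (frameComp B f b) := by
  refine ⟨smoothFamily_frameComp hf b, fun t ht x => ?_⟩
  have h1 : HasDerivWithinAt (fun s => frameComp B f b s x)
      (∑ a, B b a * lapAt (g t) (fun z => f t z a) x) T t :=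
    HasDerivWithinAt.fun_sum fun a _ => (hf.heat_eq t ht x a).const_mul _
  refine h1.congr_deriv ?_
  have hc := chart_mem_atlas (Coord 2) x
  have hx := mem_chart_source (Coord 2) x
  obtain ⟨V, hV, hyV, hVc, ⟨L⟩⟩ := exists_localFlow hT hT' hflow hc
    ((chartAt (Coord 2) x).map_source hx)
  have h2 := L.slice_lap hflow hc hVc ht ⟨_, hyV⟩ (smoothFamily_frameComp (B := B) hf b)
  have h3 (a : Fin k) := L.slice_lap hflow hc hVc ht ⟨_, hyV⟩ (hf.smoothFamily a)
  simp only [OpenPartialHomeomorph.left_inv _ hx] at h2 h3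
  rw [h2, L.lap_frameComp hf hc hVc, map_sum]
  exact Finset.sum_congr rfl fun a _ => by rw [map_smul, h3, smul_eq_mul]

include hT hT' hflow hf in
theorem vecGradSqAt_eq_sum {t : ℝ} (ht : t ∈ T) (x : S) :
    vecGradSqAt (B.transpose * B) (g t) (f t) x = ∑ b, gradSqAt (g t) (frameComp B f b t) x := by
  have hc := chart_mem_atlas (Coord 2) x
  have hx := mem_chart_source (Coord 2) x
  obtain ⟨V, hV, hyV, hVc, ⟨L⟩⟩ := exists_localFlow hT hT' hflow hc
    ((chartAt (Coord 2) x).map_source hx)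
  have h2 (b : Fin k) := L.slice_gradInner hflow hc hVc ht ⟨_, hyV⟩
    (smoothFamily_frameComp (B := B) hf b)
  simp only [OpenPartialHomeomorph.left_inv _ hx] at h2
  simp only [h2, ← map_sum]
  refine (L.realizes ht).covecNormSq_eq (X := fun b i => L.R.d i
    (LocalFlow.elem hc hVc (smoothFamily_frameComp (B := B) hf b))) B ⟨_, hyV⟩ fun b i => ?_
  rw [LocalFlow.elem_frameComp hf hc hVc b, map_sum, map_sum]
  refine Finset.sum_congr rfl fun a _ => ?_
  rw [Derivation.map_smul, map_smul, smul_eq_mul]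
  rw [(L.realizes ht).pd_eq (fun z => f t ((chartAt (Coord 2) x).symm z) a) _
      (fun z => (LocalFlow.slice_elem hc hVc (hf.smoothFamily a) ht z).symm) i ⟨_, hyV⟩]

variable (hT hT') in
include hT hT' hflow hf in
/-- The decay of the energy of the potentials dominates the norm of the curvature. -/
theorem curvNormSqAt_le {s : ℝ} (hs : s ∈ T) (hC : IsHermitian C (g s)) {t : ℝ} (ht : t ∈ T)
    (x : S) : 1 / 4 * curvNormSqAt (B.transpose * B) (g t) (μ t).curv x ≤
      ∑ b, gradDecay T g (frameComp B f b) t x := by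
  have hc := chart_mem_atlas (Coord 2) x
  have hx := mem_chart_source (Coord 2) x
  obtain ⟨V, hV, hyV, hVc, ⟨L⟩⟩ := exists_localFlow hT hT' hflow hc
    ((chartAt (Coord 2) x).map_source hx)
  have h1 := L.slice_formNormSq hflow hc hVc ht ⟨_, hyV⟩
  have h2 (b : Fin k) := L.slice_gradDecay hflow (isHeat_frameComp (hT := hT) (hT' := hT') hflow hf b)
    hc hVc ht ⟨_, hyV⟩
  simp only [OpenPartialHomeomorph.left_inv _ hx] at h1 h2
  rw [h1, map_sum, Finset.mul_sum]
  refine Finset.sum_le_sum fun b _ => ?_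
  have hpos := metricComp_posDef hc (g t) (hVc hyV)
  have hinv := (L.realizes ht).inv_eq ⟨_, hyV⟩
  have h3 := lap_sq_le hpos hinv (LocalFlow.elem hc hVc (smoothFamily_frameComp (B := B) hf b))
  have h4 : 0 ≤ slice ht ⟨_, hyV⟩ (∑ a, L.R.coInner
      (fun j => ∑ i, L.R.grad (LocalFlow.elem hc hVc (smoothFamily_frameComp (B := B) hf b)) i *
        L.F a i j)
      fun j => ∑ i, L.R.grad (LocalFlow.elem hc hVc (smoothFamily_frameComp (B := B) hf b)) i *
        L.F a i j) := by
    rw [map_sum]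
    exact Finset.sum_nonneg fun a _ => coInner_self_nonneg hpos hinv _
  rw [h2, LocalFlow.decayElem, L.formNormSq_F hf hc hVc hs hC, map_add, map_mul, map_mul, map_pow,
    map_ofNat]
  -- For each frame component, `¼|F|² = ½(Δf)² ≤ (Δf)² ≤ 2|∇²f|²`; the nonnegative gradient term is
  -- discarded.
  nlinarith [sq_nonneg (slice ht ⟨_, hyV⟩
    (L.R.lap (LocalFlow.elem hc hVc (smoothFamily_frameComp (B := B) hf b))))]

end Potential

/-! ### Nonnegativity of the two square terms. -/

section Nonneg

variable {n k : ℕ} {S : Type*} [TopologicalSpace S] [ChartedSpace (Coord n) S]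
  [IsManifold (𝓡 n) ∞ S]
  {E' H' : Type*} [NormedAddCommGroup E'] [NormedSpace ℝ E'] [FiniteDimensional ℝ E']
  [TopologicalSpace H'] {I' : ModelWithCorners ℝ E' H'} [I'.Boundaryless]
  {M : Type*} [TopologicalSpace M] [ChartedSpace H' M] [IsManifold I' ∞ M]
  {P : TorusBundle n k S M I'} {B : Matrix (Fin k) (Fin k) ℝ}
  {T : Set ℝ} (hT : T.OrdConnected) (hT' : T.Nontrivial) {T₁ : ℝ} (hT₁ : ∀ t ∈ T, t < T₁)
  {g : ℝ → Metric n S} {μ : ℝ → PrincipalConnection P}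
  (hflow : IsRYMFlow P (B.transpose * B) T g μ)
  {φ : ℝ → S → ℝ} (hφ : SmoothFamily n T φ) {t : ℝ} (ht : t ∈ T) (x : S)

include hT hT' hflow hφ ht

theorem yangMillsSqAt_nonneg :
    0 ≤ yangMillsSqAt (B.transpose * B) (g t) (μ t).curv (φ t) x := by
  have hc := chart_mem_atlas (Coord n) x
  have hx := mem_chart_source (Coord n) x
  obtain ⟨V, hV, hyV, hVc, ⟨L⟩⟩ := exists_localFlow hT hT' hflow hc
    ((chartAt (Coord n) x).map_source hx)
  have h1 := L.slice_yangMills hflow hc hVc ht ⟨_, hyV⟩ hφ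
  simp only [OpenPartialHomeomorph.left_inv _ hx] at h1
  rw [h1, map_sum]
  exact Finset.sum_nonneg fun a _ => coInner_self_nonneg (metricComp_posDef hc (g t) (hVc hyV))
    ((L.realizes ht).inv_eq ⟨_, hyV⟩) _

include hT₁ in
theorem solitonSqAt_nonneg :
    0 ≤ solitonSqAt (B.transpose * B) (g t) (μ t).curv (φ t) (T₁ - t) x := by
  have hc := chart_mem_atlas (Coord n) x
  have hx := mem_chart_source (Coord n) x
  obtain ⟨V, hV, hyV, hVc, ⟨L⟩⟩ := exists_localFlow hT hT' hflow hc
    ((chartAt (Coord n) x).map_source hx)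
  have h1 := L.slice_soliton hT₁ hflow hc hVc ht ⟨_, hyV⟩ hφ
  simp only [OpenPartialHomeomorph.left_inv _ hx] at h1
  have h2 := tensorInner_self_nonneg (metricComp_posDef hc (g t) (hVc hyV))
    ((L.realizes ht).inv_eq ⟨_, hyV⟩) fun i j => -1 * timeDeriv hT hT' hV (L.R.g i j) +
        (2 * L.R.hess (LocalFlow.elem hc hVc hφ) i j + -2 * LocalFlow.theta hT₁ * L.R.g i j)
  linarith

end Nonneg

/-! ### The monotone quantity on surfaces -/

section Rate

variable {n k : ℕ} {S : Type*} [TopologicalSpace S] [ChartedSpace (Coord n) S]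
  [IsManifold (𝓡 n) ∞ S] [T2Space S] [CompactSpace S] [MeasurableSpace S] [BorelSpace S]
  {E' H' : Type*} [NormedAddCommGroup E'] [NormedSpace ℝ E'] [FiniteDimensional ℝ E']
  [TopologicalSpace H'] {I' : ModelWithCorners ℝ E' H'} [I'.Boundaryless]
  {M : Type*} [TopologicalSpace M] [ChartedSpace H' M] [IsManifold I' ∞ M]
  {P : TorusBundle n k S M I'} {B : Matrix (Fin k) (Fin k) ℝ}
  {T : Set ℝ} (hT : T.OrdConnected) (hT' : T.Nontrivial) {T₁ : ℝ} (hT₁ : ∀ t ∈ T, t < T₁)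
  {g : ℝ → Metric n S} {μ : ℝ → PrincipalConnection P}
  (hflow : IsRYMFlow P (B.transpose * B) T g μ)
  {φ : ℝ → S → ℝ}

/-- The integrand of the lower bound for the derivative of the monotone quantity. -/
def entropyRate (h : Matrix (Fin k) (Fin k) ℝ) (g : Metric n S)
    (F : (x : S) → TangentSpace (𝓡 n) x → TangentSpace (𝓡 n) x → (Fin k → ℝ)) (φ : S → ℝ)
    (τ : ℝ) (x : S) : ℝ :=
  2 * τ * solitonSqAt h g F φ τ x + τ * yangMillsSqAt h g F φ x

include hT hT' hT₁ hflow

theorem integral_entropyRate_nonneg (hφ : SmoothFamily n T φ) {t : ℝ} (ht : t ∈ T) :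
    0 ≤ ∫ x, entropyRate (B.transpose * B) (g t) (μ t).curv (φ t) (T₁ - t) x *
      density n (φ t) (T₁ - t) x ∂(riemannianVolume (g t)) := by
  have hτ : 0 < T₁ - t := sub_pos.mpr (hT₁ t ht)
  refine integral_nonneg fun x => mul_nonneg ?_ (density_pos _ hτ x).le
  have h1 := solitonSqAt_nonneg hT hT' hT₁ hflow hφ ht x
  have h2 := yangMillsSqAt_nonneg hT hT' hflow hφ ht x
  rw [entropyRate]
  positivity

theorem continuous_entropyRate_mul (hφ : SmoothFamily n T φ) {t : ℝ} (ht : t ∈ T) :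
    Continuous fun x => entropyRate (B.transpose * B) (g t) (μ t).curv (φ t) (T₁ - t) x *
      density n (φ t) (T₁ - t) x :=
  ((continuous_const.mul
    ((smoothFamily_solitonSqAt hT hT' hT₁ hflow hφ).smoothFun ht).continuous).add
    (continuous_const.mul
      ((smoothFamily_yangMillsSqAt hT hT' hflow hφ).smoothFun ht).continuous)).mul
    ((LocalFlow.smoothFamily_density hT₁ hφ).smoothFun ht).continuous

end Rate

section Monotone

variable {k : ℕ} {S : Type*} [TopologicalSpace S] [ChartedSpace (Coord 2) S]
  [IsManifold (𝓡 2) ∞ S] [T2Space S] [CompactSpace S] [MeasurableSpace S] [BorelSpace S]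
  {E' H' : Type*} [NormedAddCommGroup E'] [NormedSpace ℝ E'] [FiniteDimensional ℝ E']
  [TopologicalSpace H'] {I' : ModelWithCorners ℝ E' H'} [I'.Boundaryless]
  {M : Type*} [TopologicalSpace M] [ChartedSpace H' M] [IsManifold I' ∞ M]
  {P : TorusBundle 2 k S M I'} {B : Matrix (Fin k) (Fin k) ℝ}
  {T : Set ℝ} (hT : T.OrdConnected) (hT' : T.Nontrivial) {T₁ : ℝ} (hT₁ : ∀ t ∈ T, t < T₁)
  {g : ℝ → Metric 2 S} {μ : ℝ → PrincipalConnection P}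
  (hflow : IsRYMFlow P (B.transpose * B) T g μ)
  {C : ComplexStructure 2 S} {μ₀ : PrincipalConnection P} {f : ℝ → S → (Fin k → ℝ)}
  (hf : IsPotential C T g μ μ₀ f)
  {φ : ℝ → S → ℝ} (hφ : IsConjugateHeat (B.transpose * B) T T₁ g μ φ)

include hT hT' hT₁ hflow hf hφ

theorem hasDerivWithinAt_integral_vecGradSqAt {t : ℝ} (ht : t ∈ T) :
    HasDerivWithinAt (fun s => ∫ x, vecGradSqAt (B.transpose * B) (g s) (f s) x *
        density 2 (φ s) (T₁ - s) x ∂(riemannianVolume (g s)))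
      (-∑ b, ∫ x, gradDecay T g (frameComp B f b) t x * density 2 (φ t) (T₁ - t) x
        ∂(riemannianVolume (g t))) T t := by
  have h1 := HasDerivWithinAt.fun_sum (u := Finset.univ) fun b _ =>
    hasDerivWithinAt_integral_gradSqAt hT hT' hT₁ hflow
      (isHeat_frameComp (hT := hT) (hT' := hT') hflow hf b) hφ ht
  rw [Finset.sum_neg_distrib] at h1
  have h2 (s : ℝ) (hs : s ∈ T) : ∫ x, vecGradSqAt (B.transpose * B) (g s) (f s) x *
        density 2 (φ s) (T₁ - s) x ∂(riemannianVolume (g s)) =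
      ∑ b, ∫ x, gradSqAt (g s) (frameComp B f b s) x * density 2 (φ s) (T₁ - s) x
        ∂(riemannianVolume (g s)) := by
    simp only [vecGradSqAt_eq_sum (hT := hT) (hT' := hT') hflow hf hs, Finset.sum_mul]
    refine integral_finsetSum _ fun b _ => integrable_riemannianVolume (hflow.smoothMetric hs) ?_
    exact (((smoothFamily_gradSqAt (hT := hT) (hT' := hT') hflow
      (smoothFamily_frameComp hf b)).smoothFun hs).continuous).mul
      ((LocalFlow.smoothFamily_density hT₁ hφ.smoothFamily).smoothFun hs).continuous
  exact h1.congr h2 (h2 t ht)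

/-- The only term of the entropy derivative with the wrong sign, `-¼|F|²`, is outweighed by the
decay of the energy through `curvNormSqAt_le`, integrated against the positive weight. -/
theorem exists_hasDerivWithinAt_entropy_sub {s : ℝ} (hs : s ∈ T) (hC : IsHermitian C (g s))
    {t : ℝ} (ht : t ∈ T) :
    ∃ D, HasDerivWithinAt
      (fun s => entropy (B.transpose * B) (g s) (μ s).curv (φ s) (T₁ - s) -
        ∫ x, vecGradSqAt (B.transpose * B) (g s) (f s) x * density 2 (φ s) (T₁ - s) x
          ∂(riemannianVolume (g s))) D T t ∧
      ∫ x, entropyRate (B.transpose * B) (g t) (μ t).curv (φ t) (T₁ - t) x *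
        density 2 (φ t) (T₁ - t) x ∂(riemannianVolume (g t)) ≤ D := by
  refine ⟨_, (hasDerivWithinAt_entropy hT hT' hT₁ hflow hφ ht).sub
    (hasDerivWithinAt_integral_vecGradSqAt hT hT' hT₁ hflow hf hφ ht), ?_⟩
  have hg := hflow.smoothMetric ht
  have hu := ((LocalFlow.smoothFamily_density hT₁ hφ.smoothFamily).smoothFun ht).continuous
  have hR := continuous_entropyRate_mul hT hT' hT₁ hflow hφ.smoothFamily ht
  have hF : Continuous fun x => 1 / 4 * curvNormSqAt (B.transpose * B) (g t) (μ t).curv x *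
      density 2 (φ t) (T₁ - t) x :=
    (continuous_const.mul ((smoothFamily_curvNormSqAt hT hT' hflow).smoothFun ht).continuous).mul hu
  have hG (b : Fin k) : Continuous fun x => gradDecay T g (frameComp B f b) t x *
      density 2 (φ t) (T₁ - t) x :=
    ((smoothFamily_gradDecay hT hT' hflow (isHeat_frameComp (hT := hT) (hT' := hT') hflow hf
      b)).smoothFun ht).continuous.mul hu
  have h1 : ∫ x, 1 / 4 * curvNormSqAt (B.transpose * B) (g t) (μ t).curv x *
        density 2 (φ t) (T₁ - t) x ∂(riemannianVolume (g t)) ≤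
      ∑ b, ∫ x, gradDecay T g (frameComp B f b) t x * density 2 (φ t) (T₁ - t) x
        ∂(riemannianVolume (g t)) := by
    rw [← integral_finsetSum _ fun b _ => integrable_riemannianVolume hg (hG b)]
    refine integral_mono (integrable_riemannianVolume hg hF)
      (integrable_finsetSum _ fun b _ => integrable_riemannianVolume hg (hG b)) fun x => ?_
    simp only [← Finset.sum_mul]
    exact mul_le_mul_of_nonneg_right (curvNormSqAt_le hT hT' hflow hf hs hC ht x)
      (density_pos _ (sub_pos.mpr (hT₁ t ht)) x).le
  have h2 := integral_sub (integrable_riemannianVolume hg hR) (integrable_riemannianVolume hg hF)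
  simp only [entropyRate, ← sub_mul] at h2 ⊢
  rw [h2]
  linarith

theorem monotoneOn_entropy_sub {s : ℝ} (hs : s ∈ T) (hC : IsHermitian C (g s)) :
    MonotoneOn (fun s => entropy (B.transpose * B) (g s) (μ s).curv (φ s) (T₁ - s) -
        ∫ x, vecGradSqAt (B.transpose * B) (g s) (f s) x * density 2 (φ s) (T₁ - s) x
          ∂(riemannianVolume (g s))) T := by
  choose! D hD hD' using fun t (ht : t ∈ T) =>
    exists_hasDerivWithinAt_entropy_sub hT hT' hT₁ hflow hf hφ hs hC ht
  exact monotoneOn_of_hasDerivWithinAt_nonneg hT.convex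
    (fun t ht => (hD t ht).continuousWithinAt)
    (fun t ht => (hD t (interior_subset ht)).mono interior_subset)
    fun t ht => (integral_entropyRate_nonneg hT hT' hT₁ hflow hφ.smoothFamily
      (interior_subset ht)).trans (hD' t (interior_subset ht))

end Monotone

end RYM

end

theorem proposition4 {n k : ℕ}
    {S : Type*} [TopologicalSpace S] [ChartedSpace (RYM.Coord n) S] [IsManifold (𝓡 n) ∞ S]
    [T2Space S] [CompactSpace S] [MeasurableSpace S] [BorelSpace S]
    {E' H' : Type*} [NormedAddCommGroup E'] [NormedSpace ℝ E'] [FiniteDimensional ℝ E']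
    [TopologicalSpace H'] {I' : ModelWithCorners ℝ E' H'} [I'.Boundaryless]
    {M : Type*} [TopologicalSpace M] [ChartedSpace H' M] [IsManifold I' ∞ M] [T2Space M]
    (P : RYM.TorusBundle n k S M I')
    (h : Matrix (Fin k) (Fin k) ℝ) (hh : h.PosDef)
    (T : Set ℝ) (hT : T.OrdConnected) (hT' : T.Nontrivial)
    (T₁ : ℝ) (hT₁ : ∀ t ∈ T, t < T₁)
    (g : ℝ → RYM.Metric n S) (μ : ℝ → RYM.PrincipalConnection P)
    (hflow : RYM.IsRYMFlow P h T g μ)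
    (φ : ℝ → S → ℝ) (hφ : RYM.IsConjugateHeat h T T₁ g μ φ) :
    -- the derivative of the entropy along the flow
    (∀ t ∈ T, HasDerivWithinAt
      (fun s => RYM.entropy h (g s) (μ s).curv (φ s) (T₁ - s))
      (∫ x, (2 * (T₁ - t) * RYM.solitonSqAt h (g t) (μ t).curv (φ t) (T₁ - t) x
          + (T₁ - t) * RYM.yangMillsSqAt h (g t) (μ t).curv (φ t) x
          - (1 / 4) * RYM.curvNormSqAt h (g t) (μ t).curv x)
        * RYM.density n (φ t) (T₁ - t) x ∂(RYM.riemannianVolume (g t))) T t) ∧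
    -- the monotone quantity for the trivial bundle over a Riemann surface
    (∀ (_ : n = 2) (C : RYM.ComplexStructure n S) (_ : ∃ t₀ ∈ T, RYM.IsHermitian C (g t₀))
      (_ : P.IsTrivial) (μ₀ : RYM.PrincipalConnection P) (f : ℝ → S → (Fin k → ℝ))
      (_ : RYM.IsPotential C T g μ μ₀ f),
      (∀ t ∈ T, ∃ D : ℝ,
        HasDerivWithinAt
          (fun s => RYM.entropy h (g s) (μ s).curv (φ s) (T₁ - s)
            - ∫ x, RYM.vecGradSqAt h (g s) (f s) x
                * RYM.density n (φ s) (T₁ - s) x ∂(RYM.riemannianVolume (g s))) D T t ∧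
        (∫ x, (2 * (T₁ - t) * RYM.solitonSqAt h (g t) (μ t).curv (φ t) (T₁ - t) x
            + (T₁ - t) * RYM.yangMillsSqAt h (g t) (μ t).curv (φ t) x)
          * RYM.density n (φ t) (T₁ - t) x ∂(RYM.riemannianVolume (g t))) ≤ D ∧
        0 ≤ ∫ x, (2 * (T₁ - t) * RYM.solitonSqAt h (g t) (μ t).curv (φ t) (T₁ - t) x
            + (T₁ - t) * RYM.yangMillsSqAt h (g t) (μ t).curv (φ t) x)
          * RYM.density n (φ t) (T₁ - t) x ∂(RYM.riemannianVolume (g t))) ∧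
      MonotoneOn
        (fun s => RYM.entropy h (g s) (μ s).curv (φ s) (T₁ - s)
          - ∫ x, RYM.vecGradSqAt h (g s) (f s) x
              * RYM.density n (φ s) (T₁ - s) x ∂(RYM.riemannianVolume (g s))) T) := by
  -- From here on the inner product is the pull-back of the standard one by `B`, as required for the
  -- orthonormal frame components of the curvature.
  obtain ⟨B, rfl⟩ := RYM.exists_eq_transpose_mul hh.posSemidef
  refine ⟨fun t ht => RYM.hasDerivWithinAt_entropy hT hT' hT₁ hflow hφ ht, ?_⟩
  rintro rfl C ⟨s, hs, hC⟩ - μ₀ f hf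
  refine ⟨fun t ht => ?_, RYM.monotoneOn_entropy_sub hT hT' hT₁ hflow hf hφ hs hC⟩
  obtain ⟨D, hD, hD'⟩ :=
    RYM.exists_hasDerivWithinAt_entropy_sub hT hT' hT₁ hflow hf hφ hs hC ht
  exact ⟨D, hD, hD', RYM.integral_entropyRate_nonneg hT hT' hT₁ hflow hφ.smoothFamily ht⟩
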